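/- Notation. For a formal power series $\varphi=\sum_{n\ge 0}a_nz^n\in\mathbb C[[z]]$, $\kappa>0$ and $\theta\in\mathbb R$, let $\mathcal B_\kappa(\varphi)(u)=\sum_{n\ge0}\frac{a_n}{\Gamma(n+\kappa)}u^n$. We say that the Borel–Laplace sum $\mathcal S^\theta_\kappa(\varphi)$ exists at $w$ if $\mathcal B_\kappa(\varphi)$ converges near $u=0$, continues analytically to a half-strip around the ray $e^{i\theta}\mathbb R_+$ with at most exponential growth along the ray, and the integral $$\mathcal S_\kappa^\theta(\varphi)(w)=w^{-\kappa}\int_0^{e^{i\theta}\infty}e^{-u/w}\,\mathcal B_\kappa(\varphi)(u)\,u^{\kappa-1}\,du$$ converges absolutely (with $\arg u=\theta$, $|\arg w-\theta|<\pi/2$). The median resummation is $\mathcal S_{med}^{\theta}(\varphi)=\frac12\big(\mathcal S_\kappa^{\theta^+}(\varphi)+\mathcal S_\kappa^{\theta^-}(\varphi)\big)$ for directions $\theta^-<\theta<\theta^+$ sufficiently close to $\theta$. For $g:\mathbb H\to\mathbb C$ and $x_0\in\mathbb Q$ we write $g\sim\varphi$ at $x_0$ if for every $M\ge 0$, $g(z)-\sum_{n<M}a_n(z-x_0)^n=O(|z-x_0|^M)$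 as $z\to x_0$ along $z=x_0+it$, $t\to0^+$. Write $q=e^{2\pi i z}$. Proposition 3.3. Let $N\ge1$ and let $g:\mathbb H\to\mathbb C$ be one of the following. (Type 4) $4\mid N$ and $g(z)=\sum_{n\ge1}a_nn^{1-k}q^n$ is the Eichler integral of a cusp form $f=\sum_{n\ge1}a_nq^n$ of weight $k\in\frac12+\mathbb N_0$ for $\Gamma_0(N)$; that is, $f$ is holomorphic on $\mathbb H$, satisfies $f(z)=\varepsilon_d^{2k}\left(\frac cd\right)(cz+d)^{-k}f\!\left(\frac{az+b}{cz+d}\right)$ for all $\begin{psmallmatrix}a&b\\c&d\end{psmallmatrix}\in\Gamma_0(N)$ (Kronecker symbol; $\varepsilon_d=1$ or $i$ according as $d\equiv1$ or $3 \bmod 4$), and decays exponentially at every cusp. (Type 5) $g(z)=\sum_{n\ge1}A_nq^n$ is the periodic function of a Maass waveform $u(x+iy)=\sqrt y\sum_{n\ne0}A_nK_0(2\pi|n|y)e^{2\pi inx}$ for $\mathrm{SL}_2(\mathbb Z)$ with spectral parameter $s=\frac12$; that is, $u$ is smooth, $\mathrm{SL}_2(\mathbb Z)$-invariant, satisfies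 $-y^2(\partial_x^2+\partial_y^2)u=\frac14u$, has vanishing zeroth Fourier coefficient, and is square-integrable on a fundamental domain of $\mathrm{SL}_2(\mathbb Z)$. Let $\gamma=\begin{psmallmatrix}a&b\\c&d\end{psmallmatrix}\in\Gamma_0(N)$ with $c\neq0$. Then $g$ has an asymptotic expansion $g\sim\varphi_{-d/c}$ at $-d/c$ in the variable $z+d/c$, and $g=\mathcal S_{med}^{\pi/2}(\varphi_{-d/c})$, for each shift $\kappa\in\frac12\mathbb Z_{>0}$. Explicitly: for each such $\kappa$ there is $\varepsilon>0$ such that for all $\theta^-\in(\frac\pi2-\varepsilon,\frac\pi2)$, $\theta^+\in(\frac\pi2,\frac\pi2+\varepsilon)$ and all $w$ with $\Re(we^{-i\theta^+})>0$ and $\Re(we^{-i\theta^-})>0$, both Borel–Laplace sums exist at $w$ and $$g\!\left(w-\tfrac dc\right)=\tfrac12\Big(\mathcal S^{\theta^+}_\kappa(\varphi_{-d/c})(w)+\mathcal S^{\theta^-}_\kappa(\varphi_{-d/c})(w)\Big).$$ (Letting $\theta^\pm\to\frac\pi2$, this covers every point of $\mathbb H$.) -/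

import Mathlib

open scoped MatrixGroups Topology ContDiff Manifold
open Complex Filter Set MeasureTheory
open UpperHalfPlane (ofComplex atImInfty)

noncomputable section

namespace MedianResum

/-! ### Formal power series, asymptotic expansions, Borel and Laplace transforms -/

/-- `φ = ∑ aₙ zⁿ` is the asymptotic expansion of `g` at the real point `x₀`, in the local variable
`z - x₀`, as `z → x₀` along the vertical geodesic `z = x₀ + i t`, `t → 0⁺`. -/
def IsAsymptoticExpansion (g : UpperHalfPlane → ℂ) (x₀ : ℝ) (φ : PowerSeries ℂ) : Prop :=
  ∀ M : ℕ,
    (fun t : ℝ => g (ofComplex (x₀ + t * I)) -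
        ∑ n ∈ Finset.range M, PowerSeries.coeff n φ * (t * I : ℂ) ^ n)
      =O[𝓝[>] (0 : ℝ)] (fun t : ℝ => t ^ M)

/-- The formal Borel transform with shift `κ`: `∑ aₙ zⁿ ↦ ∑ aₙ / Γ(n + κ) uⁿ`. -/
def borelTransform (κ : ℝ) (φ : PowerSeries ℂ) : PowerSeries ℂ :=
  PowerSeries.mk fun n => PowerSeries.coeff n φ / Complex.Gamma ((n : ℂ) + (κ : ℂ))

/-- The direction `e^{iθ}`. -/
def dir (θ : ℝ) : ℂ := Complex.exp (θ * I)

/-- The half-strip of all points at distance less than `ε` from the closed ray `e^{iθ} ℝ₊`. -/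
def halfStrip (θ ε : ℝ) : Set ℂ :=
  Metric.thickening ε ((fun r : ℝ => (r : ℂ) * dir θ) '' Ici 0)

/-- The integrand of the Laplace transform
`w^{-κ} ∫_0^{e^{iθ}∞} e^{-u/w} ψ(u) u^{κ-1} du`
in the parametrization `u = t e^{iθ}`, `t > 0`, with the prefactor `w^{-κ}` moved inside.
The powers are taken with `arg u = θ` and `arg w ∈ (θ - π/2, θ + π/2)`; then
`w^{-κ} u^{κ-1} du = (e^{iθ}/w)^κ t^{κ-1} dt`, where `e^{iθ}/w` lies in the right half-plane and the
power is the principal one. -/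
def laplaceIntegrand (κ θ : ℝ) (ψ : ℂ → ℂ) (w : ℂ) (t : ℝ) : ℂ :=
  Complex.exp (-((t : ℂ) * dir θ / w)) * ψ ((t : ℂ) * dir θ) *
    ((dir θ / w) ^ (κ : ℂ) * ((t ^ (κ - 1) : ℝ) : ℂ))

/-- `S` is the value at `w` of the Borel-Laplace sum, with shift `κ` in direction `θ`, of the formal
power series `φ`. That is: the Borel transform of `φ` converges near `0`, it continues analytically
to a function `ψ` on a half-strip around the ray `e^{iθ} ℝ₊`, of exponential type along that ray, and
the Laplace integral of `ψ` at `w` converges (absolutely), with value `S`.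
(The half-strip is connected and contains a disc about `0`, so `ψ` is unique on it.) -/
def HasBorelLaplaceSum (κ θ : ℝ) (φ : PowerSeries ℂ) (w S : ℂ) : Prop :=
  ∃ (ψ : ℂ → ℂ) (ε : ℝ), 0 < ε ∧
    DifferentiableOn ℂ ψ (halfStrip θ ε) ∧
    (∀ᶠ u in 𝓝 (0 : ℂ),
      HasSum (fun n : ℕ => PowerSeries.coeff n (borelTransform κ φ) * u ^ n) (ψ u)) ∧
    (∃ M α : ℝ, ∀ r : ℝ, 0 ≤ r → ‖ψ ((r : ℂ) * dir θ)‖ ≤ M * Real.exp (α * r)) ∧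
    IntegrableOn (laplaceIntegrand κ θ ψ w) (Ioi 0) ∧
    ∫ t in Ioi (0 : ℝ), laplaceIntegrand κ θ ψ w t = S

/-- `G` is the median resummation in direction `θ` (with shift `κ`) of `φ`: for all directions
`θ⁺ = θ + δ₁`, `θ⁻ = θ - δ₂` sufficiently close to `θ` on either side of it, both Borel-Laplace sums
exist on their common half-planes `Re (w e^{-iθ^±}) > 0`, and `G` is their average there.
These common domains exhaust the half-plane `Re (w e^{-iθ}) > 0` as `δ₁, δ₂ → 0`. -/
def HasMedianSum (κ θ : ℝ) (φ : PowerSeries ℂ) (G : ℂ → ℂ) : Prop :=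
  ∃ ε : ℝ, 0 < ε ∧ ∀ δ₁ ∈ Ioo 0 ε, ∀ δ₂ ∈ Ioo 0 ε, ∀ w : ℂ,
    0 < (w * dir (-(θ + δ₁))).re → 0 < (w * dir (-(θ - δ₂))).re →
    ∃ S₁ S₂ : ℂ,
      HasBorelLaplaceSum κ (θ + δ₁) φ w S₁ ∧ HasBorelLaplaceSum κ (θ - δ₂) φ w S₂ ∧
      G w = (S₁ + S₂) / 2

/-! ### Eichler integrals of cusp forms of half-integral weight -/

/-- The Kronecker symbol `(c/d)` for odd `d` (of either sign). -/
def kroneckerOdd (c d : ℤ) : ℤ :=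
  (if c < 0 ∧ d < 0 then -1 else 1) * jacobiSym c d.natAbs

/-- `ε_d` for odd `d`: it is `1` if `d ≡ 1 (mod 4)` and `i` if `d ≡ 3 (mod 4)`. -/
def thetaEps (d : ℤ) : ℂ := if d % 4 = 1 then 1 else I

/-- The weight `k = m + 1/2` slash operator
`f|_k γ (z) = ε_d^{2k} (c/d) (cz + d)^{-k} f (γ z)`, with the principal branch of the power. -/
def slashHalf (m : ℕ) (f : UpperHalfPlane → ℂ) (γ : SL(2, ℤ)) (z : UpperHalfPlane) : ℂ :=
  thetaEps (γ 1 1) ^ (2 * m + 1) * (kroneckerOdd (γ 1 0) (γ 1 1) : ℂ) *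
    (((γ 1 0 : ℤ) : ℂ) * (z : ℂ) + ((γ 1 1 : ℤ) : ℂ)) ^ (-((m : ℂ) + 1 / 2)) * f (γ • z)

/-- `f` is a cusp form of weight `k = m + 1/2` for `Γ₀(N)` (used for `4 ∣ N`). -/
structure IsCuspFormHalf (N m : ℕ) (f : UpperHalfPlane → ℂ) : Prop where
  holo : MDiff f
  slash : ∀ γ ∈ CongruenceSubgroup.Gamma0 N, ∀ z, f z = slashHalf m f γ z
  /-- Exponential decay at the cusp `σ ∞`, for every `σ ∈ SL₂(ℤ)`, that is, at every cusp. -/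
  decay : ∀ σ : SL(2, ℤ), ∃ ε : ℝ, 0 < ε ∧
    (fun z : UpperHalfPlane =>
        ‖((σ 1 0 : ℤ) : ℂ) * (z : ℂ) + ((σ 1 1 : ℤ) : ℂ)‖ ^ (-((m : ℝ) + 1 / 2)) * ‖f (σ • z)‖)
      =O[atImInfty] (fun z : UpperHalfPlane => Real.exp (-ε * z.im))

/-- The Eichler integral `∑_{n ≥ 1} aₙ n^{1-k} qⁿ` of `f = ∑_{n ≥ 1} aₙ qⁿ`, for `k = m + 1/2`. -/
def eichlerIntegral (m : ℕ) (f : UpperHalfPlane → ℂ) (z : UpperHalfPlane) : ℂ :=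
  ∑' n : ℕ, PowerSeries.coeff (n + 1) (UpperHalfPlane.qExpansion 1 f) *
    ((n + 1 : ℕ) : ℂ) ^ ((1 : ℂ) - ((m : ℂ) + 1 / 2)) *
    Complex.exp (2 * Real.pi * I * ((n + 1 : ℕ) : ℂ) * (z : ℂ))

/-- `g` is the Eichler integral of a cusp form of weight in `1/2 + ℕ₀` for `Γ₀(N)`, `4 ∣ N`. -/
def IsHalfIntegralEichler (N : ℕ) (g : UpperHalfPlane → ℂ) : Prop :=
  4 ∣ N ∧ ∃ (m : ℕ) (f : UpperHalfPlane → ℂ), IsCuspFormHalf N m f ∧ g = eichlerIntegral m f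

/-! ### Periodic functions of Maass waveforms with spectral parameter `1/2` -/

/-- `u` is a Maass waveform for `SL₂(ℤ)` with spectral parameter `s = 1/2`, that is, with eigenvalue
`s (1 - s) = 1/4` of the hyperbolic Laplacian `-y² (∂²/∂x² + ∂²/∂y²)`. -/
structure IsMaassWaveformHalf (u : UpperHalfPlane → ℂ) : Prop where
  smooth : ContDiffOn ℝ ∞ (fun w : ℂ => u (ofComplex w)) {w : ℂ | 0 < w.im}
  invariant : ∀ (γ : SL(2, ℤ)) (z : UpperHalfPlane), u (γ • z) = u z
  eigen : ∀ z : UpperHalfPlane,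
    -((z.im : ℂ) ^ 2) * Laplacian.laplacian (fun w : ℂ => u (ofComplex w)) (z : ℂ) = (1 / 4) * u z
  /-- The zeroth Fourier coefficient vanishes. -/
  zeroth : ∀ y : ℝ, 0 < y → ∫ x in (0 : ℝ)..1, u (ofComplex (x + y * I)) = 0
  /-- Square-integrability on the standard fundamental domain, for the hyperbolic measure. -/
  sqInt : IntegrableOn (fun z : UpperHalfPlane => ‖u z‖ ^ 2) ModularGroup.fd volume

/-- The `K`-Bessel function of order `0`: `K₀(x) = ∫_0^∞ e^{-x cosh t} dt`, `x > 0`. -/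
def besselKZero (x : ℝ) : ℝ := ∫ t in Ioi (0 : ℝ), Real.exp (-x * Real.cosh t)

/-- The coefficient `Aₙ`, `n ≠ 0`, of the expansion
`u(x + iy) = √y ∑_{n ≠ 0} Aₙ K₀(2π|n|y) e^{2πinx}`,
read off from the Fourier coefficient `∫_0^1 u(x + iy) e^{-2πinx} dx = √y Aₙ K₀(2π|n|y)` at `y = 1`
(where `K₀(2π|n|) > 0`). -/
def maassCoeff (u : UpperHalfPlane → ℂ) (n : ℤ) : ℂ :=
  (∫ x in (0 : ℝ)..1, u (ofComplex (x + I)) * Complex.exp (-(2 * Real.pi * I * n * x))) /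
    (besselKZero (2 * Real.pi * |(n : ℝ)|) : ℂ)

/-- The periodic function `∑_{n > 0} Aₙ n^{s-1/2} qⁿ` of `u`, on the upper half-plane, `s = 1/2`. -/
def maassPeriodic (u : UpperHalfPlane → ℂ) (z : UpperHalfPlane) : ℂ :=
  ∑' n : ℕ, maassCoeff u ((n + 1 : ℕ) : ℤ) *
    Complex.exp (2 * Real.pi * I * ((n + 1 : ℕ) : ℂ) * (z : ℂ))

/-- `g` is the periodic function of a Maass waveform for `SL₂(ℤ)` with spectral parameter `1/2`. -/
def IsMaassPeriodicHalf (g : UpperHalfPlane → ℂ) : Prop :=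
  ∃ u : UpperHalfPlane → ℂ, IsMaassWaveformHalf u ∧ g = maassPeriodic u

end MedianResum

end

open scoped MatrixGroups Topology ContDiff Manifold
open Complex Filter Set MeasureTheory
open UpperHalfPlane (ofComplex atImInfty)

noncomputable section

namespace MedianResum

/-! ### Holomorphic parametric integrals and Gamma integrals -/

/-! Put x₀ = -d/c and let w be the local variable at x₀. The proof rests on functions F(α, w), 0 < α
< π, defined by integrals along the ray from x₀ in direction e^{iα}, with two properties. (1) F(α,
·) is a Borel–Laplace sum of one and the same series in every direction θ with cos(θ - α) ≤ 0 and
cos(θ + α) ≤ 0. This covers θ = α + π/2 if α ≤ π/2 and θ = α - π/2 if α ≥ π/2, and the half-plane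
Re(w e^{-iθ}) > 0 is then exactly one side of the ray. (2) If w lies between the rays α < α', then
F(α, w) + F(α', w) = 2 g(w + x₀). Granting these, `median_of_rays` concludes: the lateral sums in
directions π/2 + δ₁ and π/2 - δ₂ are F(δ₁, ·) and F(π - δ₂, ·), and their average is g. All F(α, ·)
have the same series, since by (2) they coincide on sectors, where Watson's lemma recovers the
coefficients.

For an Eichler integral, F(α, w) is a constant times the integral of f(x₀ + z)(z - w)^{k-2} dz. As k
is half-integral, the branches of the power attached to two rays differ by a sign where their
domains meet, so two outgoing rays form a single Hankel contour around w. The cuspidal decay of f at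
x₀ allows the vertex to be moved into the upper half-plane (`RayForm.zero_add_eq`). There the
q-expansion is integrated termwise, and each term is a Hankel integral (`exists_hankelSum`) equal to
a constant times n^{1-k} e^{2πinw}.

For a Maass waveform the form becomes ∂u/∂z V dz + u ∂V/∂z̄ dz̄ with V = √y (z - w)^{-1/2} (i(z̄ -
w))^{-1/2}; it is closed because u and V have the same Laplace eigenvalue. Square-integrability
gives the expansion of u in K-Bessel modes (`IsMaassWaveformHalf.lineCoeff_eq`). The contour
integral of the n-th mode is holomorphic in w and covariant under real translations, hence a
multiple of e^{2πinw}. Letting w tend to i∞ identifies the multiple with a Hankel constant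
independent of n if n > 0, and with 0 if n < 0 (`exists_waveSum_const`).

For (1), set z = t e^{iα} and p = e^{-iα}/t. Then z - w is a multiple of 1 - w p, so F is a
superposition of powers (1 - w p)^{-s} against a weight decaying like e^{-A(t + 1/t)}. If s equals
the shift κ, the Gamma integral exhibits it as the Laplace transform of the superposition of
e^{up}/Γ(κ), which converges on a half-strip (`Admissible.exists_hasModerateSum`). Other pairs (s,
κ) follow from the Feynman parametrization, which raises exponents and also merges the two conjugate
factors of the Maass case, and from (1 - wp)^{1-s} = (1 - wp)^{-s} - wp (1 - wp)^{-s}, which shifts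
s by one (`superpositionSummable_nat`, `superpositionSummable_half`). -/

theorem hasDerivAt_integral_of_holomorphic {X : Type*} [MeasurableSpace X] {μ : Measure X}
    {U : Set ℂ} (hU : IsOpen U) {F : ℂ → X → ℂ} {B : X → ℝ} (hB : Integrable B μ)
    (hmeas : ∀ z ∈ U, AEStronglyMeasurable (F z) μ)
    (hbound : ∀ᵐ x ∂μ, ∀ z ∈ U, ‖F z x‖ ≤ B x)
    (hdiff : ∀ᵐ x ∂μ, DifferentiableOn ℂ (F · x) U) {z : ℂ} (hz : z ∈ U) :
    DifferentiableAt ℂ (fun z => ∫ x, F z x ∂μ) z := by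
  obtain ⟨ρ, hρ, hball⟩ := Metric.isOpen_iff.1 hU z hz
  have hρ2 : 0 < ρ / 2 := by positivity
  have hsub : ∀ y ∈ Metric.ball z (ρ / 2), Metric.closedBall y (ρ / 4) ⊆ U := by
    intro y hy x hx
    apply hball
    rw [Metric.mem_ball] at hy ⊢
    rw [Metric.mem_closedBall] at hx
    linarith [dist_triangle x y z]
  have hmem : ∀ y ∈ Metric.ball z (ρ / 2), y ∈ U := fun y hy =>
    hsub y hy (Metric.mem_closedBall_self (by positivity))
  have hd : ∀ᵐ x ∂μ, ∀ y ∈ Metric.ball z (ρ / 2), HasDerivAt (F · x) (deriv (F · x) y) y := by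
    filter_upwards [hdiff] with x hx y hy
    exact (hx.differentiableAt (hU.mem_nhds (hmem y hy))).hasDerivAt
  refine (hasDerivAt_integral_of_dominated_loc_of_deriv_le (μ := μ) (F := F)
    (F' := fun y x => deriv (F · x) y) (bound := fun x => B x / (ρ / 4))
    (Metric.ball_mem_nhds z hρ2) ?_ ?_ ?_ ?_ (hB.div_const _) hd).2.differentiableAt
  · filter_upwards [hU.mem_nhds hz] with y hy using hmeas y hy
  · exact hB.mono' (hmeas z hz) (hbound.mono fun x hx => hx z hz)
  -- Measurability of the derivative in x: it is the almost everywhere limit of difference quotients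
  -- along a sequence of real increments.
  · obtain ⟨u, hu⟩ : ∃ u : ℕ → ℝ, (∀ n, u n ∈ Ioo 0 (ρ / 2)) ∧ Tendsto u atTop (𝓝 0) := by
      obtain ⟨u, -, h2, h3⟩ := exists_seq_strictAnti_tendsto' hρ2
      exact ⟨u, h2, h3⟩
    have hmu : ∀ n, z + u n ∈ Metric.ball z (ρ / 2) := fun n => by
      simp [abs_of_pos (hu.1 n).1, (hu.1 n).2]
    refine aestronglyMeasurable_of_tendsto_ae atTop
      (f := fun n x => ((u n : ℂ))⁻¹ * (F (z + u n) x - F z x)) (fun n => ?_) ?_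
    · exact ((hmeas _ (hmem _ (hmu n))).sub (hmeas z hz)).const_mul _
    · filter_upwards [hd] with x hx
      have := (hx z (Metric.mem_ball_self hρ2)).tendsto_slope_zero
      refine Tendsto.comp this (f := fun n => (u n : ℂ)) ?_
      rw [tendsto_nhdsWithin_iff]
      refine ⟨?_, Eventually.of_forall fun n => ?_⟩
      · exact (continuous_ofReal.tendsto' 0 0 rfl).comp hu.2
      · simp [(hu.1 n).1.ne']
  · filter_upwards [hbound, hdiff] with x hx hx' y hy
    -- Cauchy's estimate on a circle of radius ρ/4 converts the bound on F into a bound on its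
    -- derivative.
    refine norm_deriv_le_of_forall_mem_sphere_norm_le (by positivity) ?_ ?_
    · refine ⟨hx'.mono ((Metric.ball_subset_closedBall).trans (hsub y hy)), ?_⟩
      exact hx'.continuousOn.mono (Metric.closure_ball_subset_closedBall.trans (hsub y hy))
    · intro w hw
      exact hx w (hsub y hy (Metric.sphere_subset_closedBall hw))

theorem norm_cexp_neg_mul_mul_rpow (a : ℝ) (r : ℂ) {t : ℝ} (ht : 0 < t) :
    ‖cexp (-(t * r)) * ((t ^ (a - 1) : ℝ) : ℂ)‖ = t ^ (a - 1) * Real.exp (-(r.re * t)) := by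
  rw [norm_mul, norm_exp, Complex.norm_real, Real.norm_of_nonneg (by positivity)]
  simp [mul_comm]

theorem integrableOn_rpow_mul_exp_neg_mul {a r : ℝ} (ha : 0 < a) (hr : 0 < r) :
    IntegrableOn (fun t : ℝ => t ^ (a - 1) * Real.exp (-(r * t))) (Ioi 0) := by
  have := integrableOn_rpow_mul_exp_neg_mul_rpow (p := 1) (s := a - 1) (b := r)
    (by linarith) one_pos hr
  simpa using this

theorem aestronglyMeasurable_exp_mul_rpow (a : ℝ) (r : ℂ) :
    AEStronglyMeasurable (fun t : ℝ => cexp (-(t * r)) * ((t ^ (a - 1) : ℝ) : ℂ))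
      (volume.restrict (Ioi 0)) := by
  apply Measurable.aestronglyMeasurable
  fun_prop

theorem integrableOn_cexp_neg_mul_mul_rpow {a : ℝ} (ha : 0 < a) {r : ℂ} (hr : 0 < r.re) :
    IntegrableOn (fun t : ℝ => cexp (-(t * r)) * ((t ^ (a - 1) : ℝ) : ℂ)) (Ioi 0) := by
  refine (integrableOn_rpow_mul_exp_neg_mul ha hr).mono' (aestronglyMeasurable_exp_mul_rpow a r) ?_
  filter_upwards [ae_restrict_mem measurableSet_Ioi] with t ht
  rw [norm_cexp_neg_mul_mul_rpow a r ht]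

/-- The Gamma integral `∫ e^{-tr} t^{a-1} dt = Γ(a) r^{-a}` for complex `r`, `Re r > 0`. -/
theorem integral_cexp_neg_mul_mul_rpow {a : ℝ} (ha : 0 < a) {r : ℂ} (hr : 0 < r.re) :
    ∫ t : ℝ in Ioi 0, cexp (-(t * r)) * ((t ^ (a - 1) : ℝ) : ℂ) =
      Complex.Gamma a * r ^ (-(a : ℂ)) := by
  set U : Set ℂ := {z | 0 < z.re} with hUdef
  have hU : IsOpen U := isOpen_lt continuous_const continuous_re
  have hpre : IsPreconnected U := (convex_halfSpace_re_gt 0).isPreconnected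
  have hl : AnalyticOnNhd ℂ
      (fun r : ℂ => ∫ t : ℝ in Ioi 0, cexp (-(t * r)) * ((t ^ (a - 1) : ℝ) : ℂ)) U := by
    refine DifferentiableOn.analyticOnNhd (fun z hz => ?_) hU
    have hz' : 0 < z.re := hz
    have hV : IsOpen {x : ℂ | z.re / 2 < x.re} := isOpen_lt continuous_const continuous_re
    have hb : ∀ᵐ t : ℝ ∂(volume.restrict (Ioi (0 : ℝ))), ∀ x ∈ {x : ℂ | z.re / 2 < x.re},
        ‖cexp (-(t * x)) * ((t ^ (a - 1) : ℝ) : ℂ)‖ ≤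
          t ^ (a - 1) * Real.exp (-(z.re / 2 * t)) := by
      filter_upwards [ae_restrict_mem measurableSet_Ioi] with t ht x hx
      rw [norm_cexp_neg_mul_mul_rpow a x ht]
      have hx' : z.re / 2 < x.re := hx
      have ht' : 0 < t := ht
      gcongr
    refine (hasDerivAt_integral_of_holomorphic hV
      (F := fun r (t : ℝ) => cexp (-(t * r)) * ((t ^ (a - 1) : ℝ) : ℂ))
      (integrableOn_rpow_mul_exp_neg_mul ha (half_pos hz')) ?_ hb ?_
      (by simpa using hz' : z ∈ {x : ℂ | z.re / 2 < x.re})).differentiableWithinAt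
    · exact fun x _ => aestronglyMeasurable_exp_mul_rpow a x
    · exact Eventually.of_forall fun t => by fun_prop
  have hrr : AnalyticOnNhd ℂ (fun r : ℂ => Complex.Gamma a * r ^ (-(a : ℂ))) U := by
    refine DifferentiableOn.analyticOnNhd (fun z hz => ?_) hU
    have hz' : z ∈ slitPlane := Or.inl hz
    exact ((differentiableAt_id.cpow_const hz').const_mul _).differentiableWithinAt
  -- Identity theorem: both sides are analytic on the right half-plane and agree at the positive
  -- reals, which accumulate at 1.
  refine hl.eqOn_of_preconnected_of_frequently_eq hrr hpre (z₀ := 1) (by simp [hUdef]) ?_ hr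
  have h1 : ∃ᶠ x : ℝ in 𝓝[≠] (1 : ℝ), 0 < x := by
    refine (Eventually.frequently ?_)
    exact nhdsWithin_le_nhds (lt_mem_nhds one_pos)
  have h2 : Tendsto (fun x : ℝ => (x : ℂ)) (𝓝[≠] 1) (𝓝[≠] 1) := by
    rw [tendsto_nhdsWithin_iff]
    refine ⟨(continuous_ofReal.tendsto' 1 1 (by simp)).mono_left nhdsWithin_le_nhds, ?_⟩
    filter_upwards [self_mem_nhdsWithin] with x hx
    simpa using hx
  refine h2.frequently (h1.mono fun x hx => ?_)
  have h3 := integral_cpow_mul_exp_neg_mul_Ioi (a := a) (r := x) (by simpa using ha) hx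
  have h4 : (1 / (x : ℂ)) ^ (a : ℂ) = (x : ℂ) ^ (-(a : ℂ)) := by
    rw [one_div, cpow_neg, inv_cpow]
    rw [arg_ofReal_of_nonneg hx.le]
    exact Real.pi_pos.ne
  rw [mul_comm, ← h4, ← h3]
  refine setIntegral_congr_fun measurableSet_Ioi fun t ht => ?_
  have ht' : (0 : ℝ) ≤ t := le_of_lt ht
  simp only [ofReal_cpow ht']
  rw [mul_comm]
  push_cast
  ring_nf

end MedianResum

namespace MedianResum

/-! ### Powers on the right half-plane and the Feynman parametrization -/

theorem log_eq_of_exp_eq {z l : ℂ} (h : cexp l = z) (h1 : -Real.pi < l.im) (h2 : l.im ≤ Real.pi) :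
    Complex.log z = l := by
  rw [← h, Complex.log_exp h1 h2]

theorem log_im_mem_of_re_pos {z : ℂ} (h : 0 < z.re) :
    -(Real.pi / 2) < (Complex.log z).im ∧ (Complex.log z).im < Real.pi / 2 := by
  rw [Complex.log_im]
  exact abs_lt.1 (Complex.abs_arg_lt_pi_div_two_iff.2 (Or.inl h))

theorem ne_zero_of_re_pos {z : ℂ} (h : 0 < z.re) : z ≠ 0 := by
  rintro rfl
  simp at h

/-- Both arguments are less than π/2 in absolute value, so their difference stays in (-π, π) and no
2πi enters the logarithm of the quotient. -/
theorem div_cpow_of_re_pos {A R : ℂ} (hA : 0 < A.re) (hR : 0 < R.re) (s : ℂ) :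
    (R / A) ^ s = A ^ (-s) * R ^ s := by
  have hA0 := ne_zero_of_re_pos hA
  have hR0 := ne_zero_of_re_pos hR
  have h1 := log_im_mem_of_re_pos hA
  have h2 := log_im_mem_of_re_pos hR
  have hl : Complex.log (R / A) = Complex.log R - Complex.log A := by
    apply log_eq_of_exp_eq
    · rw [Complex.exp_sub, Complex.exp_log hR0, Complex.exp_log hA0]
    · rw [sub_im]; linarith
    · rw [sub_im]; linarith
  rw [cpow_def_of_ne_zero (div_ne_zero hR0 hA0), cpow_def_of_ne_zero hA0, cpow_def_of_ne_zero hR0,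
    hl, ← Complex.exp_add]
  ring_nf

theorem norm_cpow_ofReal_eq {z : ℂ} (hz : z ≠ 0) (s : ℝ) : ‖z ^ (s : ℂ)‖ = ‖z‖ ^ s := by
  rw [norm_cpow_of_ne_zero hz]
  simp

theorem integrableOn_beta {a b : ℝ} (ha : 0 < a) (hb : 0 < b) :
    IntegrableOn (fun x : ℝ => x ^ (a - 1) * (1 - x) ^ (b - 1)) (Ioo 0 1) := by
  have h := Complex.betaIntegral_convergent (u := a) (v := b) (by simpa) (by simpa)
  rw [intervalIntegrable_iff_integrableOn_Ioo_of_le zero_le_one] at h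
  have h' : IntegrableOn (fun x : ℝ => ‖(x : ℂ) ^ ((a : ℂ) - 1) * (1 - (x : ℂ)) ^ ((b : ℂ) - 1)‖)
    (Ioo 0 1) volume := Integrable.norm h
  refine h'.congr_fun (fun x hx => ?_) measurableSet_Ioo
  have h1 : 0 < x := hx.1
  have h2 : 0 < 1 - x := sub_pos.2 hx.2
  have e1 : (1 : ℂ) - x = ((1 - x : ℝ) : ℂ) := by push_cast; rfl
  have e2 : (a : ℂ) - 1 = ((a - 1 : ℝ) : ℂ) := by push_cast; rfl
  have e3 : (b : ℂ) - 1 = ((b - 1 : ℝ) : ℂ) := by push_cast; rfl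
  simp only
  rw [norm_mul, e1, e2, e3, norm_cpow_ofReal_eq (by exact_mod_cast h1.ne'),
    norm_cpow_ofReal_eq (by exact_mod_cast h2.ne'), Complex.norm_real, Complex.norm_real,
    Real.norm_of_nonneg h1.le, Real.norm_of_nonneg h2.le]

/-- The density of the (unnormalized) Beta distribution. -/
def betaDensity (a b x : ℝ) : ℝ := x ^ (a - 1) * (1 - x) ^ (b - 1)

/-- The Feynman parametrization of `A^{-a} B^{-b}` on the right half-plane. -/
theorem integral_feynman {a b : ℝ} (ha : 0 < a) (hb : 0 < b) {A B : ℂ} (hA : 0 < A.re)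
    (hB : 0 < B.re) :
    ∫ x : ℝ in Ioo 0 1, (betaDensity a b x : ℂ) * (x * A + (1 - x) * B) ^ (-((a + b : ℝ) : ℂ)) =
      Complex.Gamma a * Complex.Gamma b / Complex.Gamma ((a + b : ℝ) : ℂ) *
        (A ^ (-(a : ℂ)) * B ^ (-(b : ℂ))) := by
  have hΓ : Complex.Gamma ((a + b : ℝ) : ℂ) ≠ 0 := by
    rw [Complex.Gamma_ofReal]
    exact_mod_cast (Real.Gamma_pos_of_pos (by positivity)).ne'
  -- The Laplace transform turns convolutions into products: the right-hand side is, up to Γ(a + b),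
  -- the integral of the convolution of e^{-tA} t^{a-1} and e^{-tB} t^{b-1}.
  have hconv := integral_posConvolution
    (integrableOn_cexp_neg_mul_mul_rpow ha hA) (integrableOn_cexp_neg_mul_mul_rpow hb hB)
    (ContinuousLinearMap.mul ℝ ℂ)
  simp only [ContinuousLinearMap.mul_apply'] at hconv
  rw [integral_cexp_neg_mul_mul_rpow ha hA, integral_cexp_neg_mul_mul_rpow hb hB] at hconv
  set G : ℝ → ℝ → ℂ := fun t x => (betaDensity a b x : ℂ) *
    (cexp (-(t * (x * A + (1 - x) * B))) * ((t ^ (a + b - 1) : ℝ) : ℂ)) with hG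
  have hinner : ∀ t ∈ Ioi (0 : ℝ),
      (∫ s in (0 : ℝ)..t, cexp (-(s * A)) * ((s ^ (a - 1) : ℝ) : ℂ) *
        (cexp (-(((t - s : ℝ) : ℂ) * B)) * (((t - s) ^ (b - 1) : ℝ) : ℂ))) =
      ∫ x in Ioo (0 : ℝ) 1, G t x := by
    intro t ht
    have ht' : 0 < t := ht
    -- The substitution s = t x in the convolution separates the factor t^{a+b-1} from the Beta
    -- density in x.
    have h1 := intervalIntegral.integral_comp_mul_left (a := 0) (b := 1)
      (fun s : ℝ => cexp (-(s * A)) * ((s ^ (a - 1) : ℝ) : ℂ) *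
        (cexp (-(((t - s : ℝ) : ℂ) * B)) * (((t - s) ^ (b - 1) : ℝ) : ℂ))) ht'.ne'
    rw [mul_zero, mul_one] at h1
    rw [eq_inv_smul_iff₀ ht'.ne'] at h1
    rw [← h1, intervalIntegral.integral_of_le zero_le_one, integral_Ioc_eq_integral_Ioo,
      ← integral_smul]
    refine setIntegral_congr_fun measurableSet_Ioo fun x hx => ?_
    have hx1 : 0 < x := hx.1
    have hx2 : 0 < 1 - x := sub_pos.2 hx.2
    have e1 : t - t * x = t * (1 - x) := by ring
    have e2 : t ^ (a + b - 1) = t * t ^ (a - 1) * t ^ (b - 1) := by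
      rw [show a + b - 1 = 1 + (a - 1) + (b - 1) by ring, Real.rpow_add ht', Real.rpow_add ht',
        Real.rpow_one]
    simp only [hG, betaDensity, e1, e2, Real.mul_rpow ht'.le hx1.le, Real.mul_rpow ht'.le hx2.le]
    have e3 : cexp (-(t * (x * A + (1 - x) * B))) =
        cexp (-(((t * x : ℝ) : ℂ) * A)) * cexp (-(((t * (1 - x) : ℝ) : ℂ) * B)) := by
      rw [← Complex.exp_add]
      congr 1
      push_cast
      ring
    rw [e3, real_smul]
    push_cast
    ring
  rw [setIntegral_congr_fun measurableSet_Ioi hinner] at hconv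
  have hδ : 0 < min A.re B.re := lt_min hA hB
  have hint : Integrable (Function.uncurry G)
      ((volume.restrict (Ioi 0)).prod (volume.restrict (Ioo 0 1))) := by
    have hb1 := (integrableOn_rpow_mul_exp_neg_mul (a := a + b) (by positivity) hδ).mul_prod
      (integrableOn_beta ha hb)
    refine hb1.mono' ?_ ?_
    · apply Measurable.aestronglyMeasurable
      simp only [hG, betaDensity, Function.uncurry_def]
      fun_prop
    · rw [Measure.prod_restrict]
      filter_upwards [ae_restrict_mem (measurableSet_Ioi.prod measurableSet_Ioo)] with z hz
      obtain ⟨t, x⟩ := z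
      obtain ⟨ht, hx1, hx2⟩ := hz
      have ht' : 0 < t := ht
      simp only at hx1 hx2
      have hx2' : 0 < 1 - x := sub_pos.2 hx2
      simp only [hG, betaDensity, Function.uncurry_apply_pair]
      rw [norm_mul, norm_cexp_neg_mul_mul_rpow _ _ ht', Complex.norm_real,
        Real.norm_of_nonneg (by positivity)]
      rw [mul_comm]
      have hre : min A.re B.re ≤ ((x : ℂ) * A + (1 - x) * B).re := by
        have e : (1 - (x : ℂ)) = ((1 - x : ℝ) : ℂ) := by push_cast; rfl
        rw [e, add_re, re_ofReal_mul, re_ofReal_mul]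
        nlinarith [min_le_left A.re B.re, min_le_right A.re B.re]
      gcongr
  -- With x outside, the t-integral is a Gamma integral with exponent a + b and r = x A + (1 - x) B.
  rw [integral_integral_swap hint] at hconv
  rw [div_mul_eq_mul_div, eq_div_iff hΓ]
  rw [show Complex.Gamma a * Complex.Gamma b * (A ^ (-(a : ℂ)) * B ^ (-(b : ℂ))) =
    Complex.Gamma a * A ^ (-(a : ℂ)) * (Complex.Gamma b * B ^ (-(b : ℂ))) by ring, ← hconv,
    ← integral_mul_const]
  refine setIntegral_congr_fun measurableSet_Ioo fun x hx => ?_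
  have hx1 : 0 < x := hx.1
  have hx2 : 0 < 1 - x := sub_pos.2 hx.2
  simp only [hG]
  rw [integral_const_mul, integral_cexp_neg_mul_mul_rpow (by positivity)]
  · ring
  · have e : (1 - (x : ℂ)) = ((1 - x : ℝ) : ℂ) := by push_cast; rfl
    rw [e, add_re, re_ofReal_mul, re_ofReal_mul]
    positivity

end MedianResum

namespace MedianResum

/-! ### Borel-Laplace sums with polynomial growth -/

/-- `φ` is Borel-Laplace summable with shift `κ` in direction `θ`, with sum `S` on the half-plane
`Re (w e^{-iθ}) > 0`, and its Borel transform grows at most polynomially along the ray. -/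
def HasModerateSum (κ θ : ℝ) (φ : PowerSeries ℂ) (S : ℂ → ℂ) : Prop :=
  ∃ (ψ : ℂ → ℂ) (ε : ℝ), 0 < ε ∧
    DifferentiableOn ℂ ψ (halfStrip θ ε) ∧
    (∀ᶠ u in 𝓝 (0 : ℂ),
      HasSum (fun n : ℕ => PowerSeries.coeff n (borelTransform κ φ) * u ^ n) (ψ u)) ∧
    (∃ (M : ℝ) (A : ℕ), ∀ r : ℝ, 0 ≤ r → ‖ψ ((r : ℂ) * dir θ)‖ ≤ M * (1 + r) ^ A) ∧
    ∀ w : ℂ, 0 < (w * dir (-θ)).re →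
      ∫ t in Ioi (0 : ℝ), laplaceIntegrand κ θ ψ w t = S w

theorem norm_dir (θ : ℝ) : ‖dir θ‖ = 1 := by
  rw [dir, norm_exp_ofReal_mul_I]

theorem dir_ne_zero (θ : ℝ) : dir θ ≠ 0 := Complex.exp_ne_zero _

theorem dir_mul_dir_neg (θ : ℝ) : dir θ * dir (-θ) = 1 := by
  rw [dir, dir, ← Complex.exp_add]
  simp

theorem conj_dir (θ : ℝ) : (starRingEnd ℂ) (dir θ) = dir (-θ) := by
  simp [dir, ← Complex.exp_conj]

theorem re_dir_div (θ : ℝ) (w : ℂ) : (dir θ / w).re = (w * dir (-θ)).re / normSq w := by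
  rw [← conj_dir, Complex.div_re]
  simp only [mul_re, conj_re, conj_im]
  ring

theorem re_dir_div_pos {θ : ℝ} {w : ℂ} (h : 0 < (w * dir (-θ)).re) : 0 < (dir θ / w).re := by
  rw [re_dir_div]
  have hw : w ≠ 0 := by rintro rfl; simp at h
  exact div_pos h (normSq_pos.2 hw)

theorem ne_zero_of_re_mul_pos {w e : ℂ} (h : 0 < (w * e).re) : w ≠ 0 := by
  rintro rfl; simp at h

/-- 1 - w p is the quotient of e^{iθ}/w - p e^{iθ} by e^{iθ}/w, both in the right half-plane. This
isolates the power of e^{iθ}/w that the Laplace integrand carries as a prefactor. -/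
theorem one_sub_mul_cpow {θ : ℝ} {w p : ℂ} (hw : 0 < (w * dir (-θ)).re)
    (hp : (p * dir θ).re ≤ 0) (s : ℂ) :
    (1 - w * p) ^ s = (dir θ / w) ^ (-s) * (dir θ / w - dir θ * p) ^ s := by
  have hA := re_dir_div_pos hw
  have hR : 0 < (dir θ / w - dir θ * p).re := by
    rw [sub_re, mul_comm (dir θ) p]; linarith
  rw [← div_cpow_of_re_pos hA hR]
  have hw0 := ne_zero_of_re_mul_pos hw
  congr 1
  have := dir_ne_zero θ
  field_simp

/-- The data of a superposition of powers `(1 - w p)^{-s}` whose formal Borel transforms converge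
near the origin. -/
structure Admissible {X : Type*} [MeasurableSpace X] (μ : Measure X) (p m : X → ℂ) : Prop where
  meas_p : AEStronglyMeasurable p μ
  meas_m : AEStronglyMeasurable m μ
  integrable : ∃ ε : ℝ, 0 < ε ∧ Integrable (fun x => Real.exp (ε * ‖p x‖) * ‖m x‖) μ

variable {X : Type*} [MeasurableSpace X] {μ : Measure X} {p m : X → ℂ}

theorem aestronglyMeasurable_div_const {f : X → ℂ} (hf : AEStronglyMeasurable f μ) (c : ℂ) :
    AEStronglyMeasurable (fun x => f x / c) μ := by
  simpa only [div_eq_mul_inv] using hf.mul_const c⁻¹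

theorem Admissible.integrable_m (h : Admissible μ p m) : Integrable m μ := by
  obtain ⟨ε, hε, hi⟩ := h.integrable
  refine hi.mono' h.meas_m (Eventually.of_forall fun x => ?_)
  have : 1 ≤ Real.exp (ε * ‖p x‖) := Real.one_le_exp (by positivity)
  nlinarith [norm_nonneg (m x)]

/-- An extra factor of size ‖p‖ costs half of the exponential rate, because ‖p‖ ≤ (2/ε) e^{ε‖p‖/2}.
-/
theorem Admissible.mul_left (h : Admissible μ p m) {q : X → ℂ} (hq : AEStronglyMeasurable q μ)
    (hqp : ∀ᵐ x ∂μ, ‖q x‖ ≤ ‖p x‖) : Admissible μ p (fun x => q x * m x) := by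
  obtain ⟨ε, hε, hi⟩ := h.integrable
  refine ⟨h.meas_p, hq.mul h.meas_m, ε / 2, by positivity, ?_⟩
  refine (hi.const_mul (2 / ε)).mono' ?_ ?_
  · refine AEStronglyMeasurable.mul ?_ (hq.mul h.meas_m).norm
    exact Real.continuous_exp.comp_aestronglyMeasurable (h.meas_p.norm.const_mul _)
  · filter_upwards [hqp] with x hx
    rw [Real.norm_of_nonneg (by positivity), norm_mul]
    have h1 : ε / 2 * ‖p x‖ ≤ Real.exp (ε / 2 * ‖p x‖) := by
      linarith [Real.add_one_le_exp (ε / 2 * ‖p x‖)]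
    have h2 : Real.exp (ε * ‖p x‖) = Real.exp (ε / 2 * ‖p x‖) * Real.exp (ε / 2 * ‖p x‖) := by
      rw [← Real.exp_add]; ring_nf
    have h3 : ‖q x‖ ≤ 2 / ε * Real.exp (ε / 2 * ‖p x‖) := by
      rw [div_mul_eq_mul_div, le_div_iff₀ hε]
      nlinarith
    calc Real.exp (ε / 2 * ‖p x‖) * (‖q x‖ * ‖m x‖)
        ≤ Real.exp (ε / 2 * ‖p x‖) * (2 / ε * Real.exp (ε / 2 * ‖p x‖) * ‖m x‖) := by gcongr
      _ = _ := by rw [h2]; ring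

/-- The component of u on the ray contributes a nonpositive real part; only the displacement from
the ray, of length less than ε, can make the exponent positive. Hence e^{ε‖p‖} dominates e^{up} on
the whole half-strip. -/
theorem re_mul_le_of_mem_halfStrip {θ ε : ℝ} {u p : ℂ} (hu : u ∈ halfStrip θ ε)
    (hp : (p * dir θ).re ≤ 0) : (u * p).re ≤ ε * ‖p‖ := by
  obtain ⟨z, ⟨r, hr, rfl⟩, hz⟩ := Metric.mem_thickening_iff.1 hu
  have hr' : (0 : ℝ) ≤ r := hr
  have e : u * p = (u - r * dir θ) * p + (r : ℂ) * (p * dir θ) := by ring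
  rw [e, add_re, re_ofReal_mul]
  have h1 : ((u - r * dir θ) * p).re ≤ ε * ‖p‖ := by
    refine (re_le_norm _).trans ?_
    rw [norm_mul]
    rw [dist_eq_norm] at hz
    gcongr
  nlinarith

theorem gamma_ofReal_ne_zero {κ : ℝ} (hκ : 0 < κ) : Complex.Gamma (κ : ℂ) ≠ 0 := by
  rw [Complex.Gamma_ofReal]
  exact_mod_cast (Real.Gamma_pos_of_pos hκ).ne'

theorem gamma_nat_add_ne_zero {κ : ℝ} (hκ : 0 < κ) (n : ℕ) :
    Complex.Gamma ((n : ℂ) + (κ : ℂ)) ≠ 0 := by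
  have := gamma_ofReal_ne_zero (κ := n + κ) (by positivity)
  simpa using this

theorem ray_mem_halfStrip {θ ε r : ℝ} (hε : 0 < ε) (hr : 0 ≤ r) : (r : ℂ) * dir θ ∈ halfStrip θ ε :=
  Metric.self_subset_thickening hε _ ⟨r, hr, rfl⟩

theorem integrableOn_exp_mul_poly {κ : ℝ} (hκ : 0 < κ) {a : ℝ} (ha : 0 < a) (A : ℕ) :
    IntegrableOn (fun t : ℝ => t ^ (κ - 1) * Real.exp (-(a * t)) * (1 + t) ^ A) (Ioi 0) := by
  have h : ∀ j ∈ Finset.range (A + 1), IntegrableOn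
      (fun t : ℝ => t ^ (κ + j - 1) * Real.exp (-(a * t)) * (A.choose j)) (Ioi 0) := fun j _ =>
    (integrableOn_rpow_mul_exp_neg_mul (a := κ + j) (by positivity) ha).mul_const _
  refine IntegrableOn.congr_fun (MeasureTheory.integrable_finsetSum _ h) (fun t ht => ?_)
    measurableSet_Ioi
  have ht' : 0 < t := ht
  rw [add_comm 1 t, add_pow, Finset.mul_sum]
  refine Finset.sum_congr rfl fun j _ => ?_
  rw [show κ + j - 1 = (κ - 1) + j by ring, Real.rpow_add ht', Real.rpow_natCast]
  ring

theorem norm_laplaceIntegrand {κ θ : ℝ} (ψ : ℂ → ℂ) {w : ℂ} (hw : 0 < (w * dir (-θ)).re) {t : ℝ}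
    (ht : 0 < t) : ‖laplaceIntegrand κ θ ψ w t‖ =
      ‖dir θ / w‖ ^ κ * (t ^ (κ - 1) * Real.exp (-((dir θ / w).re * t)) * ‖ψ (t * dir θ)‖) := by
  have hA := ne_zero_of_re_pos (re_dir_div_pos hw)
  rw [laplaceIntegrand, norm_mul, norm_mul, norm_mul, norm_cpow_ofReal_eq hA, Complex.norm_real,
    Real.norm_of_nonneg (by positivity), norm_exp, mul_div_assoc, neg_re, re_ofReal_mul]
  ring_nf

theorem continuousOn_ray {ψ : ℂ → ℂ} {θ ε : ℝ} (hε : 0 < ε)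
    (hd : DifferentiableOn ℂ ψ (halfStrip θ ε)) :
    ContinuousOn (fun t : ℝ => ψ (t * dir θ)) (Ioi 0) := by
  refine hd.continuousOn.comp (by fun_prop) fun t ht => ray_mem_halfStrip hε (le_of_lt ht)

theorem integrableOn_laplaceIntegrand {κ θ : ℝ} (hκ : 0 < κ) {ψ : ℂ → ℂ} {w : ℂ}
    (hw : 0 < (w * dir (-θ)).re) (hc : ContinuousOn (fun t : ℝ => ψ (t * dir θ)) (Ioi 0))
    {M : ℝ} {A : ℕ} (hM : ∀ r : ℝ, 0 ≤ r → ‖ψ ((r : ℂ) * dir θ)‖ ≤ M * (1 + r) ^ A) :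
    IntegrableOn (laplaceIntegrand κ θ ψ w) (Ioi 0) := by
  have h := (integrableOn_exp_mul_poly hκ (re_dir_div_pos hw) A).const_mul (‖dir θ / w‖ ^ κ * M)
  refine h.mono' ?_ ?_
  · unfold laplaceIntegrand
    refine AEStronglyMeasurable.mul (AEStronglyMeasurable.mul ?_
      (hc.aestronglyMeasurable measurableSet_Ioi)) ?_
    · apply Measurable.aestronglyMeasurable; fun_prop
    · apply Measurable.aestronglyMeasurable; fun_prop
  · filter_upwards [ae_restrict_mem measurableSet_Ioi] with t ht
    have ht' : 0 < t := ht
    rw [norm_laplaceIntegrand ψ hw ht']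
    have := hM t ht'.le
    calc _ ≤ ‖dir θ / w‖ ^ κ * (t ^ (κ - 1) * Real.exp (-((dir θ / w).re * t)) *
          (M * (1 + t) ^ A)) := by gcongr
      _ = _ := by ring

/-- Polynomial growth gives absolute convergence of the Laplace integral on the entire half-plane,
and (1 + r)^A ≤ e^{Ar} supplies the exponential type. -/
theorem HasModerateSum.hasBorelLaplaceSum {κ θ : ℝ} (hκ : 0 < κ) {φ : PowerSeries ℂ} {S : ℂ → ℂ}
    (h : HasModerateSum κ θ φ S) {w : ℂ} (hw : 0 < (w * dir (-θ)).re) :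
    HasBorelLaplaceSum κ θ φ w (S w) := by
  obtain ⟨ψ, ε, hε, hd, hs, ⟨M, A, hM⟩, hL⟩ := h
  refine ⟨ψ, ε, hε, hd, hs, ⟨M, A, fun r hr => (hM r hr).trans ?_⟩,
    integrableOn_laplaceIntegrand hκ hw (continuousOn_ray hε hd) hM, hL w hw⟩
  have hM0 : 0 ≤ M := by simpa using (norm_nonneg _).trans (hM 0 le_rfl)
  gcongr
  rw [Real.exp_nat_mul]
  gcongr
  linarith [Real.add_one_le_exp r]

/-- A superposition of powers `(1 - w p)^{-κ}` is a Borel-Laplace sum with shift `κ`. -/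
theorem Admissible.exists_hasModerateSum [SFinite μ] (h : Admissible μ p m) {κ : ℝ} (hκ : 0 < κ) :
    ∃ φ : PowerSeries ℂ, ∀ θ : ℝ, (∀ᵐ x ∂μ, (p x * dir θ).re ≤ 0) →
      HasModerateSum κ θ φ (fun w => ∫ x, (1 - w * p x) ^ (-(κ : ℂ)) * m x ∂μ) := by
  have hΓ := gamma_ofReal_ne_zero hκ
  obtain ⟨ε, hε, hi⟩ := h.integrable
  -- These are the binomial coefficients of (1 - w p)^{-κ}, integrated against m. They do not
  -- involve θ, so one series serves all directions.
  refine ⟨PowerSeries.mk fun n => Complex.Gamma ((n : ℂ) + κ) / (n.factorial * Complex.Gamma κ) *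
    ∫ x, p x ^ n * m x ∂μ, fun θ hθ => ?_⟩
  have hmeas : ∀ u : ℂ, AEStronglyMeasurable
      (fun x => cexp (u * p x) * (m x / Complex.Gamma κ)) μ := fun u =>
    (Complex.continuous_exp.comp_aestronglyMeasurable (h.meas_p.const_mul u)).mul
      (aestronglyMeasurable_div_const h.meas_m _)
  have hbd : ∀ᵐ x ∂μ, ∀ u ∈ halfStrip θ ε, ‖cexp (u * p x) * (m x / Complex.Gamma κ)‖ ≤
      Real.exp (ε * ‖p x‖) * ‖m x‖ / ‖Complex.Gamma κ‖ := by
    filter_upwards [hθ] with x hx u hu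
    rw [norm_mul, norm_exp, norm_div, mul_div_assoc]
    gcongr
    exact re_mul_le_of_mem_halfStrip hu hx
  -- The Borel transform in closed form: division by Γ(n + κ) turns the binomial series into the
  -- exponential series of u p.
  refine ⟨fun u => ∫ x, cexp (u * p x) * (m x / Complex.Gamma κ) ∂μ, ε, hε, ?_, ?_, ?_, ?_⟩
  · intro u hu
    refine (hasDerivAt_integral_of_holomorphic (U := halfStrip θ ε) Metric.isOpen_thickening
      (hi.div_const ‖Complex.Gamma κ‖) (fun u _ => hmeas u) hbd ?_ hu).differentiableWithinAt
    exact Eventually.of_forall fun x => by fun_prop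
  · filter_upwards [Metric.ball_mem_nhds (0 : ℂ) hε] with u hu
    have hu' : ‖u‖ ≤ ε := by simpa using (Metric.mem_ball.1 hu).le
    have key := hasSum_integral_of_dominated_convergence (μ := μ)
      (F := fun (n : ℕ) x => (u * p x) ^ n / n.factorial * (m x / Complex.Gamma κ))
      (f := fun x => cexp (u * p x) * (m x / Complex.Gamma κ))
      (fun n x => (ε * ‖p x‖) ^ n / n.factorial * (‖m x‖ / ‖Complex.Gamma κ‖))
      (fun n => ?_) (fun n => ?_) ?_ ?_ ?_
    · refine key.congr_fun fun n => ?_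
      simp only [borelTransform, PowerSeries.coeff_mk]
      rw [← integral_const_mul, div_mul_eq_mul_div, ← integral_mul_const, ← integral_div]
      congr 1 with x
      have := gamma_nat_add_ne_zero hκ n
      have : (n.factorial : ℂ) ≠ 0 := by exact_mod_cast n.factorial_ne_zero
      field_simp
      ring
    · exact (aestronglyMeasurable_div_const ((h.meas_p.const_mul u).pow n) _).mul (aestronglyMeasurable_div_const h.meas_m _)
    · filter_upwards with x
      rw [norm_mul, norm_div, norm_div, norm_pow, norm_mul, Complex.norm_natCast]
      gcongr
    · filter_upwards with x
      exact (Real.summable_pow_div_factorial _).mul_right _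
    · refine (hi.div_const ‖Complex.Gamma κ‖).congr (Eventually.of_forall fun x => ?_)
      simp only
      rw [tsum_mul_right, (NormedSpace.expSeries_div_hasSum_exp (𝔸 := ℝ) (ε * ‖p x‖)).tsum_eq,
        ← Real.exp_eq_exp_ℝ]
      ring
    · filter_upwards with x
      have := (NormedSpace.expSeries_div_hasSum_exp (𝔸 := ℂ) (u * p x)).mul_right
        (m x / Complex.Gamma κ)
      rwa [← Complex.exp_eq_exp_ℂ] at this
  · refine ⟨∫ x, Real.exp (ε * ‖p x‖) * ‖m x‖ / ‖Complex.Gamma κ‖ ∂μ, 0, fun r hr => ?_⟩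
    rw [pow_zero, mul_one]
    refine norm_integral_le_of_norm_le (hi.div_const _) ?_
    filter_upwards [hbd] with x hx using hx _ (ray_mem_halfStrip hε hr)
  · intro w hw
    set A := dir θ / w with hAdef
    have hA : 0 < A.re := re_dir_div_pos hw
    -- Fubini is legitimate because the exponent A - p e^{iθ} has real part at least Re A > 0; the
    -- inner t-integral is then a Gamma integral.
    have hG : Integrable (Function.uncurry fun (t : ℝ) x =>
        A ^ (κ : ℂ) * (m x / Complex.Gamma κ) *
          (cexp (-(t * (A - dir θ * p x))) * ((t ^ (κ - 1) : ℝ) : ℂ)))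
        ((volume.restrict (Ioi 0)).prod μ) := by
      refine ((integrableOn_rpow_mul_exp_neg_mul hκ hA).mul_prod
        ((h.integrable_m.norm.div_const ‖Complex.Gamma κ‖).const_mul ‖A ^ (κ : ℂ)‖)).mono' ?_ ?_
      · refine AEStronglyMeasurable.mul ?_ (AEStronglyMeasurable.mul ?_ ?_)
        · exact ((aestronglyMeasurable_div_const h.meas_m _).const_mul _).comp_snd
        · refine Complex.continuous_exp.comp_aestronglyMeasurable (AEStronglyMeasurable.neg ?_)
          refine AEStronglyMeasurable.mul ?_ ?_
          · apply Measurable.aestronglyMeasurable; fun_prop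
          · exact (aestronglyMeasurable_const.sub (h.meas_p.const_mul _)).comp_snd
        · apply Measurable.aestronglyMeasurable; fun_prop
      · have h1 : ∀ᵐ z ∂((volume.restrict (Ioi (0 : ℝ))).prod μ), 0 < z.1 :=
          Measure.quasiMeasurePreserving_fst.ae (ae_restrict_mem measurableSet_Ioi)
        have h2 : ∀ᵐ z ∂((volume.restrict (Ioi (0 : ℝ))).prod μ), (p z.2 * dir θ).re ≤ 0 :=
          Measure.quasiMeasurePreserving_snd.ae hθ
        filter_upwards [h1, h2] with z hz1 hz2
        obtain ⟨t, x⟩ := z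
        simp only [Function.uncurry_apply_pair] at hz1 hz2 ⊢
        rw [norm_mul, norm_mul, norm_div, norm_cexp_neg_mul_mul_rpow _ _ hz1, mul_comm]
        have : A.re ≤ (A - dir θ * p x).re := by
          rw [sub_re, mul_comm (dir θ)]; linarith
        gcongr
    have e1 : ∀ t ∈ Ioi (0 : ℝ), laplaceIntegrand κ θ
        (fun u => ∫ x, cexp (u * p x) * (m x / Complex.Gamma κ) ∂μ) w t =
        ∫ x, A ^ (κ : ℂ) * (m x / Complex.Gamma κ) *
          (cexp (-(t * (A - dir θ * p x))) * ((t ^ (κ - 1) : ℝ) : ℂ)) ∂μ := by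
      intro t _
      rw [laplaceIntegrand, ← integral_const_mul, ← integral_mul_const]
      congr 1 with x
      have e3 : cexp (-(t * (A - dir θ * p x))) =
          cexp (-(t * dir θ / w)) * cexp (t * dir θ * p x) := by
        rw [← Complex.exp_add, hAdef]
        congr 1
        ring
      rw [e3, hAdef]
      ring
    rw [setIntegral_congr_fun measurableSet_Ioi e1, integral_integral_swap hG]
    refine integral_congr_ae ?_
    filter_upwards [hθ] with x hx
    have hR : 0 < (A - dir θ * p x).re := by
      rw [sub_re, mul_comm (dir θ)]; linarith
    rw [integral_const_mul, integral_cexp_neg_mul_mul_rpow hκ hR, one_sub_mul_cpow hw hx, neg_neg,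
      ← hAdef]
    generalize A - dir θ * p x = R
    field_simp

end MedianResum

namespace MedianResum

/-! ### Closure properties and Watson's lemma -/

theorem HasModerateSum.congr {κ θ : ℝ} {φ : PowerSeries ℂ} {S T : ℂ → ℂ}
    (h : HasModerateSum κ θ φ S) (hST : ∀ w : ℂ, 0 < (w * dir (-θ)).re → S w = T w) :
    HasModerateSum κ θ φ T := by
  obtain ⟨ψ, ε, hε, hd, hs, hM, hL⟩ := h
  exact ⟨ψ, ε, hε, hd, hs, hM, fun w hw => (hL w hw).trans (hST w hw)⟩

theorem HasModerateSum.add {κ θ : ℝ} (hκ : 0 < κ) {φ₁ φ₂ : PowerSeries ℂ} {S₁ S₂ : ℂ → ℂ}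
    (h₁ : HasModerateSum κ θ φ₁ S₁) (h₂ : HasModerateSum κ θ φ₂ S₂) :
    HasModerateSum κ θ (φ₁ + φ₂) (fun w => S₁ w + S₂ w) := by
  obtain ⟨ψ₁, ε₁, hε₁, hd₁, hs₁, ⟨M₁, A₁, hM₁⟩, hL₁⟩ := h₁
  obtain ⟨ψ₂, ε₂, hε₂, hd₂, hs₂, ⟨M₂, A₂, hM₂⟩, hL₂⟩ := h₂
  refine ⟨fun u => ψ₁ u + ψ₂ u, min ε₁ ε₂, lt_min hε₁ hε₂, ?_, ?_, ⟨M₁ + M₂, A₁ + A₂, ?_⟩, ?_⟩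
  · exact (hd₁.mono (Metric.thickening_mono (min_le_left _ _) _)).add
      (hd₂.mono (Metric.thickening_mono (min_le_right _ _) _))
  · filter_upwards [hs₁, hs₂] with u h1 h2
    refine (h1.add h2).congr_fun fun n => ?_
    simp only [borelTransform, PowerSeries.coeff_mk, map_add]
    ring
  · intro r hr
    have h0 : ∀ {M : ℝ} {A : ℕ} {ψ : ℂ → ℂ},
        (∀ r : ℝ, 0 ≤ r → ‖ψ ((r : ℂ) * dir θ)‖ ≤ M * (1 + r) ^ A) → 0 ≤ M := fun h => by
      simpa using (norm_nonneg _).trans (h 0 le_rfl)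
    have h1 := h0 hM₁
    have h2 := h0 hM₂
    have hr1 : 1 ≤ 1 + r := by linarith
    calc _ ≤ M₁ * (1 + r) ^ A₁ + M₂ * (1 + r) ^ A₂ :=
          (norm_add_le _ _).trans (add_le_add (hM₁ r hr) (hM₂ r hr))
      _ ≤ M₁ * (1 + r) ^ (A₁ + A₂) + M₂ * (1 + r) ^ (A₁ + A₂) := by
          gcongr <;> first | exact hr1 | omega
      _ = _ := by ring
  · intro w hw
    show _ = S₁ w + S₂ w
    rw [← hL₁ w hw, ← hL₂ w hw, ← integral_add
      (integrableOn_laplaceIntegrand hκ hw (continuousOn_ray hε₁ hd₁) hM₁)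
      (integrableOn_laplaceIntegrand hκ hw (continuousOn_ray hε₂ hd₂) hM₂)]
    congr 1 with t
    simp only [laplaceIntegrand]
    ring

theorem HasModerateSum.const_mul {κ θ : ℝ} {φ : PowerSeries ℂ} {S : ℂ → ℂ}
    (h : HasModerateSum κ θ φ S) (c : ℂ) :
    HasModerateSum κ θ (PowerSeries.C c * φ) (fun w => c * S w) := by
  obtain ⟨ψ, ε, hε, hd, hs, ⟨M, A, hM⟩, hL⟩ := h
  refine ⟨fun u => c * ψ u, ε, hε, hd.const_mul c, ?_, ⟨‖c‖ * M, A, fun r hr => ?_⟩, ?_⟩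
  · filter_upwards [hs] with u h
    refine (h.mul_left c).congr_fun fun n => ?_
    simp only [borelTransform, PowerSeries.coeff_mk, PowerSeries.coeff_C_mul]
    ring
  · rw [norm_mul, mul_assoc]
    exact mul_le_mul_of_nonneg_left (hM r hr) (norm_nonneg c)
  · intro w hw
    show _ = c * S w
    rw [← hL w hw, ← integral_const_mul]
    congr 1 with t
    simp only [laplaceIntegrand]
    ring

/-- Multiplication by the variable moves every Gamma argument by one, so the Borel transform of X φ
with shift κ is u times that of φ with shift κ + 1. This is the mechanism that trades a factor w for
one unit of κ. -/
theorem HasModerateSum.X_mul {κ θ : ℝ} {φ : PowerSeries ℂ} {S : ℂ → ℂ}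
    (h : HasModerateSum (κ + 1) θ φ S) :
    HasModerateSum κ θ (PowerSeries.X * φ) (fun w => w * S w) := by
  obtain ⟨ψ, ε, hε, hd, hs, ⟨M, A, hM⟩, hL⟩ := h
  refine ⟨fun u => u * ψ u, ε, hε, differentiableOn_id.mul hd, ?_, ⟨M, A + 1, fun r hr => ?_⟩, ?_⟩
  · filter_upwards [hs] with u h
    rw [← hasSum_nat_add_iff' 1]
    simp only [Finset.sum_range_one, borelTransform, PowerSeries.coeff_mk]
    rw [PowerSeries.coeff_zero_X_mul, zero_div, zero_mul, sub_zero]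
    refine (h.mul_left u).congr_fun fun n => ?_
    simp only [borelTransform, PowerSeries.coeff_mk, PowerSeries.coeff_succ_X_mul]
    push_cast
    rw [show (n : ℂ) + 1 + κ = n + (κ + 1) by ring]
    ring
  · rw [norm_mul, norm_mul, norm_dir, Complex.norm_real, Real.norm_of_nonneg hr, pow_succ]
    have := hM r hr
    have h0 := (norm_nonneg _).trans this
    nlinarith
  · intro w hw
    show _ = w * S w
    rw [← hL w hw, ← integral_const_mul]
    refine setIntegral_congr_fun measurableSet_Ioi fun t ht => ?_
    have ht' : 0 < t := ht
    have hA := ne_zero_of_re_pos (re_dir_div_pos hw)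
    have hw0 := ne_zero_of_re_mul_pos hw
    have e : t ^ (κ + 1 - 1) = t ^ (κ - 1) * t := by
      rw [← Real.rpow_add_one ht'.ne']; ring_nf
    simp only [laplaceIntegrand, e]
    push_cast
    rw [cpow_add _ _ hA, cpow_one]
    field_simp

theorem integral_laplaceIntegrand_pow {κ θ : ℝ} (hκ : 0 < κ) (n : ℕ) (b : ℂ) {w : ℂ}
    (hw : 0 < (w * dir (-θ)).re) :
    ∫ t in Ioi (0 : ℝ), laplaceIntegrand κ θ (fun u => b * u ^ n) w t =
      b * Complex.Gamma (n + κ) * w ^ n := by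
  have hA := re_dir_div_pos hw
  have hA0 := ne_zero_of_re_pos hA
  have hw0 := ne_zero_of_re_mul_pos hw
  have e : ∀ t ∈ Ioi (0 : ℝ), laplaceIntegrand κ θ (fun u => b * u ^ n) w t =
      b * dir θ ^ n * (dir θ / w) ^ (κ : ℂ) *
        (cexp (-(t * (dir θ / w))) * ((t ^ (n + κ - 1) : ℝ) : ℂ)) := by
    intro t ht
    have ht' : 0 < t := ht
    rw [show (n : ℝ) + κ - 1 = (κ - 1) + n by ring, Real.rpow_add ht', Real.rpow_natCast,
      laplaceIntegrand, mul_div_assoc]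
    push_cast
    ring
  rw [setIntegral_congr_fun measurableSet_Ioi e, integral_const_mul,
    integral_cexp_neg_mul_mul_rpow (by positivity) hA]
  push_cast
  rw [neg_add, cpow_add _ _ hA0, cpow_neg _ (κ : ℂ), cpow_neg, cpow_natCast, div_pow]
  have := dir_ne_zero θ
  have h1 : (dir θ / w) ^ (κ : ℂ) ≠ 0 := by
    rw [Ne, cpow_eq_zero_iff]; tauto
  field_simp

/-- `φ` is the asymptotic expansion of `S` at `0` along the ray of direction `v`. -/
def HasExpansionAlong (S : ℂ → ℂ) (φ : PowerSeries ℂ) (v : ℂ) : Prop :=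
  ∀ M : ℕ, (fun t : ℝ => S (t * v) - ∑ n ∈ Finset.range M, PowerSeries.coeff n φ * (t * v) ^ n)
    =O[𝓝[>] (0 : ℝ)] (fun t : ℝ => t ^ M)

/-- Once the coefficients below n agree, subtracting the truncations of order n + 1 leaves δ vⁿ tⁿ =
O(t^{n+1}), which forces δ = 0. -/
theorem HasExpansionAlong.unique {S : ℂ → ℂ} {φ₁ φ₂ : PowerSeries ℂ} {v : ℂ} (hv : v ≠ 0)
    (h₁ : HasExpansionAlong S φ₁ v) (h₂ : HasExpansionAlong S φ₂ v) : φ₁ = φ₂ := by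
  ext n
  induction n using Nat.strong_induction_on with
  | _ n ih =>
    have h := (h₂ (n + 1)).sub (h₁ (n + 1))
    set δ := PowerSeries.coeff n φ₁ - PowerSeries.coeff n φ₂ with hδ
    have e : (fun t : ℝ => δ * v ^ n * (t : ℂ) ^ n) =O[𝓝[>] (0 : ℝ)]
        (fun t : ℝ => t ^ (n + 1)) := by
      refine h.congr_left fun t => ?_
      have es : ∑ k ∈ Finset.range n, PowerSeries.coeff k φ₁ * (t * v) ^ k =
          ∑ k ∈ Finset.range n, PowerSeries.coeff k φ₂ * (t * v) ^ k :=
        Finset.sum_congr rfl fun k hk => by rw [ih k (Finset.mem_range.1 hk)]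
      rw [Finset.sum_range_succ, Finset.sum_range_succ, es, hδ]
      ring
    have e2 : Tendsto (fun _ : ℝ => δ * v ^ n) (𝓝[>] (0 : ℝ)) (𝓝 0) := by
      obtain ⟨C, hC⟩ := e.bound
      refine squeeze_zero_norm' (a := fun t => C * t) ?_ ?_
      · filter_upwards [hC, self_mem_nhdsWithin] with t ht h0
        have h0' : 0 < t := h0
        rw [norm_mul, norm_pow, Complex.norm_real, norm_pow, Real.norm_of_nonneg h0'.le, pow_succ,
          ← mul_assoc, mul_right_comm] at ht
        exact le_of_mul_le_mul_right ht (by positivity)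
      · exact ((continuous_const.mul continuous_id).tendsto' 0 0 (by simp)).mono_left
          nhdsWithin_le_nhds
    have e3 := tendsto_nhds_unique e2 tendsto_const_nhds
    rw [eq_comm, mul_eq_zero] at e3
    rcases e3 with e3 | e3
    · exact sub_eq_zero.1 e3
    · exact absurd e3 (pow_ne_zero _ hv)

/-- For r < δ this is the Taylor remainder. For r ≥ δ both terms have polynomial growth, and the
factor (r/δ)^N ≥ 1 supplies the missing power of r. -/
theorem exists_norm_sub_partialSum_le {ψ : ℂ → ℂ} {b : ℕ → ℂ} {θ : ℝ}
    (hs : ∀ᶠ u in 𝓝 (0 : ℂ), HasSum (fun n : ℕ => b n * u ^ n) (ψ u))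
    {M : ℝ} {A : ℕ} (hM : ∀ r : ℝ, 0 ≤ r → ‖ψ ((r : ℂ) * dir θ)‖ ≤ M * (1 + r) ^ A) (N : ℕ) :
    ∃ C : ℝ, ∀ r : ℝ, 0 ≤ r →
      ‖ψ ((r : ℂ) * dir θ) - ∑ n ∈ Finset.range N, b n * ((r : ℂ) * dir θ) ^ n‖ ≤
        C * r ^ N * (1 + r) ^ (A + N) := by
  have hM0 : 0 ≤ M := by simpa using (norm_nonneg _).trans (hM 0 le_rfl)
  have hp : HasFPowerSeriesAt ψ (FormalMultilinearSeries.ofScalars ℂ b) 0 := by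
    rw [hasFPowerSeriesAt_iff]
    filter_upwards [hs] with u hu
    rw [zero_add]
    refine hu.congr_fun fun n => ?_
    rw [FormalMultilinearSeries.coeff_ofScalars, smul_eq_mul, mul_comm]
  obtain ⟨C₁, hC₁⟩ := (hp.isBigO_sub_partialSum_pow N).bound
  obtain ⟨δ, hδ, hball⟩ := Metric.eventually_nhds_iff.1 hC₁
  set B : ℝ := ∑ n ∈ Finset.range N, ‖b n‖
  have hB : 0 ≤ B := Finset.sum_nonneg fun _ _ => norm_nonneg _
  refine ⟨max (max C₁ 0) ((M + B) * (δ⁻¹) ^ N), fun r hr => ?_⟩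
  have hr1 : 1 ≤ 1 + r := by linarith
  have hn : ‖(r : ℂ) * dir θ‖ = r := by
    rw [norm_mul, norm_dir, Complex.norm_real, Real.norm_of_nonneg hr, mul_one]
  rcases lt_or_ge r δ with h | h
  · have h1 := @hball ((r : ℂ) * dir θ) (by rwa [dist_zero_right, hn])
    rw [zero_add, norm_pow, norm_norm, hn] at h1
    simp only [FormalMultilinearSeries.partialSum, FormalMultilinearSeries.ofScalars_apply_eq,
      smul_eq_mul] at h1
    refine h1.trans ?_
    have h2 : 1 ≤ (1 + r) ^ (A + N) := one_le_pow₀ hr1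
    calc C₁ * r ^ N ≤ max (max C₁ 0) ((M + B) * (δ⁻¹) ^ N) * r ^ N := by
          gcongr
          exact (le_max_left _ _).trans (le_max_left _ _)
      _ ≤ _ := by
          refine le_mul_of_one_le_right ?_ h2
          have : 0 ≤ max (max C₁ 0) ((M + B) * (δ⁻¹) ^ N) :=
            (le_max_right C₁ 0).trans (le_max_left _ _)
          positivity
  · have h1 : ‖∑ n ∈ Finset.range N, b n * ((r : ℂ) * dir θ) ^ n‖ ≤ B * (1 + r) ^ (A + N) := by
      rw [Finset.sum_mul]
      refine (norm_sum_le _ _).trans (Finset.sum_le_sum fun n hn' => ?_)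
      rw [norm_mul, norm_pow, hn]
      gcongr
      calc r ^ n ≤ (1 + r) ^ n := by gcongr; linarith
        _ ≤ _ := pow_le_pow_right₀ hr1 (by have := Finset.mem_range.1 hn'; omega)
    have h2 : ‖ψ ((r : ℂ) * dir θ)‖ ≤ M * (1 + r) ^ (A + N) := by
      refine (hM r hr).trans ?_
      gcongr
      omega
    have h3 : 1 ≤ (δ⁻¹) ^ N * r ^ N := by
      rw [← mul_pow]
      refine one_le_pow₀ ?_
      rw [inv_mul_eq_div, one_le_div hδ]
      exact h
    calc _ ≤ M * (1 + r) ^ (A + N) + B * (1 + r) ^ (A + N) :=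
          (norm_sub_le _ _).trans (add_le_add h2 h1)
      _ = (M + B) * 1 * (1 + r) ^ (A + N) := by ring
      _ ≤ (M + B) * ((δ⁻¹) ^ N * r ^ N) * (1 + r) ^ (A + N) := by gcongr
      _ = ((M + B) * (δ⁻¹) ^ N) * r ^ N * (1 + r) ^ (A + N) := by ring
      _ ≤ _ := by gcongr; exact le_max_right _ _

/-- Watson's lemma: a Borel-Laplace sum has the original series as asymptotic expansion. -/
theorem HasModerateSum.hasExpansionAlong {κ θ : ℝ} (hκ : 0 < κ) {φ : PowerSeries ℂ} {S : ℂ → ℂ}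
    (h : HasModerateSum κ θ φ S) {v : ℂ} (hv : 0 < (v * dir (-θ)).re) :
    HasExpansionAlong S φ v := by
  obtain ⟨ψ, ε, hε, hd, hs, ⟨M, A, hM⟩, hL⟩ := h
  intro N
  set b : ℕ → ℂ := fun n => PowerSeries.coeff n (borelTransform κ φ) with hb
  obtain ⟨C, hC⟩ := exists_norm_sub_partialSum_le (θ := θ) (b := b) hs hM N
  set A₁ := dir θ / v with hA₁
  have hA₁pos : 0 < A₁.re := re_dir_div_pos hv
  set K : ℝ := ∫ x in Ioi (0 : ℝ), x ^ (κ + N - 1) * Real.exp (-(A₁.re * x)) * (1 + x) ^ (A + N)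
  have hKi := integrableOn_exp_mul_poly (κ := κ + N) (by positivity) hA₁pos (A + N)
  refine Asymptotics.IsBigO.of_bound (‖A₁‖ ^ κ * (max C 0 * K)) ?_
  have hmem : Ioc (0 : ℝ) 1 ∈ 𝓝[>] (0 : ℝ) := Ioc_mem_nhdsGT one_pos
  filter_upwards [hmem] with t ht
  obtain ⟨ht, ht1⟩ := ht
  set w : ℂ := t * v with hwdef
  have hw : 0 < (w * dir (-θ)).re := by
    rw [hwdef, mul_assoc, re_ofReal_mul]; positivity
  have hAw : dir θ / w = ((t⁻¹ : ℝ) : ℂ) * A₁ := by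
    have : (t : ℂ) ≠ 0 := by exact_mod_cast ht.ne'
    have := ne_zero_of_re_mul_pos hv
    rw [hwdef, hA₁]
    push_cast
    field_simp
  have hi := integrableOn_laplaceIntegrand hκ hw (continuousOn_ray hε hd) hM
  have hin : ∀ n ∈ Finset.range N, IntegrableOn
      (laplaceIntegrand κ θ (fun u => b n * u ^ n) w) (Ioi 0) := fun n _ => by
    refine integrableOn_laplaceIntegrand hκ hw (by fun_prop) (M := ‖b n‖) (A := n) fun r hr => ?_
    rw [norm_mul, norm_pow, norm_mul, norm_dir, Complex.norm_real, Real.norm_of_nonneg hr, mul_one]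
    gcongr
    linarith
  have e1 : S w - ∑ n ∈ Finset.range N, PowerSeries.coeff n φ * w ^ n =
      ∫ r in Ioi (0 : ℝ), laplaceIntegrand κ θ
        (fun u => ψ u - ∑ n ∈ Finset.range N, b n * u ^ n) w r := by
    have e2 : ∀ n, PowerSeries.coeff n φ * w ^ n =
        ∫ r in Ioi (0 : ℝ), laplaceIntegrand κ θ (fun u => b n * u ^ n) w r := fun n => by
      rw [integral_laplaceIntegrand_pow hκ n _ hw]
      simp only [hb, borelTransform, PowerSeries.coeff_mk]
      rw [div_mul_cancel₀ _ (gamma_nat_add_ne_zero hκ n)]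
    rw [← hL w hw, Finset.sum_congr rfl fun n _ => e2 n, ← integral_finsetSum _ hin,
      ← integral_sub hi (integrable_finsetSum _ hin)]
    congr 1 with r
    simp only [laplaceIntegrand]
    rw [mul_sub, sub_mul, Finset.mul_sum, Finset.sum_mul]
  rw [e1, norm_pow, Real.norm_of_nonneg ht.le]
  -- The substitution r = t x brings out t^{κ+N} and leaves an integral bounded by K, because t ≤ 1;
  -- the prefactor t^{-κ} then leaves exactly t^N.
  have hcomp := integral_comp_mul_left_Ioi
    (fun r : ℝ => r ^ (κ + N - 1) * Real.exp (-(t⁻¹ * A₁.re * r)) * (1 + r) ^ (A + N)) 0 ht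
  rw [mul_zero, smul_eq_mul, eq_inv_mul_iff_mul_eq₀ ht.ne'] at hcomp
  have hi2 := integrableOn_exp_mul_poly (κ := κ + N) (by positivity)
    (mul_pos (inv_pos.2 ht) hA₁pos) (A + N)
  have hbound : ‖∫ r in Ioi (0 : ℝ), laplaceIntegrand κ θ
        (fun u => ψ u - ∑ n ∈ Finset.range N, b n * u ^ n) w r‖ ≤
      ∫ r in Ioi (0 : ℝ), ‖A₁‖ ^ κ * t ^ (-κ) * max C 0 *
        (r ^ (κ + N - 1) * Real.exp (-(t⁻¹ * A₁.re * r)) * (1 + r) ^ (A + N)) := by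
    refine norm_integral_le_of_norm_le (hi2.const_mul _) ?_
    filter_upwards [ae_restrict_mem measurableSet_Ioi] with r hr
    have hr' : 0 < r := hr
    rw [norm_laplaceIntegrand _ hw hr', hAw, norm_mul, Complex.norm_real,
      Real.norm_of_nonneg (inv_pos.2 ht).le, re_ofReal_mul, Real.mul_rpow (inv_pos.2 ht).le
      (norm_nonneg _), Real.inv_rpow ht.le, ← Real.rpow_neg ht.le,
      show κ + N - 1 = (κ - 1) + N by ring, Real.rpow_add hr', Real.rpow_natCast]
    calc _ ≤ t ^ (-κ) * ‖A₁‖ ^ κ * (r ^ (κ - 1) * Real.exp (-(t⁻¹ * A₁.re * r)) *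
          (max C 0 * r ^ N * (1 + r) ^ (A + N))) := by
          gcongr
          refine (hC r hr'.le).trans ?_
          gcongr
          exact le_max_left _ _
      _ = _ := by ring
  refine hbound.trans ?_
  rw [integral_const_mul, ← hcomp, ← integral_const_mul]
  have hfin : ∫ x in Ioi (0 : ℝ), t * ((t * x) ^ (κ + N - 1) * Real.exp (-(t⁻¹ * A₁.re * (t * x))) *
      (1 + t * x) ^ (A + N)) ≤ t ^ (κ + N) * K := by
    rw [← integral_const_mul]
    refine integral_mono_of_nonneg ?_ (hKi.const_mul _) ?_
    · filter_upwards [ae_restrict_mem measurableSet_Ioi] with x hx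
      have hx' : 0 < x := hx
      positivity
    · filter_upwards [ae_restrict_mem measurableSet_Ioi] with x hx
      have hx' : 0 < x := hx
      have e4 : t⁻¹ * A₁.re * (t * x) = A₁.re * x := by field_simp
      have e5 : t ^ (κ + N) = t * t ^ (κ + N - 1) := by
        rw [mul_comm, ← Real.rpow_add_one ht.ne']; ring_nf
      simp only [e4, e5]
      rw [Real.mul_rpow ht.le hx'.le]
      have : (1 + t * x) ^ (A + N) ≤ (1 + x) ^ (A + N) := by
        gcongr
        nlinarith
      calc _ ≤ t * (t ^ (κ + N - 1) * x ^ (κ + N - 1) * Real.exp (-(A₁.re * x)) *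
            (1 + x) ^ (A + N)) := by gcongr
        _ = _ := by ring
  calc _ ≤ ‖A₁‖ ^ κ * t ^ (-κ) * max C 0 * (t ^ (κ + N) * K) := by
        gcongr
    _ = ‖A₁‖ ^ κ * (max C 0 * K) * (t ^ (-κ) * t ^ (κ + N)) := by ring
    _ = _ := by
        rw [← Real.rpow_add ht, neg_add_cancel_left, Real.rpow_natCast]

end MedianResum

namespace MedianResum

/-! ### Superpositions with half-integral exponents -/

/-- Convex combinations of p₁ and p₂ keep the condition Re(p e^{iθ}) ≤ 0, so all three powers split
off their power of e^{iθ}/w and the Feynman formula applies to the remaining factors. -/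
theorem one_sub_mul_cpow_feynman {a b : ℝ} (ha : 0 < a) (hb : 0 < b) {θ : ℝ} {w p₁ p₂ : ℂ}
    (hw : 0 < (w * dir (-θ)).re) (h₁ : (p₁ * dir θ).re ≤ 0) (h₂ : (p₂ * dir θ).re ≤ 0) :
    ∫ x : ℝ in Ioo 0 1, (1 - w * (x * p₁ + (1 - x) * p₂)) ^ (-((a + b : ℝ) : ℂ)) *
        (Complex.Gamma ((a + b : ℝ) : ℂ) / (Complex.Gamma a * Complex.Gamma b) *
          betaDensity a b x) =
      (1 - w * p₁) ^ (-(a : ℂ)) * (1 - w * p₂) ^ (-(b : ℂ)) := by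
  have hA := re_dir_div_pos hw
  have hR : ∀ {p : ℂ}, (p * dir θ).re ≤ 0 → 0 < (dir θ / w - dir θ * p).re := fun {p} hp => by
    rw [sub_re, mul_comm (dir θ) p]; linarith
  have key := integral_feynman ha hb (hR h₁) (hR h₂)
  have e : ∀ x ∈ Ioo (0 : ℝ) 1, (1 - w * (x * p₁ + (1 - x) * p₂)) ^ (-((a + b : ℝ) : ℂ)) *
        (Complex.Gamma ((a + b : ℝ) : ℂ) / (Complex.Gamma a * Complex.Gamma b) *
          betaDensity a b x) =
      Complex.Gamma ((a + b : ℝ) : ℂ) / (Complex.Gamma a * Complex.Gamma b) *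
      (dir θ / w) ^ ((a + b : ℝ) : ℂ) * (betaDensity a b x * (x * (dir θ / w - dir θ * p₁) +
        (1 - x) * (dir θ / w - dir θ * p₂)) ^ (-((a + b : ℝ) : ℂ))) := by
    intro x hx
    have hp : ((x * p₁ + (1 - x) * p₂) * dir θ).re ≤ 0 := by
      have e1 : (x * p₁ + (1 - x) * p₂) * dir θ =
        (x : ℂ) * (p₁ * dir θ) + ((1 - x : ℝ) : ℂ) * (p₂ * dir θ) := by push_cast; ring
      rw [e1, add_re, re_ofReal_mul, re_ofReal_mul]
      nlinarith [hx.1, hx.2]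
    rw [one_sub_mul_cpow hw hp, neg_neg]
    have e2 : dir θ / w - dir θ * (x * p₁ + (1 - x) * p₂) =
      x * (dir θ / w - dir θ * p₁) + (1 - x) * (dir θ / w - dir θ * p₂) := by ring
    rw [e2]
    ring
  rw [setIntegral_congr_fun measurableSet_Ioo e, integral_const_mul, key, one_sub_mul_cpow hw h₁,
    one_sub_mul_cpow hw h₂, neg_neg, neg_neg]
  have h3 := gamma_ofReal_ne_zero ha
  have h4 := gamma_ofReal_ne_zero hb
  have h5 := gamma_ofReal_ne_zero (add_pos ha hb)
  rw [ofReal_add, cpow_add _ _ (ne_zero_of_re_pos hA)]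
  rw [ofReal_add] at h5
  field_simp

theorem norm_one_sub_mul_cpow_le {s : ℝ} (hs : 0 < s) {θ : ℝ} {w p : ℂ}
    (hw : 0 < (w * dir (-θ)).re) (hp : (p * dir θ).re ≤ 0) :
    ‖(1 - w * p) ^ (-(s : ℂ))‖ ≤ ‖dir θ / w‖ ^ s * (dir θ / w).re ^ (-s) := by
  have hA := re_dir_div_pos hw
  have hR : (dir θ / w).re ≤ (dir θ / w - dir θ * p).re := by
    rw [sub_re, mul_comm (dir θ) p]; linarith
  have hR0 := ne_zero_of_re_pos (hA.trans_le hR)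
  rw [one_sub_mul_cpow hw hp, neg_neg, norm_mul, norm_cpow_ofReal_eq (ne_zero_of_re_pos hA),
    ← ofReal_neg, norm_cpow_ofReal_eq hR0]
  gcongr ?_ * ?_
  exact Real.rpow_le_rpow_of_nonpos hA (hR.trans (re_le_norm _)) (by linarith)

variable {X : Type*} [MeasurableSpace X] {μ : Measure X} {p m : X → ℂ}

theorem aestronglyMeasurable_one_sub_mul_cpow (hp : AEStronglyMeasurable p μ) (w s : ℂ) :
    AEStronglyMeasurable (fun x => (1 - w * p x) ^ s) μ :=
  (((hp.const_mul w).aemeasurable.const_sub 1).pow_const s).aestronglyMeasurable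

theorem Admissible.integrable_one_sub_mul_cpow (h : Admissible μ p m) {s : ℝ} (hs : 0 < s) {θ : ℝ}
    {w : ℂ} (hw : 0 < (w * dir (-θ)).re) (hp : ∀ᵐ x ∂μ, (p x * dir θ).re ≤ 0) :
    Integrable (fun x => (1 - w * p x) ^ (-(s : ℂ)) * m x) μ := by
  refine h.integrable_m.bdd_mul (c := ‖dir θ / w‖ ^ s * (dir θ / w).re ^ (-s))
    (aestronglyMeasurable_one_sub_mul_cpow h.meas_p w _) ?_
  filter_upwards [hp] with x hx using norm_one_sub_mul_cpow_le hs hw hx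

/-- The kernel of the Feynman parametrization. -/
def feynmanWeight (a b : ℝ) (x : ℝ) : ℂ :=
  Complex.Gamma ((a + b : ℝ) : ℂ) / (Complex.Gamma a * Complex.Gamma b) * betaDensity a b x

/-- The parameter on X × (0, 1) is a convex combination of p₁ and p₂, hence still bounded by ‖q‖,
and the same ε works. The pair p₁, p₂ is thereby replaced by a single parameter to which the basic
summation result applies. -/
theorem Admissible.feynman [SFinite μ] {q p₁ p₂ : X → ℂ} (h : Admissible μ q m)
    (hm₁ : AEStronglyMeasurable p₁ μ) (hm₂ : AEStronglyMeasurable p₂ μ)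
    (h₁ : ∀ᵐ x ∂μ, ‖p₁ x‖ ≤ ‖q x‖) (h₂ : ∀ᵐ x ∂μ, ‖p₂ x‖ ≤ ‖q x‖) {a b : ℝ} (ha : 0 < a)
    (hb : 0 < b) :
    Admissible (μ.prod (volume.restrict (Ioo (0 : ℝ) 1)))
      (fun z => (z.2 : ℂ) * p₁ z.1 + (1 - (z.2 : ℂ)) * p₂ z.1)
      (fun z => feynmanWeight a b z.2 * m z.1) := by
  obtain ⟨ε, hε, hi⟩ := h.integrable
  have hx : AEStronglyMeasurable (fun z : X × ℝ => (z.2 : ℂ))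
      (μ.prod (volume.restrict (Ioo (0 : ℝ) 1))) := by
    apply Measurable.aestronglyMeasurable; fun_prop
  have hP : AEStronglyMeasurable (fun z : X × ℝ => (z.2 : ℂ) * p₁ z.1 + (1 - (z.2 : ℂ)) * p₂ z.1)
      (μ.prod (volume.restrict (Ioo (0 : ℝ) 1))) :=
    (hx.mul hm₁.comp_fst).add ((aestronglyMeasurable_const.sub hx).mul hm₂.comp_fst)
  have hW : AEStronglyMeasurable (fun z : X × ℝ => feynmanWeight a b z.2)
      (μ.prod (volume.restrict (Ioo (0 : ℝ) 1))) := by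
    apply Measurable.aestronglyMeasurable
    unfold feynmanWeight betaDensity
    fun_prop
  refine ⟨hP, hW.mul h.meas_m.comp_fst, ε, hε, ?_⟩
  have hwi : IntegrableOn (feynmanWeight a b) (Ioo 0 1) :=
    (Integrable.ofReal (𝕜 := ℂ) (integrableOn_beta ha hb)).const_mul _
  refine (hi.mul_prod hwi.norm).mono' ?_ ?_
  · exact (Real.continuous_exp.comp_aestronglyMeasurable (hP.norm.const_mul _)).mul
      (hW.mul h.meas_m.comp_fst).norm
  · have hz1 : ∀ᵐ z ∂(μ.prod (volume.restrict (Ioo (0 : ℝ) 1))),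
        ‖p₁ z.1‖ ≤ ‖q z.1‖ ∧ ‖p₂ z.1‖ ≤ ‖q z.1‖ :=
      Measure.quasiMeasurePreserving_fst.ae (h₁.and h₂)
    have hz2 : ∀ᵐ z ∂(μ.prod (volume.restrict (Ioo (0 : ℝ) 1))), z.2 ∈ Ioo (0 : ℝ) 1 :=
      Measure.quasiMeasurePreserving_snd.ae (ae_restrict_mem measurableSet_Ioo)
    filter_upwards [hz1, hz2] with z hz1 hz2
    rw [Real.norm_of_nonneg (by positivity), norm_mul]
    have : ‖(z.2 : ℂ) * p₁ z.1 + (1 - (z.2 : ℂ)) * p₂ z.1‖ ≤ ‖q z.1‖ := by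
      have e : (1 - (z.2 : ℂ)) = ((1 - z.2 : ℝ) : ℂ) := by push_cast; rfl
      refine (norm_add_le _ _).trans ?_
      rw [e, norm_mul, norm_mul, Complex.norm_real, Complex.norm_real, Real.norm_of_nonneg hz2.1.le,
        Real.norm_of_nonneg (sub_nonneg.2 hz2.2.le)]
      nlinarith [hz2.1, hz2.2]
    calc _ ≤ Real.exp (ε * ‖q z.1‖) * (‖feynmanWeight a b z.2‖ * ‖m z.1‖) := by gcongr
      _ = _ := by ring

theorem Admissible.integral_feynman [SFinite μ] {q p₁ p₂ : X → ℂ} (h : Admissible μ q m)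
    (hm₁ : AEStronglyMeasurable p₁ μ) (hm₂ : AEStronglyMeasurable p₂ μ)
    (h₁ : ∀ᵐ x ∂μ, ‖p₁ x‖ ≤ ‖q x‖) (h₂ : ∀ᵐ x ∂μ, ‖p₂ x‖ ≤ ‖q x‖) {a b : ℝ} (ha : 0 < a)
    (hb : 0 < b) {θ : ℝ} (hθ₁ : ∀ᵐ x ∂μ, (p₁ x * dir θ).re ≤ 0)
    (hθ₂ : ∀ᵐ x ∂μ, (p₂ x * dir θ).re ≤ 0) :
    (∀ᵐ z ∂(μ.prod (volume.restrict (Ioo (0 : ℝ) 1))),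
      (((z.2 : ℂ) * p₁ z.1 + (1 - (z.2 : ℂ)) * p₂ z.1) * dir θ).re ≤ 0) ∧
    ∀ w : ℂ, 0 < (w * dir (-θ)).re →
      ∫ z, (1 - w * ((z.2 : ℂ) * p₁ z.1 + (1 - (z.2 : ℂ)) * p₂ z.1)) ^ (-((a + b : ℝ) : ℂ)) *
        (feynmanWeight a b z.2 * m z.1) ∂(μ.prod (volume.restrict (Ioo (0 : ℝ) 1))) =
      ∫ x, (1 - w * p₁ x) ^ (-(a : ℂ)) * (1 - w * p₂ x) ^ (-(b : ℂ)) * m x ∂μ := by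
  have hz1 : ∀ᵐ z ∂(μ.prod (volume.restrict (Ioo (0 : ℝ) 1))),
      (p₁ z.1 * dir θ).re ≤ 0 ∧ (p₂ z.1 * dir θ).re ≤ 0 :=
    Measure.quasiMeasurePreserving_fst.ae (hθ₁.and hθ₂)
  have hz2 : ∀ᵐ z ∂(μ.prod (volume.restrict (Ioo (0 : ℝ) 1))), z.2 ∈ Ioo (0 : ℝ) 1 :=
    Measure.quasiMeasurePreserving_snd.ae (ae_restrict_mem measurableSet_Ioo)
  have hre : ∀ᵐ z ∂(μ.prod (volume.restrict (Ioo (0 : ℝ) 1))),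
      (((z.2 : ℂ) * p₁ z.1 + (1 - (z.2 : ℂ)) * p₂ z.1) * dir θ).re ≤ 0 := by
    filter_upwards [hz1, hz2] with z hz1 hz2
    have e1 : ((z.2 : ℂ) * p₁ z.1 + (1 - (z.2 : ℂ)) * p₂ z.1) * dir θ =
      (z.2 : ℂ) * (p₁ z.1 * dir θ) + ((1 - z.2 : ℝ) : ℂ) * (p₂ z.1 * dir θ) := by push_cast; ring
    rw [e1, add_re, re_ofReal_mul, re_ofReal_mul]
    nlinarith [hz2.1, hz2.2, hz1.1, hz1.2]
  refine ⟨hre, fun w hw => ?_⟩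
  rw [integral_prod _ ((h.feynman hm₁ hm₂ h₁ h₂ ha hb).integrable_one_sub_mul_cpow
    (add_pos ha hb) hw hre)]
  refine integral_congr_ae ?_
  filter_upwards [hθ₁, hθ₂] with x hx1 hx2
  rw [← one_sub_mul_cpow_feynman ha hb hw hx1 hx2, ← integral_mul_const]
  congr 1 with y
  simp only [feynmanWeight]
  ring

/-- The superposition of `(1 - w p)^{-s}` is summable with shift `κ`, as a statement about all
admissible weights. -/
def SuperpositionSummable (μ : Measure X) (p : X → ℂ) (s κ : ℝ) : Prop :=
  ∀ m : X → ℂ, Admissible μ p m → ∃ φ : PowerSeries ℂ, ∀ θ : ℝ,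
    (∀ᵐ x ∂μ, (p x * dir θ).re ≤ 0) →
      HasModerateSum κ θ φ (fun w => ∫ x, (1 - w * p x) ^ (-(s : ℂ)) * m x ∂μ)

/-- Equality is the basic case. Otherwise the factor 1 = (1 - w · 0)^{-(κ-s)} is inserted and merged
by the Feynman parametrization with p₂ = 0, which raises the exponent to κ. -/
theorem superpositionSummable_of_le [SFinite μ] {s κ : ℝ} (hs : 0 < s) (h : s ≤ κ) :
    SuperpositionSummable μ p s κ := by
  intro m hm
  rcases h.eq_or_lt with rfl | h
  · exact hm.exists_hasModerateSum hs
  · have hb : 0 < κ - s := sub_pos.2 h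
    have hz : AEStronglyMeasurable (fun _ : X => (0 : ℂ)) μ := aestronglyMeasurable_const
    have h0 : ∀ᵐ x ∂μ, ‖(0 : ℂ)‖ ≤ ‖p x‖ := Eventually.of_forall fun x => by simp
    have h1 : ∀ᵐ x ∂μ, ‖p x‖ ≤ ‖p x‖ := Eventually.of_forall fun x => le_rfl
    obtain ⟨φ, hφ⟩ := (hm.feynman hm.meas_p hz h1 h0 hs hb).exists_hasModerateSum
      (hs.trans h)
    refine ⟨φ, fun θ hθ => ?_⟩
    obtain ⟨hre, hint⟩ := hm.integral_feynman hm.meas_p hz h1 h0 hs hb hθ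
      (Eventually.of_forall fun x => by simp)
    refine (hφ θ hre).congr fun w hw => ?_
    have := hint w hw
    rw [add_sub_cancel] at this
    rw [this]
    simp

/-- With exponent 0 the sum is the constant ∫ m, which is also the superposition of (1 - w ·
0)^{-κ}. -/
theorem superpositionSummable_zero [SFinite μ] {κ : ℝ} (hκ : 0 < κ) :
    SuperpositionSummable μ p 0 κ := by
  intro m hm
  have h0 : Admissible μ (fun _ => (0 : ℂ)) m := by
    refine ⟨aestronglyMeasurable_const, hm.meas_m, 1, one_pos, ?_⟩
    simpa using hm.integrable_m.norm
  obtain ⟨φ, hφ⟩ := h0.exists_hasModerateSum hκ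
  refine ⟨φ, fun θ _ => (hφ θ (Eventually.of_forall fun x => by simp)).congr fun w _ => ?_⟩
  simp

/-- Integrated form of (1 - wp)^{1-s} = (1 - wp)^{-s} - w p (1 - wp)^{-s}: neighbouring exponents
are linked through one factor w and one factor p in the weight. -/
theorem integral_one_sub_mul_cpow_sub_one {s : ℝ} {θ : ℝ} {w : ℂ} (hw : 0 < (w * dir (-θ)).re)
    (hθ : ∀ᵐ x ∂μ, (p x * dir θ).re ≤ 0)
    (hi₁ : Integrable (fun x => (1 - w * p x) ^ (-(s : ℂ)) * m x) μ)
    (hi₂ : Integrable (fun x => (1 - w * p x) ^ (-(s : ℂ)) * (p x * m x)) μ) :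
    ∫ x, (1 - w * p x) ^ (-((s - 1 : ℝ) : ℂ)) * m x ∂μ =
      (∫ x, (1 - w * p x) ^ (-(s : ℂ)) * m x ∂μ) -
        w * ∫ x, (1 - w * p x) ^ (-(s : ℂ)) * (p x * m x) ∂μ := by
  rw [← integral_const_mul, ← integral_sub hi₁ (hi₂.const_mul w)]
  refine integral_congr_ae ?_
  filter_upwards [hθ] with x hx
  have hne : 1 - w * p x ≠ 0 := by
    have hR : 0 < (dir θ / w - dir θ * p x).re := by
      rw [sub_re, mul_comm (dir θ)]; linarith [re_dir_div_pos hw]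
    have := ne_zero_of_re_pos hR
    have hw0 := ne_zero_of_re_mul_pos hw
    intro h
    apply this
    have : dir θ / w - dir θ * p x = dir θ / w * (1 - w * p x) := by field_simp
    rw [this, h, mul_zero]
  rw [show -((s - 1 : ℝ) : ℂ) = -(s : ℂ) + 1 by push_cast; ring, cpow_add _ _ hne, cpow_one]
  ring

theorem Admissible.mul_self (h : Admissible μ p m) : Admissible μ p (fun x => p x * m x) :=
  h.mul_left h.meas_p (Eventually.of_forall fun _ => le_rfl)

/-- Lowers the exponent: the term with the factor w is handled at shift κ + 1 by
`HasModerateSum.X_mul`. Integrability is assumed because the powers become unbounded once the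
exponent s is negative. -/
theorem superpositionSummable_sub_one {s κ : ℝ} (hs : ∀ (m : X → ℂ), Admissible μ p m →
      ∀ (θ : ℝ) (w : ℂ), 0 < (w * dir (-θ)).re → (∀ᵐ x ∂μ, (p x * dir θ).re ≤ 0) →
      Integrable (fun x => (1 - w * p x) ^ (-(s : ℂ)) * m x) μ) (hκ : 0 < κ)
    (h₁ : SuperpositionSummable μ p s κ) (h₂ : SuperpositionSummable μ p s (κ + 1)) :
    SuperpositionSummable μ p (s - 1) κ := by
  intro m hm
  obtain ⟨φ₁, hφ₁⟩ := h₁ m hm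
  obtain ⟨φ₂, hφ₂⟩ := h₂ _ hm.mul_self
  refine ⟨φ₁ + PowerSeries.C (-1) * (PowerSeries.X * φ₂), fun θ hθ => ?_⟩
  refine ((hφ₁ θ hθ).add hκ ((hφ₂ θ hθ).X_mul.const_mul (-1))).congr fun w hw => ?_
  rw [integral_one_sub_mul_cpow_sub_one hw hθ (hs m hm θ w hw hθ) (hs _ hm.mul_self θ w hw hθ)]
  ring

/-- The same identity solved for the power -s, used when the exponent exceeds the shift. -/
theorem superpositionSummable_of_sub_one {s κ : ℝ} (hs : 0 < s) (hκ : 0 < κ)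
    (h₁ : SuperpositionSummable μ p (s - 1) κ) (h₂ : SuperpositionSummable μ p s (κ + 1)) :
    SuperpositionSummable μ p s κ := by
  intro m hm
  obtain ⟨φ₁, hφ₁⟩ := h₁ m hm
  obtain ⟨φ₂, hφ₂⟩ := h₂ _ hm.mul_self
  refine ⟨φ₁ + PowerSeries.X * φ₂, fun θ hθ => ?_⟩
  refine ((hφ₁ θ hθ).add hκ (hφ₂ θ hθ).X_mul).congr fun w hw => ?_
  rw [integral_one_sub_mul_cpow_sub_one hw hθ (hm.integrable_one_sub_mul_cpow hs hw hθ)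
    (hm.mul_self.integrable_one_sub_mul_cpow hs hw hθ)]
  ring

/-- If a ≤ j, the exponent does not exceed the shift. If a > j, then a ≥ 2 and the claim follows
from the pairs (a - 2, j) and (a, j + 2); both make a + (a - j) smaller. -/
theorem superpositionSummable_nat [SFinite μ] (a j : ℕ) (hj : 0 < j) :
    SuperpositionSummable μ p ((a : ℝ) / 2) ((j : ℝ) / 2) := by
  have hj' : (0 : ℝ) < (j : ℝ) / 2 := by positivity
  rcases Nat.eq_zero_or_pos a with rfl | ha
  · simpa using superpositionSummable_zero (μ := μ) (p := p) hj'
  have ha' : (0 : ℝ) < (a : ℝ) / 2 := by positivity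
  by_cases hle : a ≤ j
  · exact superpositionSummable_of_le ha' (by gcongr)
  · have h1 := superpositionSummable_nat (a - 2) j hj
    have h2 := superpositionSummable_nat a (j + 2) (by omega)
    have e : ((a - 2 : ℕ) : ℝ) / 2 = (a : ℝ) / 2 - 1 := by
      rw [Nat.cast_sub (by omega)]; push_cast; ring
    have e2 : ((j + 2 : ℕ) : ℝ) / 2 = (j : ℝ) / 2 + 1 := by push_cast; ring
    rw [e] at h1
    rw [e2] at h2
    exact superpositionSummable_of_sub_one ha' hj' h1 h2
termination_by a + (a - j)
decreasing_by all_goals omega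

end MedianResum

namespace MedianResum

/-! ### Superpositions with exponents `3/2 - n` -/

variable {X : Type*} [MeasurableSpace X] {μ : Measure X} {p m : X → ℂ}

theorem one_sub_mul_ne_zero {θ : ℝ} {w q : ℂ} (hw : 0 < (w * dir (-θ)).re)
    (hq : (q * dir θ).re ≤ 0) : 1 - w * q ≠ 0 := by
  have hR : 0 < (dir θ / w - dir θ * q).re := by
    rw [sub_re, mul_comm (dir θ)]; linarith [re_dir_div_pos hw]
  have := ne_zero_of_re_pos hR
  have hw0 := ne_zero_of_re_mul_pos hw
  intro h
  apply this
  have : dir θ / w - dir θ * q = dir θ / w * (1 - w * q) := by field_simp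
  rw [this, h, mul_zero]

/-- For n ≥ 2 the power grows with p. Each step multiplies by 1 - w p, and admissible weights absorb
every further factor p. -/
theorem Admissible.integrable_one_sub_mul_cpow_half (n : ℕ) :
    ∀ (m : X → ℂ), Admissible μ p m →
      ∀ (θ : ℝ) (w : ℂ), 0 < (w * dir (-θ)).re → (∀ᵐ x ∂μ, (p x * dir θ).re ≤ 0) →
      Integrable (fun x => (1 - w * p x) ^ (-((3 / 2 - n : ℝ) : ℂ)) * m x) μ := by
  induction n with
  | zero =>
    intro m hm θ w hw hθ
    exact hm.integrable_one_sub_mul_cpow (by norm_num) hw hθ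
  | succ n ih =>
    intro m hm θ w hw hθ
    refine ((ih m hm θ w hw hθ).sub ((ih _ hm.mul_self θ w hw hθ).const_mul w)).congr ?_
    filter_upwards [hθ] with x hx
    have hne := one_sub_mul_ne_zero hw hx
    simp only [Pi.sub_apply]
    rw [show -((3 / 2 - ((n + 1 : ℕ) : ℝ) : ℝ) : ℂ) = -((3 / 2 - n : ℝ) : ℂ) + 1 by
      push_cast; ring, cpow_add _ _ hne, cpow_one]
    ring

/-- The exponent 3/2 - n equals 2 - k for the weight k = n + 1/2. Starting from 3/2 it is lowered
one unit at a time, each step calling the previous exponent at the shifts j/2 and j/2 + 1. -/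
theorem superpositionSummable_half [SFinite μ] (n j : ℕ) (hj : 0 < j) :
    SuperpositionSummable μ p (3 / 2 - n) ((j : ℝ) / 2) := by
  induction n generalizing j with
  | zero =>
    have := superpositionSummable_nat (μ := μ) (p := p) 3 j hj
    norm_num at this ⊢
    exact this
  | succ n ih =>
    have h2 := ih (j + 2) (by omega)
    have e2 : ((j + 2 : ℕ) : ℝ) / 2 = (j : ℝ) / 2 + 1 := by push_cast; ring
    rw [e2] at h2
    have := superpositionSummable_sub_one (Admissible.integrable_one_sub_mul_cpow_half n)
      (by positivity) (ih j hj) h2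
    rwa [show (3 / 2 - n - 1 : ℝ) = 3 / 2 - ((n + 1 : ℕ) : ℝ) by push_cast; ring] at this

/-! ### Median sums from families of ray integrals -/

theorem dir_mul_dir (a b : ℝ) : dir a * dir b = dir (a + b) := by
  rw [dir, dir, dir, ← Complex.exp_add]
  push_cast
  ring_nf

theorem dir_re (θ : ℝ) : (dir θ).re = Real.cos θ := by
  rw [dir, exp_ofReal_mul_I_re]

theorem dir_im (θ : ℝ) : (dir θ).im = Real.sin θ := by
  rw [dir, exp_ofReal_mul_I_im]

theorem dir_pi_div_two : dir (Real.pi / 2) = I := by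
  apply Complex.ext <;> simp [dir_re, dir_im]

theorem HasExpansionAlong.congr {S T : ℂ → ℂ} {φ : PowerSeries ℂ} {v : ℂ}
    (h : HasExpansionAlong S φ v) (hST : ∀ t : ℝ, 0 < t → S (t * v) = T (t * v)) :
    HasExpansionAlong T φ v := by
  intro M
  refine (h M).congr' ?_ EventuallyEq.rfl
  filter_upwards [self_mem_nhdsWithin] with t ht
  rw [hST t ht]

/-- The half-plane of direction θ = α + π/2 is the left side Im(w e^{-iα}) > 0 of the ray α, that of
θ = α - π/2 the right side. So the lateral sums in directions π/2 + δ₁ and π/2 - δ₂ are F(δ₁, ·) and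
F(π - δ₂, ·), both defined exactly for w between these rays, where `hsum` evaluates their sum. The
remaining point is that one series serves all α and all shifts. -/
theorem median_of_rays {g : UpperHalfPlane → ℂ} {x₀ : ℝ} (F : ℝ → ℂ → ℂ)
    (hF : ∀ α ∈ Ioo 0 Real.pi, ∀ j : ℕ, 0 < j → ∃ φ : PowerSeries ℂ, ∀ θ : ℝ,
      Real.cos (θ - α) ≤ 0 → Real.cos (θ + α) ≤ 0 → HasModerateSum ((j : ℝ) / 2) θ φ (F α))
    (hsum : ∀ α ∈ Ioo 0 Real.pi, ∀ α' ∈ Ioo 0 Real.pi, α < α' → ∀ w : ℂ,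
      0 < (w * dir (-α)).im → (w * dir (-α')).im < 0 →
      F α w + F α' w = 2 * g (ofComplex (w + x₀))) :
    ∃ φ : PowerSeries ℂ, IsAsymptoticExpansion g x₀ φ ∧
      ∀ j : ℕ, 0 < j → HasMedianSum ((j : ℝ) / 2) (Real.pi / 2) φ
        (fun w : ℂ => g (ofComplex (w + (x₀ : ℂ)))) := by
  have hπ := Real.pi_pos
  have hmid : Real.pi / 2 ∈ Ioo 0 Real.pi := ⟨by linarith, by linarith⟩
  -- Reference series: α = π/2 with shift 1. It is summable in both directions 0 and π, so it can be
  -- compared with the series of any other ray.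
  obtain ⟨φ, hφ⟩ := hF _ hmid 2 two_pos
  have h1 : (0 : ℝ) < ((2 : ℕ) : ℝ) / 2 := by norm_num
  have him : ∀ t : ℝ, 0 < t → ∀ β α : ℝ,
      ((t * dir β) * dir (-α)).im = t * Real.sin (β - α) := fun t ht β α => by
    rw [mul_assoc, dir_mul_dir, im_ofReal_mul, dir_im, ← sub_eq_add_neg]
  have hre : ∀ β α : ℝ, (dir β * dir (-α)).re = Real.cos (β - α) := fun β α => by
    rw [dir_mul_dir, dir_re, ← sub_eq_add_neg]
  have hright : ∀ α : ℝ, 0 < α → α ≤ Real.pi / 2 → ∀ j : ℕ, 0 < j →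
      HasModerateSum ((j : ℝ) / 2) (α + Real.pi / 2) φ (F α) := by
    intro α hα hα2 j hj
    have hαm : α ∈ Ioo 0 Real.pi := ⟨hα, by linarith⟩
    obtain ⟨φ', hφ'⟩ := hF α hαm j hj
    have hs := hφ' (α + Real.pi / 2) (by rw [add_sub_cancel_left, Real.cos_pi_div_two])
      (by rw [show α + Real.pi / 2 + α = 2 * α + Real.pi / 2 by ring, Real.cos_add_pi_div_two]
          have := Real.sin_nonneg_of_nonneg_of_le_pi (x := 2 * α) (by linarith) (by linarith)
          linarith)
    have hm := hφ Real.pi (by rw [show Real.pi - Real.pi / 2 = Real.pi / 2 by ring,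
        Real.cos_pi_div_two]) (by
      rw [Real.cos_add_pi_div_two, Real.sin_pi, neg_zero])
    have hj' : (0 : ℝ) < (j : ℝ) / 2 := by positivity
    have e1 := hs.hasExpansionAlong hj' (v := dir (3 * Real.pi / 4)) (by
      rw [hre]; exact Real.cos_pos_of_mem_Ioo ⟨by linarith, by linarith⟩)
    have e2 := hm.hasExpansionAlong h1 (v := dir (3 * Real.pi / 4)) (by
      rw [hre]; exact Real.cos_pos_of_mem_Ioo ⟨by linarith, by linarith⟩)
    -- Points of direction 3π/4 lie to the left of the rays α and π/2 and to the right of the ray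
    -- 7π/8. Pairing each of the first two with the third gives the same value 2g, so they agree
    -- there and have the same expansion.
    have e3 : ∀ t : ℝ, 0 < t → F α (t * dir (3 * Real.pi / 4)) =
        F (Real.pi / 2) (t * dir (3 * Real.pi / 4)) := by
      intro t ht
      have hα' : 7 * Real.pi / 8 ∈ Ioo 0 Real.pi := ⟨by linarith, by linarith⟩
      have hneg : ((t * dir (3 * Real.pi / 4)) * dir (-(7 * Real.pi / 8))).im < 0 := by
        rw [him t ht]
        exact mul_neg_of_pos_of_neg ht (Real.sin_neg_of_neg_of_neg_pi_lt (by linarith)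
          (by linarith))
      have a1 := hsum α hαm _ hα' (by linarith) _ (by
        rw [him t ht]; exact mul_pos ht (Real.sin_pos_of_pos_of_lt_pi (by linarith)
          (by linarith))) hneg
      have a2 := hsum _ hmid _ hα' (by linarith) _ (by
        rw [him t ht]; exact mul_pos ht (Real.sin_pos_of_pos_of_lt_pi (by linarith)
          (by linarith))) hneg
      linear_combination a1 - a2
    have : φ' = φ := (e1.congr e3).unique (dir_ne_zero _) e2
    rwa [this] at hs
  have hleft : ∀ α : ℝ, Real.pi / 2 ≤ α → α < Real.pi → ∀ j : ℕ, 0 < j →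
      HasModerateSum ((j : ℝ) / 2) (α - Real.pi / 2) φ (F α) := by
    intro α hα hα2 j hj
    have hαm : α ∈ Ioo 0 Real.pi := ⟨by linarith, by linarith⟩
    obtain ⟨φ', hφ'⟩ := hF α hαm j hj
    have hs := hφ' (α - Real.pi / 2) (by rw [show α - Real.pi / 2 - α = -(Real.pi / 2) by ring,
        Real.cos_neg, Real.cos_pi_div_two])
      (by rw [show α - Real.pi / 2 + α = 2 * α - Real.pi + Real.pi / 2 by ring,
            Real.cos_add_pi_div_two]
          have := Real.sin_nonneg_of_nonneg_of_le_pi (x := 2 * α - Real.pi) (by linarith)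
            (by linarith)
          linarith)
    have hm := hφ 0 (by rw [zero_sub, Real.cos_neg, Real.cos_pi_div_two]) (by
      rw [zero_add, Real.cos_pi_div_two])
    have hj' : (0 : ℝ) < (j : ℝ) / 2 := by positivity
    have e1 := hs.hasExpansionAlong hj' (v := dir (Real.pi / 4)) (by
      rw [hre]; exact Real.cos_pos_of_mem_Ioo ⟨by linarith, by linarith⟩)
    have e2 := hm.hasExpansionAlong h1 (v := dir (Real.pi / 4)) (by
      rw [hre]; exact Real.cos_pos_of_mem_Ioo ⟨by linarith, by linarith⟩)
    -- Mirror image: the direction is π/4 and the auxiliary ray is π/8.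
    have e3 : ∀ t : ℝ, 0 < t → F α (t * dir (Real.pi / 4)) =
        F (Real.pi / 2) (t * dir (Real.pi / 4)) := by
      intro t ht
      have hα' : Real.pi / 8 ∈ Ioo 0 Real.pi := ⟨by linarith, by linarith⟩
      have hpos : 0 < ((t * dir (Real.pi / 4)) * dir (-(Real.pi / 8))).im := by
        rw [him t ht]; exact mul_pos ht (Real.sin_pos_of_pos_of_lt_pi (by linarith)
          (by linarith))
      have a1 := hsum _ hα' α hαm (by linarith) _ hpos (by
        rw [him t ht]
        exact mul_neg_of_pos_of_neg ht (Real.sin_neg_of_neg_of_neg_pi_lt (by linarith)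
          (by linarith)))
      have a2 := hsum _ hα' _ hmid (by linarith) _ hpos (by
        rw [him t ht]
        exact mul_neg_of_pos_of_neg ht (Real.sin_neg_of_neg_of_neg_pi_lt (by linarith)
          (by linarith)))
      linear_combination a1 - a2
    have : φ' = φ := (e1.congr e3).unique (dir_ne_zero _) e2
    rwa [this] at hs
  refine ⟨φ, ?_, ?_⟩
  · intro M
    -- On the vertical line g is the average of F(π/4, ·) and F(3π/4, ·), whose half-planes both
    -- contain the direction i.
    have e1 := (hright (Real.pi / 4) (by linarith) (by linarith) 2 two_pos).hasExpansionAlong h1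
      (v := dir (Real.pi / 2)) (by
        rw [hre]; exact Real.cos_pos_of_mem_Ioo ⟨by linarith, by linarith⟩) M
    have e2 := (hleft (3 * Real.pi / 4) (by linarith) (by linarith) 2 two_pos).hasExpansionAlong h1
      (v := dir (Real.pi / 2)) (by
        rw [hre]; exact Real.cos_pos_of_mem_Ioo ⟨by linarith, by linarith⟩) M
    refine ((e1.add e2).const_mul_left (1 / 2 : ℂ)).congr' ?_ EventuallyEq.rfl
    filter_upwards [self_mem_nhdsWithin] with t ht
    have ht' : 0 < t := ht
    have := hsum (Real.pi / 4) ⟨by linarith, by linarith⟩ (3 * Real.pi / 4)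
      ⟨by linarith, by linarith⟩ (by linarith) (t * dir (Real.pi / 2)) (by
        rw [him t ht']; exact mul_pos ht' (Real.sin_pos_of_pos_of_lt_pi (by linarith)
          (by linarith))) (by
        rw [him t ht']
        exact mul_neg_of_pos_of_neg ht' (Real.sin_neg_of_neg_of_neg_pi_lt (by linarith)
          (by linarith)))
    rw [dir_pi_div_two] at this ⊢
    rw [add_comm (x₀ : ℂ)]
    linear_combination (1 / 2 : ℂ) * this
  · intro j hj
    have hj' : (0 : ℝ) < (j : ℝ) / 2 := by positivity
    -- With ε = π/2 the angles δ₁ and π - δ₂ stay in the ranges of `hright` and `hleft`.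
    refine ⟨Real.pi / 2, by linarith, fun δ₁ hδ₁ δ₂ hδ₂ w hw₁ hw₂ => ?_⟩
    have eα : Real.pi / 2 + δ₁ = δ₁ + Real.pi / 2 := by ring
    have eα' : Real.pi / 2 - δ₂ = (Real.pi - δ₂) - Real.pi / 2 := by ring
    rw [eα] at hw₁ ⊢
    rw [eα'] at hw₂ ⊢
    refine ⟨F δ₁ w, F (Real.pi - δ₂) w,
      (hright δ₁ hδ₁.1 hδ₁.2.le j hj).hasBorelLaplaceSum hj' hw₁,
      (hleft (Real.pi - δ₂) (by linarith [hδ₂.2]) (by linarith [hδ₂.1]) j hj).hasBorelLaplaceSum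
        hj' hw₂, ?_⟩
    have i1 : (w * dir (-(δ₁ + Real.pi / 2))).re = (w * dir (-δ₁)).im := by
      rw [neg_add, ← dir_mul_dir, ← conj_dir (Real.pi / 2), dir_pi_div_two, ← mul_assoc]
      simp
    have i2 : (w * dir (-(Real.pi - δ₂ - Real.pi / 2))).re = -(w * dir (-(Real.pi - δ₂))).im := by
      rw [neg_sub, sub_eq_neg_add, ← dir_mul_dir, dir_pi_div_two, ← mul_assoc]
      simp
    rw [i1] at hw₁
    rw [i2] at hw₂
    have := hsum δ₁ ⟨hδ₁.1, by linarith [hδ₁.2]⟩ (Real.pi - δ₂)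
      ⟨by linarith [hδ₂.2], by linarith [hδ₂.1]⟩ (by linarith [hδ₁.2, hδ₂.2]) w hw₁ (by linarith)
    rw [this]
    ring

end MedianResum

namespace MedianResum

/-! ### Ray integrals of closed 1-forms -/

/-- An exact 1-form on a convex open set stable under translation in direction `e`, which decays
exponentially along rays of direction `e`. -/
structure RayForm (D : Set ℂ) (e : ℂ) (W : ℂ → ℂ →L[ℝ] ℂ) : Prop where
  convex : Convex ℝ D
  isOpen : IsOpen D
  add_mem : ∀ z ∈ D, ∀ t : ℝ, 0 ≤ t → z + t * e ∈ D
  cont : ContinuousOn W D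
  prim : ∃ Φ : ℂ → ℂ, ∀ z ∈ D, HasFDerivAt Φ (W z) z
  decay : ∀ P ∈ D, ∀ Q ∈ D, ∃ (C ε : ℝ), 0 < ε ∧ ∀ z ∈ segment ℝ P Q, ∀ t : ℝ, 0 ≤ t →
    ‖W (z + t * e)‖ ≤ C * Real.exp (-(ε * t))

/-- The integral of the 1-form `W` along the ray from `P` in direction `e`. -/
def rayIntegral (W : ℂ → ℂ →L[ℝ] ℂ) (e P : ℂ) : ℂ := ∫ t in Ioi (0 : ℝ), W (P + t * e) e

variable {D D' : Set ℂ} {e e' : ℂ} {W W' : ℂ → ℂ →L[ℝ] ℂ}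

theorem RayForm.continuousOn_apply (h : RayForm D e W) {P : ℂ} {s : Set ℝ}
    (hP : ∀ t ∈ s, P + t * e ∈ D) : ContinuousOn (fun t : ℝ => W (P + t * e) e) s :=
  (h.cont.comp (by fun_prop) hP).clm_apply continuousOn_const

theorem RayForm.integrableOn (h : RayForm D e W) {P : ℂ} (hP : P ∈ D) :
    IntegrableOn (fun t : ℝ => W (P + t * e) e) (Ioi 0) := by
  obtain ⟨C, ε, hε, hC⟩ := h.decay P hP P hP
  have hi : IntegrableOn (fun t : ℝ => C * Real.exp (-(ε * t)) * ‖e‖) (Ioi 0) := by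
    have := integrableOn_exp_mul_Ioi (a := -ε) (by linarith) 0
    simp only [neg_mul] at this
    exact (this.const_mul C).mul_const ‖e‖
  refine hi.mono' ((h.continuousOn_apply fun t ht => h.add_mem P hP t
    (le_of_lt ht)).aestronglyMeasurable measurableSet_Ioi) ?_
  filter_upwards [ae_restrict_mem measurableSet_Ioi] with t ht
  refine (ContinuousLinearMap.le_opNorm _ _).trans ?_
  gcongr
  exact hC P (left_mem_segment ℝ P P) t (le_of_lt ht)

theorem norm_sub_le_of_hasFDerivAt_segment {Φ : ℂ → ℂ} {P Q : ℂ} {C : ℝ}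
    (hΦ : ∀ z ∈ segment ℝ P Q, HasFDerivAt Φ (W z) z) (hC : ∀ z ∈ segment ℝ P Q, ‖W z‖ ≤ C) :
    ‖Φ P - Φ Q‖ ≤ C * ‖P - Q‖ :=
  (convex_segment P Q).norm_image_sub_le_of_norm_hasFDerivWithin_le
    (fun z hz => (hΦ z hz).hasFDerivWithinAt) hC (right_mem_segment ℝ P Q) (left_mem_segment ℝ P Q)

theorem add_segment_mem {P Q v z : ℂ} (hz : z ∈ segment ℝ (P + v) (Q + v)) :
    z - v ∈ segment ℝ P Q := by
  rw [← mem_segment_translate ℝ v]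
  simpa [add_comm v] using hz

/-- Fundamental theorem on both rays. The contribution at infinity vanishes because the values of Φ
at P + te and Q + te differ by at most the bound of W on the joining segment times ‖P - Q‖. -/
theorem RayForm.rayIntegral_sub (h : RayForm D e W) {Φ : ℂ → ℂ}
    (hΦ : ∀ z ∈ D, HasFDerivAt Φ (W z) z) {P Q : ℂ} (hP : P ∈ D) (hQ : Q ∈ D) :
    rayIntegral W e P - rayIntegral W e Q = Φ Q - Φ P := by
  obtain ⟨C, ε, hε, hC⟩ := h.decay P hP Q hQ
  have hd : ∀ {R : ℂ}, R ∈ D → ∀ t : ℝ, 0 ≤ t →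
      HasDerivAt (fun t : ℝ => Φ (R + t * e)) (W (R + t * e) e) t := fun {R} hR t ht => by
    have h1 : HasDerivAt (fun t : ℝ => R + t * e) e t := by
      simpa using ((hasDerivAt_id t).ofReal_comp.mul_const e).const_add R
    exact (hΦ _ (h.add_mem R hR t ht)).comp_hasDerivAt t h1
  have hlim : Tendsto (fun t : ℝ => Φ (P + t * e) - Φ (Q + t * e)) atTop (𝓝 0) := by
    refine squeeze_zero_norm' (a := fun t => C * Real.exp (-(ε * t)) * ‖P - Q‖) ?_ ?_
    · filter_upwards [eventually_ge_atTop 0] with t ht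
      have hsub : ∀ z ∈ segment ℝ (P + t * e) (Q + t * e), z - t * e ∈ segment ℝ P Q :=
        fun z hz => add_segment_mem hz
      have := norm_sub_le_of_hasFDerivAt_segment (W := W) (Φ := Φ) (P := P + t * e)
        (Q := Q + t * e) (C := C * Real.exp (-(ε * t)))
        (fun z hz => hΦ z (h.convex.segment_subset (h.add_mem P hP t ht) (h.add_mem Q hQ t ht) hz))
        (fun z hz => by simpa using hC _ (hsub z hz) t ht)
      simpa using this
    · have h1 : Tendsto (fun t : ℝ => Real.exp (-(ε * t))) atTop (𝓝 0) :=
        Real.tendsto_exp_neg_atTop_nhds_zero.comp (tendsto_id.const_mul_atTop hε)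
      simpa using (h1.const_mul C).mul_const ‖P - Q‖
  have key := integral_Ioi_of_hasDerivAt_of_tendsto (a := 0)
    (f := fun t : ℝ => Φ (P + t * e) - Φ (Q + t * e))
    (f' := fun t : ℝ => W (P + t * e) e - W (Q + t * e) e)
    ((hd hP 0 le_rfl).sub (hd hQ 0 le_rfl)).continuousAt.continuousWithinAt
    (fun t ht => (hd hP t (le_of_lt ht)).sub (hd hQ t (le_of_lt ht)))
    ((h.integrableOn hP).sub (h.integrableOn hQ)) hlim
  rw [integral_sub (h.integrableOn hP) (h.integrableOn hQ)] at key
  rw [rayIntegral, rayIntegral, key]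
  simp

/-- The sum of two ray integrals of opposite forms does not depend on the common vertex. -/
theorem RayForm.add_eq (h : RayForm D e W) (h' : RayForm D' e' W')
    (hW : ∀ z ∈ D ∩ D', W' z = -W z) {P Q : ℂ} (hP : P ∈ D ∩ D') (hQ : Q ∈ D ∩ D') :
    rayIntegral W e P + rayIntegral W' e' P = rayIntegral W e Q + rayIntegral W' e' Q := by
  obtain ⟨Φ, hΦ⟩ := h.prim
  obtain ⟨Φ', hΦ'⟩ := h'.prim
  have h1 := h.rayIntegral_sub hΦ hP.1 hQ.1
  have h2 := h'.rayIntegral_sub hΦ' hP.2 hQ.2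
  -- On the convex overlap Φ + Φ' has derivative zero, hence is constant.
  have h3 : ‖(Φ P + Φ' P) - (Φ Q + Φ' Q)‖ ≤ 0 * ‖P - Q‖ := by
    refine (h.convex.inter h'.convex).norm_image_sub_le_of_norm_hasFDerivWithin_le
      (f := fun z => Φ z + Φ' z) (f' := fun _ => 0) (fun z hz => ?_) (fun z _ => (norm_zero (E := ℂ →L[ℝ] ℂ)).le) hQ hP
    have := (hΦ z hz.1).add (hΦ' z hz.2)
    rw [hW z hz, add_neg_cancel] at this
    exact this.hasFDerivWithinAt
  rw [zero_mul] at h3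
  have h4 := norm_le_zero_iff.1 h3
  linear_combination h1 + h2 - h4

/-- The origin is only a boundary point, but W stays bounded near it on the sector spanned by e and
v. Passing from the vertex t v to t e changes the integral by at most C t ‖e - v‖, and the part of
the ray cut off contributes at most C ‖e‖ t. -/
theorem RayForm.exists_tendsto_zero (h : RayForm D e W) {v : ℂ} {r C : ℝ} (hr : 0 < r)
    (he : ∀ t : ℝ, 0 < t → (t : ℂ) * e ∈ D) (hv : ∀ t : ℝ, 0 < t → t < r → (t : ℂ) * v ∈ D)
    (hC : ∀ t : ℝ, 0 < t → t < r → ∀ z ∈ segment ℝ ((t : ℂ) * e) ((t : ℂ) * v), ‖W z‖ ≤ C) :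
    IntegrableOn (fun t : ℝ => W (t * e) e) (Ioi 0) ∧
    Tendsto (fun t : ℝ => rayIntegral W e (t * v)) (𝓝[>] 0)
      (𝓝 (∫ t in Ioi (0 : ℝ), W (t * e) e)) := by
  have hcont : ContinuousOn (fun t : ℝ => W (t * e) e) (Ioi 0) := by
    have := h.continuousOn_apply (P := 0) (s := Ioi 0) (fun t ht => by simpa using he t ht)
    simpa using this
  have hCe : ∀ t : ℝ, 0 < t → t < r → ‖W (t * e) e‖ ≤ C * ‖e‖ := fun t ht htr =>
    (ContinuousLinearMap.le_opNorm _ _).trans (by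
      gcongr; exact hC t ht htr _ (left_mem_segment ℝ _ _))
  have hpre : ∀ η : ℝ, (fun t : ℝ => η + t) ⁻¹' Ioi η = Ioi 0 := fun η => by ext t; simp
  have hshift : ∀ η : ℝ, 0 < η → rayIntegral W e (η * e) = ∫ t in Ioi η, W (t * e) e := by
    intro η _
    rw [rayIntegral]
    have := (measurePreserving_add_left volume η).setIntegral_preimage_emb
      (measurableEmbedding_addLeft η) (fun t : ℝ => W (t * e) e) (Ioi η)
    rw [hpre η] at this
    rw [← this]
    congr 1 with t
    rw [← add_mul]
    push_cast
    rfl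
  have hint : ∀ η : ℝ, 0 < η → IntegrableOn (fun t : ℝ => W (t * e) e) (Ioi η) := by
    intro η hη
    have h1 := h.integrableOn (he η hη)
    rw [← (measurePreserving_add_left volume η).integrableOn_comp_preimage
      (measurableEmbedding_addLeft η), hpre η]
    refine h1.congr_fun (fun t _ => ?_) measurableSet_Ioi
    simp only [Function.comp_apply]
    rw [← add_mul]
    push_cast
    rfl
  have hi : IntegrableOn (fun t : ℝ => W (t * e) e) (Ioi 0) := by
    rw [← Ioc_union_Ioi_eq_Ioi (half_pos hr).le]
    refine IntegrableOn.union ?_ (hint _ (half_pos hr))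
    refine IntegrableOn.of_bound (C := C * ‖e‖) (by simp) ?_ ?_
    · exact (hcont.mono Ioc_subset_Ioi_self).aestronglyMeasurable measurableSet_Ioc
    · filter_upwards [ae_restrict_mem measurableSet_Ioc] with t ht
      exact hCe t ht.1 (by linarith [ht.2])
  refine ⟨hi, ?_⟩
  obtain ⟨Φ, hΦ⟩ := h.prim
  rw [tendsto_iff_norm_sub_tendsto_zero]
  have hlim : Tendsto (fun t : ℝ => C * (t * ‖e - v‖) + C * ‖e‖ * t) (𝓝[>] 0) (𝓝 0) := by
    have : Continuous (fun t : ℝ => C * (t * ‖e - v‖) + C * ‖e‖ * t) := by fun_prop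
    exact (this.tendsto' 0 0 (by simp)).mono_left nhdsWithin_le_nhds
  refine squeeze_zero' (Eventually.of_forall fun _ => norm_nonneg _) ?_ hlim
  filter_upwards [Ioo_mem_nhdsGT hr] with η hη
  have h1 := h.rayIntegral_sub hΦ (he η hη.1) (hv η hη.1 hη.2)
  have h2 : ‖Φ (η * e) - Φ (η * v)‖ ≤ C * (η * ‖e - v‖) := by
    have := norm_sub_le_of_hasFDerivAt_segment (W := W) (Φ := Φ)
      (fun z hz => hΦ z (h.convex.segment_subset (he η hη.1) (hv η hη.1 hη.2) hz))
      (hC η hη.1 hη.2)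
    rwa [← mul_sub, norm_mul, Complex.norm_real, Real.norm_of_nonneg hη.1.le] at this
  have h3 : ∫ t in Ioi (0 : ℝ), W (t * e) e =
      (∫ t in Ioc 0 η, W (t * e) e) + ∫ t in Ioi η, W (t * e) e := by
    rw [← setIntegral_union (Ioc_disjoint_Ioi le_rfl) measurableSet_Ioi
      (hi.mono_set Ioc_subset_Ioi_self) (hint η hη.1), Ioc_union_Ioi_eq_Ioi hη.1.le]
  have h4 : ‖∫ t in Ioc 0 η, W (t * e) e‖ ≤ C * ‖e‖ * η := by
    have := norm_setIntegral_le_of_norm_le_const (μ := volume) (s := Ioc 0 η) (C := C * ‖e‖)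
      (f := fun t : ℝ => W (t * e) e) (by simp)
      (fun t ht => hCe t ht.1 (ht.2.trans_lt hη.2))
    simpa [hη.1.le] using this
  rw [hshift η hη.1] at h1
  have h5 : rayIntegral W e (η * v) - ∫ t in Ioi (0 : ℝ), W (t * e) e =
      (Φ (η * e) - Φ (η * v)) - ∫ t in Ioc 0 η, W (t * e) e := by
    rw [h3]; linear_combination -h1
  rw [h5]
  exact (norm_sub_le _ _).trans (add_le_add h2 h4)

/-- Two rays from the origin, on which opposite forms are integrated, may be moved to a common
vertex inside the overlap of the domains. -/
theorem RayForm.zero_add_eq (h : RayForm D e W) (h' : RayForm D' e' W')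
    (hW : ∀ z ∈ D ∩ D', W' z = -W z) {v : ℂ} {r C : ℝ} (hr : 0 < r)
    (he : ∀ t : ℝ, 0 < t → (t : ℂ) * e ∈ D) (he' : ∀ t : ℝ, 0 < t → (t : ℂ) * e' ∈ D')
    (hv : ∀ t : ℝ, 0 < t → t < r → (t : ℂ) * v ∈ D ∩ D')
    (hC : ∀ t : ℝ, 0 < t → t < r → ∀ z ∈ segment ℝ ((t : ℂ) * e) ((t : ℂ) * v), ‖W z‖ ≤ C)
    (hC' : ∀ t : ℝ, 0 < t → t < r → ∀ z ∈ segment ℝ ((t : ℂ) * e') ((t : ℂ) * v), ‖W' z‖ ≤ C)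
    {P : ℂ} (hP : P ∈ D ∩ D') :
    (∫ t in Ioi (0 : ℝ), W (t * e) e) + (∫ t in Ioi (0 : ℝ), W' (t * e') e') =
      rayIntegral W e P + rayIntegral W' e' P := by
  have h1 := (h.exists_tendsto_zero hr he (fun t ht htr => (hv t ht htr).1) hC).2
  have h2 := (h'.exists_tendsto_zero hr he' (fun t ht htr => (hv t ht htr).2) hC').2
  refine tendsto_nhds_unique (h1.add h2) (tendsto_const_nhds.congr' ?_)
  filter_upwards [Ioo_mem_nhdsGT hr] with t ht
  exact h.add_eq h' hW hP (hv t ht.1 ht.2)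

end MedianResum

namespace MedianResum

/-! ### Branches of complex powers on half-planes -/

/-- The open half-plane `Re (z e^{-iβ}) > 0`. -/
def halfPlane (β : ℝ) : Set ℂ := {z | 0 < (z * dir (-β)).re}

/-- The branch of `z ^ (-s)` on the half-plane `Re (z e^{-iβ}) > 0` for which `arg z` is close
to `β`. -/
def branch (β s : ℝ) (z : ℂ) : ℂ := cexp (-(s : ℂ) * (log (z * dir (-β)) + β * I))

theorem ne_zero_of_mem_halfPlane {β : ℝ} {z : ℂ} (hz : z ∈ halfPlane β) : z ≠ 0 :=
  ne_zero_of_re_mul_pos hz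

theorem isOpen_halfPlane (β : ℝ) : IsOpen (halfPlane β) :=
  isOpen_lt continuous_const (by fun_prop)

theorem convex_halfPlane (β : ℝ) : Convex ℝ (halfPlane β) := by
  refine convex_halfSpace_gt (f := fun z : ℂ => (z * dir (-β)).re) ⟨fun x y => ?_, fun c x => ?_⟩ 0
  · simp only [add_mul, add_re]
  · simp only [real_smul, mul_assoc, re_ofReal_mul, smul_eq_mul]

theorem smul_mem_halfPlane {β r : ℝ} {z : ℂ} (hr : 0 < r) (hz : z ∈ halfPlane β) :
    (r : ℂ) * z ∈ halfPlane β := by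
  have hz' : 0 < (z * dir (-β)).re := hz
  change 0 < ((r : ℂ) * z * dir (-β)).re
  rw [mul_assoc, re_ofReal_mul]
  positivity

theorem branch_hasDerivAt {β : ℝ} (s : ℝ) {z : ℂ} (hz : z ∈ halfPlane β) :
    HasDerivAt (branch β s) (-(s : ℂ) * branch β (s + 1) z) z := by
  have hz0 := ne_zero_of_mem_halfPlane hz
  have hd := dir_ne_zero (-β)
  have h1 : HasDerivAt (fun z => log (z * dir (-β))) (z⁻¹) z := by
    have := (((hasDerivAt_id z).mul_const (dir (-β))).clog
      (Or.inl hz : z * dir (-β) ∈ slitPlane))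
    refine (this.congr_deriv ?_ : HasDerivAt (fun z => log (z * dir (-β))) _ z)
    rw [one_mul, div_mul_cancel_right₀ hd, id]
  have h2 := ((h1.add_const (β * I)).const_mul (-(s : ℂ))).cexp
  refine (h2.congr_deriv ?_ : HasDerivAt (branch β s) _ z)
  rw [branch, show (-((s + 1 : ℝ) : ℂ)) * (log (z * dir (-β)) + β * I) =
    -(s : ℂ) * (log (z * dir (-β)) + β * I) - (log (z * dir (-β)) + β * I) by push_cast; ring,
    Complex.exp_sub, Complex.exp_add (log _), Complex.exp_log (mul_ne_zero hz0 hd)]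
  change _ = _ * (_ / (z * dir (-β) * dir β))
  rw [mul_assoc z, mul_comm (dir (-β)), dir_mul_dir_neg]
  field_simp

theorem branch_differentiableOn (β s : ℝ) : DifferentiableOn ℂ (branch β s) (halfPlane β) :=
  fun _ hz => (branch_hasDerivAt s hz).differentiableAt.differentiableWithinAt

theorem norm_branch {β : ℝ} (s : ℝ) {z : ℂ} (hz : z ≠ 0) :
    ‖branch β s z‖ = ‖z‖ ^ (-s) := by
  rw [branch, Complex.norm_exp, Real.rpow_def_of_pos (norm_pos_iff.2 hz)]
  congr 1
  simp [log_re, norm_dir]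
  ring

theorem branch_add (β s t : ℝ) (z : ℂ) : branch β (s + t) z = branch β s z * branch β t z := by
  rw [branch, branch, branch, ← Complex.exp_add]
  push_cast
  ring_nf

theorem branch_one {β : ℝ} {z : ℂ} (hz : z ≠ 0) : branch β 1 z = z⁻¹ := by
  rw [branch]
  push_cast
  rw [neg_one_mul, Complex.exp_neg, Complex.exp_add,
    Complex.exp_log (mul_ne_zero hz (dir_ne_zero _))]
  change (z * dir (-β) * dir β)⁻¹ = _
  rw [mul_assoc z, mul_comm (dir (-β)), dir_mul_dir_neg, mul_one]

theorem branch_smul {β r : ℝ} (s : ℝ) {z : ℂ} (hr : 0 < r) (hz : z ≠ 0) :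
    branch β s (r * z) = ((r ^ (-s) : ℝ) : ℂ) * branch β s z := by
  rw [branch, branch, mul_assoc, Complex.log_ofReal_mul hr (mul_ne_zero hz (dir_ne_zero _)),
    Real.rpow_def_of_pos hr, ofReal_exp, ← Complex.exp_add]
  push_cast
  ring_nf

/-- On the overlap the two determinations of arg z differ by exactly 2π, and e^{2πis} = -1 for
half-integral s. This sign makes the forms on the two rays opposite, so that two outgoing rays make
up one contour around the branch point. -/
theorem branch_overlap {β β' : ℝ} (h1 : Real.pi < β' - β) (h2 : β' - β < 2 * Real.pi) (n : ℕ)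
    {z : ℂ} (hz : z ∈ halfPlane β) (hz' : z ∈ halfPlane β') :
    branch β' (3 / 2 - n) z = -branch β (3 / 2 - n) z := by
  have hz0 := ne_zero_of_mem_halfPlane hz
  have a1 := log_im_mem_of_re_pos hz
  have a2 := log_im_mem_of_re_pos hz'
  have hl : log (z * dir (-β')) = log (z * dir (-β)) + β * I - β' * I + 2 * Real.pi * I := by
    have hne : z * dir (-β) ≠ 0 := mul_ne_zero hz0 (dir_ne_zero _)
    have hexp : cexp (log (z * dir (-β)) + β * I - β' * I + 2 * Real.pi * I) = z * dir (-β') := by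
      rw [Complex.exp_add, Complex.exp_two_pi_mul_I, Complex.exp_sub, Complex.exp_add,
        Complex.exp_log hne]
      change z * dir (-β) * dir β / dir β' * 1 = _
      rw [mul_assoc z, mul_comm (dir (-β)), dir_mul_dir_neg, mul_one, mul_one,
        div_eq_iff (dir_ne_zero _), mul_assoc z, mul_comm (dir (-β')), dir_mul_dir_neg, mul_one]
    -- Both logarithms have imaginary part within π/2 of 0 and π < β' - β < 2π, which leaves k = 0
    -- as the only possibility.
    obtain ⟨k, hk⟩ := Complex.exp_eq_exp_iff_exists_int.1
      ((Complex.exp_log (mul_ne_zero hz0 (dir_ne_zero (-β')))).trans hexp.symm)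
    have him := congrArg Complex.im hk
    simp at him
    have hπ := Real.pi_pos
    have k1 : (-1 : ℝ) < k := by
      by_contra hcon
      push Not at hcon
      nlinarith [a1.1, a1.2, a2.1, a2.2]
    have k2 : (k : ℝ) < 1 := by
      by_contra hcon
      push Not at hcon
      nlinarith [a1.1, a1.2, a2.1, a2.2]
    have hk0 : k = 0 := by
      have : (-1 : ℤ) < k := by exact_mod_cast k1
      have : k < (1 : ℤ) := by exact_mod_cast k2
      omega
    rw [hk, hk0]
    simp
  rw [branch, branch, hl, show -((3 / 2 - n : ℝ) : ℂ) *
      (log (z * dir (-β)) + β * I - β' * I + 2 * Real.pi * I + β' * I) =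
      -((3 / 2 - n : ℝ) : ℂ) * (log (z * dir (-β)) + β * I) + Real.pi * I
        + ((n - 2 : ℤ) : ℂ) * (2 * Real.pi * I) by push_cast; ring,
    Complex.exp_add, Complex.exp_int_mul_two_pi_mul_I, Complex.exp_add, Complex.exp_pi_mul_I]
  ring

theorem dir_mul_dir_neg_right (α : ℝ) : dir α * dir (-(α - Real.pi / 2)) = I := by
  rw [dir_mul_dir, ← dir_pi_div_two]; ring_nf

theorem dir_mul_dir_neg_left (α : ℝ) : dir α * dir (-(α + Real.pi / 2)) = -I := by
  rw [dir_mul_dir, show α + -(α + Real.pi / 2) = -(Real.pi / 2) by ring, ← conj_dir, dir_pi_div_two,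
    conj_I]

/-- Since 1 - p is in the closed lower half-plane, adding π/2 to its argument stays within the
principal range. The condition `hre` excludes p > 1 real, where the principal argument of 1 - p
would be π. -/
theorem branch_ray_right {α t : ℝ} (s : ℝ) {p : ℂ} (ht : 0 < t) (hp : 0 ≤ p.im) (hp1 : p ≠ 1)
    (hre : p.im = 0 → p.re < 1) :
    branch (α - Real.pi / 2) s (t * dir α * (1 - p)) =
      ((t ^ (-s) : ℝ) : ℂ) * dir (-(s * α)) * (1 - p) ^ (-(s : ℂ)) := by
  have h1 : (1 - p) ≠ 0 := sub_ne_zero.2 hp1.symm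
  have harg : (log (1 - p)).im ≤ 0 ∧ -Real.pi < (log (1 - p)).im := by
    rw [log_im]
    refine ⟨?_, neg_pi_lt_arg _⟩
    rcases hp.eq_or_lt with h | h
    · have : arg (1 - p) = 0 := arg_eq_zero_iff.2 ⟨by simp; linarith [hre h.symm], by simp [← h]⟩
      rw [this]
    · exact (arg_neg_iff.2 (by simpa using h)).le
  have hl : log (t * dir α * (1 - p) * dir (-(α - Real.pi / 2))) =
      Real.log t + log (1 - p) + Real.pi / 2 * I := by
    have e1 : t * dir α * (1 - p) * dir (-(α - Real.pi / 2)) = t * ((1 - p) * I) := by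
      linear_combination (t * (1 - p)) * dir_mul_dir_neg_right α
    rw [e1, log_ofReal_mul ht (mul_ne_zero h1 I_ne_zero), add_assoc]
    congr 1
    apply log_eq_of_exp_eq
    · rw [Complex.exp_add, Complex.exp_log h1, Complex.exp_pi_div_two_mul_I]
    · simp; linarith [harg.2, Real.pi_pos]
    · simp; linarith [harg.1, Real.pi_pos]
  rw [branch, hl, cpow_def_of_ne_zero h1, dir, Real.rpow_def_of_pos ht, ofReal_exp,
    ← Complex.exp_add, ← Complex.exp_add]
  push_cast
  ring_nf

/-- Here π/2 is subtracted from an argument in [0, π], so the value π on the cut does no harm and no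
analogue of `hre` is needed. -/
theorem branch_ray_left {α t : ℝ} (s : ℝ) {p : ℂ} (ht : 0 < t) (hp : p.im ≤ 0) (hp1 : p ≠ 1) :
    branch (α + Real.pi / 2) s (t * dir α * (1 - p)) =
      ((t ^ (-s) : ℝ) : ℂ) * dir (-(s * α)) * (1 - p) ^ (-(s : ℂ)) := by
  have h1 : (1 - p) ≠ 0 := sub_ne_zero.2 hp1.symm
  have harg : 0 ≤ (log (1 - p)).im ∧ (log (1 - p)).im ≤ Real.pi := by
    rw [log_im]
    exact ⟨arg_nonneg_iff.2 (by simpa using hp), arg_le_pi _⟩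
  have hl : log (t * dir α * (1 - p) * dir (-(α + Real.pi / 2))) =
      Real.log t + log (1 - p) + -Real.pi / 2 * I := by
    have e1 : t * dir α * (1 - p) * dir (-(α + Real.pi / 2)) = t * ((1 - p) * -I) := by
      linear_combination (t * (1 - p)) * dir_mul_dir_neg_left α
    rw [e1, log_ofReal_mul ht (mul_ne_zero h1 (neg_ne_zero.2 I_ne_zero)), add_assoc]
    congr 1
    apply log_eq_of_exp_eq
    · rw [Complex.exp_add, Complex.exp_log h1, Complex.exp_neg_pi_div_two_mul_I]
    · simp; linarith [harg.1, Real.pi_pos]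
    · simp; linarith [harg.2, Real.pi_pos]
  rw [branch, hl, cpow_def_of_ne_zero h1, dir, Real.rpow_def_of_pos ht, ofReal_exp,
    ← Complex.exp_add, ← Complex.exp_add]
  push_cast
  ring_nf

/-! ### Growth of branches along rays -/

/-- The lower bound d on x is what makes the estimate available for negative s as well. -/
theorem rpow_le_mul_exp (s : ℝ) {d ε : ℝ} (hd : 0 < d) (hε : 0 < ε) :
    ∃ C : ℝ, 0 < C ∧ ∀ x : ℝ, d ≤ x → x ^ s ≤ C * Real.exp (ε * x) := by
  obtain ⟨n, hn⟩ := exists_nat_ge s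
  refine ⟨d ^ s * (n.factorial / (ε * d) ^ n), by positivity, fun x hx => ?_⟩
  have hx0 : 0 < x := hd.trans_le hx
  have h1 : x ^ s = d ^ s * (x / d) ^ s := by
    rw [← Real.mul_rpow hd.le (by positivity), mul_div_cancel₀ _ hd.ne']
  have h2 : (x / d) ^ s ≤ (x / d) ^ n := by
    rw [← Real.rpow_natCast]
    exact Real.rpow_le_rpow_of_exponent_le ((one_le_div hd).2 hx) hn
  have h3 := Real.pow_div_factorial_le_exp (x := ε * x) (by positivity) n
  rw [h1, mul_assoc]
  gcongr
  calc (x / d) ^ s ≤ (x / d) ^ n := h2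
    _ = n.factorial / (ε * d) ^ n * ((ε * x) ^ n / n.factorial) := by
        rw [mul_pow, mul_pow, div_pow]; field_simp
    _ ≤ _ := by gcongr

theorem re_mul_le_norm (z : ℂ) (β : ℝ) : (z * dir (-β)).re ≤ ‖z‖ := by
  refine (Complex.re_le_norm _).trans ?_
  rw [norm_mul, norm_dir, mul_one]

theorem exists_lower_bound_segment {β : ℝ} {P Q : ℂ} (hP : P ∈ halfPlane β)
    (hQ : Q ∈ halfPlane β) : ∃ d : ℝ, 0 < d ∧ ∀ z ∈ segment ℝ P Q, d ≤ (z * dir (-β)).re := by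
  refine ⟨min (P * dir (-β)).re (Q * dir (-β)).re, lt_min hP hQ, fun z hz => ?_⟩
  obtain ⟨a, b, ha, hb, hab, rfl⟩ := hz
  simp only [real_smul, add_mul, add_re, mul_assoc, re_ofReal_mul]
  have h1 := min_le_left (P * dir (-β)).re (Q * dir (-β)).re
  have h2 := min_le_right (P * dir (-β)).re (Q * dir (-β)).re
  calc _ = a * min (P * dir (-β)).re (Q * dir (-β)).re +
        b * min (P * dir (-β)).re (Q * dir (-β)).re := by rw [← add_mul, hab, one_mul]
    _ ≤ _ := by gcongr

theorem norm_le_of_mem_segment {P Q z : ℂ} (hz : z ∈ segment ℝ P Q) : ‖z‖ ≤ ‖P‖ + ‖Q‖ := by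
  obtain ⟨a, b, ha, hb, hab, rfl⟩ := hz
  refine (norm_add_le _ _).trans ?_
  rw [norm_smul, norm_smul, Real.norm_of_nonneg ha, Real.norm_of_nonneg hb]
  have h1 : a ≤ 1 := by linarith
  have h2 : b ≤ 1 := by linarith
  nlinarith [norm_nonneg P, norm_nonneg Q]

theorem add_mul_mem_halfPlane {β : ℝ} {z e : ℂ} (he : (e * dir (-β)).re = 0)
    (hz : z ∈ halfPlane β) (t : ℝ) : z + t * e ∈ halfPlane β := by
  have hz' : 0 < (z * dir (-β)).re := hz
  change 0 < ((z + t * e) * dir (-β)).re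
  rwa [add_mul, add_re, mul_assoc (t : ℂ), re_ofReal_mul, he, mul_zero, add_zero]

/-- Along the rays the distance to w stays above a positive d and grows at most linearly, so any
power of it costs at most an arbitrarily small exponential rate. -/
theorem branch_decay {β : ℝ} (s : ℝ) {e P Q w : ℂ} (he : (e * dir (-β)).re = 0) (he1 : ‖e‖ = 1)
    (hP : P - w ∈ halfPlane β) (hQ : Q - w ∈ halfPlane β) {ε : ℝ} (hε : 0 < ε) :
    ∃ C : ℝ, 0 < C ∧ ∀ z ∈ segment ℝ P Q, ∀ t : ℝ, 0 ≤ t →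
      ‖branch β s (z + t * e - w)‖ ≤ C * Real.exp (ε * t) := by
  obtain ⟨d, hd, hdz⟩ := exists_lower_bound_segment hP hQ
  obtain ⟨C, hC, hCx⟩ := rpow_le_mul_exp (-s) hd hε
  refine ⟨C * Real.exp (ε * (‖P - w‖ + ‖Q - w‖)), by positivity, fun z hz t ht => ?_⟩
  have hz' : z - w ∈ segment ℝ (P - w) (Q - w) := by
    have := add_segment_mem (P := P - w) (Q := Q - w) (v := w) (z := z) (by simpa using hz)
    exact this
  have h1 : d ≤ ‖z + t * e - w‖ := by
    refine le_trans ?_ (re_mul_le_norm _ β)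
    rw [add_sub_right_comm, add_mul, add_re, mul_assoc (t : ℂ), re_ofReal_mul, he, mul_zero,
      add_zero]
    exact hdz _ hz'
  have h2 : ‖z + t * e - w‖ ≤ (‖P - w‖ + ‖Q - w‖) + t := by
    rw [add_sub_right_comm]
    refine (norm_add_le _ _).trans (add_le_add (norm_le_of_mem_segment hz') ?_)
    rw [norm_mul, he1, Complex.norm_real, Real.norm_of_nonneg ht, mul_one]
  rw [norm_branch s (norm_pos_iff.1 (hd.trans_le h1)), mul_assoc, ← Real.exp_add, ← mul_add]
  refine (hCx _ h1).trans ?_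
  gcongr

/-! ### Holomorphic 1-forms -/

/-- The 1-form `h dz`. -/
def holForm (h : ℂ → ℂ) (z : ℂ) : ℂ →L[ℝ] ℂ := h z • (1 : ℂ →L[ℝ] ℂ)

theorem holForm_apply (h : ℂ → ℂ) (z e : ℂ) : holForm h z e = h z * e := by simp [holForm]

theorem norm_holForm (h : ℂ → ℂ) (z : ℂ) : ‖holForm h z‖ = ‖h z‖ := by
  rw [holForm, norm_smul, norm_one, mul_one]

theorem continuousOn_holForm {h : ℂ → ℂ} {D : Set ℂ} (hh : ContinuousOn h D) :
    ContinuousOn (holForm h) D := hh.smul continuousOn_const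

theorem exists_primitive_holForm {h : ℂ → ℂ} {D : Set ℂ} (hD : Convex ℝ D) (hDo : IsOpen D)
    (hh : DifferentiableOn ℂ h D) : ∃ Φ : ℂ → ℂ, ∀ z ∈ D, HasFDerivAt Φ (holForm h z) z := by
  obtain ⟨Φ, hΦ⟩ := hD.exists_forall_hasDerivWithinAt hh
  exact ⟨Φ, fun z hz => ((hΦ z hz).hasDerivAt (hDo.mem_nhds hz)).complexToReal_fderiv⟩

/-- The form `h(z) (z - w)^{-s} dz` on a half-plane based at `w`, for `h` decaying along rays. -/
theorem rayForm_branch {h : ℂ → ℂ} {U : Set ℂ} {β : ℝ} (s : ℝ) {e w : ℂ} (hU : Convex ℝ U)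
    (hUo : IsOpen U) (hadd : ∀ z ∈ U, ∀ t : ℝ, 0 ≤ t → z + t * e ∈ U) (hh : DifferentiableOn ℂ h U)
    (he : (e * dir (-β)).re = 0) (he1 : ‖e‖ = 1)
    (hdec : ∀ P ∈ U, ∀ Q ∈ U, ∃ (C ε : ℝ), 0 < ε ∧ ∀ z ∈ segment ℝ P Q, ∀ t : ℝ, 0 ≤ t →
      ‖h (z + t * e)‖ ≤ C * Real.exp (-(ε * t))) :
    RayForm {z | z ∈ U ∧ z - w ∈ halfPlane β} e (holForm fun z => h z * branch β s (z - w)) := by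
  have hconv : Convex ℝ {z | z ∈ U ∧ z - w ∈ halfPlane β} := by
    have hset : {z | z ∈ U ∧ z - w ∈ halfPlane β} = U ∩ (fun z => -w + z) ⁻¹' halfPlane β := by
      ext z; simp [neg_add_eq_sub]
    rw [hset]
    exact hU.inter ((convex_halfPlane β).translate_preimage_right (-w))
  have hopen : IsOpen {z | z ∈ U ∧ z - w ∈ halfPlane β} :=
    hUo.inter ((isOpen_halfPlane β).preimage (by fun_prop : Continuous fun z : ℂ => z - w))
  have hdiff : DifferentiableOn ℂ (fun z => h z * branch β s (z - w))
      {z | z ∈ U ∧ z - w ∈ halfPlane β} := by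
    refine (hh.mono fun z hz => hz.1).mul ?_
    exact (branch_differentiableOn β s).comp (by fun_prop) (fun z hz => hz.2)
  refine ⟨hconv, hopen, fun z hz t ht => ⟨hadd z hz.1 t ht, ?_⟩,
    continuousOn_holForm hdiff.continuousOn, exists_primitive_holForm hconv hopen hdiff, ?_⟩
  · rw [add_sub_right_comm]
    exact add_mul_mem_halfPlane he hz.2 t
  · intro P hP Q hQ
    obtain ⟨C, ε, hε, hC⟩ := hdec P hP.1 Q hQ.1
    obtain ⟨C', hC', hC'z⟩ := branch_decay s he he1 hP.2 hQ.2 (half_pos hε)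
    refine ⟨C * C', ε / 2, half_pos hε, fun z hz t ht => ?_⟩
    rw [norm_holForm, norm_mul]
    calc _ ≤ (C * Real.exp (-(ε * t))) * (C' * Real.exp (ε / 2 * t)) := by
          gcongr
          · exact (norm_nonneg _).trans (hC z hz t ht)
          · exact hC z hz t ht
          · exact hC'z z hz t ht
      _ = _ := by
          rw [mul_mul_mul_comm, ← Real.exp_add]; ring_nf

end MedianResum

namespace MedianResum

/-! ### The Hankel integral -/

/-- `e^{2πiz}`. -/
def expTwoPi (z : ℂ) : ℂ := cexp (2 * Real.pi * I * z)

theorem norm_expTwoPi (z : ℂ) : ‖expTwoPi z‖ = Real.exp (-(2 * Real.pi * z.im)) := by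
  rw [expTwoPi, Complex.norm_exp]
  congr 1
  simp

theorem expTwoPi_add (z w : ℂ) : expTwoPi (z + w) = expTwoPi z * expTwoPi w := by
  rw [expTwoPi, expTwoPi, expTwoPi, ← Complex.exp_add]
  ring_nf

theorem expTwoPi_hasDerivAt (z : ℂ) : HasDerivAt expTwoPi (2 * Real.pi * I * expTwoPi z) z := by
  have := ((hasDerivAt_id z).const_mul (2 * Real.pi * I : ℂ)).cexp
  refine (this.congr_deriv ?_ : HasDerivAt expTwoPi _ z)
  rw [expTwoPi, mul_one, mul_comm]; rfl

theorem expTwoPi_differentiable : Differentiable ℂ expTwoPi :=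
  fun z => (expTwoPi_hasDerivAt z).differentiableAt

theorem norm_expTwoPi_ray_le {α : ℝ} {P Q z : ℂ} (hz : z ∈ segment ℝ P Q) (t : ℝ) :
    ‖expTwoPi (z + t * dir α)‖ ≤ Real.exp (2 * Real.pi * (‖P‖ + ‖Q‖)) *
      Real.exp (-(2 * Real.pi * Real.sin α * t)) := by
  rw [norm_expTwoPi, ← Real.exp_add, add_im, im_ofReal_mul, dir_im]
  refine Real.exp_le_exp.2 ?_
  have h1 := (neg_le_abs z.im).trans ((Complex.abs_im_le_norm z).trans (norm_le_of_mem_segment hz))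
  nlinarith [Real.pi_pos]

/-- The half-plane `halfPlane β` lies on the right or on the left of the direction `α`. -/
def IsSide (α β : ℝ) : Prop := β = α - Real.pi / 2 ∨ β = α + Real.pi / 2

variable {α β : ℝ}

theorem IsSide.re_eq_zero (h : IsSide α β) : (dir α * dir (-β)).re = 0 := by
  rcases h with rfl | rfl
  · rw [dir_mul_dir_neg_right, I_re]
  · rw [dir_mul_dir_neg_left, neg_re, I_re, neg_zero]

theorem IsSide.mem_slitPlane (h : IsSide α β) {t : ℝ} (ht : 0 < t) :
    t * dir α * dir (-β) ∈ slitPlane := by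
  rcases h with rfl | rfl
  · rw [mul_assoc, dir_mul_dir_neg_right]; exact Or.inr (by simp [ht.ne'])
  · rw [mul_assoc, dir_mul_dir_neg_left]; exact Or.inr (by simp [ht.ne'])

theorem IsSide.branch_ray (h : IsSide α β) (s : ℝ) {t : ℝ} (ht : 0 < t) :
    branch β s (t * dir α) = ((t ^ (-s) : ℝ) : ℂ) * dir (-(s * α)) := by
  rcases h with rfl | rfl
  · simpa using branch_ray_right (α := α) s (p := 0) ht (by simp) (by simp) (by simp)
  · simpa using branch_ray_left (α := α) s (p := 0) ht (by simp) (by simp)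

theorem continuousAt_branch (s : ℝ) {z : ℂ} (hz : z * dir (-β) ∈ slitPlane) :
    ContinuousAt (branch β s) z := by
  unfold branch
  have h1 : ContinuousAt (fun z : ℂ => log (z * dir (-β))) z :=
    ContinuousAt.clog (by fun_prop) hz
  fun_prop

theorem rayForm_expTwoPi (hα : α ∈ Ioo 0 Real.pi) (h : IsSide α β) (s : ℝ) (w : ℂ) :
    RayForm {z | z ∈ univ ∧ z - w ∈ halfPlane β} (dir α)
      (holForm fun z => expTwoPi z * branch β s (z - w)) := by
  refine rayForm_branch s convex_univ isOpen_univ (fun _ _ _ _ => mem_univ _)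
    expTwoPi_differentiable.differentiableOn h.re_eq_zero (norm_dir α) fun P _ Q _ => ?_
  refine ⟨_, 2 * Real.pi * Real.sin α, ?_, fun z hz t _ => norm_expTwoPi_ray_le hz t⟩
  have := Real.sin_pos_of_mem_Ioo hα
  have := Real.pi_pos
  positivity

/-- The integral of `e^{2πiz} z^{-s}` along a ray. -/
def hankelRay (α β s : ℝ) (Q : ℂ) : ℂ :=
  rayIntegral (holForm fun z => expTwoPi z * branch β s z) (dir α) Q

theorem rayForm_hankel (hα : α ∈ Ioo 0 Real.pi) (h : IsSide α β) (s : ℝ) :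
    RayForm (halfPlane β) (dir α) (holForm fun z => expTwoPi z * branch β s z) := by
  simpa using rayForm_expTwoPi hα h s 0

/-- Integration by parts of e^{2πiz} z^{-s}. The boundary term at the vertex has opposite signs for
the two rays of a Hankel contour and disappears from their sum. -/
theorem hankelRay_recursion (hα : α ∈ Ioo 0 Real.pi) (h : IsSide α β) (s : ℝ) {Q : ℂ}
    (hQ : Q ∈ halfPlane β) : 2 * Real.pi * I * hankelRay α β s Q =
      s * hankelRay α β (s + 1) Q - expTwoPi Q * branch β s Q := by
  have h1 := rayForm_hankel hα h s
  have h2 := rayForm_hankel hα h (s + 1)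
  have i1 := h1.integrableOn hQ
  have i2 := h2.integrableOn hQ
  simp only [holForm_apply] at i1 i2
  have hd : ∀ t : ℝ, 0 ≤ t → HasDerivAt
      (fun t : ℝ => expTwoPi (Q + t * dir α) * branch β s (Q + t * dir α))
      (2 * Real.pi * I * (expTwoPi (Q + t * dir α) * branch β s (Q + t * dir α) * dir α) -
        s * (expTwoPi (Q + t * dir α) * branch β (s + 1) (Q + t * dir α) * dir α)) t := by
    intro t ht
    have hm : Q + t * dir α ∈ halfPlane β := h1.add_mem Q hQ t ht
    have hline : HasDerivAt (fun t : ℝ => Q + t * dir α) (dir α) t := by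
      simpa using ((hasDerivAt_id t).ofReal_comp.mul_const (dir α)).const_add Q
    have := ((expTwoPi_hasDerivAt _).mul (branch_hasDerivAt s hm)).comp t hline
    refine this.congr_deriv ?_
    ring
  have hlim : Tendsto (fun t : ℝ => expTwoPi (Q + t * dir α) * branch β s (Q + t * dir α)) atTop
      (𝓝 0) := by
    obtain ⟨C, ε, hε, hC⟩ := h1.decay Q hQ Q hQ
    refine squeeze_zero_norm' (a := fun t => C * Real.exp (-(ε * t))) ?_ ?_
    · filter_upwards [eventually_ge_atTop 0] with t ht
      simpa only [norm_holForm] using hC Q (left_mem_segment ℝ Q Q) t ht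
    · simpa using (Real.tendsto_exp_neg_atTop_nhds_zero.comp
        (tendsto_id.const_mul_atTop hε)).const_mul C
  have key := integral_Ioi_of_hasDerivAt_of_tendsto (a := 0)
    (hd 0 le_rfl).continuousAt.continuousWithinAt (fun t ht => hd t (le_of_lt ht))
    ((i1.const_mul _).sub (i2.const_mul _)) hlim
  rw [integral_sub (i1.const_mul _) (i2.const_mul _), integral_const_mul, integral_const_mul] at key
  simp only [ofReal_zero, zero_mul, add_zero] at key
  simp only [hankelRay, rayIntegral, holForm_apply]
  linear_combination key

/-- The value of the Hankel integral along half of the contour, for `s = -1/2` and vertex `0`. -/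
def hankelHalf : ℂ :=
  Complex.Gamma ((3 / 2 : ℝ) : ℂ) * (((2 * Real.pi) ^ (-(3 / 2) : ℝ) : ℝ) : ℂ) *
    dir (3 * Real.pi / 4)

theorem hankelHalf_ne_zero : hankelHalf ≠ 0 := by
  have := Real.pi_pos
  refine mul_ne_zero (mul_ne_zero (gamma_ofReal_ne_zero (by norm_num)) ?_) (dir_ne_zero _)
  exact_mod_cast (by positivity : (2 * Real.pi) ^ (-(3 / 2) : ℝ) ≠ 0)

theorem ofReal_mul_dir_cpow {r φ : ℝ} (hr : 0 < r) (hφ : φ ∈ Ioo (-Real.pi) Real.pi) (a : ℝ) :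
    ((r : ℂ) * dir φ) ^ (a : ℂ) = ((r ^ a : ℝ) : ℂ) * dir (a * φ) := by
  have hl : log ((r : ℂ) * dir φ) = Real.log r + φ * I := by
    rw [log_ofReal_mul hr (dir_ne_zero _)]
    congr 1
    apply log_eq_of_exp_eq
    · rfl
    · simpa using hφ.1
    · simpa using hφ.2.le
  rw [cpow_def_of_ne_zero (mul_ne_zero (by exact_mod_cast hr.ne') (dir_ne_zero _)), hl,
    Real.rpow_def_of_pos hr, dir, ofReal_exp, ← Complex.exp_add]
  push_cast
  ring_nf

/-- A Gamma integral with r = 2π e^{i(α - π/2)}; the powers of e^{iα} cancel, so the value does not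
depend on the direction. -/
theorem integral_hankel_zero (hα : α ∈ Ioo 0 Real.pi) :
    ∫ t : ℝ in Ioi 0, expTwoPi (t * dir α) * (((t ^ (1 / 2 : ℝ) : ℝ) : ℂ) * dir (1 / 2 * α)) * dir α
      = hankelHalf := by
  have hπ := Real.pi_pos
  have hr : (((2 * Real.pi : ℝ) : ℂ) * dir (α - Real.pi / 2)).re = 2 * Real.pi * Real.sin α := by
    rw [re_ofReal_mul, dir_re, Real.cos_sub_pi_div_two]
  have := integral_cexp_neg_mul_mul_rpow (a := 3 / 2) (by norm_num)
    (r := ((2 * Real.pi : ℝ) : ℂ) * dir (α - Real.pi / 2))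
    (by rw [hr]; have := Real.sin_pos_of_mem_Ioo hα; positivity)
  have hE : ∀ t : ℝ, expTwoPi (t * dir α) *
      (((t ^ (1 / 2 : ℝ) : ℝ) : ℂ) * dir (1 / 2 * α)) * dir α = dir (3 / 2 * α) *
      (cexp (-(t * (((2 * Real.pi : ℝ) : ℂ) * dir (α - Real.pi / 2)))) *
        ((t ^ (3 / 2 - 1 : ℝ) : ℝ) : ℂ)) := by
    intro t
    have e1 : dir (α - Real.pi / 2) = -(I * dir α) := by
      rw [sub_eq_add_neg, ← dir_mul_dir, ← conj_dir, dir_pi_div_two, conj_I]; ring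
    have e2 : dir (3 / 2 * α) = dir (1 / 2 * α) * dir α := by
      rw [dir_mul_dir]; ring_nf
    rw [expTwoPi, e1, e2]
    norm_num
    ring_nf
  simp_rw [hE]
  rw [integral_const_mul, this, ← ofReal_neg, ofReal_mul_dir_cpow (by positivity)
    ⟨by linarith [hα.1], by linarith [hα.2]⟩, hankelHalf]
  have e3 : dir (3 * Real.pi / 4) = dir (3 / 2 * α) * dir (-(3 / 2) * (α - Real.pi / 2)) := by
    rw [dir_mul_dir]; ring_nf
  rw [e3]
  ring

/-- For s = -1/2 the power is bounded near 0, so the vertex may be moved to 0 by dominated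
convergence. On the ray itself the branch is the same for either side (`IsSide.branch_ray`), hence
so is the limit. -/
theorem tendsto_hankelRay_zero (hα : α ∈ Ioo 0 Real.pi) (h : IsSide α β) {Q : ℂ}
    (hQ : Q ∈ halfPlane β) :
    Tendsto (fun η : ℝ => hankelRay α β (-(1 / 2)) (η * Q)) (𝓝[>] 0) (𝓝 hankelHalf) := by
  have hsin := Real.sin_pos_of_mem_Ioo hα
  have hπ := Real.pi_pos
  set r := 2 * Real.pi * Real.sin α with hr
  have hr0 : 0 < r := by positivity
  obtain ⟨C, hC, hCx⟩ := rpow_le_mul_exp (1 / 2) one_pos (half_pos hr0)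
  rw [← integral_hankel_zero hα]
  simp only [hankelRay, rayIntegral, holForm_apply]
  refine tendsto_integral_filter_of_dominated_convergence
    (fun t => Real.exp (2 * Real.pi * (‖Q‖ + ‖Q‖)) * Real.exp (-(r * t)) *
      (C * Real.exp (r / 2 * (1 + ‖Q‖ + t)))) ?_ ?_ ?_ ?_
  · filter_upwards [self_mem_nhdsWithin] with η hη
    have := (rayForm_hankel hα h (-(1 / 2))).integrableOn (smul_mem_halfPlane hη hQ)
    simp only [holForm_apply] at this
    exact this.aestronglyMeasurable
  · filter_upwards [Ioo_mem_nhdsGT (zero_lt_one' ℝ)] with η hη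
    filter_upwards [ae_restrict_mem measurableSet_Ioi] with t ht
    have ht' : 0 < t := ht
    have hm := (rayForm_hankel hα h (-(1 / 2))).add_mem _ (smul_mem_halfPlane hη.1 hQ) t ht'.le
    have hseg : (η : ℂ) * Q ∈ segment ℝ (0 : ℂ) Q :=
      ⟨1 - η, η, by linarith [hη.2], hη.1.le, by ring, by simp⟩
    rw [norm_mul, norm_mul, norm_dir, mul_one, norm_branch _ (ne_zero_of_mem_halfPlane hm), neg_neg]
    have hn : ‖(η : ℂ) * Q + t * dir α‖ ≤ 1 + ‖Q‖ + t := by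
      refine (norm_add_le _ _).trans ?_
      rw [norm_mul, norm_mul, norm_dir, Complex.norm_real, Complex.norm_real,
        Real.norm_of_nonneg hη.1.le, Real.norm_of_nonneg ht'.le]
      nlinarith [norm_nonneg Q, hη.2]
    gcongr
    · refine (norm_expTwoPi_ray_le hseg t).trans ?_
      gcongr
      simp
    · refine le_trans ?_ (hCx _ (by linarith [norm_nonneg Q]))
      exact Real.rpow_le_rpow (norm_nonneg _) hn (by norm_num)
  · have := (integrableOn_exp_mul_Ioi (a := -(r / 2)) (by linarith) 0).const_mul
      (Real.exp (2 * Real.pi * (‖Q‖ + ‖Q‖)) * (C * Real.exp (r / 2 * (1 + ‖Q‖))))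
    refine Integrable.congr this (Eventually.of_forall fun t => ?_)
    simp only
    have e1 : Real.exp (-(r / 2) * t) = Real.exp (-(r * t)) * Real.exp (r / 2 * t) := by
      rw [← Real.exp_add]; ring_nf
    have e2 : Real.exp (r / 2 * (1 + ‖Q‖ + t)) =
        Real.exp (r / 2 * (1 + ‖Q‖)) * Real.exp (r / 2 * t) := by
      rw [← Real.exp_add]; ring_nf
    rw [e1, e2]
    ring
  · filter_upwards [ae_restrict_mem measurableSet_Ioi] with t ht
    have hb : ((t ^ (1 / 2 : ℝ) : ℝ) : ℂ) * dir (1 / 2 * α) = branch β (-(1 / 2)) (t * dir α) := by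
      rw [h.branch_ray _ ht, neg_neg, neg_mul, neg_neg]
    rw [hb]
    have h1 : ContinuousAt (fun z => expTwoPi z * branch β (-(1 / 2)) z * dir α) (t * dir α) :=
      ((expTwoPi_differentiable.continuous.continuousAt).mul
        (continuousAt_branch _ (h.mem_slitPlane ht))).mul continuousAt_const
    have h2 : Tendsto (fun η : ℝ => (η : ℂ) * Q + t * dir α) (𝓝[>] 0) (𝓝 (t * dir α)) := by
      have : Continuous (fun η : ℝ => (η : ℂ) * Q + t * dir α) := by fun_prop
      exact (this.tendsto' 0 _ (by simp)).mono_left nhdsWithin_le_nhds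
    exact Tendsto.comp (g := fun z => expTwoPi z * branch β (-(1 / 2)) z * dir α) h1 h2

theorem isSide_right (α : ℝ) : IsSide α (α - Real.pi / 2) := Or.inl rfl
theorem isSide_left (α : ℝ) : IsSide α (α + Real.pi / 2) := Or.inr rfl

theorem branch_overlap_sides {α α' : ℝ} (hα : α ∈ Ioo 0 Real.pi) (hα' : α' ∈ Ioo 0 Real.pi)
    (h : α < α') (n : ℕ) {z : ℂ} (hz : z ∈ halfPlane (α - Real.pi / 2))
    (hz' : z ∈ halfPlane (α' + Real.pi / 2)) :
    branch (α' + Real.pi / 2) (3 / 2 - n) z = -branch (α - Real.pi / 2) (3 / 2 - n) z :=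
  branch_overlap (by linarith [hα.1, hα'.2]) (by linarith [hα.1, hα'.2]) n hz hz'

theorem holForm_eq_neg {f g : ℂ → ℂ} {z : ℂ} (h : f z = -g z) : holForm f z = -holForm g z :=
  ContinuousLinearMap.ext fun v => by simp [holForm_apply, h]

/-- The Hankel integral over both rays. -/
def hankelSum (α α' s : ℝ) (Q : ℂ) : ℂ :=
  hankelRay α (α - Real.pi / 2) s Q + hankelRay α' (α' + Real.pi / 2) s Q

theorem hankelSum_recursion {α α' : ℝ} (hα : α ∈ Ioo 0 Real.pi) (hα' : α' ∈ Ioo 0 Real.pi)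
    (h : α < α') (n : ℕ) {Q : ℂ} (hQ : Q ∈ halfPlane (α - Real.pi / 2))
    (hQ' : Q ∈ halfPlane (α' + Real.pi / 2)) :
    2 * Real.pi * I * hankelSum α α' (3 / 2 - (n + 1 : ℕ)) Q =
      (1 / 2 - n) * hankelSum α α' (3 / 2 - n) Q := by
  have h1 := hankelRay_recursion hα (isSide_right α) (3 / 2 - (n + 1 : ℕ)) hQ
  have h2 := hankelRay_recursion hα' (isSide_left α') (3 / 2 - (n + 1 : ℕ)) hQ'
  rw [branch_overlap_sides hα hα' h (n + 1) hQ hQ'] at h2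
  rw [show (3 / 2 - ((n + 1 : ℕ) : ℝ) + 1 : ℝ) = 3 / 2 - n by push_cast; ring] at h1 h2
  rw [hankelSum, hankelSum, mul_add, h1, h2]
  push_cast
  ring

/-- The sum does not depend on the vertex, so it equals its limit as the vertex tends to 0, to which
the two rays contribute equally. -/
theorem hankelSum_two {α α' : ℝ} (hα : α ∈ Ioo 0 Real.pi) (hα' : α' ∈ Ioo 0 Real.pi)
    (h : α < α') {Q : ℂ} (hQ : Q ∈ halfPlane (α - Real.pi / 2))
    (hQ' : Q ∈ halfPlane (α' + Real.pi / 2)) :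
    hankelSum α α' (3 / 2 - (2 : ℕ)) Q = 2 * hankelHalf := by
  have e : (3 / 2 - (2 : ℕ) : ℝ) = -(1 / 2) := by norm_num
  have h1 := (tendsto_hankelRay_zero hα (isSide_right α) hQ).add
    (tendsto_hankelRay_zero hα' (isSide_left α') hQ')
  rw [← two_mul] at h1
  refine tendsto_nhds_unique (tendsto_const_nhds.congr' ?_) h1
  filter_upwards [self_mem_nhdsWithin] with η hη
  have h2 := (rayForm_hankel hα (isSide_right α) (-(1 / 2))).add_eq
    (rayForm_hankel hα' (isSide_left α') (-(1 / 2))) (fun z hz => ?_) ⟨hQ, hQ'⟩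
    ⟨smul_mem_halfPlane hη hQ, smul_mem_halfPlane hη hQ'⟩
  · rw [e]
    exact h2
  · have := branch_overlap_sides hα hα' h 2 hz.1 hz.2
    rw [e] at this
    exact holForm_eq_neg (by rw [this, mul_neg])

/-- Only n = 2, that is s = -1/2, is computed. The recursion carries the value to all other n in
both directions, and its factor 1/2 - n never vanishes, which keeps the constant nonzero. -/
theorem exists_hankelSum (n : ℕ) : ∃ C : ℂ, C ≠ 0 ∧ ∀ α ∈ Ioo 0 Real.pi, ∀ α' ∈ Ioo 0 Real.pi,
    α < α' → ∀ Q ∈ halfPlane (α - Real.pi / 2), Q ∈ halfPlane (α' + Real.pi / 2) →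
    hankelSum α α' (3 / 2 - n) Q = C := by
  have hπ : (2 * Real.pi * I : ℂ) ≠ 0 := Complex.two_pi_I_ne_zero
  have hhalf : ∀ n : ℕ, (1 / 2 - n : ℂ) ≠ 0 := fun n hn => by
    have h1 : (1 : ℂ) = ((2 * n : ℕ) : ℂ) := by push_cast; linear_combination 2 * hn
    have h2 : 1 = 2 * n := by exact_mod_cast h1
    omega
  have hdown : ∀ n : ℕ, (∃ C : ℂ, C ≠ 0 ∧ ∀ α ∈ Ioo 0 Real.pi, ∀ α' ∈ Ioo 0 Real.pi,
      α < α' → ∀ Q ∈ halfPlane (α - Real.pi / 2), Q ∈ halfPlane (α' + Real.pi / 2) →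
      hankelSum α α' (3 / 2 - (n + 1 : ℕ)) Q = C) → (∃ C : ℂ, C ≠ 0 ∧ ∀ α ∈ Ioo 0 Real.pi,
      ∀ α' ∈ Ioo 0 Real.pi, α < α' → ∀ Q ∈ halfPlane (α - Real.pi / 2),
      Q ∈ halfPlane (α' + Real.pi / 2) → hankelSum α α' (3 / 2 - n) Q = C) := by
    rintro n ⟨C, hC, h⟩
    refine ⟨2 * Real.pi * I * C / (1 / 2 - n), div_ne_zero (mul_ne_zero hπ hC) (hhalf n),
      fun α hα α' hα' hlt Q hQ hQ' => ?_⟩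
    rw [eq_div_iff (hhalf n), mul_comm, ← hankelSum_recursion hα hα' hlt n hQ hQ',
      h α hα α' hα' hlt Q hQ hQ']
  have h2 : ∃ C : ℂ, C ≠ 0 ∧ ∀ α ∈ Ioo 0 Real.pi, ∀ α' ∈ Ioo 0 Real.pi,
      α < α' → ∀ Q ∈ halfPlane (α - Real.pi / 2), Q ∈ halfPlane (α' + Real.pi / 2) →
      hankelSum α α' (3 / 2 - (2 : ℕ)) Q = C :=
    ⟨2 * hankelHalf, mul_ne_zero two_ne_zero hankelHalf_ne_zero,
      fun α hα α' hα' hlt Q hQ hQ' => hankelSum_two hα hα' hlt hQ hQ'⟩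
  rcases lt_or_ge n 2 with hn | hn
  · have h1 := hdown 1 h2
    interval_cases n
    · exact hdown 0 h1
    · exact h1
  · induction n, hn using Nat.le_induction with
    | base => exact h2
    | succ n _ ih =>
      obtain ⟨C, hC, h⟩ := ih
      refine ⟨(1 / 2 - n) * C / (2 * Real.pi * I), div_ne_zero (mul_ne_zero (hhalf n) hC) hπ,
        fun α hα α' hα' hlt Q hQ hQ' => ?_⟩
      rw [eq_div_iff hπ, mul_comm, hankelSum_recursion hα hα' hlt n hQ hQ',
        h α hα α' hα' hlt Q hQ hQ']

end MedianResum

namespace MedianResum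

/-! ### Cusp forms of half-integral weight -/

theorem IsCuspFormHalf.periodic {N m : ℕ} {f : UpperHalfPlane → ℂ} (hf : IsCuspFormHalf N m f) :
    Function.Periodic (f ∘ ofComplex) (1 : ℝ) := by
  intro z
  rcases lt_or_ge 0 z.im with hz | hz
  · have hz1 : 0 < (z + (1 : ℝ)).im := by simpa using hz
    simp only [Function.comp_apply]
    rw [UpperHalfPlane.ofComplex_apply_of_im_pos hz1, UpperHalfPlane.ofComplex_apply_of_im_pos hz]
    -- The translation lies in every Γ₀(N) and has c = 0, d = 1, so its multiplier is trivial.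
    have hT : ModularGroup.T ∈ CongruenceSubgroup.Gamma0 N := by
      simp [CongruenceSubgroup.Gamma0_mem, ModularGroup.coe_T]
    rw [hf.slash _ hT ⟨z, hz⟩, slashHalf, UpperHalfPlane.modular_T_smul]
    have e : (⟨z + (1 : ℝ), hz1⟩ : UpperHalfPlane) = (1 : ℝ) +ᵥ ⟨z, hz⟩ := by
      apply UpperHalfPlane.ext
      simp [add_comm]
    rw [e]
    simp [ModularGroup.coe_T, thetaEps, kroneckerOdd]
  -- Off the upper half-plane `ofComplex` takes a constant default value, so periodicity is
  -- automatic there.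
  · have hz1 : (z + (1 : ℝ)).im ≤ 0 := by simpa using hz
    simp only [Function.comp_apply]
    rw [UpperHalfPlane.ofComplex_apply_of_im_nonpos hz1,
      UpperHalfPlane.ofComplex_apply_of_im_nonpos hz]

theorem IsCuspFormHalf.isZeroAtImInfty {N m : ℕ} {f : UpperHalfPlane → ℂ}
    (hf : IsCuspFormHalf N m f) : UpperHalfPlane.IsZeroAtImInfty f := by
  obtain ⟨ε, hε, h⟩ := hf.decay 1
  have h1 : f =O[atImInfty] (fun z : UpperHalfPlane => Real.exp (-ε * z.im)) := by
    refine (Asymptotics.isBigO_norm_left (f' := f)).1 ?_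
    simpa using h
  refine h1.trans_tendsto ?_
  have h2 : Tendsto (fun y : ℝ => Real.exp (-ε * y)) atTop (𝓝 0) := by
    have := Real.tendsto_exp_neg_atTop_nhds_zero.comp (tendsto_id.const_mul_atTop hε)
    refine this.congr fun y => ?_
    simp
  exact h2.comp tendsto_comap

theorem IsCuspFormHalf.hasSum {N m : ℕ} {f : UpperHalfPlane → ℂ} (hf : IsCuspFormHalf N m f)
    {z : ℂ} (hz : 0 < z.im) :
    HasSum (fun n : ℕ => PowerSeries.coeff (n + 1) (UpperHalfPlane.qExpansion 1 f) *
      expTwoPi ((n + 1 : ℕ) * z)) (f (ofComplex z)) := by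
  have hb : UpperHalfPlane.IsBoundedAtImInfty f := hf.isZeroAtImInfty.isBoundedAtImInfty
  have h0 : PowerSeries.coeff 0 (UpperHalfPlane.qExpansion 1 f) = 0 := by
    rw [UpperHalfPlane.qExpansion_coeff_zero one_pos
      (UpperHalfPlane.analyticAt_cuspFunction_zero one_pos hf.periodic hf.holo hb) hf.periodic]
    exact hf.isZeroAtImInfty.valueAtInfty_eq_zero
  have h := UpperHalfPlane.hasSum_qExpansion one_pos hf.periodic hf.holo hb (ofComplex z)
  rw [← hasSum_nat_add_iff' 1] at h
  simp only [Finset.range_one, Finset.sum_singleton, h0, zero_smul, sub_zero] at h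
  have e : (fun n : ℕ => PowerSeries.coeff (n + 1) (UpperHalfPlane.qExpansion 1 f) *
      expTwoPi ((n + 1 : ℕ) * z)) = fun n : ℕ => PowerSeries.coeff (n + 1)
        (UpperHalfPlane.qExpansion 1 f) • Function.Periodic.qParam 1 (ofComplex z : UpperHalfPlane) ^ (n + 1) := by
    ext n
    rw [smul_eq_mul, Function.Periodic.qParam, ← Complex.exp_nat_mul,
      UpperHalfPlane.ofComplex_apply_of_im_pos hz, expTwoPi]
    congr 2
    push_cast
    simp
    ring
  rw [e]
  exact h

theorem IsCuspFormHalf.differentiableOn {N m : ℕ} {f : UpperHalfPlane → ℂ}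
    (hf : IsCuspFormHalf N m f) : DifferentiableOn ℂ (fun z => f (ofComplex z)) {z | 0 < z.im} :=
  UpperHalfPlane.mdifferentiable_iff.1 hf.holo

theorem norm_expTwoPi_nat (n : ℕ) (z : ℂ) :
    ‖expTwoPi (n * z)‖ = Real.exp (-(2 * Real.pi * n * z.im)) := by
  rw [norm_expTwoPi]
  simp [mul_assoc]

theorem norm_expTwoPi_succ_le (n : ℕ) {z : ℂ} {h : ℝ} (hz : h ≤ z.im) :
    ‖expTwoPi ((n + 1 : ℕ) * z)‖ ≤
      ‖expTwoPi ((n + 1 : ℕ) * (h * I))‖ * Real.exp (-(2 * Real.pi * (z.im - h))) := by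
  rw [norm_expTwoPi_nat, norm_expTwoPi_nat, ← Real.exp_add]
  refine Real.exp_le_exp.2 ?_
  have : 0 ≤ Real.pi * n * (z.im - h) := by
    have := Real.pi_pos
    have := sub_nonneg.2 hz
    positivity
  simp
  linarith

/-- A `q`-series without constant term decays exponentially in every half-plane `Im z ≥ h > 0`. -/
theorem exists_norm_le_of_hasSum {a : ℕ → ℂ} {F : ℂ → ℂ}
    (hF : ∀ z : ℂ, 0 < z.im → HasSum (fun n : ℕ => a n * expTwoPi ((n + 1 : ℕ) * z)) (F z))
    {h : ℝ} (hh : 0 < h) :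
    ∃ C : ℝ, 0 < C ∧ ∀ z : ℂ, h ≤ z.im → ‖F z‖ ≤ C * Real.exp (-(2 * Real.pi * z.im)) := by
  have hs : Summable fun n : ℕ => ‖a n * expTwoPi ((n + 1 : ℕ) * (h * I))‖ :=
    (hF (h * I) (by simpa using hh)).summable.norm
  set S := ∑' n : ℕ, ‖a n * expTwoPi ((n + 1 : ℕ) * (h * I))‖ with hS
  have hS0 : 0 ≤ S := tsum_nonneg fun _ => norm_nonneg _
  refine ⟨S * Real.exp (2 * Real.pi * h) + 1, by positivity, fun z hz => ?_⟩
  have h1 : ‖F z‖ ≤ S * Real.exp (-(2 * Real.pi * (z.im - h))) := by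
    refine (hF z (hh.trans_le hz)).norm_le_of_bounded (hs.hasSum.mul_right _) fun n => ?_
    rw [norm_mul, norm_mul, mul_assoc]
    gcongr
    exact norm_expTwoPi_succ_le n hz
  refine h1.trans ?_
  rw [add_mul, mul_assoc S, ← Real.exp_add]
  have : -(2 * Real.pi * (z.im - h)) = 2 * Real.pi * h + -(2 * Real.pi * z.im) := by ring
  rw [this]
  have := Real.exp_pos (-(2 * Real.pi * z.im))
  linarith

theorem norm_thetaEps (d : ℤ) : ‖thetaEps d‖ = 1 := by
  rw [thetaEps]; split_ifs <;> simp

theorem norm_kroneckerOdd_le (c d : ℤ) : ‖(kroneckerOdd c d : ℂ)‖ ≤ 1 := by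
  rw [kroneckerOdd]
  rcases jacobiSym.trichotomy c d.natAbs with h | h | h <;> rw [h] <;> split_ifs <;> simp

/-- In the variable τ = z + d/c the denominator is c τ: γ sends the cusp -d/c to i∞ and inverts the
distance to it. This is where decay at i∞ becomes decay at the cusp. -/
theorem smul_im_of_add {γ : SL(2, ℤ)} (hc : γ 1 0 ≠ 0) {τ : ℂ} (hτ : 0 < τ.im) :
    ((γ 1 0 : ℤ) : ℂ) * ((ofComplex (((-(γ 1 1 : ℝ) / (γ 1 0 : ℝ) : ℝ) : ℂ) + τ) : UpperHalfPlane) : ℂ)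
      + ((γ 1 1 : ℤ) : ℂ) = ((γ 1 0 : ℤ) : ℂ) * τ ∧
    (γ • ofComplex (((-(γ 1 1 : ℝ) / (γ 1 0 : ℝ) : ℝ) : ℂ) + τ)).im =
      τ.im / ((γ 1 0 : ℝ) ^ 2 * ‖τ‖ ^ 2) := by
  have hz : 0 < (((-(γ 1 1 : ℝ) / (γ 1 0 : ℝ) : ℝ) : ℂ) + τ).im := by simpa using hτ
  have hc' : ((γ 1 0 : ℤ) : ℂ) ≠ 0 := by exact_mod_cast hc
  have h1 : ((γ 1 0 : ℤ) : ℂ) *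
      ((ofComplex (((-(γ 1 1 : ℝ) / (γ 1 0 : ℝ) : ℝ) : ℂ) + τ) : UpperHalfPlane) : ℂ)
      + ((γ 1 1 : ℤ) : ℂ) = ((γ 1 0 : ℤ) : ℂ) * τ := by
    rw [UpperHalfPlane.ofComplex_apply_of_im_pos hz]
    push_cast
    field_simp
    ring
  refine ⟨h1, ?_⟩
  rw [ModularGroup.im_smul_eq_div_normSq, ModularGroup.denom_apply, h1, normSq_eq_norm_sq,
    norm_mul, mul_pow, UpperHalfPlane.ofComplex_apply_of_im_pos hz]
  simp [UpperHalfPlane.im]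

theorem IsCuspFormHalf.norm_le {N m : ℕ} {f : UpperHalfPlane → ℂ} (hf : IsCuspFormHalf N m f)
    {γ : SL(2, ℤ)} (hγ : γ ∈ CongruenceSubgroup.Gamma0 N) (hc : γ 1 0 ≠ 0) {τ : ℂ}
    (hτ : 0 < τ.im) :
    ‖f (ofComplex (((-(γ 1 1 : ℝ) / (γ 1 0 : ℝ) : ℝ) : ℂ) + τ))‖ ≤
      ‖((γ 1 0 : ℤ) : ℂ) * τ‖ ^ (-((m : ℝ) + 1 / 2)) *
      ‖f (γ • ofComplex (((-(γ 1 1 : ℝ) / (γ 1 0 : ℝ) : ℝ) : ℂ) + τ))‖ := by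
  have hτ0 : τ ≠ 0 := by rintro rfl; simp at hτ
  have hc' : ((γ 1 0 : ℤ) : ℂ) ≠ 0 := by exact_mod_cast hc
  rw [hf.slash γ hγ, slashHalf, (smul_im_of_add hc hτ).1, norm_mul, norm_mul, norm_mul, norm_pow,
    norm_thetaEps, one_pow, one_mul]
  have e : (-((m : ℂ) + 1 / 2)) = ((-((m : ℝ) + 1 / 2) : ℝ) : ℂ) := by push_cast; rfl
  rw [e, norm_cpow_ofReal_eq (mul_ne_zero hc' hτ0)]
  gcongr
  exact mul_le_of_le_one_left (by positivity) (norm_kroneckerOdd_le _ _)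

/-- Rapid decay of a cusp form along sectors at the cusp `-d/c`. -/
theorem IsCuspFormHalf.exists_norm_le_sector {N m : ℕ} {f : UpperHalfPlane → ℂ}
    (hf : IsCuspFormHalf N m f) {γ : SL(2, ℤ)} (hγ : γ ∈ CongruenceSubgroup.Gamma0 N)
    (hc : γ 1 0 ≠ 0) {δ R : ℝ} (hδ : 0 < δ) (hR : 0 < R) :
    ∃ C A : ℝ, 0 < C ∧ 0 < A ∧ ∀ t : ℝ, 0 < t → t ≤ 1 → ∀ ζ : ℂ, δ ≤ ζ.im → ‖ζ‖ ≤ R →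
      ‖f (ofComplex (((-(γ 1 1 : ℝ) / (γ 1 0 : ℝ) : ℝ) : ℂ) + t * ζ))‖ ≤
        C * Real.exp (-(A * t⁻¹)) := by
  have hπ := Real.pi_pos
  set c : ℝ := (γ 1 0 : ℝ) with hcdef
  have hc0 : 0 < |c| := abs_pos.2 (by rw [hcdef]; exact_mod_cast hc)
  have hc2 : c ^ 2 = |c| ^ 2 := (sq_abs c).symm
  set A : ℝ := 2 * Real.pi * (δ / (|c| ^ 2 * R ^ 2)) with hA
  have hA0 : 0 < A := by positivity
  obtain ⟨C₁, hC₁, hb⟩ := exists_norm_le_of_hasSum (F := fun z => f (ofComplex z))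
    (fun z hz => hf.hasSum hz) (h := δ / (|c| ^ 2 * R ^ 2)) (by positivity)
  -- The automorphy factor contributes t^{-k}; with x = 1/t it is absorbed by half of the decay
  -- e^{-A/t}.
  obtain ⟨C₂, hC₂, hx⟩ := rpow_le_mul_exp ((m : ℝ) + 1 / 2) one_pos (half_pos hA0)
  refine ⟨(|c| * δ) ^ (-((m : ℝ) + 1 / 2)) * C₂ * C₁, A / 2, by positivity, half_pos hA0,
    fun t ht ht1 ζ hζ hζR => ?_⟩
  have hζ0 : δ ≤ ‖ζ‖ := hζ.trans ((le_abs_self _).trans (Complex.abs_im_le_norm ζ))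
  have htζ : 0 < ((t : ℂ) * ζ).im := by rw [im_ofReal_mul]; exact mul_pos ht (hδ.trans_le hζ)
  have hnorm : ‖(t : ℂ) * ζ‖ = t * ‖ζ‖ := by
    rw [norm_mul, Complex.norm_real, Real.norm_of_nonneg ht.le]
  have him : δ / (|c| ^ 2 * R ^ 2) * t⁻¹ ≤
      (γ • ofComplex (((-(γ 1 1 : ℝ) / (γ 1 0 : ℝ) : ℝ) : ℂ) + t * ζ)).im := by
    rw [(smul_im_of_add hc htζ).2, hnorm, im_ofReal_mul, ← hcdef, hc2]
    have e : t * ζ.im / (|c| ^ 2 * (t * ‖ζ‖) ^ 2) = ζ.im / (|c| ^ 2 * ‖ζ‖ ^ 2) * t⁻¹ := by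
      have : ‖ζ‖ ≠ 0 := (hδ.trans_le hζ0).ne'
      field_simp
    rw [e]
    have : 0 < ‖ζ‖ := hδ.trans_le hζ0
    have : 0 ≤ ζ.im := hδ.le.trans hζ
    gcongr
  refine (hf.norm_le hγ hc htζ).trans ?_
  have h1 : ‖((γ 1 0 : ℤ) : ℂ) * (t * ζ)‖ ^ (-((m : ℝ) + 1 / 2)) ≤
      (|c| * δ) ^ (-((m : ℝ) + 1 / 2)) * (C₂ * Real.exp (A / 2 * t⁻¹)) := by
    have e1 : ‖((γ 1 0 : ℤ) : ℂ) * (t * ζ)‖ = |c| * (t * ‖ζ‖) := by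
      rw [norm_mul, hnorm, Complex.norm_intCast]
    have e2 : t⁻¹ ^ ((m : ℝ) + 1 / 2) = t ^ (-((m : ℝ) + 1 / 2)) := by
      rw [Real.inv_rpow ht.le, Real.rpow_neg ht.le]
    have h2 := hx t⁻¹ (by rw [one_le_inv₀ ht]; exact ht1)
    rw [e2] at h2
    calc _ ≤ (|c| * (t * δ)) ^ (-((m : ℝ) + 1 / 2)) := by
          rw [e1]
          refine Real.rpow_le_rpow_of_nonpos (by positivity) (by gcongr) ?_
          have : (0 : ℝ) ≤ m := by positivity
          linarith
      _ = (|c| * δ) ^ (-((m : ℝ) + 1 / 2)) * t ^ (-((m : ℝ) + 1 / 2)) := by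
          rw [← Real.mul_rpow (by positivity) ht.le]; ring_nf
      _ ≤ _ := by gcongr
  have h3 : ‖f (γ • ofComplex (((-(γ 1 1 : ℝ) / (γ 1 0 : ℝ) : ℝ) : ℂ) + t * ζ))‖ ≤
      C₁ * Real.exp (-(A * t⁻¹)) := by
    have hle : δ / (|c| ^ 2 * R ^ 2) ≤ δ / (|c| ^ 2 * R ^ 2) * t⁻¹ :=
      le_mul_of_one_le_right (by positivity) (by rw [one_le_inv₀ ht]; exact ht1)
    have := hb ((γ • ofComplex (((-(γ 1 1 : ℝ) / (γ 1 0 : ℝ) : ℝ) : ℂ) + t * ζ) : UpperHalfPlane) : ℂ)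
      (hle.trans him)
    simp only [UpperHalfPlane.ofComplex_apply] at this
    refine this.trans (mul_le_mul_of_nonneg_left (Real.exp_le_exp.2 (neg_le_neg ?_)) hC₁.le)
    rw [hA, mul_assoc (2 * Real.pi)]
    exact mul_le_mul_of_nonneg_left him (by positivity)
  calc _ ≤ ((|c| * δ) ^ (-((m : ℝ) + 1 / 2)) * (C₂ * Real.exp (A / 2 * t⁻¹))) *
        (C₁ * Real.exp (-(A * t⁻¹))) := by gcongr
    _ = (|c| * δ) ^ (-((m : ℝ) + 1 / 2)) * C₂ * C₁ *
        (Real.exp (A / 2 * t⁻¹) * Real.exp (-(A * t⁻¹))) := by ring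
    _ = _ := by rw [← Real.exp_add]; ring_nf

end MedianResum

namespace MedianResum

/-! ### Integrals along rays from a cusp -/

theorem rpow_le_mul_exp_add_inv (s : ℝ) {A : ℝ} (hA : 0 < A) :
    ∃ C : ℝ, 0 < C ∧ ∀ t : ℝ, 0 < t → t ^ s ≤ C * Real.exp (A * (t + t⁻¹)) := by
  obtain ⟨C₁, hC₁, h₁⟩ := rpow_le_mul_exp s one_pos hA
  obtain ⟨C₂, hC₂, h₂⟩ := rpow_le_mul_exp (-s) one_pos hA
  refine ⟨max C₁ C₂, lt_max_of_lt_left hC₁, fun t ht => ?_⟩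
  have hi : 0 < t⁻¹ := inv_pos.2 ht
  rcases le_total 1 t with h | h
  · refine (h₁ t h).trans ?_
    gcongr
    · exact le_max_left _ _
    · linarith
  · have := h₂ t⁻¹ (by rw [one_le_inv₀ ht]; exact h)
    rw [Real.inv_rpow ht.le, Real.rpow_neg ht.le, inv_inv] at this
    refine this.trans ?_
    gcongr
    · exact le_max_right _ _
    · linarith

/-- Glues the decay at the cusp, t → 0, to the decay at i∞, t → ∞, into one bound on the whole ray.
-/
theorem exists_norm_le_exp_add_inv {E : Type*} [NormedAddCommGroup E] {f : ℝ → E}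
    {C₁ C₂ A₁ A₂ : ℝ} (hC₁ : 0 ≤ C₁) (hC₂ : 0 ≤ C₂) (hA₁ : 0 < A₁) (hA₂ : 0 < A₂)
    (h₁ : ∀ t : ℝ, 0 < t → t ≤ 1 → ‖f t‖ ≤ C₁ * Real.exp (-(A₁ * t⁻¹)))
    (h₂ : ∀ t : ℝ, 1 ≤ t → ‖f t‖ ≤ C₂ * Real.exp (-(A₂ * t))) :
    ∃ C A : ℝ, 0 ≤ C ∧ 0 < A ∧ ∀ t : ℝ, 0 < t → ‖f t‖ ≤ C * Real.exp (-(A * (t + t⁻¹))) := by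
  set A := min A₁ A₂
  have hA : 0 < A := lt_min hA₁ hA₂
  refine ⟨(C₁ + C₂) * Real.exp A, A, by positivity, hA, fun t ht => ?_⟩
  have hi : 0 < t⁻¹ := inv_pos.2 ht
  rw [mul_assoc, ← Real.exp_add]
  rcases le_total 1 t with h | h
  · refine (h₂ t h).trans ?_
    have : t⁻¹ ≤ 1 := inv_le_one_of_one_le₀ h
    have h3 : A * t ≤ A₂ * t := by gcongr; exact min_le_right _ _
    gcongr
    · linarith
    · nlinarith
  · refine (h₁ t ht h).trans ?_
    have h3 : A * t⁻¹ ≤ A₁ * t⁻¹ := by gcongr; exact min_le_left _ _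
    gcongr
    · linarith
    · nlinarith

/-- The decay e^{-A/t} compensates e^{ε‖p‖} for ε = A/B because ‖p‖ ≤ B/t; the remaining e^{-At}
gives integrability. -/
theorem admissible_ray {m p : ℝ → ℂ} {C A B : ℝ} (hA : 0 < A) (hB : 0 < B)
    (hp : AEStronglyMeasurable p (volume.restrict (Ioi 0)))
    (hm : AEStronglyMeasurable m (volume.restrict (Ioi 0)))
    (hpB : ∀ t : ℝ, 0 < t → ‖p t‖ ≤ B * t⁻¹)
    (hmC : ∀ t : ℝ, 0 < t → ‖m t‖ ≤ C * Real.exp (-(A * (t + t⁻¹)))) :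
    Admissible (volume.restrict (Ioi 0)) p m := by
  refine ⟨hp, hm, A / B, by positivity, ?_⟩
  have hi : IntegrableOn (fun t : ℝ => C * Real.exp (-A * t)) (Ioi 0) :=
    (integrableOn_exp_mul_Ioi (by linarith) 0).const_mul C
  refine Integrable.mono' hi ?_ ?_
  · exact (Real.continuous_exp.comp_aestronglyMeasurable (hp.norm.const_mul _)).mul hm.norm
  · filter_upwards [ae_restrict_mem measurableSet_Ioi] with t ht
    rw [Real.norm_of_nonneg (by positivity)]
    have h1 : A / B * ‖p t‖ ≤ A * t⁻¹ := by
      calc _ ≤ A / B * (B * t⁻¹) := by gcongr; exact hpB t ht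
        _ = _ := by field_simp
    calc _ ≤ Real.exp (A * t⁻¹) * (C * Real.exp (-(A * (t + t⁻¹)))) := by
          gcongr
          exact hmC t ht
      _ = C * (Real.exp (A * t⁻¹) * Real.exp (-(A * (t + t⁻¹)))) := by ring
      _ = _ := by rw [← Real.exp_add]; ring_nf

theorem hasSum_rayIntegral {ι : Type*} [Countable ι] {W : ι → ℂ → ℂ →L[ℝ] ℂ}
    {V : ℂ → ℂ →L[ℝ] ℂ} {e P : ℂ} {b : ι → ℝ} {G : ℝ → ℝ}
    (hmeas : ∀ n, AEStronglyMeasurable (fun t : ℝ => W n (P + t * e) e) (volume.restrict (Ioi 0)))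
    (hb : Summable b) (hG : IntegrableOn G (Ioi 0))
    (hbound : ∀ n, ∀ t : ℝ, 0 < t → ‖W n (P + t * e) e‖ ≤ b n * G t)
    (hsum : ∀ t : ℝ, 0 < t → HasSum (fun n => W n (P + t * e) e) (V (P + t * e) e)) :
    HasSum (fun n => rayIntegral (W n) e P) (rayIntegral V e P) := by
  refine hasSum_integral_of_dominated_convergence (fun n t => b n * G t) hmeas (fun n => ?_) ?_ ?_ ?_
  · filter_upwards [ae_restrict_mem measurableSet_Ioi] with t ht using hbound n t ht
  · exact Eventually.of_forall fun t => hb.mul_right _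
  · simp_rw [tsum_mul_right]
    exact hG.const_mul _
  · filter_upwards [ae_restrict_mem measurableSet_Ioi] with t ht using hsum t ht

theorem exists_of_mem_segment_mul {t : ℝ} {e w z : ℂ} (hz : z ∈ segment ℝ ((t : ℂ) * e) (t * w)) :
    ∃ ζ ∈ segment ℝ e w, z = t * ζ := by
  obtain ⟨a, b, ha, hb, hab, rfl⟩ := hz
  refine ⟨a • e + b • w, ⟨a, b, ha, hb, hab, rfl⟩, ?_⟩
  simp only [real_smul]
  ring

theorem min_im_le_of_mem_segment {P Q z : ℂ} (hz : z ∈ segment ℝ P Q) : min P.im Q.im ≤ z.im := by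
  obtain ⟨a, b, ha, hb, hab, rfl⟩ := hz
  simp only [real_smul, add_im, im_ofReal_mul]
  calc _ = a * min P.im Q.im + b * min P.im Q.im := by rw [← add_mul, hab, one_mul]
    _ ≤ _ := by
      gcongr
      · exact min_le_left _ _
      · exact min_le_right _ _

variable {α β : ℝ}

/-- The direction of the ray does not contribute to Re(· e^{-iβ}); what remains is a multiple of -w
with coefficient at least 1/2. So w stays away from the small segments near the cusp. -/
theorem IsSide.le_re_of_mem_segment (h : IsSide α β) {w z : ℂ} {t : ℝ} (hw : -w ∈ halfPlane β)
    (ht : 0 < t) (ht2 : t < 1 / 2) (hz : z ∈ segment ℝ ((t : ℂ) * dir α) (t * w)) :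
    (-w * dir (-β)).re / 2 ≤ ((z - w) * dir (-β)).re := by
  obtain ⟨ζ, ⟨a, b, ha, hb, hab, rfl⟩, rfl⟩ := exists_of_mem_segment_mul hz
  have hw' : 0 < (-w * dir (-β)).re := hw
  have e : ((t : ℂ) * (a • dir α + b • w) - w) * dir (-β) =
      ((t * a : ℝ) : ℂ) * (dir α * dir (-β)) + ((1 - t * b : ℝ) : ℂ) * (-w * dir (-β)) := by
    simp only [real_smul]
    push_cast
    ring
  rw [e, add_re, re_ofReal_mul, re_ofReal_mul, h.re_eq_zero, mul_zero, zero_add]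
  have : t * b ≤ 1 / 2 := by nlinarith
  nlinarith

theorem IsSide.exists_branch_le_segment (h : IsSide α β) (s : ℝ) {w : ℂ} (hw : -w ∈ halfPlane β) :
    ∃ C : ℝ, 0 < C ∧ ∀ t : ℝ, 0 < t → t < 1 / 2 → ∀ z ∈ segment ℝ ((t : ℂ) * dir α) (t * w),
      ‖branch β s (z - w)‖ ≤ C := by
  have hw' : 0 < (-w * dir (-β)).re := hw
  obtain ⟨C, hC, hCx⟩ := rpow_le_mul_exp (-s) (half_pos hw') one_pos
  refine ⟨C * Real.exp (1 * (1 + ‖w‖ + ‖w‖)), by positivity, fun t ht ht2 z hz => ?_⟩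
  have h1 := (h.le_re_of_mem_segment hw ht ht2 hz).trans (re_mul_le_norm _ _)
  have h2 : ‖z - w‖ ≤ 1 + ‖w‖ + ‖w‖ := by
    obtain ⟨ζ, hζ, rfl⟩ := exists_of_mem_segment_mul hz
    refine (norm_sub_le _ _).trans (add_le_add ?_ le_rfl)
    rw [norm_mul, Complex.norm_real, Real.norm_of_nonneg ht.le]
    have := norm_le_of_mem_segment hζ
    rw [norm_dir] at this
    nlinarith [norm_nonneg ζ]
  rw [norm_branch s (norm_pos_iff.1 ((half_pos hw').trans_le h1))]
  refine (hCx _ h1).trans ?_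
  gcongr

/-- Substitution of r (z - w) for z. With r = n and s = 2 - k the prefactor is n^{1-k} e^{2πinw},
the n-th term of the Eichler integral. -/
theorem rayIntegral_expTwoPi_scale (h : IsSide α β) (s : ℝ) {r : ℝ}
    (hr : 0 < r) {w P : ℂ} (hP : P - w ∈ halfPlane β) :
    rayIntegral (holForm fun z => expTwoPi (r * z) * branch β s (z - w)) (dir α) P =
      expTwoPi (r * w) * ((r ^ (s - 1) : ℝ) : ℂ) * hankelRay α β s (r * (P - w)) := by
  have key := integral_comp_mul_left_Ioi (fun t : ℝ => expTwoPi (r * (P - w) + t * dir α) *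
    branch β s (r * (P - w) + t * dir α) * dir α) 0 hr
  rw [mul_zero] at key
  have hr1 : ((r ^ (s - 1) : ℝ) : ℂ) = ((r ^ s : ℝ) : ℂ) * (r : ℂ)⁻¹ := by
    rw [Real.rpow_sub_one hr.ne']; push_cast; rw [div_eq_mul_inv]
  have hrs : ((r ^ s : ℝ) : ℂ) * ((r ^ (-s) : ℝ) : ℂ) = 1 := by
    rw [← ofReal_mul, ← Real.rpow_add hr, add_neg_cancel, Real.rpow_zero, ofReal_one]
  simp only [rayIntegral, hankelRay, holForm_apply]
  rw [hr1, mul_assoc, mul_assoc, ← ofReal_inv, ← real_smul (x := r⁻¹), ← key,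
    ← integral_const_mul, ← integral_const_mul]
  refine setIntegral_congr_fun measurableSet_Ioi fun t ht => ?_
  have hm : P - w + t * dir α ∈ halfPlane β := add_mul_mem_halfPlane h.re_eq_zero hP t
  have e1 : (r : ℂ) * (P - w) + ((r * t : ℝ) : ℂ) * dir α = r * (P - w + t * dir α) := by
    push_cast; ring
  rw [e1, branch_smul s hr (ne_zero_of_mem_halfPlane hm),
    show (r : ℂ) * (P + t * dir α) = r * w + r * (P - w + t * dir α) by ring, expTwoPi_add,
    show P + t * dir α - w = P - w + t * dir α by ring]
  linear_combination (-expTwoPi (r * w) * expTwoPi (r * (P - w + t * dir α)) *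
    branch β s (P - w + t * dir α) * dir α) * hrs

end MedianResum

namespace MedianResum

/-! ### The median sum for Eichler integrals -/

section Ray

variable {α β : ℝ}

/-- `p = e^{-iα} / t`, so that `t e^{iα} - w = t e^{iα} (1 - w p)`. -/
def rayInv (α t : ℝ) : ℂ := dir (-α) * (t : ℂ)⁻¹

theorem ray_sub {t : ℝ} (ht : t ≠ 0) (w : ℂ) :
    t * dir α - w = t * dir α * (1 - w * rayInv α t) := by
  have : (t : ℂ) ≠ 0 := by exact_mod_cast ht
  rw [rayInv, mul_sub, mul_one]
  congr 1
  rw [show t * dir α * (w * (dir (-α) * (t : ℂ)⁻¹)) = (dir α * dir (-α)) * w * (t * (t : ℂ)⁻¹) by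
    ring, dir_mul_dir_neg, mul_inv_cancel₀ this]
  ring

theorem im_mul_rayInv (w : ℂ) (t : ℝ) : (w * rayInv α t).im = (w * dir (-α)).im * t⁻¹ := by
  rw [rayInv, ← mul_assoc, ← ofReal_inv, mul_comm, im_ofReal_mul, mul_comm]

theorem norm_rayInv {t : ℝ} (ht : 0 < t) : ‖rayInv α t‖ = t⁻¹ := by
  rw [rayInv, norm_mul, norm_dir, one_mul, norm_inv, Complex.norm_real, Real.norm_of_nonneg ht.le]

theorem measurable_rayInv : Measurable (rayInv α) := by
  unfold rayInv
  fun_prop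

theorem re_rayInv_mul_dir (θ : ℝ) {t : ℝ} :
    (rayInv α t * dir θ).re = t⁻¹ * Real.cos (θ - α) := by
  rw [rayInv, mul_assoc, mul_comm (dir (-α)), mul_assoc, dir_mul_dir, ← ofReal_inv, re_ofReal_mul,
    dir_re]
  ring_nf

/-- `w` lies on the side of the ray opposite to `halfPlane β`. -/
theorem neg_mem_halfPlane_right {w : ℂ} (hw : 0 < (w * dir (-α)).im) :
    -w ∈ halfPlane (α - Real.pi / 2) := by
  change 0 < (-w * dir (-(α - Real.pi / 2))).re
  have : dir (-(α - Real.pi / 2)) = dir (-α) * I := by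
    rw [← dir_pi_div_two, dir_mul_dir]; ring_nf
  rw [this, ← mul_assoc, mul_I_re, neg_mul, neg_im, neg_neg]
  exact hw

theorem neg_mem_halfPlane_left {w : ℂ} (hw : (w * dir (-α)).im < 0) :
    -w ∈ halfPlane (α + Real.pi / 2) := by
  change 0 < (-w * dir (-(α + Real.pi / 2))).re
  have : dir (-(α + Real.pi / 2)) = dir (-α) * -I := by
    rw [← conj_I, ← dir_pi_div_two, conj_dir, dir_mul_dir]; ring_nf
  rw [this, ← mul_assoc, mul_neg, neg_re, mul_I_re, neg_mul, neg_im, neg_neg]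
  linarith

/-- The branches on both sides, in terms of the principal branch of `(1 - w p)^{-s}`. -/
theorem branch_ray_sub (s : ℝ) {w : ℂ} {t : ℝ} (ht : 0 < t)
    (h : (β = α - Real.pi / 2 ∧ 0 < (w * dir (-α)).im) ∨
      (β = α + Real.pi / 2 ∧ (w * dir (-α)).im < 0)) :
    branch β s (t * dir α - w) =
      ((t ^ (-s) : ℝ) : ℂ) * dir (-(s * α)) * (1 - w * rayInv α t) ^ (-(s : ℂ)) := by
  have hi : 0 < t⁻¹ := inv_pos.2 ht
  rw [ray_sub ht.ne']
  rcases h with ⟨rfl, hw⟩ | ⟨rfl, hw⟩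
  · have h1 : 0 < (w * rayInv α t).im := by rw [im_mul_rayInv]; positivity
    refine branch_ray_right s ht h1.le ?_ (fun h => absurd h h1.ne')
    intro h; rw [h] at h1; simp at h1
  · have h1 : (w * rayInv α t).im < 0 := by
      rw [im_mul_rayInv]; exact mul_neg_of_neg_of_pos hw hi
    refine branch_ray_left s ht h1.le ?_
    intro h; rw [h] at h1; simp at h1

/-- By the addition formula, sin(α' - α) Im w is a positive combination of the distances of w from
the two rays. -/
theorem im_pos_of_sector {α' : ℝ} (hα : α ∈ Ioo 0 Real.pi) (hα' : α' ∈ Ioo 0 Real.pi)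
    (h : α < α') {w : ℂ} (hw : 0 < (w * dir (-α)).im) (hw' : (w * dir (-α')).im < 0) :
    0 < w.im := by
  have e : w.im * Real.sin (α' - α) =
      Real.sin α' * (w * dir (-α)).im - Real.sin α * (w * dir (-α')).im := by
    simp only [mul_im, dir_re, dir_im, Real.cos_neg, Real.sin_neg, Real.sin_sub]
    ring
  have h1 : 0 < Real.sin (α' - α) :=
    Real.sin_pos_of_pos_of_lt_pi (by linarith) (by linarith [hα'.2, hα.1])
  have h2 := Real.sin_pos_of_mem_Ioo hα
  have h3 := Real.sin_pos_of_mem_Ioo hα'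
  have h4 : 0 < w.im * Real.sin (α' - α) := by
    rw [e]
    have := mul_pos h3 hw
    have := mul_neg_of_pos_of_neg h2 hw'
    linarith
  exact pos_of_mul_pos_left h4 h1.le

/-- The points `t w`, `0 < t < 1`, lie in the half-plane based at `w`. -/
theorem mul_sub_mem_halfPlane {w : ℂ} {t : ℝ} (hw : -w ∈ halfPlane β) (ht : t < 1) :
    t * w - w ∈ halfPlane β := by
  have := smul_mem_halfPlane (r := 1 - t) (by linarith) hw
  rwa [show ((1 - t : ℝ) : ℂ) * -w = t * w - w by push_cast; ring] at this

theorem mul_dir_sub_mem_halfPlane (h : IsSide α β) {w : ℂ} (hw : -w ∈ halfPlane β) (t : ℝ) :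
    t * dir α - w ∈ halfPlane β := by
  have := add_mul_mem_halfPlane h.re_eq_zero hw t
  rwa [neg_add_eq_sub] at this

end Ray

section Eichler

variable {N m : ℕ} {f : UpperHalfPlane → ℂ} {γ : SL(2, ℤ)}

/-- The form `f(x₀ + z) (z - w)^{-s} dz`. -/
def eichlerForm (f : UpperHalfPlane → ℂ) (x₀ β s : ℝ) (w : ℂ) : ℂ → ℂ →L[ℝ] ℂ :=
  holForm fun z => f (ofComplex (x₀ + z)) * branch β s (z - w)

/-- The density of the superposition obtained from `eichlerForm` on the ray of direction `α`. -/
def eichlerDensity (f : UpperHalfPlane → ℂ) (x₀ α s t : ℝ) : ℂ :=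
  f (ofComplex (x₀ + t * dir α)) * (((t ^ (-s) : ℝ) : ℂ) * dir (-(s * α)) * dir α)

theorem eichlerForm_ray {x₀ α β s : ℝ} {w : ℂ} {t : ℝ} (ht : 0 < t)
    (h : (β = α - Real.pi / 2 ∧ 0 < (w * dir (-α)).im) ∨
      (β = α + Real.pi / 2 ∧ (w * dir (-α)).im < 0)) :
    eichlerForm f x₀ β s w (t * dir α) (dir α) =
      (1 - w * rayInv α t) ^ (-(s : ℂ)) * eichlerDensity f x₀ α s t := by
  rw [eichlerForm, holForm_apply, branch_ray_sub s ht h, eichlerDensity]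
  ring

theorem IsCuspFormHalf.hasSum_add (hf : IsCuspFormHalf N m f) (x₀ : ℝ) {z : ℂ} (hz : 0 < z.im) :
    HasSum (fun n : ℕ => PowerSeries.coeff (n + 1) (UpperHalfPlane.qExpansion 1 f) *
      expTwoPi ((n + 1 : ℕ) * x₀) * expTwoPi ((n + 1 : ℕ) * z)) (f (ofComplex (x₀ + z))) := by
  have := hf.hasSum (z := x₀ + z) (by simpa using hz)
  simpa only [mul_add, expTwoPi_add, ← mul_assoc] using this

theorem IsCuspFormHalf.differentiableOn_add (hf : IsCuspFormHalf N m f) (x₀ : ℝ) :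
    DifferentiableOn ℂ (fun z => f (ofComplex (x₀ + z))) {z | 0 < z.im} :=
  hf.differentiableOn.comp (f := fun z : ℂ => (x₀ : ℂ) + z) (by fun_prop) (fun z hz => by simpa using hz)

theorem rayForm_eichlerForm (hf : IsCuspFormHalf N m f) (x₀ : ℝ) {α β : ℝ} (hα : α ∈ Ioo 0 Real.pi)
    (h : IsSide α β) (s : ℝ) (w : ℂ) :
    RayForm {z | z ∈ {z : ℂ | 0 < z.im} ∧ z - w ∈ halfPlane β} (dir α)
      (eichlerForm f x₀ β s w) := by
  have hsin := Real.sin_pos_of_mem_Ioo hα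
  refine rayForm_branch s (convex_halfSpace_im_gt 0) (isOpen_lt continuous_const continuous_im)
    (fun z hz t ht => ?_) (hf.differentiableOn_add x₀) h.re_eq_zero (norm_dir α) ?_
  · change 0 < (z + t * dir α).im
    rw [add_im, im_ofReal_mul, dir_im]
    have : 0 < z.im := hz
    positivity
  · intro P hP Q hQ
    obtain ⟨C, hC, hb⟩ := exists_norm_le_of_hasSum (fun z hz => hf.hasSum_add x₀ hz)
      (h := min P.im Q.im) (lt_min hP hQ)
    have hπ := Real.pi_pos
    refine ⟨C, 2 * Real.pi * Real.sin α, by positivity, fun z hz t ht => ?_⟩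
    have h1 := min_im_le_of_mem_segment hz
    have h0 : 0 < min P.im Q.im := lt_min hP hQ
    have him : (z + t * dir α).im = z.im + t * Real.sin α := by
      rw [add_im, im_ofReal_mul, dir_im]
    have h2 : 0 ≤ t * Real.sin α := by positivity
    refine (hb _ (by rw [him]; linarith)).trans ?_
    rw [him]
    refine mul_le_mul_of_nonneg_left (Real.exp_le_exp.2 ?_) hC.le
    nlinarith [mul_pos hπ (h0.trans_le h1)]

/-- On the ray f decays at both ends: towards x₀ by automorphy under γ, towards i∞ by its
q-expansion. The factor t^{-s} only halves the rate. -/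
theorem admissible_eichler (hf : IsCuspFormHalf N m f) (hγ : γ ∈ CongruenceSubgroup.Gamma0 N)
    (hc : γ 1 0 ≠ 0) {α : ℝ} (hα : α ∈ Ioo 0 Real.pi) (s : ℝ) :
    Admissible (volume.restrict (Ioi 0)) (rayInv α)
      (eichlerDensity f (-(γ 1 1 : ℝ) / (γ 1 0 : ℝ)) α s) := by
  have hsin := Real.sin_pos_of_mem_Ioo hα
  have hπ := Real.pi_pos
  set x₀ : ℝ := -(γ 1 1 : ℝ) / (γ 1 0 : ℝ)
  have him : ∀ t : ℝ, (t * dir α).im = t * Real.sin α := fun t => by rw [im_ofReal_mul, dir_im]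
  have hcont : ContinuousOn (fun t : ℝ => f (ofComplex (x₀ + t * dir α))) (Ioi 0) := by
    refine (hf.differentiableOn_add x₀).continuousOn.comp (by fun_prop) (fun t ht => ?_)
    change 0 < (t * dir α).im
    rw [him]
    exact mul_pos ht hsin
  obtain ⟨C₁, A₁, hC₁, hA₁, h₁⟩ := hf.exists_norm_le_sector hγ hc hsin one_pos
  obtain ⟨C₂, hC₂, h₂⟩ := exists_norm_le_of_hasSum (fun z hz => hf.hasSum_add x₀ hz) hsin
  obtain ⟨C, A, hC, hA, hb⟩ := exists_norm_le_exp_add_inv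
    (f := fun t : ℝ => f (ofComplex (x₀ + t * dir α))) hC₁.le hC₂.le hA₁
    (by positivity : 0 < 2 * Real.pi * Real.sin α)
    (fun t ht ht1 => h₁ t ht ht1 (dir α) (by rw [dir_im]) (norm_dir α).le)
    (fun t ht => by
      have := h₂ (t * dir α) (by rw [him]; nlinarith)
      rw [him] at this
      rwa [show 2 * Real.pi * Real.sin α * t = 2 * Real.pi * (t * Real.sin α) by ring])
  obtain ⟨C', hC', hx⟩ := rpow_le_mul_exp_add_inv (-s) (half_pos hA)
  refine admissible_ray (C := C * C') (half_pos hA) one_pos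
    measurable_rayInv.aestronglyMeasurable ?_ (fun t ht => by rw [norm_rayInv ht, one_mul])
    (fun t ht => ?_)
  · refine (hcont.aestronglyMeasurable measurableSet_Ioi).mul ?_
    have : Measurable fun t : ℝ => ((t ^ (-s) : ℝ) : ℂ) * dir (-(s * α)) * dir α := by fun_prop
    exact this.aestronglyMeasurable
  · rw [eichlerDensity, norm_mul, norm_mul, norm_mul, norm_dir, norm_dir, mul_one, mul_one,
      Complex.norm_real, Real.norm_of_nonneg (Real.rpow_nonneg (le_of_lt ht) _)]
    calc _ ≤ C * Real.exp (-(A * (t + t⁻¹))) * (C' * Real.exp (A / 2 * (t + t⁻¹))) := by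
          gcongr
          · exact hb t ht
          · exact hx t ht
      _ = _ := by
          rw [mul_mul_mul_comm, ← Real.exp_add]; ring_nf

/-- The absolutely convergent q-series at height Im P dominates the whole ray above it. This needs
Im P > 0 and is the reason for moving the vertex off the cusp. -/
theorem hasSum_rayIntegral_eichlerForm (hf : IsCuspFormHalf N m f) (x₀ : ℝ) {α β : ℝ}
    (hα : α ∈ Ioo 0 Real.pi) (h : IsSide α β) (s : ℝ) {w P : ℂ} (hP : 0 < P.im)
    (hPw : P - w ∈ halfPlane β) :
    HasSum (fun n : ℕ => PowerSeries.coeff (n + 1) (UpperHalfPlane.qExpansion 1 f) *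
        expTwoPi ((n + 1 : ℕ) * x₀) * (expTwoPi ((n + 1 : ℕ) * w) *
        ((((n + 1 : ℕ) : ℝ) ^ (s - 1) : ℝ) : ℂ)) *
          hankelRay α β s (((n + 1 : ℕ) : ℝ) * (P - w)))
      (rayIntegral (eichlerForm f x₀ β s w) (dir α) P) := by
  have hsin := Real.sin_pos_of_mem_Ioo hα
  have hπ := Real.pi_pos
  set a : ℕ → ℂ := fun n => PowerSeries.coeff (n + 1) (UpperHalfPlane.qExpansion 1 f) *
        expTwoPi ((n + 1 : ℕ) * x₀) with ha
  have hb : Summable fun n : ℕ => ‖a n * expTwoPi ((n + 1 : ℕ) * (P.im * I))‖ :=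
    (hf.hasSum_add x₀ (z := P.im * I) (by simpa using hP)).summable.norm
  obtain ⟨C, hC, hbr⟩ := branch_decay s h.re_eq_zero (norm_dir α) hPw hPw
    (by positivity : 0 < Real.pi * Real.sin α)
  have him : ∀ t : ℝ, (P + t * dir α).im = P.im + t * Real.sin α := fun t => by
    rw [add_im, im_ofReal_mul, dir_im]
  have hmem : ∀ t : ℝ, P + t * dir α - w ∈ halfPlane β := fun t => by
    rw [add_sub_right_comm]; exact add_mul_mem_halfPlane h.re_eq_zero hPw t
  have key := hasSum_rayIntegral (e := dir α) (P := P)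
    (W := fun n : ℕ => holForm fun z => a n * (expTwoPi (((n + 1 : ℕ) : ℝ) * z) * branch β s (z - w)))
    (V := eichlerForm f x₀ β s w)
    (b := fun n : ℕ => ‖a n * expTwoPi ((n + 1 : ℕ) * (P.im * I))‖)
    (G := fun t => C * Real.exp (-(Real.pi * Real.sin α) * t)) ?_ hb
    ((integrableOn_exp_mul_Ioi (by nlinarith) 0).const_mul C) ?_ ?_
  · convert key using 2 with n
    have := rayIntegral_expTwoPi_scale h s (r := ((n + 1 : ℕ) : ℝ)) (by positivity) hPw
    have e : ∀ (c : ℂ) (F : ℂ → ℂ), rayIntegral (holForm fun z => c * F z) (dir α) P =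
        c * rayIntegral (holForm F) (dir α) P := fun c F => by
      simp only [rayIntegral, holForm_apply, mul_assoc, integral_const_mul]
    rw [e, this, ofReal_natCast]
    ring
  · intro n
    refine ContinuousOn.aestronglyMeasurable (fun t _ => ContinuousAt.continuousWithinAt ?_)
      measurableSet_Ioi
    simp only [holForm_apply]
    have h1 : ContinuousAt (fun t : ℝ => branch β s (P + t * dir α - w)) t :=
      ContinuousAt.comp (g := branch β s) (continuousAt_branch s (Or.inl (hmem t))) (by fun_prop)
    have h2 : ContinuousAt (fun t : ℝ => expTwoPi (((n + 1 : ℕ) : ℝ) * (P + t * dir α))) t :=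
      (expTwoPi_differentiable.continuous.comp (by fun_prop)).continuousAt
    exact (continuousAt_const.mul (h2.mul h1)).mul continuousAt_const
  · intro n t ht
    have h1 := norm_expTwoPi_succ_le n (z := P + t * dir α) (h := P.im) (by
      rw [him]; have := mul_pos ht hsin; linarith)
    rw [holForm_apply, norm_mul, norm_dir, mul_one, norm_mul (a n), norm_mul (expTwoPi _),
      ofReal_natCast]
    calc _ ≤ ‖a n‖ * ((‖expTwoPi ((n + 1 : ℕ) * (P.im * I))‖ *
          Real.exp (-(2 * Real.pi * ((P + t * dir α).im - P.im)))) *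
          (C * Real.exp (Real.pi * Real.sin α * t))) := by
          gcongr
          exact hbr P (left_mem_segment ℝ P P) t ht.le
      _ = ‖a n‖ * ‖expTwoPi ((n + 1 : ℕ) * (P.im * I))‖ *
          (C * (Real.exp (-(2 * Real.pi * ((P + t * dir α).im - P.im))) *
          Real.exp (Real.pi * Real.sin α * t))) := by ring
      _ = _ := by rw [← Real.exp_add, him, norm_mul (a n)]; ring_nf
  · intro t ht
    have hz : 0 < (P + t * dir α).im := by
      rw [him]; have := mul_pos ht hsin; linarith
    have := ((hf.hasSum_add x₀ hz).mul_right (branch β s (P + t * dir α - w))).mul_right (dir α)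
    simp only [eichlerForm, holForm_apply, ofReal_natCast]
    simpa only [ha, mul_assoc] using this

theorem exists_median_eichler (hf : IsCuspFormHalf N m f)
    (hγ : γ ∈ CongruenceSubgroup.Gamma0 N) (hc : γ 1 0 ≠ 0) :
    ∃ φ : PowerSeries ℂ,
      IsAsymptoticExpansion (eichlerIntegral m f) (-(γ 1 1 : ℝ) / (γ 1 0 : ℝ)) φ ∧
      ∀ j : ℕ, 0 < j → HasMedianSum ((j : ℝ) / 2) (Real.pi / 2) φ
        (fun w : ℂ => eichlerIntegral m f
          (ofComplex (w + ((-(γ 1 1 : ℝ) / (γ 1 0 : ℝ) : ℝ) : ℂ)))) := by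
  obtain ⟨C, hC0, hC⟩ := exists_hankelSum m
  set x₀ : ℝ := -(γ 1 1 : ℝ) / (γ 1 0 : ℝ) with hx₀
  -- s = 2 - k for the weight k = m + 1/2, and C is the Hankel constant for this exponent.
  set s : ℝ := 3 / 2 - m with hs
  -- The factor 2/C normalizes the two rays together to 2g.
  refine median_of_rays (fun α w => 2 / C * ∫ t in Ioi (0 : ℝ),
    (1 - w * rayInv α t) ^ (-(s : ℂ)) * eichlerDensity f x₀ α s t) ?_ ?_
  · intro α hα j hj
    obtain ⟨φ, hφ⟩ := superpositionSummable_half m j hj _ (admissible_eichler hf hγ hc hα s)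
    refine ⟨PowerSeries.C (2 / C) * φ, fun θ hθ _ => (hφ θ ?_).const_mul _⟩
    filter_upwards [ae_restrict_mem measurableSet_Ioi] with t ht
    rw [re_rayInv_mul_dir]
    exact mul_nonpos_of_nonneg_of_nonpos (inv_nonneg.2 (le_of_lt ht)) hθ
  · intro α hα α' hα' hlt w hw hw'
    have hsin := Real.sin_pos_of_mem_Ioo hα
    have hsin' := Real.sin_pos_of_mem_Ioo hα'
    have him := im_pos_of_sector hα hα' hlt hw hw'
    have hr := neg_mem_halfPlane_right hw
    have hl := neg_mem_halfPlane_left hw'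
    -- The point w/2 is used as common vertex: it lies in the upper half-plane and in both
    -- half-planes based at w.
    have hP : (1 / 2 : ℝ) * w ∈ {z | z ∈ {z : ℂ | 0 < z.im} ∧ z - w ∈ halfPlane (α - Real.pi / 2)} ∩
        {z | z ∈ {z : ℂ | 0 < z.im} ∧ z - w ∈ halfPlane (α' + Real.pi / 2)} := by
      have : 0 < (((1 / 2 : ℝ) : ℂ) * w).im := by rw [im_ofReal_mul]; positivity
      exact ⟨⟨this, mul_sub_mem_halfPlane hr (by norm_num)⟩,
        ⟨this, mul_sub_mem_halfPlane hl (by norm_num)⟩⟩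
    have hbound : ∀ {α β : ℝ}, α ∈ Ioo 0 Real.pi → IsSide α β → -w ∈ halfPlane β →
        ∃ B : ℝ, ∀ t : ℝ, 0 < t → t < 1 / 2 → ∀ z ∈ segment ℝ ((t : ℂ) * dir α) (t * w),
          ‖eichlerForm f x₀ β s w z‖ ≤ B := by
      intro α β hα h hwβ
      obtain ⟨B₁, hB₁, hb₁⟩ := h.exists_branch_le_segment s hwβ
      obtain ⟨B₂, A, hB₂, hA, hb₂⟩ := hf.exists_norm_le_sector hγ hc
        (δ := min (dir α).im w.im) (R := ‖dir α‖ + ‖w‖)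
        (lt_min (by rw [dir_im]; exact Real.sin_pos_of_mem_Ioo hα) him)
        (by rw [norm_dir]; positivity)
      refine ⟨B₂ * B₁, fun t ht ht2 z hz => ?_⟩
      rw [eichlerForm, norm_holForm, norm_mul]
      gcongr
      · obtain ⟨ζ, hζ, rfl⟩ := exists_of_mem_segment_mul hz
        refine (hb₂ t ht (by linarith) ζ (min_im_le_of_mem_segment hζ)
          (norm_le_of_mem_segment hζ)).trans ?_
        refine mul_le_of_le_one_right hB₂.le (Real.exp_le_one_iff.2 ?_)
        have := inv_pos.2 ht
        simp only [Left.neg_nonpos_iff]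
        positivity
      · exact hb₁ t ht ht2 z hz
    obtain ⟨B, hB⟩ := hbound hα (isSide_right α) hr
    obtain ⟨B', hB'⟩ := hbound hα' (isSide_left α') hl
    have hsum := (rayForm_eichlerForm hf x₀ hα (isSide_right α) s w).zero_add_eq
      (rayForm_eichlerForm hf x₀ hα' (isSide_left α') s w)
      (fun z hz => holForm_eq_neg (by
        rw [hs, branch_overlap_sides hα hα' hlt m hz.1.2 hz.2.2, mul_neg]))
      (v := w) (r := 1 / 2) (C := max B B') (by norm_num)
      (fun t ht => ⟨by
          change 0 < (t * dir α).im
          rw [im_ofReal_mul, dir_im]; positivity,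
        mul_dir_sub_mem_halfPlane (isSide_right α) hr t⟩)
      (fun t ht => ⟨by
          change 0 < (t * dir α').im
          rw [im_ofReal_mul, dir_im]; positivity,
        mul_dir_sub_mem_halfPlane (isSide_left α') hl t⟩)
      (fun t ht ht2 => by
        have : 0 < ((t : ℂ) * w).im := by rw [im_ofReal_mul]; positivity
        exact ⟨⟨this, mul_sub_mem_halfPlane hr (by linarith)⟩,
          ⟨this, mul_sub_mem_halfPlane hl (by linarith)⟩⟩)
      (fun t ht ht2 z hz => (hB t ht ht2 z hz).trans (le_max_left _ _))
      (fun t ht ht2 z hz => (hB' t ht ht2 z hz).trans (le_max_right _ _)) hP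
    have e1 : ∫ t in Ioi (0 : ℝ), eichlerForm f x₀ (α - Real.pi / 2) s w (t * dir α) (dir α) =
        ∫ t in Ioi (0 : ℝ), (1 - w * rayInv α t) ^ (-(s : ℂ)) * eichlerDensity f x₀ α s t :=
      setIntegral_congr_fun measurableSet_Ioi fun t ht => eichlerForm_ray ht (Or.inl ⟨rfl, hw⟩)
    have e2 : ∫ t in Ioi (0 : ℝ), eichlerForm f x₀ (α' + Real.pi / 2) s w (t * dir α') (dir α') =
        ∫ t in Ioi (0 : ℝ), (1 - w * rayInv α' t) ^ (-(s : ℂ)) * eichlerDensity f x₀ α' s t :=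
      setIntegral_congr_fun measurableSet_Ioi fun t ht => eichlerForm_ray ht (Or.inr ⟨rfl, hw'⟩)
    rw [e1, e2] at hsum
    have hS := (hasSum_rayIntegral_eichlerForm hf x₀ hα (isSide_right α) s hP.1.1 hP.1.2).add
      (hasSum_rayIntegral_eichlerForm hf x₀ hα' (isSide_left α') s hP.2.1 hP.2.2)
    have hz : 0 < (w + (x₀ : ℂ)).im := by simpa using him
    -- In each q-term the two ray contributions share their prefactor and add up to the full Hankel
    -- constant C.
    have hterm : ∀ n : ℕ, PowerSeries.coeff (n + 1) (UpperHalfPlane.qExpansion 1 f) *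
          ((n + 1 : ℕ) : ℂ) ^ ((1 : ℂ) - ((m : ℂ) + 1 / 2)) *
          Complex.exp (2 * Real.pi * I * ((n + 1 : ℕ) : ℂ) * (w + (x₀ : ℂ))) * C =
        PowerSeries.coeff (n + 1) (UpperHalfPlane.qExpansion 1 f) *
        expTwoPi ((n + 1 : ℕ) * x₀) * (expTwoPi ((n + 1 : ℕ) * w) *
        ((((n + 1 : ℕ) : ℝ) ^ (s - 1) : ℝ) : ℂ)) *
          hankelRay α (α - Real.pi / 2) s (((n + 1 : ℕ) : ℝ) * ((1 / 2 : ℝ) * w - w)) +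
        PowerSeries.coeff (n + 1) (UpperHalfPlane.qExpansion 1 f) *
        expTwoPi ((n + 1 : ℕ) * x₀) * (expTwoPi ((n + 1 : ℕ) * w) *
        ((((n + 1 : ℕ) : ℝ) ^ (s - 1) : ℝ) : ℂ)) *
          hankelRay α' (α' + Real.pi / 2) s (((n + 1 : ℕ) : ℝ) * ((1 / 2 : ℝ) * w - w)) := by
      intro n
      have hn : (0 : ℝ) < ((n + 1 : ℕ) : ℝ) := by positivity
      have h1 := hC α hα α' hα' hlt (((n + 1 : ℕ) : ℝ) * ((1 / 2 : ℝ) * w - w))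
        (smul_mem_halfPlane hn hP.1.2) (smul_mem_halfPlane hn hP.2.2)
      rw [hankelSum] at h1
      have h2 : ((n + 1 : ℕ) : ℂ) ^ ((1 : ℂ) - ((m : ℂ) + 1 / 2)) =
          ((((n + 1 : ℕ) : ℝ) ^ (s - 1) : ℝ) : ℂ) := by
        rw [ofReal_cpow hn.le, hs]
        push_cast
        ring_nf
      have h3 : Complex.exp (2 * Real.pi * I * ((n + 1 : ℕ) : ℂ) * (w + (x₀ : ℂ))) =
          expTwoPi ((n + 1 : ℕ) * x₀) * expTwoPi ((n + 1 : ℕ) * w) := by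
        rw [← expTwoPi_add, expTwoPi]; ring_nf
      rw [← mul_add, h1, h2, h3]
      ring
    have hS' : HasSum (fun n : ℕ => PowerSeries.coeff (n + 1) (UpperHalfPlane.qExpansion 1 f) *
          ((n + 1 : ℕ) : ℂ) ^ ((1 : ℂ) - ((m : ℂ) + 1 / 2)) *
          Complex.exp (2 * Real.pi * I * ((n + 1 : ℕ) : ℂ) * (w + (x₀ : ℂ))) * C)
        (rayIntegral (eichlerForm f x₀ (α - Real.pi / 2) s w) (dir α) ((1 / 2 : ℝ) * w) +
          rayIntegral (eichlerForm f x₀ (α' + Real.pi / 2) s w) (dir α') ((1 / 2 : ℝ) * w)) := by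
      simp_rw [hterm]
      exact hS
    have hg := hS'.tsum_eq
    rw [tsum_mul_right, ← hsum] at hg
    have hcancel : ∀ S : ℂ, 2 / C * (S * C) = 2 * S := fun S => by field_simp
    rw [eichlerIntegral, UpperHalfPlane.ofComplex_apply_of_im_pos hz, ← mul_add, ← hg, hcancel]

end Eichler

end MedianResum

namespace MedianResum

/-! ### The Bessel function `K₀` -/

/-- The moments `∫_0^∞ cosh^j t e^{-x cosh t} dt`. -/
def besselMoment (j : ℕ) (x : ℝ) : ℝ :=
  ∫ t in Ioi (0 : ℝ), Real.cosh t ^ j * Real.exp (-x * Real.cosh t)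

theorem besselMoment_zero (x : ℝ) : besselMoment 0 x = besselKZero x := by
  simp [besselMoment, besselKZero]

theorem one_add_sq_div_two_le_cosh (t : ℝ) : 1 + t ^ 2 / 2 ≤ Real.cosh t := by
  have h1 : Real.cosh t = 1 + 2 * Real.sinh (t / 2) ^ 2 := by
    have := Real.cosh_two_mul (t / 2)
    rw [show 2 * (t / 2) = t by ring, Real.cosh_sq] at this
    linarith
  have h2 : (t / 2) ^ 2 ≤ Real.sinh (t / 2) ^ 2 := by
    rw [sq_le_sq]
    rcases le_total 0 (t / 2) with h | h
    · rw [abs_of_nonneg h, abs_of_nonneg (Real.sinh_nonneg_iff.2 h)]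
      exact Real.self_le_sinh_iff.2 h
    · rw [abs_of_nonpos h, abs_of_nonpos (Real.sinh_nonpos_iff.2 h)]
      exact neg_le_neg (Real.sinh_le_self_iff.2 h)
  rw [h1]
  linarith

theorem le_cosh (t : ℝ) : t ≤ Real.cosh t := by
  nlinarith [one_add_sq_div_two_le_cosh t, sq_nonneg (t - 1)]

theorem cosh_pow_mul_exp_le (j : ℕ) {x : ℝ} (hx : 0 < x) :
    ∃ C : ℝ, 0 < C ∧ ∀ t : ℝ, Real.cosh t ^ j * Real.exp (-x * Real.cosh t) ≤
      C * Real.exp (-(x / 2) * Real.cosh t) := by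
  obtain ⟨C, hC, h⟩ := rpow_le_mul_exp j one_pos (half_pos hx)
  refine ⟨C, hC, fun t => ?_⟩
  have h1 := h _ (Real.one_le_cosh t)
  rw [Real.rpow_natCast] at h1
  calc _ ≤ C * Real.exp (x / 2 * Real.cosh t) * Real.exp (-x * Real.cosh t) := by gcongr
    _ = _ := by rw [mul_assoc, ← Real.exp_add]; ring_nf

theorem integrableOn_besselMoment (j : ℕ) {x : ℝ} (hx : 0 < x) :
    IntegrableOn (fun t : ℝ => Real.cosh t ^ j * Real.exp (-x * Real.cosh t)) (Ioi 0) := by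
  obtain ⟨C, hC, h⟩ := cosh_pow_mul_exp_le j hx
  have hi := (integrableOn_exp_mul_Ioi (a := -(x / 2)) (by linarith) 0).const_mul C
  refine Integrable.mono' hi (by fun_prop) ?_
  filter_upwards with t
  rw [Real.norm_of_nonneg (by positivity)]
  refine (h t).trans ?_
  gcongr C * Real.exp ?_
  have := le_cosh t
  nlinarith

theorem besselMoment_pos (j : ℕ) {x : ℝ} (hx : 0 < x) : 0 < besselMoment j x := by
  refine (setIntegral_pos_iff_support_of_nonneg_ae ?_ (integrableOn_besselMoment j hx)).2 ?_
  · exact Eventually.of_forall fun t => by simp only [Pi.zero_apply]; positivity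
  · have : Function.support (fun t : ℝ => Real.cosh t ^ j * Real.exp (-x * Real.cosh t)) = univ := by
      ext t
      simp only [Function.mem_support, mem_univ, iff_true]
      positivity
    rw [this, univ_inter, Real.volume_Ioi]
    exact ENNReal.zero_lt_top

theorem besselMoment_hasDerivAt (j : ℕ) {x : ℝ} (hx : 0 < x) :
    HasDerivAt (besselMoment j) (-besselMoment (j + 1) x) x := by
  have key := (hasDerivAt_integral_of_dominated_loc_of_deriv_le (μ := volume.restrict (Ioi 0))
    (F := fun x t => Real.cosh t ^ j * Real.exp (-x * Real.cosh t))
    (F' := fun x t => -(Real.cosh t ^ (j + 1) * Real.exp (-x * Real.cosh t)))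
    (bound := fun t => Real.cosh t ^ (j + 1) * Real.exp (-(x / 2) * Real.cosh t))
    (x₀ := x) (s := Ioi (x / 2)) (Ioi_mem_nhds (by linarith)) ?_
    (integrableOn_besselMoment j hx) ?_ ?_
    (integrableOn_besselMoment (j + 1) (half_pos hx)) ?_).2
  · rw [integral_neg] at key
    exact key
  · exact Eventually.of_forall fun y => by fun_prop
  · fun_prop
  · filter_upwards with t y hy
    have hy' : x / 2 < y := hy
    rw [norm_neg, Real.norm_of_nonneg (by positivity)]
    have := Real.cosh_pos t
    gcongr
  · filter_upwards with t y hy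
    have h1 : HasDerivAt (fun y : ℝ => Real.exp (-y * Real.cosh t))
        (Real.exp (-y * Real.cosh t) * (-1 * Real.cosh t)) y :=
      ((hasDerivAt_id y).neg.mul_const _).exp
    refine (h1.const_mul (Real.cosh t ^ j)).congr_deriv ?_
    ring

theorem besselMoment_le (j : ℕ) {x x' : ℝ} (hx' : 0 < x') (h : x' ≤ x) :
    besselMoment j x ≤ Real.exp (-(x - x')) * besselMoment j x' := by
  rw [besselMoment, besselMoment, ← integral_const_mul]
  refine setIntegral_mono (integrableOn_besselMoment j (hx'.trans_le h))
    ((integrableOn_besselMoment j hx').const_mul _) fun t => ?_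
  simp only
  rw [mul_left_comm, ← Real.exp_add]
  have := Real.one_le_cosh t
  gcongr
  nlinarith

/-- cosh t ≤ δ⁻¹ e^{δ cosh t} trades the factor cosh for a small decrease of x. -/
theorem besselMoment_one_le {x δ : ℝ} (hδ : 0 < δ) (h : δ < x) :
    besselMoment 1 x ≤ δ⁻¹ * besselMoment 0 (x - δ) := by
  rw [besselMoment, besselMoment, ← integral_const_mul]
  refine setIntegral_mono (integrableOn_besselMoment 1 (hδ.trans h))
    ((integrableOn_besselMoment 0 (sub_pos.2 h)).const_mul _) fun t => ?_
  simp only [pow_one, pow_zero, one_mul]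
  have h1 : δ * Real.cosh t ≤ Real.exp (δ * Real.cosh t) := by
    linarith [Real.add_one_le_exp (δ * Real.cosh t)]
  have h2 : Real.exp (-(x - δ) * Real.cosh t) =
      Real.exp (δ * Real.cosh t) * Real.exp (-x * Real.cosh t) := by
    rw [← Real.exp_add]; ring_nf
  rw [h2, inv_mul_eq_div, le_div_iff₀ hδ]
  calc _ = δ * Real.cosh t * Real.exp (-x * Real.cosh t) := by ring
    _ ≤ _ := by gcongr

/-- The Bessel differential equation. -/
theorem besselMoment_two {x : ℝ} (hx : 0 < x) :
    x * besselMoment 2 x = x * besselMoment 0 x + besselMoment 1 x := by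
  have i0 := integrableOn_besselMoment 0 hx
  have i1 := integrableOn_besselMoment 1 hx
  have i2 := integrableOn_besselMoment 2 hx
  -- Integrating this total derivative, with sinh² = cosh² - 1, gives the equation; the boundary
  -- terms vanish at 0 and at infinity.
  have hd : ∀ t : ℝ, HasDerivAt (fun t => Real.sinh t * Real.exp (-x * Real.cosh t))
      (Real.cosh t ^ 1 * Real.exp (-x * Real.cosh t) -
        x * (Real.cosh t ^ 2 * Real.exp (-x * Real.cosh t) -
          Real.cosh t ^ 0 * Real.exp (-x * Real.cosh t))) t := by
    intro t
    have h1 := (Real.hasDerivAt_sinh t).mul (((Real.hasDerivAt_cosh t).const_mul (-x)).exp)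
    refine h1.congr_deriv ?_
    linear_combination (-x * Real.exp (-x * Real.cosh t)) * Real.sinh_sq t
  have hlim : Tendsto (fun t => Real.sinh t * Real.exp (-x * Real.cosh t)) atTop (𝓝 0) := by
    obtain ⟨C, hC, h⟩ := cosh_pow_mul_exp_le 1 hx
    refine squeeze_zero_norm' (a := fun t => C * Real.exp (-(x / 2 * t))) ?_ ?_
    · filter_upwards [eventually_ge_atTop 0] with t ht
      rw [Real.norm_of_nonneg (mul_nonneg (Real.sinh_nonneg_iff.2 ht) (Real.exp_pos _).le)]
      calc _ ≤ Real.cosh t ^ 1 * Real.exp (-x * Real.cosh t) := by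
            rw [pow_one]
            gcongr
            exact (Real.sinh_lt_cosh t).le
        _ ≤ _ := h t
        _ ≤ _ := by
            gcongr
            have := le_cosh t
            nlinarith
    · simpa using (Real.tendsto_exp_neg_atTop_nhds_zero.comp
        (tendsto_id.const_mul_atTop (half_pos hx))).const_mul C
  have i20 : IntegrableOn (fun t : ℝ => Real.cosh t ^ 2 * Real.exp (-x * Real.cosh t) -
      Real.cosh t ^ 0 * Real.exp (-x * Real.cosh t)) (Ioi 0) := i2.sub i0
  have key := integral_Ioi_of_hasDerivAt_of_tendsto (a := 0)
    (hd 0).continuousAt.continuousWithinAt (fun t _ => hd t) (i1.sub (i20.const_mul x)) hlim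
  rw [integral_sub i1 (i20.const_mul x), integral_const_mul, integral_sub i2 i0] at key
  simp only [Real.sinh_zero, zero_mul, sub_zero] at key
  simp only [besselMoment]
  linarith

/-- cosh u - 1 = 2 sinh²(u/2) with u = s/√x, and sinh has derivative 1 at 0. -/
theorem tendsto_mul_cosh_sub_one (s : ℝ) :
    Tendsto (fun x : ℝ => x * (Real.cosh (s / √x) - 1)) atTop (𝓝 (s ^ 2 / 2)) := by
  have hs : Tendsto (fun x : ℝ => √x) atTop atTop := Real.tendsto_sqrt_atTop
  have h1 : Tendsto (fun r : ℝ => r * Real.sinh (s / 2 * r⁻¹)) atTop (𝓝 (s / 2)) := by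
    have hd : HasDerivAt (fun h : ℝ => Real.sinh (s / 2 * h)) (s / 2) 0 := by
      have := ((hasDerivAt_id (0 : ℝ)).const_mul (s / 2)).sinh
      simpa using this
    have h2 := hd.tendsto_slope_zero_right.comp tendsto_inv_atTop_nhdsGT_zero
    refine h2.congr fun r => ?_
    simp
  have h2 := ((h1.comp hs).pow 2).const_mul 2
  have e : 2 * (s / 2) ^ 2 = s ^ 2 / 2 := by ring
  rw [e] at h2
  refine h2.congr' ?_
  filter_upwards [eventually_gt_atTop 0] with x hx
  have h3 := Real.cosh_two_mul (s / √x / 2)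
  rw [show 2 * (s / √x / 2) = s / √x by ring, Real.cosh_sq] at h3
  simp only [Function.comp_apply]
  rw [mul_pow, Real.sq_sqrt hx.le, h3, show s / 2 * (√x)⁻¹ = s / √x / 2 by ring]
  ring

/-- Laplace's method: after t = s/√x the integrand tends to the Gaussian e^{-s²/2}, whose integral
over the half-line is √(π/2). For j ≤ 1 the factor cosh^j is at most e^s, which the Gaussian
absorbs. -/
theorem tendsto_besselMoment (j : ℕ) (hj : j ≤ 1) :
    Tendsto (fun x : ℝ => √x * Real.exp x * besselMoment j x) atTop (𝓝 √(Real.pi / 2)) := by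
  have hG : ∫ s : ℝ in Ioi 0, Real.exp (-(s ^ 2 / 2)) = √(Real.pi / 2) := by
    have := integral_gaussian_Ioi (1 / 2)
    rw [show (fun s : ℝ => Real.exp (-(s ^ 2 / 2))) = fun s => Real.exp (-(1 / 2) * s ^ 2) by
      ext s; ring_nf, this]
    rw [show Real.pi / (1 / 2) = 2 ^ 2 * (Real.pi / 2) by ring, Real.sqrt_mul (by norm_num),
      Real.sqrt_sq (by norm_num)]
    ring
  have hscale : ∀ x : ℝ, 0 < x → √x * Real.exp x * besselMoment j x =
      ∫ s : ℝ in Ioi 0, Real.cosh (s / √x) ^ j * Real.exp (-(x * (Real.cosh (s / √x) - 1))) := by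
    intro x hx
    have hr : 0 < (√x)⁻¹ := inv_pos.2 (Real.sqrt_pos.2 hx)
    have := integral_comp_mul_left_Ioi (fun t : ℝ => Real.exp x *
      (Real.cosh t ^ j * Real.exp (-x * Real.cosh t))) 0 hr
    rw [mul_zero, inv_inv, smul_eq_mul, integral_const_mul, integral_const_mul] at this
    rw [besselMoment, mul_assoc, ← this, ← integral_const_mul]
    refine integral_congr_ae (Eventually.of_forall fun s => ?_)
    simp only
    rw [mul_left_comm, ← Real.exp_add, mul_comm (√x)⁻¹, ← div_eq_mul_inv]
    ring_nf
  have hlim : Tendsto (fun x : ℝ => ∫ s : ℝ in Ioi 0,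
      Real.cosh (s / √x) ^ j * Real.exp (-(x * (Real.cosh (s / √x) - 1)))) atTop
      (𝓝 (∫ s : ℝ in Ioi 0, Real.exp (-(s ^ 2 / 2)))) := by
    refine tendsto_integral_filter_of_dominated_convergence
      (fun s => Real.exp 1 * Real.exp (-(1 / 4) * s ^ 2)) ?_ ?_ ?_ ?_
    · exact Eventually.of_forall fun x => by fun_prop
    · filter_upwards [eventually_ge_atTop 1] with x hx
      filter_upwards [ae_restrict_mem measurableSet_Ioi] with s hs
      have hs0 : 0 < s := hs
      have hx0 : 0 < x := by linarith
      have hsx : s / √x ≤ s := div_le_self hs0.le (Real.one_le_sqrt.2 hx)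
      have hsx0 : 0 < s / √x := div_pos hs0 (Real.sqrt_pos.2 hx0)
      rw [Real.norm_of_nonneg (by positivity), ← Real.exp_add]
      have h1 : Real.cosh (s / √x) ^ j ≤ Real.exp s := by
        have hc : Real.cosh (s / √x) ≤ Real.exp s := by
          calc _ ≤ Real.exp (s / √x) := by
                rw [Real.cosh_eq]
                have : Real.exp (-(s / √x)) ≤ Real.exp (s / √x) :=
                  Real.exp_le_exp.2 (by linarith)
                linarith
            _ ≤ _ := Real.exp_le_exp.2 hsx
        interval_cases j
        · simpa using Real.one_le_exp hs0.le
        · simpa using hc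
      have h2 : s ^ 2 / 2 ≤ x * (Real.cosh (s / √x) - 1) := by
        have h3 := one_add_sq_div_two_le_cosh (s / √x)
        have h4 : x * ((s / √x) ^ 2 / 2) = s ^ 2 / 2 := by
          rw [div_pow, Real.sq_sqrt hx0.le]; field_simp
        rw [← h4]
        gcongr
        linarith
      calc _ ≤ Real.exp s * Real.exp (-(s ^ 2 / 2)) := by gcongr
        _ = Real.exp (s + -(s ^ 2 / 2)) := (Real.exp_add _ _).symm
        _ ≤ _ := by
            refine Real.exp_le_exp.2 ?_
            nlinarith [sq_nonneg (s / 2 - 1)]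
    · exact ((integrable_exp_neg_mul_sq (by norm_num : (0 : ℝ) < 1 / 4)).const_mul _).integrableOn
    · filter_upwards with s
      have h1 : Tendsto (fun x : ℝ => Real.cosh (s / √x) ^ j) atTop (𝓝 1) := by
        have h2 : Tendsto (fun x : ℝ => s / √x) atTop (𝓝 0) :=
          Real.tendsto_sqrt_atTop.const_div_atTop s
        have h3 := (Real.continuous_cosh.tendsto 0).comp h2
        rw [Real.cosh_zero] at h3
        simpa using h3.pow j
      have h2 := (Real.continuous_exp.tendsto _).comp (tendsto_mul_cosh_sub_one s).neg
      simpa using h1.mul h2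
  rw [hG] at hlim
  refine hlim.congr' ?_
  filter_upwards [eventually_gt_atTop 0] with x hx
  exact (hscale x hx).symm

end MedianResum

namespace MedianResum

/-! ### The vertical parts `√y K₀(2πνy)` of the Fourier modes -/

/-- `√y K₀(2πνy)`. -/
def waveK (ν y : ℝ) : ℝ := √y * besselMoment 0 (2 * Real.pi * ν * y)

/-- The derivative of `waveK ν`. -/
def waveK' (ν y : ℝ) : ℝ :=
  1 / (2 * √y) * besselMoment 0 (2 * Real.pi * ν * y) -
    √y * (2 * Real.pi * ν * besselMoment 1 (2 * Real.pi * ν * y))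

theorem waveK_pos {ν y : ℝ} (hν : 0 < ν) (hy : 0 < y) : 0 < waveK ν y := by
  have := besselMoment_pos 0 (x := 2 * Real.pi * ν * y) (by positivity)
  exact mul_pos (Real.sqrt_pos.2 hy) this

theorem besselMoment_comp_hasDerivAt (j : ℕ) {ν y : ℝ} (hν : 0 < ν) (hy : 0 < y) :
    HasDerivAt (fun y => besselMoment j (2 * Real.pi * ν * y))
      (-(2 * Real.pi * ν * besselMoment (j + 1) (2 * Real.pi * ν * y))) y := by
  have h := (besselMoment_hasDerivAt j (x := 2 * Real.pi * ν * y) (by positivity)).comp y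
    ((hasDerivAt_id y).const_mul (2 * Real.pi * ν))
  refine h.congr_deriv ?_
  ring

theorem waveK_hasDerivAt {ν y : ℝ} (hν : 0 < ν) (hy : 0 < y) :
    HasDerivAt (waveK ν) (waveK' ν y) y := by
  refine ((Real.hasDerivAt_sqrt hy.ne').mul (besselMoment_comp_hasDerivAt 0 hν hy)).congr_deriv ?_
  rw [waveK']
  ring

/-- Bessel's equation in the form satisfied by √y K₀(2πνy); the factor √y removes the first-order
term and produces -1/(4y²). -/
theorem waveK'_hasDerivAt {ν y : ℝ} (hν : 0 < ν) (hy : 0 < y) :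
    HasDerivAt (waveK' ν) ((4 * Real.pi ^ 2 * ν ^ 2 - 1 / (4 * y ^ 2)) * waveK ν y) y := by
  have hs := Real.hasDerivAt_sqrt hy.ne'
  have hs0 : 0 < √y := Real.sqrt_pos.2 hy
  have h1 : HasDerivAt (fun y : ℝ => 1 / (2 * √y)) (-1 / (4 * √y ^ 3)) y := by
    have := (hs.const_mul 2).inv (by positivity)
    simp only [one_div]
    refine this.congr_deriv ?_
    field_simp
    ring
  have h2 := (h1.mul (besselMoment_comp_hasDerivAt 0 hν hy)).sub
    (hs.mul ((besselMoment_comp_hasDerivAt 1 hν hy).const_mul (2 * Real.pi * ν)))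
  refine h2.congr_deriv ?_
  have hb := besselMoment_two (x := 2 * Real.pi * ν * y) (by positivity)
  have hy2 : y = √y ^ 2 := (Real.sq_sqrt hy.le).symm
  rw [waveK]
  set r := √y
  set K0 := besselMoment 0 (2 * Real.pi * ν * y)
  set K1 := besselMoment 1 (2 * Real.pi * ν * y)
  set K2 := besselMoment 2 (2 * Real.pi * ν * y)
  rw [hy2] at hb ⊢
  field_simp
  linear_combination (8 * Real.pi * ν * r ^ 2) * hb

theorem waveK_scale {ν y : ℝ} (hν : 0 < ν) : waveK ν y = (√ν)⁻¹ * waveK 1 (ν * y) := by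
  have : √ν ≠ 0 := (Real.sqrt_pos.2 hν).ne'
  rw [waveK, waveK, Real.sqrt_mul hν.le]
  field_simp

theorem waveK'_scale {ν y : ℝ} (hν : 0 < ν) : waveK' ν y = √ν * waveK' 1 (ν * y) := by
  have h1 : √ν ≠ 0 := (Real.sqrt_pos.2 hν).ne'
  have h2 : √ν * √ν = ν := Real.mul_self_sqrt hν.le
  rw [waveK', waveK', Real.sqrt_mul hν.le, show 2 * Real.pi * 1 * (ν * y) = 2 * Real.pi * ν * y by
    ring, mul_sub]
  congr 1
  · field_simp
  · linear_combination (-√y * 2 * Real.pi * besselMoment 1 (2 * Real.pi * ν * y)) * h2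

theorem exp_mul_besselMoment_tendsto (j : ℕ) (hj : j ≤ 1) :
    Tendsto (fun y : ℝ => √y * Real.exp (2 * Real.pi * y) * besselMoment j (2 * Real.pi * y)) atTop
      (𝓝 (1 / 2)) := by
  have hπ := Real.pi_pos
  have h1 := ((tendsto_besselMoment j hj).comp
    (tendsto_id.const_mul_atTop (by positivity : 0 < 2 * Real.pi))).const_mul (√(2 * Real.pi))⁻¹
  have e : (√(2 * Real.pi))⁻¹ * √(Real.pi / 2) = 1 / 2 := by
    rw [← Real.sqrt_inv, ← Real.sqrt_mul (by positivity),
      show (2 * Real.pi)⁻¹ * (Real.pi / 2) = (1 / 2) ^ 2 by field_simp,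
      Real.sqrt_sq (by norm_num)]
  rw [e] at h1
  refine h1.congr fun y => ?_
  simp only [Function.comp_apply, id]
  have : √(2 * Real.pi) ≠ 0 := (Real.sqrt_pos.2 (by positivity)).ne'
  rw [Real.sqrt_mul (by positivity : 0 ≤ 2 * Real.pi) y]
  generalize √(2 * Real.pi) = r at this
  field_simp

theorem exp_mul_waveK_tendsto :
    Tendsto (fun y : ℝ => Real.exp (2 * Real.pi * y) * waveK 1 y) atTop (𝓝 (1 / 2)) := by
  refine (exp_mul_besselMoment_tendsto 0 (by norm_num)).congr fun y => ?_
  rw [waveK, mul_one]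
  ring

theorem exp_mul_waveK'_tendsto :
    Tendsto (fun y : ℝ => Real.exp (2 * Real.pi * y) * waveK' 1 y) atTop (𝓝 (-Real.pi)) := by
  have h0 := exp_mul_besselMoment_tendsto 0 (by norm_num)
  have h1 := exp_mul_besselMoment_tendsto 1 (by norm_num)
  have h2 : Tendsto (fun y : ℝ => 1 / 2 * y⁻¹) atTop (𝓝 0) := by
    simpa using tendsto_inv_atTop_zero.const_mul (1 / 2 : ℝ)
  have h3 := (h2.mul h0).sub (h1.const_mul (2 * Real.pi))
  rw [show (0 : ℝ) * (1 / 2) - 2 * Real.pi * (1 / 2) = -Real.pi by ring] at h3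
  refine h3.congr' ?_
  filter_upwards [eventually_gt_atTop 0] with y hy
  have hs : √y ≠ 0 := (Real.sqrt_pos.2 hy).ne'
  have hy2 : y⁻¹ = (√y)⁻¹ * (√y)⁻¹ := by rw [← mul_inv, Real.mul_self_sqrt hy.le]
  rw [waveK', mul_one, hy2]
  field_simp

/-- Uniform exponential decay of the modes in terms of their values at a lower height. -/
theorem exists_waveK_le {h : ℝ} (hh : 0 < h) : ∃ C : ℝ, 0 < C ∧ ∀ ν y : ℝ, 1 ≤ ν → h ≤ y →
    waveK ν y ≤ C * waveK ν (h / 2) * Real.exp (-(ν * y)) ∧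
    ν * waveK ν y ≤ C * waveK ν (h / 2) * Real.exp (-(ν * y)) ∧
    |waveK' ν y| ≤ C * waveK ν (h / 2) * Real.exp (-(ν * y)) := by
  have hπ := Real.pi_gt_three
  obtain ⟨C₁, hC₁, hx₁⟩ := rpow_le_mul_exp (1 / 2) hh (by norm_num : (0 : ℝ) < 1 / 4)
  set B : ℝ := 4 / h * C₁ * (√(h / 2))⁻¹ with hB
  have hs : 0 < √(h / 2) := Real.sqrt_pos.2 (half_pos hh)
  have hB0 : 0 < B := by positivity
  -- The intermediate height y - h/4 leaves a margin used below to bound the first moment by the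
  -- zeroth. Since y - 3h/4 ≥ y/4 and 2π > 6, the comparison with height h/2 gives the rate 3/2; a
  -- quarter pays for √y and another quarter for the factor ν.
  have key : ∀ ν y : ℝ, 1 ≤ ν → h ≤ y → 0 ≤ besselMoment 0 (2 * Real.pi * ν * (y - h / 4)) ∧
      √y * besselMoment 0 (2 * Real.pi * ν * (y - h / 4)) ≤
        C₁ * (√(h / 2))⁻¹ * waveK ν (h / 2) * Real.exp (-(5 / 4 * (ν * y))) ∧
      √y * ν * besselMoment 0 (2 * Real.pi * ν * y) ≤
        B * waveK ν (h / 2) * Real.exp (-(ν * y)) ∧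
      besselMoment 0 (2 * Real.pi * ν * y) ≤ besselMoment 0 (2 * Real.pi * ν * (y - h / 4)) := by
    intro ν y hν hy
    have hy0 : 0 < y := hh.trans_le hy
    have hν0 : 0 < ν := by linarith
    have hνy : 0 < ν * y := by positivity
    have hνh : ν * h ≤ ν * y := by gcongr
    have hνh0 : 0 < ν * h := by positivity
    have hsq : √y ≤ C₁ * Real.exp (1 / 4 * (ν * y)) := by
      have := hx₁ y hy
      rw [← Real.sqrt_eq_rpow] at this
      refine this.trans ?_
      gcongr
      nlinarith
    have hW : besselMoment 0 (2 * Real.pi * ν * (h / 2)) = (√(h / 2))⁻¹ * waveK ν (h / 2) := by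
      rw [waveK]; field_simp
    have hW0 : 0 < waveK ν (h / 2) := waveK_pos hν0 (half_pos hh)
    have hm := besselMoment_le 0 (x := 2 * Real.pi * ν * (y - h / 4))
      (x' := 2 * Real.pi * ν * (h / 2)) (by positivity) (by gcongr; linarith)
    have hm' := besselMoment_le 0 (x := 2 * Real.pi * ν * y)
      (x' := 2 * Real.pi * ν * (y - h / 4)) (by
        have : 0 < y - h / 4 := by linarith
        positivity) (by gcongr; linarith)
    have hp := besselMoment_pos 0 (x := 2 * Real.pi * ν * (y - h / 4)) (by
        have : 0 < y - h / 4 := by linarith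
        positivity)
    have hle : besselMoment 0 (2 * Real.pi * ν * y) ≤
        besselMoment 0 (2 * Real.pi * ν * (y - h / 4)) := by
      refine hm'.trans (mul_le_of_le_one_left hp.le (Real.exp_le_one_iff.2 ?_))
      nlinarith
    have h2 : √y * besselMoment 0 (2 * Real.pi * ν * (y - h / 4)) ≤
        C₁ * (√(h / 2))⁻¹ * waveK ν (h / 2) * Real.exp (-(5 / 4 * (ν * y))) := by
      calc _ ≤ (C₁ * Real.exp (1 / 4 * (ν * y))) *
            (Real.exp (-(2 * Real.pi * ν * (y - h / 4) - 2 * Real.pi * ν * (h / 2))) *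
              ((√(h / 2))⁻¹ * waveK ν (h / 2))) := by rw [← hW]; gcongr
        _ = C₁ * (√(h / 2))⁻¹ * waveK ν (h / 2) * (Real.exp (1 / 4 * (ν * y)) *
            Real.exp (-(2 * Real.pi * ν * (y - h / 4) - 2 * Real.pi * ν * (h / 2)))) := by ring
        _ ≤ _ := by
            rw [← Real.exp_add]
            gcongr
            nlinarith
    refine ⟨hp.le, h2, ?_, hle⟩
    have h3 : ν ≤ 4 / h * Real.exp (1 / 4 * (ν * y)) := by
      have := Real.add_one_le_exp (1 / 4 * (ν * y))
      rw [div_mul_eq_mul_div, le_div_iff₀ hh]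
      linarith
    calc √y * ν * besselMoment 0 (2 * Real.pi * ν * y)
        ≤ √y * ν * besselMoment 0 (2 * Real.pi * ν * (y - h / 4)) := by gcongr
      _ = ν * (√y * besselMoment 0 (2 * Real.pi * ν * (y - h / 4))) := by ring
      _ ≤ 4 / h * Real.exp (1 / 4 * (ν * y)) * (C₁ * (√(h / 2))⁻¹ * waveK ν (h / 2) *
            Real.exp (-(5 / 4 * (ν * y)))) := by gcongr
      _ = B * waveK ν (h / 2) * (Real.exp (1 / 4 * (ν * y)) * Real.exp (-(5 / 4 * (ν * y)))) := by
            rw [hB]; ring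
      _ = _ := by rw [← Real.exp_add]; ring_nf
  refine ⟨B + 1 / (2 * h) * (C₁ * (√(h / 2))⁻¹) + 4 / h * (C₁ * (√(h / 2))⁻¹), by positivity,
    fun ν y hν hy => ?_⟩
  obtain ⟨k1, k2, k3, k4⟩ := key ν y hν hy
  have hy0 : 0 < y := hh.trans_le hy
  have hν0 : 0 < ν := by linarith
  have hW0 : 0 < waveK ν (h / 2) := waveK_pos hν0 (half_pos hh)
  have hνk : ν * waveK ν y ≤ B * waveK ν (h / 2) * Real.exp (-(ν * y)) := by
    rw [waveK]; linarith
  have hk0 := waveK_pos hν0 hy0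
  have hE : 0 < waveK ν (h / 2) * Real.exp (-(ν * y)) := by positivity
  have hle : B * waveK ν (h / 2) * Real.exp (-(ν * y)) ≤
      (B + 1 / (2 * h) * (C₁ * (√(h / 2))⁻¹) + 4 / h * (C₁ * (√(h / 2))⁻¹)) *
        waveK ν (h / 2) * Real.exp (-(ν * y)) := by
    gcongr
    rw [add_assoc]
    exact le_add_of_nonneg_right (by positivity)
  refine ⟨?_, hνk.trans hle, ?_⟩
  · refine le_trans ?_ (hνk.trans hle)
    exact le_mul_of_one_le_left hk0.le hν
  · have hsy : 0 < √y := Real.sqrt_pos.2 hy0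
    have hexp : Real.exp (-(5 / 4 * (ν * y))) ≤ Real.exp (-(ν * y)) := by
      refine Real.exp_le_exp.2 ?_
      have : 0 < ν * y := by positivity
      linarith
    have k5 : √y * besselMoment 0 (2 * Real.pi * ν * (y - h / 4)) ≤
        C₁ * (√(h / 2))⁻¹ * waveK ν (h / 2) * Real.exp (-(ν * y)) := by
      refine k2.trans ?_
      gcongr
    have t1 : 1 / (2 * √y) * besselMoment 0 (2 * Real.pi * ν * y) ≤
        1 / (2 * h) * (C₁ * (√(h / 2))⁻¹ * waveK ν (h / 2) * Real.exp (-(ν * y))) := by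
      calc _ ≤ 1 / (2 * √y) * besselMoment 0 (2 * Real.pi * ν * (y - h / 4)) := by gcongr
        _ = 1 / (2 * y) * (√y * besselMoment 0 (2 * Real.pi * ν * (y - h / 4))) := by
            have : y = √y * √y := (Real.mul_self_sqrt hy0.le).symm
            rw [show 1 / (2 * y) = 1 / (2 * (√y * √y)) by rw [← this]]
            field_simp
        _ ≤ _ := by gcongr
    have t2 : √y * (2 * Real.pi * ν * besselMoment 1 (2 * Real.pi * ν * y)) ≤
        4 / h * (C₁ * (√(h / 2))⁻¹ * waveK ν (h / 2) * Real.exp (-(ν * y))) := by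
      have hm := besselMoment_one_le (x := 2 * Real.pi * ν * y) (δ := 2 * Real.pi * ν * (h / 4))
        (by positivity) (by gcongr; linarith)
      rw [← mul_sub] at hm
      calc _ ≤ √y * (2 * Real.pi * ν * ((2 * Real.pi * ν * (h / 4))⁻¹ *
            besselMoment 0 (2 * Real.pi * ν * (y - h / 4)))) := by gcongr
        _ = 4 / h * (√y * besselMoment 0 (2 * Real.pi * ν * (y - h / 4))) := by field_simp
        _ ≤ _ := by gcongr
    have p1 : 0 ≤ 1 / (2 * √y) * besselMoment 0 (2 * Real.pi * ν * y) := by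
      have := besselMoment_pos 0 (x := 2 * Real.pi * ν * y) (by positivity)
      positivity
    have p2 : 0 ≤ √y * (2 * Real.pi * ν * besselMoment 1 (2 * Real.pi * ν * y)) := by
      have := besselMoment_pos 1 (x := 2 * Real.pi * ν * y) (by positivity)
      positivity
    have p3 : 0 ≤ B * (waveK ν (h / 2) * Real.exp (-(ν * y))) := by positivity
    rw [waveK']
    refine abs_sub_le_iff.2 ⟨?_, ?_⟩ <;> nlinarith

end MedianResum

namespace MedianResum

/-! ### Wirtinger derivatives -/

/-- The real-linear map `v ↦ p v + q v̄`. -/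
def wirt (p q : ℂ) : ℂ →L[ℝ] ℂ := p • (1 : ℂ →L[ℝ] ℂ) + q • (conjCLE : ℂ →L[ℝ] ℂ)

theorem wirt_apply (p q v : ℂ) : wirt p q v = p * v + q * (starRingEnd ℂ) v := by
  simp [wirt]

theorem norm_wirt_le (p q : ℂ) : ‖wirt p q‖ ≤ ‖p‖ + ‖q‖ := by
  refine ContinuousLinearMap.opNorm_le_bound _ (by positivity) fun v => ?_
  rw [wirt_apply, add_mul]
  refine (norm_add_le _ _).trans ?_
  rw [norm_mul, norm_mul, RCLike.norm_conj]

theorem eq_wirt (L : ℂ →L[ℝ] ℂ) : L = wirt ((L 1 - I * L I) / 2) ((L 1 + I * L I) / 2) := by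
  ext v
  have hv : v = (v.re : ℝ) • (1 : ℂ) + (v.im : ℝ) • I := by simp [Complex.re_add_im]
  have h1 : L v = v.re * L 1 + v.im * L I := by
    conv_lhs => rw [hv]
    rw [map_add, map_smul, map_smul, real_smul, real_smul]
  have h2 : (starRingEnd ℂ) v = v.re - v.im * I := by
    apply Complex.ext <;> simp
  have h3 : v = v.re + v.im * I := (Complex.re_add_im v).symm
  rw [wirt_apply, h1, h2]
  conv_rhs => rw [h3]
  simp only [add_re, ofReal_re, mul_re, I_re, mul_zero, ofReal_im, I_im, mul_one, sub_self,
    add_zero, add_im, mul_im, zero_add]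
  linear_combination (v.im * L I : ℂ) * I_sq

theorem wirt_inj {p q p' q' : ℂ} (h : wirt p q = wirt p' q') : p = p' ∧ q = q' := by
  have h1 := DFunLike.congr_fun h 1
  have h2 := DFunLike.congr_fun h I
  simp only [wirt_apply, map_one, conj_I] at h1 h2
  constructor
  · linear_combination (1 / 2 : ℂ) * h1 - (I / 2) * h2 + (p - p' - q + q') / 2 * I_sq
  · linear_combination (1 / 2 : ℂ) * h1 + (I / 2) * h2 + (p' - p + q - q') / 2 * I_sq

theorem congr_wirt {a : ℂ → ℂ} {p q p' q' z : ℂ} (h : HasFDerivAt a (wirt p q) z)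
    (hp : p = p') (hq : q = q') : HasFDerivAt a (wirt p' q') z := by
  rwa [← hp, ← hq]

theorem hasWirt_of_hasDerivAt {f : ℂ → ℂ} {f' z : ℂ} (h : HasDerivAt f f' z) :
    HasFDerivAt f (wirt f' 0) z := by
  refine h.complexToReal_fderiv.congr_fderiv ?_
  ext v
  simp [wirt_apply]

theorem hasWirt_conj {f : ℂ → ℂ} {f' z : ℂ} (h : HasDerivAt f f' ((starRingEnd ℂ) z)) :
    HasFDerivAt (fun z => f ((starRingEnd ℂ) z)) (wirt 0 f') z := by
  have h1 : HasFDerivAt (fun z : ℂ => (starRingEnd ℂ) z) (conjCLE : ℂ →L[ℝ] ℂ) z :=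
    conjCLE.hasFDerivAt
  refine (h.complexToReal_fderiv.comp z h1).congr_fderiv ?_
  ext v
  simp [wirt_apply]

theorem hasWirt_im {k : ℝ → ℂ} {k' : ℂ} {z : ℂ} (h : HasDerivAt k k' z.im) :
    HasFDerivAt (fun z : ℂ => k z.im) (wirt (-(I / 2) * k') (I / 2 * k')) z := by
  refine (h.hasFDerivAt.comp z imCLM.hasFDerivAt).congr_fderiv ?_
  ext v
  have h2 : (starRingEnd ℂ) v = v - 2 * v.im * I := by
    apply Complex.ext <;> simp; ring
  rw [wirt_apply, h2]
  simp
  linear_combination ((v.im : ℂ) * k') * I_sq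

theorem hasWirt_re {k : ℝ → ℂ} {k' : ℂ} {z : ℂ} (h : HasDerivAt k k' z.re) :
    HasFDerivAt (fun z : ℂ => k z.re) (wirt (k' / 2) (k' / 2)) z := by
  refine (h.hasFDerivAt.comp z reCLM.hasFDerivAt).congr_fderiv ?_
  ext v
  have h2 : (starRingEnd ℂ) v = 2 * v.re - v := by
    apply Complex.ext <;> simp; ring
  rw [wirt_apply, h2]
  simp
  ring

theorem hasWirt_mul {a b : ℂ → ℂ} {z p q r s : ℂ} (ha : HasFDerivAt a (wirt p q) z)
    (hb : HasFDerivAt b (wirt r s) z) :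
    HasFDerivAt (fun z => a z * b z) (wirt (p * b z + a z * r) (q * b z + a z * s)) z := by
  refine (ha.mul hb).congr_fderiv ?_
  ext v
  simp [wirt_apply]
  ring

theorem hasWirt_const_mul {a : ℂ → ℂ} {z p q : ℂ} (c : ℂ) (ha : HasFDerivAt a (wirt p q) z) :
    HasFDerivAt (fun z => c * a z) (wirt (c * p) (c * q)) z := by
  refine (ha.const_mul c).congr_fderiv ?_
  ext v
  simp [wirt_apply]
  ring

/-- A form `P dz + Q dz̄` with `∂P/∂z̄ = ∂Q/∂z` on a convex open set is exact. -/
theorem exists_primitive_wirt {D : Set ℂ} (hD : Convex ℝ D) (hDo : IsOpen D) {P Q : ℂ → ℂ}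
    (h : ∀ z ∈ D, ∃ p r q : ℂ, HasFDerivAt P (wirt p r) z ∧ HasFDerivAt Q (wirt r q) z) :
    ∃ Φ : ℂ → ℂ, ∀ z ∈ D, HasFDerivAt Φ (wirt (P z) (Q z)) z := by
  have hd : ∀ z ∈ D, ∃ p r q : ℂ, HasFDerivAt (fun z => wirt (P z) (Q z))
      ((wirt p r).smulRight (1 : ℂ →L[ℝ] ℂ) +
        (wirt r q).smulRight (conjCLE : ℂ →L[ℝ] ℂ)) z := by
    intro z hz
    obtain ⟨p, r, q, h1, h2⟩ := h z hz
    exact ⟨p, r, q, (h1.smul_const (1 : ℂ →L[ℝ] ℂ)).add (h2.smul_const (conjCLE : ℂ →L[ℝ] ℂ))⟩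
  -- Poincaré lemma: the common cross coefficient r is exactly the symmetry of the derivative of the
  -- form.
  refine hD.exists_forall_hasFDerivAt_of_fderiv_symmetric hDo
    (fun z hz => ?_) (fun z hz x y => ?_)
  · obtain ⟨p, r, q, h1⟩ := hd z hz
    exact h1.differentiableAt.differentiableWithinAt
  · obtain ⟨p, r, q, h1⟩ := hd z hz
    rw [h1.fderiv]
    simp [wirt_apply]
    ring

/-! ### Eigenfunctions of the Laplacian and closed forms -/

/-- `a` is an eigenfunction of the hyperbolic Laplacian with eigenvalue `1/4` on the upper
half-plane, and `p` is its derivative `∂a/∂z`. -/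
structure IsWave (a p : ℂ → ℂ) : Prop where
  fst : ∀ z : ℂ, 0 < z.im → ∃ q : ℂ, HasFDerivAt a (wirt (p z) q) z
  snd : ∀ z : ℂ, 0 < z.im → ∃ p₁ : ℂ, HasFDerivAt p (wirt p₁ (-(a z) / (16 * (z.im : ℂ) ^ 2))) z

/-- The Fourier mode `√y K₀(2π|n|y) e^{2πinx}`. -/
def modeK (n : ℤ) (z : ℂ) : ℂ := (waveK |(n : ℝ)| z.im : ℂ) * expTwoPi (n * (z.re : ℂ))

/-- The derivative `∂/∂z` of `modeK n`. -/
def modeK' (n : ℤ) (z : ℂ) : ℂ :=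
  I * (Real.pi * n * waveK |(n : ℝ)| z.im - waveK' |(n : ℝ)| z.im / 2) *
    expTwoPi (n * (z.re : ℂ))

theorem expTwoPi_ofReal_hasDerivAt (n : ℤ) (x : ℝ) :
    HasDerivAt (fun x : ℝ => expTwoPi (n * (x : ℂ)))
      (2 * Real.pi * I * n * expTwoPi (n * (x : ℂ))) x := by
  have h1 := (expTwoPi_hasDerivAt (n * (x : ℂ))).comp (x : ℂ)
    ((hasDerivAt_id (x : ℂ)).const_mul (n : ℂ))
  refine h1.comp_ofReal.congr_deriv ?_
  ring

theorem isWave_modeK {n : ℤ} (hn : n ≠ 0) : IsWave (modeK n) (modeK' n) := by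
  have hν : 0 < |(n : ℝ)| := abs_pos.2 (by exact_mod_cast hn)
  have hν2 : ((|(n : ℝ)| : ℝ) : ℂ) ^ 2 = (n : ℂ) ^ 2 := by
    rw [← ofReal_pow, sq_abs]; push_cast; rfl
  constructor
  · intro z hz
    have h1 := hasWirt_im ((waveK_hasDerivAt hν hz).ofReal_comp)
    have h2 := hasWirt_re (expTwoPi_ofReal_hasDerivAt n z.re)
    refine ⟨_, congr_wirt (hasWirt_mul h1 h2) ?_ rfl⟩
    rw [modeK']
    ring
  · intro z hz
    have hy : (z.im : ℂ) ≠ 0 := by exact_mod_cast hz.ne'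
    have h0 : HasDerivAt (fun y : ℝ => I * (Real.pi * n * (waveK |(n : ℝ)| y : ℂ) -
        (waveK' |(n : ℝ)| y : ℂ) / 2)) (I * (Real.pi * n * (waveK' |(n : ℝ)| z.im : ℂ) -
        (((4 * Real.pi ^ 2 * |(n : ℝ)| ^ 2 - 1 / (4 * z.im ^ 2)) * waveK |(n : ℝ)| z.im : ℝ) : ℂ)
          / 2)) z.im :=
      ((((waveK_hasDerivAt hν hz).ofReal_comp).const_mul _).sub
        (((waveK'_hasDerivAt hν hz).ofReal_comp).div_const 2)).const_mul I
    have h2 := hasWirt_re (expTwoPi_ofReal_hasDerivAt n z.re)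
    refine ⟨_, congr_wirt (hasWirt_mul (hasWirt_im h0) h2) rfl ?_⟩
    rw [modeK]
    push_cast
    rw [hν2]
    field_simp
    ring_nf
    simp only [I_sq]
    ring

variable {β : ℝ} {w : ℂ}

theorem re_I_mul_conj_sub (z w : ℂ) : (I * ((starRingEnd ℂ) z - w)).re = z.im + w.im := by
  simp
  ring

/-- The eigenfunction `√y (z - w)^{-1/2} (i (z̄ - w))^{-1/2}`. -/
def waveV (β : ℝ) (w z : ℂ) : ℂ :=
  ((√z.im : ℝ) : ℂ) * branch β (1 / 2) (z - w) *
    (I * ((starRingEnd ℂ) z - w)) ^ (-((1 / 2 : ℝ) : ℂ))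

/-- The derivative `∂/∂z̄` of `waveV`. -/
def waveV' (β : ℝ) (w z : ℂ) : ℂ :=
  -(1 / 4) * (((√z.im)⁻¹ : ℝ) : ℂ) * branch β (-(1 / 2)) (z - w) *
    (I * ((starRingEnd ℂ) z - w)) ^ (-((3 / 2 : ℝ) : ℂ))

theorem hasWirt_branch_sub (s : ℝ) {z : ℂ} (hz : z - w ∈ halfPlane β) :
    HasFDerivAt (fun z => branch β s (z - w)) (wirt (-(s : ℂ) * branch β (s + 1) (z - w)) 0) z :=
  hasWirt_of_hasDerivAt ((branch_hasDerivAt s hz).comp_sub_const z w)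

theorem hasWirt_conj_cpow (s : ℝ) {z : ℂ} (hz : 0 < z.im + w.im) :
    HasFDerivAt (fun z => (I * ((starRingEnd ℂ) z - w)) ^ (-(s : ℂ)))
      (wirt 0 (-(s : ℂ) * I * (I * ((starRingEnd ℂ) z - w)) ^ (-((s + 1 : ℝ) : ℂ)))) z := by
  have h1 : HasDerivAt (fun ζ : ℂ => I * (ζ - w)) I ((starRingEnd ℂ) z) := by
    simpa using ((hasDerivAt_id ((starRingEnd ℂ) z)).sub_const w).const_mul I
  have h2 := h1.cpow_const (c := -(s : ℂ)) (Or.inl (by rw [re_I_mul_conj_sub]; exact hz))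
  refine (hasWirt_conj h2).congr_fderiv ?_
  congr 1
  rw [show -((s + 1 : ℝ) : ℂ) = -(s : ℂ) - 1 by push_cast; ring]
  ring

theorem conj_cpow_half {z : ℂ} (hz : 0 < z.im + w.im) :
    (I * ((starRingEnd ℂ) z - w)) ^ (-((1 / 2 : ℝ) : ℂ)) =
      (I * ((starRingEnd ℂ) z - w)) ^ (-((3 / 2 : ℝ) : ℂ)) * (I * ((starRingEnd ℂ) z - w)) := by
  have h0 : I * ((starRingEnd ℂ) z - w) ≠ 0 := ne_zero_of_re_pos (by
    rw [re_I_mul_conj_sub]; exact hz)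
  rw [show -((1 / 2 : ℝ) : ℂ) = -((3 / 2 : ℝ) : ℂ) + 1 by push_cast; ring, cpow_add _ _ h0, cpow_one]

theorem branch_half {z : ℂ} (hz : z - w ∈ halfPlane β) :
    branch β (-(1 / 2)) (z - w) = branch β (1 / 2) (z - w) * (z - w) := by
  have h0 := ne_zero_of_mem_halfPlane hz
  rw [show (1 / 2 : ℝ) = -(1 / 2) + 1 by norm_num, branch_add, branch_one h0, mul_assoc,
    inv_mul_cancel₀ h0, mul_one]
  norm_num

theorem ofReal_im_eq (z : ℂ) : (z.im : ℂ) = -(I / 2) * (z - (starRingEnd ℂ) z) := by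
  apply Complex.ext <;> simp; ring

/-- The two terms produced by ∂/∂z̄ combine because 2iy = (z - w) - (z̄ - w); what remains carries
(z - w)^{1/2} (i(z̄ - w))^{-3/2}. -/
theorem waveV_fst (hw : 0 < w.im) {z : ℂ} (hz : 0 < z.im) (hzw : z - w ∈ halfPlane β) :
    ∃ r : ℂ, HasFDerivAt (waveV β w) (wirt r (waveV' β w z)) z := by
  have hs := hasWirt_im ((Real.hasDerivAt_sqrt hz.ne').ofReal_comp)
  have hzw' : 0 < z.im + w.im := by linarith
  refine ⟨_, congr_wirt (hasWirt_mul (hasWirt_mul hs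
    (hasWirt_branch_sub (1 / 2) hzw)) (hasWirt_conj_cpow (1 / 2) hzw')) rfl ?_⟩
  have hr : ((√z.im : ℝ) : ℂ) ≠ 0 := by exact_mod_cast (Real.sqrt_pos.2 hz).ne'
  have hr2 : ((√z.im : ℝ) : ℂ) ^ 2 = -(I / 2) * (z - (starRingEnd ℂ) z) := by
    rw [← ofReal_pow, Real.sq_sqrt hz.le, ← ofReal_im_eq]
  rw [waveV', branch_half hzw, conj_cpow_half hzw', show (1 / 2 + 1 : ℝ) = 3 / 2 by norm_num]
  push_cast
  field_simp
  rw [hr2]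
  ring_nf
  simp only [I_sq]
  ring

/-- Together with `waveV_fst` this is the eigenvalue equation for V: ∂²/∂z∂z̄ is a quarter of the
Euclidean Laplacian, and eigenvalue 1/4 means that the latter acts as -1/(4y²). -/
theorem waveV'_snd (hw : 0 < w.im) {z : ℂ} (hz : 0 < z.im) (hzw : z - w ∈ halfPlane β) :
    ∃ q : ℂ, HasFDerivAt (waveV' β w)
      (wirt (-(waveV β w z) / (16 * (z.im : ℂ) ^ 2)) q) z := by
  have hs0 := Real.sqrt_pos.2 hz
  have hs1 : HasDerivAt (fun y => (√y)⁻¹) (-(1 / (2 * √z.im)) / √z.im ^ 2) z.im :=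
    (Real.hasDerivAt_sqrt hz.ne').inv hs0.ne'
  have hs := hasWirt_im hs1.ofReal_comp
  have hzw' : 0 < z.im + w.im := by linarith
  refine ⟨_, congr_wirt (hasWirt_mul (hasWirt_mul (hasWirt_const_mul (-(1 / 4)) hs)
    (hasWirt_branch_sub (-(1 / 2)) hzw)) (hasWirt_conj_cpow (3 / 2) hzw')) ?_ rfl⟩
  have hr : ((√z.im : ℝ) : ℂ) ≠ 0 := by exact_mod_cast hs0.ne'
  have hy : (z.im : ℂ) = ((√z.im : ℝ) : ℂ) ^ 2 := by
    rw [← ofReal_pow, Real.sq_sqrt hz.le]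
  have hr2 : ((√z.im : ℝ) : ℂ) ^ 2 = -(I / 2) * (z - (starRingEnd ℂ) z) := by
    rw [← hy, ← ofReal_im_eq]
  have e : (-(1 / 2) + 1 : ℝ) = 1 / 2 := by norm_num
  rw [waveV, e, branch_half hzw, conj_cpow_half hzw', hy]
  push_cast
  field_simp
  rw [hr2]
  ring_nf

/-- The closed form `∂a/∂z v dz + a ∂v/∂z̄ dz̄` of two eigenfunctions. -/
def waveForm (a p : ℂ → ℂ) (β : ℝ) (w z : ℂ) : ℂ →L[ℝ] ℂ :=
  wirt (p z * waveV β w z) (a z * waveV' β w z)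

/-- Closedness: the z̄-derivative of the dz coefficient and the z-derivative of the dz̄ coefficient
are both p ∂v/∂z̄ - a v/(16y²), because a and v have the same eigenvalue. -/
theorem exists_primitive_waveForm {a p : ℂ → ℂ} (h : IsWave a p) (hw : 0 < w.im) {D : Set ℂ}
    (hD : Convex ℝ D) (hDo : IsOpen D) (hD1 : ∀ z ∈ D, 0 < z.im)
    (hD2 : ∀ z ∈ D, z - w ∈ halfPlane β) :
    (∃ Φ : ℂ → ℂ, ∀ z ∈ D, HasFDerivAt Φ (waveForm a p β w z) z) ∧
      ContinuousOn (waveForm a p β w) D := by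
  have key : ∀ z ∈ D, ∃ p' r q : ℂ, HasFDerivAt (fun z => p z * waveV β w z) (wirt p' r) z ∧
      HasFDerivAt (fun z => a z * waveV' β w z) (wirt r q) z := by
    intro z hz
    obtain ⟨q, h1⟩ := h.fst z (hD1 z hz)
    obtain ⟨p₁, h2⟩ := h.snd z (hD1 z hz)
    obtain ⟨r, h3⟩ := waveV_fst hw (hD1 z hz) (hD2 z hz)
    obtain ⟨q', h4⟩ := waveV'_snd hw (hD1 z hz) (hD2 z hz)
    refine ⟨_, _, _, hasWirt_mul h2 h3, congr_wirt (hasWirt_mul h1 h4) ?_ rfl⟩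
    ring
  refine ⟨exists_primitive_wirt hD hDo key, fun z hz => ?_⟩
  obtain ⟨p', r, q, h1, h2⟩ := key z hz
  exact ((h1.continuousAt.smul continuousAt_const).add
    (h2.continuousAt.smul continuousAt_const)).continuousWithinAt

end MedianResum

namespace MedianResum

/-! ### Fourier coefficients along horizontal lines -/

/-- Mixed second derivatives commute, so ∂²/∂z∂z̄ is a quarter of the Laplacian; with ΔU = -U/(4y²)
this produces the constant 16. -/
theorem isWave_of_eigen {U : ℂ → ℂ} (hs : ContDiffOn ℝ ∞ U {w : ℂ | 0 < w.im})
    (he : ∀ z : ℂ, 0 < z.im → -((z.im : ℂ) ^ 2) * Laplacian.laplacian U z = (1 / 4) * U z) :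
    IsWave U (fun z => (fderiv ℝ U z 1 - I * fderiv ℝ U z I) / 2) := by
  have hopen : IsOpen {w : ℂ | 0 < w.im} := isOpen_lt continuous_const continuous_im
  have hU : ∀ z : ℂ, 0 < z.im → ContDiffAt ℝ ∞ U z := fun z hz => hs.contDiffAt (hopen.mem_nhds hz)
  have hU2 : ∀ z : ℂ, 0 < z.im → ContDiffAt ℝ 2 U z := fun z hz =>
    (hU z hz).of_le (WithTop.coe_le_coe.2 le_top)
  constructor
  · intro z hz
    have h1 := ((hU z hz).differentiableAt (by simp)).hasFDerivAt
    refine ⟨(fderiv ℝ U z 1 + I * fderiv ℝ U z I) / 2, ?_⟩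
    rwa [← eq_wirt]
  · intro z hz
    have hd : DifferentiableAt ℝ (fderiv ℝ U) z :=
      ((hU2 z hz).fderiv_right (m := 1) (by norm_num [one_add_one_eq_two])).differentiableAt (by simp)
    have hsym : IsSymmSndFDerivAt ℝ U z :=
      (hU2 z hz).isSymmSndFDerivAt (by simp)
    have h1 := hd.hasFDerivAt.clm_apply (hasFDerivAt_const (1 : ℂ) z)
    have h2 := hd.hasFDerivAt.clm_apply (hasFDerivAt_const I z)
    have h3 := (h1.sub (h2.const_mul I)).const_mul (1 / 2 : ℂ)
    have hlap := he z hz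
    rw [InnerProductSpace.laplacian_eq_iteratedFDeriv_complexPlane] at hlap
    simp only [iteratedFDeriv_two_apply, Matrix.cons_val_zero, Matrix.cons_val_one] at hlap
    refine ⟨_, congr_wirt ((h3.congr_fderiv (eq_wirt _)).congr_of_eventuallyEq (Eventually.of_forall fun z => ?_)) rfl ?_⟩
    · simp [div_eq_mul_inv]; ring
    · have hy : (z.im : ℂ) ≠ 0 := by exact_mod_cast hz.ne'
      have hs1 := hsym 1 I
      simp
      rw [hs1]
      field_simp
      ring_nf
      simp only [I_sq]
      linear_combination (-16 : ℂ) * hlap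

/-- The `n`-th Fourier coefficient of `f` along the line of height `y`. -/
def lineCoeff (f : ℂ → ℂ) (n : ℤ) (y : ℝ) : ℂ :=
  ∫ x in (0 : ℝ)..1, f (x + y * I) * expTwoPi (-n * (x : ℂ))

theorem add_mul_I_hasDerivAt (x y : ℝ) :
    HasDerivAt (fun x : ℝ => (x : ℂ) + y * I) 1 x ∧
      HasDerivAt (fun y : ℝ => (x : ℂ) + y * I) I y := by
  constructor
  · exact (hasDerivAt_id x).ofReal_comp.add_const _
  · simpa using ((hasDerivAt_id y).ofReal_comp.mul_const I).const_add (x : ℂ)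

variable {f : ℂ → ℂ}

theorem continuousOn_line {E : Type*} [TopologicalSpace E] {f : ℂ → E}
    (hf : ContinuousOn f {w : ℂ | 0 < w.im}) {y : ℝ} (hy : 0 < y) :
    Continuous fun x : ℝ => f (x + y * I) := by
  refine hf.comp_continuous (by fun_prop) fun x => ?_
  simpa using hy

theorem lineCoeff_hasDerivAt (hf : ContDiffOn ℝ 1 f {w : ℂ | 0 < w.im}) (n : ℤ) {y : ℝ}
    (hy : 0 < y) :
    HasDerivAt (lineCoeff f n) (lineCoeff (fun z => fderiv ℝ f z I) n y) y := by
  have hopen : IsOpen {w : ℂ | 0 < w.im} := isOpen_lt continuous_const continuous_im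
  have hd : ContinuousOn (fun z => fderiv ℝ f z I) {w : ℂ | 0 < w.im} :=
    (hf.continuousOn_fderiv_of_isOpen hopen le_rfl).clm_apply continuousOn_const
  have hcomp : IsCompact ((fun p : ℝ × ℝ => (p.1 : ℂ) + p.2 * I) '' (Icc 0 1 ×ˢ Icc (y / 2) (2 * y))) :=
    (isCompact_Icc.prod isCompact_Icc).image (by fun_prop)
  obtain ⟨M, hM⟩ := hcomp.exists_bound_of_continuousOn (f := fun z => fderiv ℝ f z I) (hd.mono (by
    rintro _ ⟨p, hp, rfl⟩
    have := hp.2.1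
    simp only [mem_ofPred_eq, add_im, ofReal_im, zero_add, mul_I_im, ofReal_re]
    linarith))
  have hnorm : ∀ x : ℝ, ‖expTwoPi (-n * (x : ℂ))‖ = 1 := fun x => by
    rw [norm_expTwoPi]; simp
  have hexp : Continuous fun x : ℝ => expTwoPi (-n * (x : ℂ)) :=
    expTwoPi_differentiable.continuous.comp (by fun_prop)
  refine (intervalIntegral.hasDerivAt_integral_of_dominated_loc_of_deriv_le
    (μ := volume) (a := 0) (b := 1) (bound := fun _ => M)
    (F := fun y x => f ((x : ℝ) + (y : ℝ) * I) * expTwoPi (-n * (x : ℂ)))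
    (F' := fun y x => fderiv ℝ f ((x : ℝ) + (y : ℝ) * I) I * expTwoPi (-n * (x : ℂ)))
    (x₀ := y) (Ioo_mem_nhds (half_lt_self hy) (by linarith : y < 2 * y)) ?_ ?_ ?_ ?_ ?_ ?_).2
  · filter_upwards [lt_mem_nhds hy] with y' hy'
    exact ((continuousOn_line hf.continuousOn hy').mul hexp).aestronglyMeasurable
  · exact ((continuousOn_line hf.continuousOn hy).mul hexp).intervalIntegrable _ _
  · exact ((continuousOn_line hd hy).mul hexp).aestronglyMeasurable
  · refine Eventually.of_forall fun x hx y' hy' => ?_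
    rw [uIoc_of_le zero_le_one] at hx
    rw [norm_mul, hnorm, mul_one]
    exact hM _ ⟨(x, y'), ⟨⟨hx.1.le, hx.2⟩, ⟨hy'.1.le, hy'.2.le⟩⟩, rfl⟩
  · simp
  · refine Eventually.of_forall fun x _ y' hy' => ?_
    have hpos : 0 < y' := (half_pos hy).trans hy'.1
    have h1 : HasFDerivAt f (fderiv ℝ f (x + y' * I)) (x + y' * I) :=
      ((hf.differentiableOn (by simp)).differentiableAt (hopen.mem_nhds (by simpa using hpos))).hasFDerivAt
    exact (h1.comp_hasDerivAt y' (add_mul_I_hasDerivAt x y').2).mul_const _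

theorem lineCoeff_fderiv_one (hf : ContDiffOn ℝ 1 f {w : ℂ | 0 < w.im})
    (hp : ∀ z : ℂ, 0 < z.im → f (z + 1) = f z) (n : ℤ) {y : ℝ} (hy : 0 < y) :
    lineCoeff (fun z => fderiv ℝ f z 1) n y = 2 * Real.pi * I * n * lineCoeff f n y := by
  have hopen : IsOpen {w : ℂ | 0 < w.im} := isOpen_lt continuous_const continuous_im
  have hd : ContinuousOn (fun z => fderiv ℝ f z 1) {w : ℂ | 0 < w.im} :=
    (hf.continuousOn_fderiv_of_isOpen hopen le_rfl).clm_apply continuousOn_const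
  have hexp : Continuous fun x : ℝ => expTwoPi (-n * (x : ℂ)) :=
    expTwoPi_differentiable.continuous.comp (by fun_prop)
  have hder : ∀ x ∈ uIcc (0 : ℝ) 1, HasDerivAt (fun x : ℝ => f (x + y * I) * expTwoPi (-n * (x : ℂ)))
      (fderiv ℝ f (x + y * I) 1 * expTwoPi (-n * (x : ℂ)) -
        2 * Real.pi * I * n * (f (x + y * I) * expTwoPi (-n * (x : ℂ)))) x := by
    intro x _
    have h1 : HasFDerivAt f (fderiv ℝ f (x + y * I)) (x + y * I) :=
      ((hf.differentiableOn (by simp)).differentiableAt (hopen.mem_nhds (by simpa using hy))).hasFDerivAt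
    have h2 := expTwoPi_ofReal_hasDerivAt (-n) x
    push_cast at h2
    refine ((h1.comp_hasDerivAt x (add_mul_I_hasDerivAt x y).1).mul h2).congr_deriv ?_
    ring
  have i1 : IntervalIntegrable (fun x : ℝ => fderiv ℝ f (x + y * I) 1 * expTwoPi (-n * (x : ℂ)))
    volume 0 1 := ((continuousOn_line hd hy).mul hexp).intervalIntegrable _ _
  have i2 : IntervalIntegrable (fun x : ℝ => 2 * Real.pi * I * n *
      (f (x + y * I) * expTwoPi (-n * (x : ℂ)))) volume 0 1 :=
    (continuous_const.mul ((continuousOn_line hf.continuousOn hy).mul hexp)).intervalIntegrable _ _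
  have key := intervalIntegral.integral_eq_sub_of_hasDerivAt hder (i1.sub i2)
  rw [intervalIntegral.integral_sub i1 i2, intervalIntegral.integral_const_mul] at key
  have h0 : f (((1 : ℝ) : ℂ) + y * I) * expTwoPi (-n * ((1 : ℝ) : ℂ)) =
      f (((0 : ℝ) : ℂ) + y * I) * expTwoPi (-n * ((0 : ℝ) : ℂ)) := by
    have e1 : expTwoPi (-n * ((1 : ℝ) : ℂ)) = 1 := by
      rw [expTwoPi, Complex.exp_eq_one_iff]
      exact ⟨-n, by push_cast; ring⟩
    have e2 : expTwoPi (-n * ((0 : ℝ) : ℂ)) = 1 := by simp [expTwoPi]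
    rw [e1, e2, ← hp (((0 : ℝ) : ℂ) + y * I) (by simpa using hy)]
    push_cast
    congr 2
    ring
  rw [h0, sub_self] at key
  exact sub_eq_zero.1 key

theorem hasSum_lineCoeff (hf : ContinuousOn f {w : ℂ | 0 < w.im})
    (hp : ∀ z : ℂ, 0 < z.im → f (z + 1) = f z) {z : ℂ} (hz : 0 < z.im)
    (hs : Summable fun n : ℤ => lineCoeff f n z.im) :
    HasSum (fun n : ℤ => lineCoeff f n z.im * expTwoPi (n * (z.re : ℂ))) (f z) := by
  have : Fact ((0 : ℝ) < 1) := ⟨one_pos⟩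
  have hper : Function.Periodic (fun x : ℝ => f (x + z.im * I)) 1 := fun x => by
    simp only
    rw [← hp (x + z.im * I) (by simpa using hz)]
    push_cast
    congr 1
    ring
  have hcont : Continuous fun x : ℝ => f (x + z.im * I) := continuousOn_line hf hz
  set F : C(AddCircle (1 : ℝ), ℂ) := ⟨hper.lift, continuous_coinduced_dom.mpr hcont⟩ with hF
  have hFx : ∀ x : ℝ, F (x : AddCircle (1 : ℝ)) = f (x + z.im * I) := fun x => rfl
  have hc : ∀ n : ℤ, fourierCoeff F n = lineCoeff f n z.im := by
    intro n
    rw [fourierCoeff_eq_intervalIntegral F n 0, lineCoeff]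
    simp only [div_one, one_smul, zero_add]
    refine intervalIntegral.integral_congr fun x _ => ?_
    simp only [fourier_coe_apply, hFx, smul_eq_mul, expTwoPi]
    rw [mul_comm]
    congr 2
    push_cast
    ring
  have key := has_pointwise_sum_fourier_series_of_summable (f := F) (by rwa [funext hc])
    (z.re : AddCircle (1 : ℝ))
  rw [hFx, Complex.re_add_im] at key
  convert key using 2 with n
  rw [hc, fourier_coe_apply, smul_eq_mul, expTwoPi]
  congr 2
  push_cast
  ring

end MedianResum

namespace MedianResum

/-! ### Uniqueness of square-integrable solutions -/

/-- A solution on `[1, ∞)` of `D'' = l D`, `l ≥ 0`, which vanishes at `1` and is square-integrable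
with respect to `dy/y²` is zero. -/
theorem eq_zero_of_ode {D D' : ℝ → ℂ} {l : ℝ → ℝ} (h1 : ∀ y, 0 < y → HasDerivAt D (D' y) y)
    (h2 : ∀ y, 0 < y → HasDerivAt D' (l y * D y) y) (hl : ∀ y, 1 ≤ y → 0 ≤ l y) (hD : D 1 = 0)
    (hint : IntegrableOn (fun y => ‖D y‖ ^ 2 / y ^ 2) (Ioi 1)) {y : ℝ} (hy : 1 ≤ y) : D y = 0 := by
  -- Half the derivative of |D|². The equation and l ≥ 0 make it nondecreasing on [1, ∞), so |D|² is
  -- convex there.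
  set w : ℝ → ℝ := fun y => inner ℝ (D y) (D' y) with hw
  have hh : ∀ y, 0 < y → HasDerivAt (‖D ·‖ ^ 2) (2 * w y) y := fun y hy => (h1 y hy).norm_sq
  have hw' : ∀ y, 0 < y → HasDerivAt w (l y * ‖D y‖ ^ 2 + ‖D' y‖ ^ 2) y := fun y hy => by
    refine ((h1 y hy).inner ℝ (h2 y hy)).congr_deriv ?_
    rw [← real_smul, inner_smul_right, real_inner_self_eq_norm_sq, real_inner_self_eq_norm_sq]
  have hmono : MonotoneOn w (Ici 1) := by
    refine monotoneOn_of_deriv_nonneg (convex_Ici 1)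
      (fun y hy => (hw' y (zero_lt_one.trans_le hy)).continuousAt.continuousWithinAt)
      (fun y hy => ?_) (fun y hy => ?_) <;> rw [interior_Ici] at hy
    · exact (hw' y (zero_lt_one.trans hy)).differentiableAt.differentiableWithinAt
    · rw [(hw' y (zero_lt_one.trans hy)).deriv]
      have := hl y hy.le
      positivity
  have hconv : ConvexOn ℝ (Ici 1) (‖D ·‖ ^ 2) := by
    refine MonotoneOn.convexOn_of_deriv (convex_Ici 1)
      (fun y hy => (hh y (zero_lt_one.trans_le hy)).continuousAt.continuousWithinAt)
      (fun y hy => ?_) (fun a ha b hb hab => ?_)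
    · rw [interior_Ici] at hy
      exact (hh y (zero_lt_one.trans hy)).differentiableAt.differentiableWithinAt
    · rw [interior_Ici] at ha hb
      rw [(hh a (zero_lt_one.trans ha)).deriv, (hh b (zero_lt_one.trans hb)).deriv]
      have := hmono (mem_Ici.2 (le_of_lt ha)) (mem_Ici.2 (le_of_lt hb)) hab
      linarith
  by_contra hne
  have hy1 : 1 < y := lt_of_le_of_ne hy (by rintro rfl; exact hne hD)
  have hc : 0 < ‖D y‖ ^ 2 := by positivity
  set c := ‖D y‖ ^ 2 with hcdef
  -- Convexity and D(1) = 0 force at least linear growth of |D|² beyond a point where D ≠ 0, and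
  -- then ∫ |D|²/y² diverges like ∫ dy/y.
  have hlow : ∀ z, y < z → c * ((z - 1) / (y - 1)) ≤ ‖D z‖ ^ 2 := by
    intro z hz
    have hs := hconv.secant_mono (a := 1) (x := y) (y := z) (by simp) hy
      (hy.trans hz.le) hy1.ne' (hy1.trans hz).ne' hz.le
    simp only [hD, norm_zero] at hs
    rw [div_le_div_iff₀ (by linarith) (by linarith)] at hs
    rw [← mul_div_assoc, div_le_iff₀ (by linarith)]
    linarith
  have hsub : IntegrableOn (fun y => ‖D y‖ ^ 2 / y ^ 2) (Ioi (max y 2)) :=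
    hint.mono_set (Ioi_subset_Ioi (hy.trans (le_max_left _ _)))
  -- Beyond 2 one has z ≤ 2(z - 1), which compares 1/z with the linear lower bound divided by z².
  refine not_integrableOn_Ioi_inv (a := max y 2)
    ((hsub.const_mul (2 * (y - 1) / c)).mono' (by fun_prop) ?_)
  filter_upwards [ae_restrict_mem measurableSet_Ioi] with z hz
  have hz1 : y < z := (le_max_left _ _).trans_lt hz
  have hz2 : 2 < z := (le_max_right _ _).trans_lt hz
  have hz0 : 0 < z := by linarith
  rw [Real.norm_of_nonneg (inv_nonneg.2 hz0.le)]
  have := hlow z hz1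
  have hy0 : 0 < y - 1 := by linarith
  calc z⁻¹ ≤ 2 * (z - 1) / z ^ 2 := by
        rw [inv_eq_one_div, div_le_div_iff₀ hz0 (by positivity)]; nlinarith
    _ = 2 * (y - 1) / c * (c * ((z - 1) / (y - 1)) / z ^ 2) := by field_simp
    _ ≤ _ := by gcongr

/-- A solution on `(0, ∞)` of `D'' = l D` which vanishes on `[1, ∞)` vanishes if there is another
solution without zeros. -/
theorem eq_zero_of_wronskian {D D' : ℝ → ℂ} {K K' l : ℝ → ℝ}
    (h1 : ∀ y, 0 < y → HasDerivAt D (D' y) y) (h2 : ∀ y, 0 < y → HasDerivAt D' (l y * D y) y)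
    (k1 : ∀ y, 0 < y → HasDerivAt K (K' y) y) (k2 : ∀ y, 0 < y → HasDerivAt K' (l y * K y) y)
    (hK : ∀ y, 0 < y → 0 < K y) (hD : ∀ y, 1 ≤ y → D y = 0) {y : ℝ} (hy : 0 < y) : D y = 0 := by
  -- The point 2 is interior to [1, ∞), so D and its derivative both vanish there and with them the
  -- constant Wronskian.
  have hD2 : D' 2 = 0 := by
    have : D =ᶠ[𝓝 2] fun _ => 0 := by
      filter_upwards [lt_mem_nhds (one_lt_two : (1 : ℝ) < 2)] with z hz using hD z hz.le
    exact ((h1 2 two_pos).congr_of_eventuallyEq this.symm).unique (hasDerivAt_const _ _)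
  have hconst : ∀ {F F' : ℝ → ℂ}, (∀ y, 0 < y → HasDerivAt F (F' y) y) → (∀ y, 0 < y → F' y = 0) →
      ∀ y, 0 < y → F y = F 2 := by
    intro F F' hF hF' y hy
    exact isOpen_Ioi.is_const_of_deriv_eq_zero isPreconnected_Ioi
      (fun z hz => (hF z hz).differentiableAt.differentiableWithinAt)
      (fun z hz => by rw [(hF z hz).deriv, hF' z hz]; rfl) hy (two_pos : (0 : ℝ) < 2)
  have hW : ∀ y, 0 < y → D' y * K y - D y * K' y = 0 := by
    intro y hy
    have := hconst (F := fun y => D' y * K y - D y * K' y)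
      (fun y hy => ((h2 y hy).mul (k1 y hy).ofReal_comp).sub
        ((h1 y hy).mul (k2 y hy).ofReal_comp)) (fun y hy => by push_cast; ring) y hy
    rw [this, hD2, hD 2 one_le_two]
    ring
  have hne : ∀ y, 0 < y → (K y : ℂ) ≠ 0 := fun y hy => by exact_mod_cast (hK y hy).ne'
  have hQ := hconst (F := fun y => D y / K y)
    (fun y hy => (h1 y hy).div (k1 y hy).ofReal_comp (hne y hy))
    (fun y hy => by rw [hW y hy, zero_div]) y hy
  rw [hD 2 one_le_two, zero_div] at hQ
  exact (div_eq_zero_iff.1 hQ).resolve_right (hne y hy)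

/-- Cauchy–Schwarz as nonnegativity of the variance. -/
theorem sq_integral_le {g : ℝ → ℝ} (hg : Continuous g) (a : ℝ) :
    (∫ x in a..(a + 1), g x) ^ 2 ≤ ∫ x in a..(a + 1), g x ^ 2 := by
  set m := ∫ x in a..(a + 1), g x with hm
  have h0 : 0 ≤ ∫ x in a..(a + 1), (g x - m) ^ 2 :=
    intervalIntegral.integral_nonneg (by linarith) fun x _ => sq_nonneg _
  have i1 : IntervalIntegrable (fun x => g x ^ 2) volume a (a + 1) :=
    (hg.pow 2).intervalIntegrable _ _
  have i2 : IntervalIntegrable (fun x => 2 * m * g x) volume a (a + 1) :=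
    (continuous_const.mul hg).intervalIntegrable _ _
  have e : (fun x => (g x - m) ^ 2) = fun x => g x ^ 2 - 2 * m * g x + m ^ 2 := by
    ext x; ring
  rw [e, intervalIntegral.integral_add (i1.sub i2) (by simp),
    intervalIntegral.integral_sub i1 i2, intervalIntegral.integral_const_mul, ← hm,
    intervalIntegral.integral_const] at h0
  simp at h0
  nlinarith

/-- By periodicity the integral is taken over [-1/2, 1/2], the width of the standard fundamental
domain, where square-integrability is available. -/
theorem norm_sq_lineCoeff_le {f : ℂ → ℂ} (hf : ContinuousOn f {w : ℂ | 0 < w.im})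
    (hp : ∀ z : ℂ, 0 < z.im → f (z + 1) = f z) (n : ℤ) {y : ℝ} (hy : 0 < y) :
    ‖lineCoeff f n y‖ ^ 2 ≤ ∫ x in (-(1 / 2) : ℝ)..(1 / 2), ‖f (x + y * I)‖ ^ 2 := by
  have hper : Function.Periodic (fun x : ℝ => f (x + y * I) * expTwoPi (-n * (x : ℂ))) 1 := by
    intro x
    simp only
    rw [← hp (x + y * I) (by simpa using hy)]
    congr 1
    · congr 1; push_cast; ring
    · rw [expTwoPi, expTwoPi, Complex.exp_eq_exp_iff_exists_int]
      exact ⟨-n, by push_cast; ring⟩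
  have hs := hper.intervalIntegral_add_eq 0 (-(1 / 2))
  have hnorm : ∀ x : ℝ, ‖expTwoPi (-n * (x : ℂ))‖ = 1 := fun x => by
    rw [norm_expTwoPi]; simp
  rw [zero_add] at hs
  rw [lineCoeff, hs]
  have h2 := sq_integral_le (continuousOn_line hf hy).norm (-(1 / 2))
  rw [show (-(1 / 2) + 1 : ℝ) = 1 / 2 by norm_num] at h2 ⊢
  refine le_trans ?_ h2
  gcongr
  refine (intervalIntegral.norm_integral_le_integral_norm (by norm_num)).trans_eq ?_
  simp_rw [norm_mul, hnorm, mul_one]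

/-- The half-strip |Re z| ≤ 1/2, Im z > 1 lies in the fundamental domain; Fubini for dx dy/y² yields
the integral over heights. -/
theorem IsMaassWaveformHalf.integrableOn_strip {u : UpperHalfPlane → ℂ}
    (hu : IsMaassWaveformHalf u) :
    IntegrableOn (fun y : ℝ => ∫ x in (-(1 / 2) : ℝ)..(1 / 2), ‖u (ofComplex (x + y * I))‖ ^ 2 / y ^ 2)
      (Ioi 1) := by
  set B : Set ℂ := Icc (-(1 / 2)) (1 / 2) ×ℂ Ioi 1 with hB
  have hBm : MeasurableSet B :=
    (measurableSet_Icc.preimage measurable_re).inter (measurableSet_Ioi.preimage measurable_im)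
  have hS : MeasurableSet (UpperHalfPlane.coe ⁻¹' B) := UpperHalfPlane.measurable_coe hBm
  have hsub : UpperHalfPlane.coe ⁻¹' B ⊆ ModularGroup.fd := by
    intro z hz
    have hre : z.re ∈ Icc (-(1 / 2) : ℝ) (1 / 2) := hz.1
    have him : 1 < z.im := hz.2
    refine ⟨?_, abs_le.2 hre⟩
    rw [normSq_apply, ← UpperHalfPlane.re, ← UpperHalfPlane.im]
    nlinarith [sq_nonneg z.re]
  have h1 := hu.sqInt.mono_set hsub
  rw [← integrable_indicator_iff hS, UpperHalfPlane.volume_def,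
    integrable_withDensity_iff_integrable_smul (by
      have : Continuous fun z : UpperHalfPlane => (1 / NNReal.mk z.im z.im_pos.le : NNReal) ^ 2 := by
        refine .pow (.div₀ continuous_const ?_ ?_) _
        · exact UpperHalfPlane.continuous_im.subtype_mk _
        · exact fun x ↦ NNReal.ne_iff.mp x.im_ne_zero
      exact this.measurable)] at h1
  have h2 : Integrable ((B.indicator fun z => ‖u (ofComplex z)‖ ^ 2 / z.im ^ 2) ∘ UpperHalfPlane.coe)
      (volume.comap UpperHalfPlane.coe) := by
    refine h1.congr (Eventually.of_forall fun z => ?_)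
    simp only [Function.comp_apply]
    by_cases hz : (z : ℂ) ∈ B
    · rw [indicator_of_mem (by exact hz), indicator_of_mem hz,
        UpperHalfPlane.ofComplex_apply, NNReal.smul_def]
      simp [div_eq_mul_inv, mul_comm]
    · rw [indicator_of_notMem (by exact hz), indicator_of_notMem hz, smul_zero]
  rw [← UpperHalfPlane.measurableEmbedding_coe.integrableOn_range_iff_comap] at h2
  have hr : B ⊆ range UpperHalfPlane.coe := fun z hz => by
    have : 0 < z.im := zero_lt_one.trans hz.2
    exact ⟨⟨z, this⟩, rfl⟩
  have h3 : IntegrableOn (fun z => ‖u (ofComplex z)‖ ^ 2 / z.im ^ 2) B :=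
    (h2.mono_set hr).congr_fun (fun z hz => indicator_of_mem hz _) hBm
  have h4 := (Complex.volume_preserving_equiv_real_prod.symm.integrableOn_comp_preimage
    Complex.measurableEquivRealProd.symm.measurableEmbedding).2 h3
  have hpre : Complex.measurableEquivRealProd.symm ⁻¹' B = Icc (-(1 / 2)) (1 / 2) ×ˢ Ioi 1 := by
    ext p; rfl
  rw [hpre, IntegrableOn, Measure.volume_eq_prod, ← Measure.prod_restrict] at h4
  have h5 := h4.integral_prod_right
  refine h5.congr (Eventually.of_forall fun y => ?_)
  simp only
  rw [intervalIntegral.integral_of_le (by norm_num), ← integral_Icc_eq_integral_Ioc]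
  refine integral_congr_ae (Eventually.of_forall fun x => ?_)
  simp only [Function.comp_apply, Complex.measurableEquivRealProd_symm_apply]
  rw [Complex.mk_eq_add_mul_I]

end MedianResum

namespace MedianResum

/-! ### The Fourier expansion of a Maass waveform -/

/-- The function `u` on the upper half-plane, as a function of a complex variable. -/
def maassFun (u : UpperHalfPlane → ℂ) (z : ℂ) : ℂ := u (ofComplex z)

/-- The derivative `∂u/∂z`. -/
def maassDz (u : UpperHalfPlane → ℂ) (z : ℂ) : ℂ :=
  (fderiv ℝ (maassFun u) z 1 - I * fderiv ℝ (maassFun u) z I) / 2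

variable {u : UpperHalfPlane → ℂ}

theorem IsMaassWaveformHalf.isWave (hu : IsMaassWaveformHalf u) :
    IsWave (maassFun u) (maassDz u) := by
  refine isWave_of_eigen hu.smooth fun z hz => ?_
  have := hu.eigen ⟨z, hz⟩
  rw [maassFun, UpperHalfPlane.ofComplex_apply_of_im_pos hz, ← this]
  rfl

theorem IsMaassWaveformHalf.contDiffOn_maassDz (hu : IsMaassWaveformHalf u) :
    ContDiffOn ℝ 1 (maassDz u) {w : ℂ | 0 < w.im} := by
  have hopen : IsOpen {w : ℂ | 0 < w.im} := isOpen_lt continuous_const continuous_im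
  have h1 : ContDiffOn ℝ 1 (fderiv ℝ (maassFun u)) {w : ℂ | 0 < w.im} :=
    hu.smooth.fderiv_of_isOpen hopen (WithTop.coe_le_coe.2 le_top)
  exact ((h1.clm_apply contDiffOn_const).sub
    (contDiffOn_const.mul (h1.clm_apply contDiffOn_const))).div_const 2

theorem moebius_hasDerivAt (γ : SL(2, ℤ)) {z : ℂ} (hz : 0 < z.im) :
    HasDerivAt (fun z : ℂ => (((γ 0 0 : ℤ) : ℂ) * z + ((γ 0 1 : ℤ) : ℂ)) /
      (((γ 1 0 : ℤ) : ℂ) * z + ((γ 1 1 : ℤ) : ℂ)))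
      ((((γ 1 0 : ℤ) : ℂ) * z + ((γ 1 1 : ℤ) : ℂ)) ^ 2)⁻¹ z ∧
    (((γ 0 0 : ℤ) : ℂ) * z + ((γ 0 1 : ℤ) : ℂ)) / (((γ 1 0 : ℤ) : ℂ) * z + ((γ 1 1 : ℤ) : ℂ)) =
      (γ • ofComplex z : UpperHalfPlane) := by
  have hd : ((γ 1 0 : ℤ) : ℂ) * z + ((γ 1 1 : ℤ) : ℂ) ≠ 0 := by
    have := UpperHalfPlane.denom_ne_zero (γ : GL (Fin 2) ℝ) ⟨z, hz⟩
    rwa [ModularGroup.denom_apply] at this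
  have hdet : ((γ 0 0 : ℤ) : ℂ) * ((γ 1 1 : ℤ) : ℂ) - ((γ 0 1 : ℤ) : ℂ) * ((γ 1 0 : ℤ) : ℂ) = 1 := by
    have := γ.det_coe
    rw [Matrix.det_fin_two] at this
    exact_mod_cast this
  constructor
  · have h : ∀ a b : ℂ, HasDerivAt (fun z : ℂ => a * z + b) a z := fun a b => by
      simpa using ((hasDerivAt_id z).const_mul a).add_const b
    refine ((h _ _).div (h _ _) hd).congr_deriv ?_
    rw [inv_eq_one_div]
    congr 1
    linear_combination hdet
  · rw [UpperHalfPlane.coe_specialLinearGroup_apply, UpperHalfPlane.ofComplex_apply_of_im_pos hz]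
    simp

theorem IsMaassWaveformHalf.maassFun_smul (hu : IsMaassWaveformHalf u) (γ : SL(2, ℤ)) (z : ℂ) :
    maassFun u z = maassFun u (γ • ofComplex z : UpperHalfPlane) := by
  rw [maassFun, maassFun, UpperHalfPlane.ofComplex_apply, hu.invariant]

/-- Chain rule for the invariant u and the holomorphic map γ, then uniqueness of the coefficients of
dz and dz̄: ∂u/∂z transforms with weight 2. -/
theorem IsMaassWaveformHalf.maassDz_smul (hu : IsMaassWaveformHalf u) (γ : SL(2, ℤ)) {z : ℂ}
    (hz : 0 < z.im) :
    maassDz u z = maassDz u (γ • ofComplex z : UpperHalfPlane) *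
      ((((γ 1 0 : ℤ) : ℂ) * z + ((γ 1 1 : ℤ) : ℂ)) ^ 2)⁻¹ := by
  obtain ⟨q, h1⟩ := hu.isWave.fst z hz
  obtain ⟨q', h2⟩ := hu.isWave.fst (γ • ofComplex z : UpperHalfPlane) (γ • ofComplex z).im_pos
  have h3 := hasWirt_of_hasDerivAt (moebius_hasDerivAt γ hz).1
  rw [← (moebius_hasDerivAt γ hz).2] at h2
  have h4 := (h2.comp z h3).congr_of_eventuallyEq (f₁ := maassFun u) (by
    filter_upwards [(isOpen_lt continuous_const continuous_im).mem_nhds hz] with y hy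
    rw [Function.comp_apply, (moebius_hasDerivAt γ hy).2, ← hu.maassFun_smul])
  have h5 := h1.unique h4
  rw [(moebius_hasDerivAt γ hz).2] at h5
  refine (wirt_inj (q' := q' * (starRingEnd ℂ) ((((γ 1 0 : ℤ) : ℂ) * z + ((γ 1 1 : ℤ) : ℂ)) ^ 2)⁻¹)
    (h5.trans ?_)).1
  ext v
  simp only [ContinuousLinearMap.comp_apply, wirt_apply, map_mul, zero_mul, add_zero]
  ring

theorem IsMaassWaveformHalf.add_one (hu : IsMaassWaveformHalf u) {z : ℂ} (hz : 0 < z.im) :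
    maassFun u (z + 1) = maassFun u z ∧ maassDz u (z + 1) = maassDz u z := by
  have hT : ((ModularGroup.T • ofComplex z : UpperHalfPlane) : ℂ) = z + 1 := by
    rw [UpperHalfPlane.modular_T_smul, UpperHalfPlane.coe_vadd,
      UpperHalfPlane.ofComplex_apply_of_im_pos hz]
    push_cast
    ring
  have h1 := hu.maassFun_smul ModularGroup.T z
  have h2 := hu.maassDz_smul ModularGroup.T hz
  rw [hT] at h1 h2
  refine ⟨h1.symm, ?_⟩
  rw [h2]
  simp [ModularGroup.T]

theorem lineCoeff_eq_add {f g k : ℂ → ℂ} (hf : ContinuousOn f {w : ℂ | 0 < w.im})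
    (hg : ContinuousOn g {w : ℂ | 0 < w.im}) {y : ℝ} (hy : 0 < y) {c d : ℂ}
    (h : ∀ z : ℂ, z.im = y → k z = c * f z + d * g z) (n : ℤ) :
    lineCoeff k n y = c * lineCoeff f n y + d * lineCoeff g n y := by
  have hexp : Continuous fun x : ℝ => expTwoPi (-n * (x : ℂ)) :=
    expTwoPi_differentiable.continuous.comp (by fun_prop)
  have i : ∀ {f : ℂ → ℂ} (c : ℂ), ContinuousOn f {w : ℂ | 0 < w.im} → IntervalIntegrable
      (fun x : ℝ => c * (f (x + y * I) * expTwoPi (-n * (x : ℂ)))) volume 0 1 := fun c hf =>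
    (continuous_const.mul ((continuousOn_line hf hy).mul hexp)).intervalIntegrable _ _
  rw [lineCoeff, lineCoeff, lineCoeff, ← intervalIntegral.integral_const_mul,
    ← intervalIntegral.integral_const_mul, ← intervalIntegral.integral_add (i c hf) (i d hg)]
  refine intervalIntegral.integral_congr fun x _ => ?_
  rw [h _ (by simp)]
  ring

/-- Uses ∂_y = 2i ∂_z - i ∂_x for u and ∂_y = i ∂_x - 2i ∂_z̄ for ∂u/∂z; on the n-th coefficient ∂_x
acts as 2πin. The resulting first-order system is equivalent to the Bessel-type equation for the
coefficient of u. -/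
theorem IsMaassWaveformHalf.lineCoeff_hasDerivAt (hu : IsMaassWaveformHalf u) (n : ℤ) {y : ℝ}
    (hy : 0 < y) :
    HasDerivAt (lineCoeff (maassFun u) n) (2 * I * lineCoeff (maassDz u) n y +
      2 * Real.pi * n * lineCoeff (maassFun u) n y) y ∧
    HasDerivAt (lineCoeff (maassDz u) n) (-(2 * Real.pi * n) * lineCoeff (maassDz u) n y +
      I / (8 * y ^ 2) * lineCoeff (maassFun u) n y) y := by
  have hopen : IsOpen {w : ℂ | 0 < w.im} := isOpen_lt continuous_const continuous_im
  have hU : ContDiffOn ℝ 1 (maassFun u) {w : ℂ | 0 < w.im} :=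
    ContDiffOn.of_le hu.smooth (WithTop.coe_le_coe.2 le_top)
  have hP := hu.contDiffOn_maassDz
  have hd : ∀ {f : ℂ → ℂ}, ContDiffOn ℝ 1 f {w : ℂ | 0 < w.im} →
      ContinuousOn (fun z => fderiv ℝ f z 1) {w : ℂ | 0 < w.im} := fun hf =>
    (hf.continuousOn_fderiv_of_isOpen hopen le_rfl).clm_apply continuousOn_const
  constructor
  · refine (MedianResum.lineCoeff_hasDerivAt hU n hy).congr_deriv ?_
    rw [lineCoeff_eq_add (f := maassDz u) (g := fun z => fderiv ℝ (maassFun u) z 1)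
      (c := 2 * I) (d := -I) hP.continuousOn (hd hU) hy (fun z _ => ?_),
      lineCoeff_fderiv_one hU (fun z hz => (hu.add_one hz).1) n hy]
    · linear_combination (-(2 * Real.pi * n * lineCoeff (maassFun u) n y)) * I_sq
    · rw [maassDz]
      linear_combination (fderiv ℝ (maassFun u) z I) * I_sq
  · refine (MedianResum.lineCoeff_hasDerivAt hP n hy).congr_deriv ?_
    rw [lineCoeff_eq_add (f := fun z => fderiv ℝ (maassDz u) z 1) (g := maassFun u)
      (c := I) (d := I / (8 * y ^ 2)) (hd hP) hU.continuousOn hy (fun z hz => ?_),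
      lineCoeff_fderiv_one hP (fun z hz => (hu.add_one hz).2) n hy]
    · linear_combination (2 * Real.pi * n * lineCoeff (maassDz u) n y) * I_sq
    · obtain ⟨p₁, h⟩ := hu.isWave.snd z (hz ▸ hy)
      rw [h.fderiv, wirt_apply, wirt_apply, hz]
      have : (y : ℂ) ≠ 0 := by exact_mod_cast hy.ne'
      simp only [map_one, conj_I]
      field_simp
      ring

theorem waveK_one (n : ℤ) : waveK |(n : ℝ)| 1 = besselKZero (2 * Real.pi * |(n : ℝ)|) := by
  rw [waveK, Real.sqrt_one, one_mul, mul_one, besselMoment_zero]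

theorem IsMaassWaveformHalf.lineCoeff_zero (hu : IsMaassWaveformHalf u) {y : ℝ} (hy : 0 < y) :
    lineCoeff (maassFun u) 0 y = 0 := by
  rw [lineCoeff, ← hu.zeroth y hy]
  simp [maassFun, expTwoPi]

theorem lineCoeff_one (u : UpperHalfPlane → ℂ) (n : ℤ) :
    lineCoeff (maassFun u) n 1 =
      ∫ x in (0 : ℝ)..1, u (ofComplex (x + I)) * Complex.exp (-(2 * Real.pi * I * n * x)) := by
  rw [lineCoeff]
  refine intervalIntegral.integral_congr fun x _ => ?_
  simp only [maassFun, expTwoPi]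
  congr 2
  · push_cast; ring_nf
  · ring

theorem IsMaassWaveformHalf.maassCoeff_zero (hu : IsMaassWaveformHalf u) : maassCoeff u 0 = 0 := by
  rw [maassCoeff, ← lineCoeff_one, hu.lineCoeff_zero one_pos, zero_div]

/-- The Fourier coefficient and the K-Bessel solution satisfy the same second-order equation and
agree at y = 1 by the normalization of `maassCoeff`. On [1, ∞), where the coefficient l is
nonnegative, square-integrability makes their difference zero; below 1, where l may be negative, the
Wronskian with the zero-free K-solution takes over. -/
theorem IsMaassWaveformHalf.lineCoeff_eq (hu : IsMaassWaveformHalf u) (n : ℤ) {y : ℝ} (hy : 0 < y) :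
    lineCoeff (maassFun u) n y = maassCoeff u n * waveK |(n : ℝ)| y := by
  rcases eq_or_ne n 0 with rfl | hn
  · rw [hu.lineCoeff_zero hy, hu.maassCoeff_zero, zero_mul]
  have hν1 : 1 ≤ |(n : ℝ)| := by exact_mod_cast Int.one_le_abs hn
  have hν : 0 < |(n : ℝ)| := by linarith
  have hπ := Real.pi_gt_three
  set ν := |(n : ℝ)| with hνdef
  have hν2 : ((ν : ℝ) : ℂ) ^ 2 = (n : ℂ) ^ 2 := by
    rw [hνdef, ← ofReal_pow, sq_abs]; push_cast; rfl
  set a := maassCoeff u n with ha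
  set A := lineCoeff (maassFun u) n with hA
  set B := lineCoeff (maassDz u) n with hB
  set l : ℝ → ℝ := fun y => 4 * Real.pi ^ 2 * ν ^ 2 - 1 / (4 * y ^ 2) with hl
  have h1 : ∀ y, 0 < y → HasDerivAt (fun y => A y - a * waveK ν y)
      ((2 * I * B y + 2 * Real.pi * n * A y) - a * waveK' ν y) y := fun y hy =>
    (hu.lineCoeff_hasDerivAt n hy).1.sub ((waveK_hasDerivAt hν hy).ofReal_comp.const_mul a)
  have h2 : ∀ y, 0 < y → HasDerivAt
      (fun y => (2 * I * B y + 2 * Real.pi * n * A y) - a * waveK' ν y)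
      (l y * (A y - a * waveK ν y)) y := fun y hy => by
    refine ((((hu.lineCoeff_hasDerivAt n hy).2.const_mul (2 * I)).add
      ((hu.lineCoeff_hasDerivAt n hy).1.const_mul (2 * Real.pi * n : ℂ))).sub
      ((waveK'_hasDerivAt hν hy).ofReal_comp.const_mul a)).congr_deriv ?_
    have hy0 : (y : ℂ) ≠ 0 := by exact_mod_cast hy.ne'
    rw [hl]
    push_cast
    rw [hν2]
    field_simp
    linear_combination 8 * A y * I_sq
  have hl0 : ∀ y, 1 ≤ y → 0 ≤ l y := fun y hy => by
    have e1 : 1 / (4 * y ^ 2) ≤ 1 := by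
      rw [div_le_one (by positivity)]; nlinarith
    have e2 : 1 ≤ Real.pi ^ 2 := by nlinarith
    have e3 : 1 ≤ ν ^ 2 := by nlinarith
    have : 1 ≤ Real.pi ^ 2 * ν ^ 2 := one_le_mul_of_one_le_of_one_le e2 e3
    simp only [hl]
    linarith
  have hD1 : A 1 - a * waveK ν 1 = 0 := by
    have hb : ((besselKZero (2 * Real.pi * ν) : ℝ) : ℂ) ≠ 0 :=
      ofReal_ne_zero.2 (by rw [hνdef, ← waveK_one]; exact (waveK_pos hν one_pos).ne')
    rw [ha, maassCoeff, hA, lineCoeff_one, hνdef, waveK_one, div_mul_cancel₀ _ hb, sub_self]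
  have hint : IntegrableOn (fun y => ‖A y - a * waveK ν y‖ ^ 2 / y ^ 2) (Ioi 1) := by
    obtain ⟨C, hC, hK⟩ := exists_waveK_le one_pos
    have hM : ∀ y, 1 ≤ y → waveK ν y ≤ C * waveK ν (1 / 2) := fun y hy => by
      refine (hK ν y hν1 hy).1.trans (mul_le_of_le_one_right ?_ ?_)
      · exact mul_nonneg hC.le (waveK_pos hν (by norm_num)).le
      · rw [Real.exp_le_one_iff]; nlinarith
    set M := C * waveK ν (1 / 2)
    have hinv : IntegrableOn (fun y : ℝ => (y ^ 2)⁻¹) (Ioi 1) := by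
      refine (integrableOn_Ioi_rpow_of_lt (by norm_num : (-2 : ℝ) < -1) one_pos).congr_fun
        (fun y hy => ?_) measurableSet_Ioi
      have hy0 : (0 : ℝ) < y := zero_lt_one.trans hy
      simp only [Real.rpow_neg hy0.le, Real.rpow_two]
    refine ((hu.integrableOn_strip.const_mul 2).add (hinv.const_mul (2 * (‖a‖ * M) ^ 2))).mono' ?_ ?_
    · refine ContinuousOn.aestronglyMeasurable (fun y hy => ContinuousAt.continuousWithinAt ?_)
        measurableSet_Ioi
      have hy0 : (0 : ℝ) < y := zero_lt_one.trans hy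
      exact (((h1 y hy0).continuousAt.norm).pow 2).div (continuousAt_id.pow 2) (by positivity)
    · filter_upwards [ae_restrict_mem measurableSet_Ioi] with y hy
      have hy0 : (0 : ℝ) < y := zero_lt_one.trans hy
      have hcont : ContinuousOn (maassFun u) {w : ℂ | 0 < w.im} := hu.smooth.continuousOn
      have e1 := norm_sq_lineCoeff_le hcont (fun z hz => (hu.add_one hz).1) n hy0
      have e2 : ‖a * (waveK ν y : ℂ)‖ ≤ ‖a‖ * M := by
        rw [norm_mul, Complex.norm_real, Real.norm_of_nonneg (waveK_pos hν hy0).le]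
        gcongr
        exact hM y (le_of_lt hy)
      have e3 : ‖A y - a * waveK ν y‖ ^ 2 ≤ 2 * ‖A y‖ ^ 2 + 2 * (‖a‖ * M) ^ 2 := by
        have := norm_sub_le (A y) (a * waveK ν y)
        have h4 : ‖a * (waveK ν y : ℂ)‖ ^ 2 ≤ (‖a‖ * M) ^ 2 := by gcongr
        nlinarith [sq_nonneg (‖A y‖ - ‖a * (waveK ν y : ℂ)‖), norm_nonneg (A y - a * waveK ν y),
          norm_nonneg (A y), norm_nonneg (a * (waveK ν y : ℂ))]
      rw [Real.norm_of_nonneg (by positivity), Pi.add_apply, intervalIntegral.integral_div]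
      calc _ ≤ (2 * (∫ x in (-(1 / 2) : ℝ)..(1 / 2), ‖maassFun u (x + y * I)‖ ^ 2) +
            2 * (‖a‖ * M) ^ 2) / y ^ 2 := by gcongr; linarith
        _ = _ := by simp only [maassFun]; ring
  have h0 : ∀ y, 1 ≤ y → A y - a * waveK ν y = 0 := fun y hy =>
    eq_zero_of_ode h1 h2 hl0 hD1 hint hy
  exact sub_eq_zero.1 (eq_zero_of_wronskian h1 h2 (fun y hy => waveK_hasDerivAt hν hy)
    (fun y hy => waveK'_hasDerivAt hν hy) (fun y hy => waveK_pos hν hy) h0 hy)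

theorem IsMaassWaveformHalf.lineCoeff_maassDz_eq (hu : IsMaassWaveformHalf u) (n : ℤ) {y : ℝ}
    (hy : 0 < y) : lineCoeff (maassDz u) n y =
      maassCoeff u n * (I * (Real.pi * n * waveK |(n : ℝ)| y - waveK' |(n : ℝ)| y / 2)) := by
  have h1 := (hu.lineCoeff_hasDerivAt n hy).1
  have h2 : HasDerivAt (lineCoeff (maassFun u) n) (maassCoeff u n * waveK' |(n : ℝ)| y) y := by
    rcases eq_or_ne n 0 with rfl | hn
    · rw [hu.maassCoeff_zero, zero_mul]
      refine (hasDerivAt_const y (0 : ℂ)).congr_of_eventuallyEq ?_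
      filter_upwards [lt_mem_nhds hy] with t ht using hu.lineCoeff_zero ht
    · have hν : 0 < |(n : ℝ)| := abs_pos.2 (by exact_mod_cast hn)
      refine ((waveK_hasDerivAt hν hy).ofReal_comp.const_mul (maassCoeff u n)).congr_of_eventuallyEq ?_
      filter_upwards [lt_mem_nhds hy] with t ht using hu.lineCoeff_eq n ht
  have h3 := h1.unique h2
  rw [hu.lineCoeff_eq n hy] at h3
  linear_combination (-(I / 2)) * h3 + (lineCoeff (maassDz u) n y) * I_sq

end MedianResum

namespace MedianResum

/-! ### Decay of Maass waveforms at the cusps -/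

theorem norm_expTwoPi_real (n : ℤ) (x : ℝ) : ‖expTwoPi (n * (x : ℂ))‖ = 1 := by
  rw [norm_expTwoPi]; simp

theorem exists_norm_modeK_le {h : ℝ} (hh : 0 < h) : ∃ C : ℝ, 0 < C ∧ ∀ n : ℤ, n ≠ 0 → ∀ z : ℂ,
    h ≤ z.im →
    ‖modeK n z‖ ≤ C * waveK |(n : ℝ)| (h / 2) * Real.exp (-(|(n : ℝ)| * z.im)) ∧
    ‖modeK' n z‖ ≤ C * waveK |(n : ℝ)| (h / 2) * Real.exp (-(|(n : ℝ)| * z.im)) := by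
  obtain ⟨C, hC, hK⟩ := exists_waveK_le hh
  have hπ := Real.pi_gt_three
  refine ⟨(Real.pi + 1) * C, by positivity, fun n hn z hz => ?_⟩
  have hν1 : 1 ≤ |(n : ℝ)| := by exact_mod_cast Int.one_le_abs hn
  have hν : 0 < |(n : ℝ)| := by linarith
  obtain ⟨k1, k2, k3⟩ := hK _ _ hν1 hz
  have hK0 := waveK_pos hν (hh.trans_le hz)
  set E := C * waveK |(n : ℝ)| (h / 2) * Real.exp (-(|(n : ℝ)| * z.im)) with hE
  have hE0 : 0 < E := hK0.trans_le k1
  rw [show (Real.pi + 1) * C * waveK |(n : ℝ)| (h / 2) * Real.exp (-(|(n : ℝ)| * z.im)) =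
    (Real.pi + 1) * E by rw [hE]; ring]
  constructor
  · rw [modeK, norm_mul, norm_expTwoPi_real, mul_one, Complex.norm_real, Real.norm_of_nonneg hK0.le]
    nlinarith
  · rw [modeK', norm_mul, norm_expTwoPi_real, mul_one, norm_mul, norm_I, one_mul]
    refine (norm_sub_le _ _).trans ?_
    rw [norm_mul, norm_mul, norm_div, Complex.norm_real, Complex.norm_real, Complex.norm_real,
      Complex.norm_intCast, Real.norm_of_nonneg Real.pi_pos.le, Real.norm_of_nonneg hK0.le,
      Real.norm_eq_abs, Complex.norm_ofNat]
    have : Real.pi * |(n : ℝ)| * waveK |(n : ℝ)| z.im ≤ Real.pi * E := by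
      rw [mul_assoc]; gcongr
    linarith

/-- Uniform exponential decay of a function and its derivative at `i∞`. -/
def DecaysAtInfty (a p : ℂ → ℂ) : Prop :=
  ∀ h : ℝ, 0 < h → ∃ C : ℝ, 0 < C ∧ ∀ z : ℂ, h ≤ z.im →
    ‖a z‖ ≤ C * Real.exp (-z.im) ∧ ‖p z‖ ≤ C * Real.exp (-z.im)

theorem decaysAtInfty_modeK {n : ℤ} (hn : n ≠ 0) : DecaysAtInfty (modeK n) (modeK' n) := by
  intro h hh
  obtain ⟨C, hC, hb⟩ := exists_norm_modeK_le hh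
  have hν1 : 1 ≤ |(n : ℝ)| := by exact_mod_cast Int.one_le_abs hn
  have hK0 := waveK_pos (by linarith : 0 < |(n : ℝ)|) (half_pos hh)
  refine ⟨C * waveK |(n : ℝ)| (h / 2), by positivity, fun z hz => ?_⟩
  have he : Real.exp (-(|(n : ℝ)| * z.im)) ≤ Real.exp (-z.im) := by
    refine Real.exp_le_exp.2 (neg_le_neg ?_)
    nlinarith
  exact ⟨(hb n hn z hz).1.trans (by gcongr), (hb n hn z hz).2.trans (by gcongr)⟩

theorem summable_exp_abs {h : ℝ} (hh : 0 < h) :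
    Summable fun n : ℤ => Real.exp (-(|(n : ℝ)| * h)) := by
  have hnat : Summable fun n : ℕ => Real.exp (-((n : ℝ) * h)) := by
    have := Real.summable_exp_nat_mul_iff (a := -h)
    simpa using this.2 (by linarith)
  refine Summable.of_nat_of_neg ?_ ?_ <;> simpa using hnat

/-- The products of `maassCoeff` with the modes at height h/2 are Fourier coefficients of u on that
line, hence bounded in n. At heights ≥ h the modes are exponentially smaller than at h/2, so no
lower bound for K₀ is needed. -/
theorem IsMaassWaveformHalf.exists_summable_bound {u : UpperHalfPlane → ℂ}
    (hu : IsMaassWaveformHalf u) {h : ℝ} (hh : 0 < h) :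
    ∃ b : ℤ → ℝ, Summable b ∧ (∀ n, 0 ≤ b n) ∧ ∀ (n : ℤ) (z : ℂ), h ≤ z.im →
      ‖maassCoeff u n * modeK n z‖ ≤ b n * Real.exp (-z.im) ∧
      ‖maassCoeff u n * modeK' n z‖ ≤ b n * Real.exp (-z.im) := by
  obtain ⟨C, hC, hb⟩ := exists_norm_modeK_le hh
  have hcont : Continuous fun x : ℝ => maassFun u (x + (h / 2 : ℝ) * I) :=
    continuousOn_line hu.smooth.continuousOn (half_pos hh)
  obtain ⟨M, hM⟩ := (isCompact_Icc (a := (0 : ℝ)) (b := 1)).exists_bound_of_continuousOn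
    hcont.continuousOn
  have hM0 : 0 ≤ M := (norm_nonneg _).trans (hM 0 (by simp))
  have hcoef : ∀ n : ℤ, n ≠ 0 → ‖maassCoeff u n‖ * waveK |(n : ℝ)| (h / 2) ≤ M := by
    intro n hn
    have hν : 0 < |(n : ℝ)| := abs_pos.2 (by exact_mod_cast hn)
    have h1 := hu.lineCoeff_eq n (half_pos hh)
    have h2 : ‖lineCoeff (maassFun u) n (h / 2)‖ ≤ M * |(1 : ℝ) - 0| := by
      refine intervalIntegral.norm_integral_le_of_norm_le_const fun x hx => ?_
      rw [uIoc_of_le zero_le_one] at hx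
      have : ‖expTwoPi (-n * (x : ℂ))‖ = 1 := by rw [norm_expTwoPi]; simp
      rw [norm_mul, this, mul_one]
      exact hM x ⟨hx.1.le, hx.2⟩
    rw [h1, norm_mul, Complex.norm_real, Real.norm_of_nonneg (waveK_pos hν (half_pos hh)).le] at h2
    simpa using h2
  refine ⟨fun n => C * M * Real.exp h * Real.exp (-(|(n : ℝ)| * h)),
    (summable_exp_abs hh).mul_left _, fun n => by positivity, fun n z hz => ?_⟩
  rcases eq_or_ne n 0 with rfl | hn
  · rw [hu.maassCoeff_zero, zero_mul, zero_mul, norm_zero]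
    constructor <;> positivity
  have hν1 : 1 ≤ |(n : ℝ)| := by exact_mod_cast Int.one_le_abs hn
  have he : Real.exp (-(|(n : ℝ)| * z.im)) ≤
      Real.exp h * Real.exp (-(|(n : ℝ)| * h)) * Real.exp (-z.im) := by
    rw [← Real.exp_add, ← Real.exp_add]
    refine Real.exp_le_exp.2 ?_
    nlinarith
  have key : ∀ x : ℂ, ‖x‖ ≤ C * waveK |(n : ℝ)| (h / 2) * Real.exp (-(|(n : ℝ)| * z.im)) →
      ‖maassCoeff u n * x‖ ≤ C * M * Real.exp h * Real.exp (-(|(n : ℝ)| * h)) * Real.exp (-z.im) := by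
    intro x hx
    rw [norm_mul]
    calc _ ≤ ‖maassCoeff u n‖ * (C * waveK |(n : ℝ)| (h / 2) * Real.exp (-(|(n : ℝ)| * z.im))) := by
          gcongr
      _ = C * (‖maassCoeff u n‖ * waveK |(n : ℝ)| (h / 2)) * Real.exp (-(|(n : ℝ)| * z.im)) := by ring
      _ ≤ C * M * (Real.exp h * Real.exp (-(|(n : ℝ)| * h)) * Real.exp (-z.im)) := by
          gcongr
          exact hcoef n hn
      _ = _ := by ring
  exact ⟨key _ (hb n hn z hz).1, key _ (hb n hn z hz).2⟩

theorem IsMaassWaveformHalf.hasSum {u : UpperHalfPlane → ℂ} (hu : IsMaassWaveformHalf u) {z : ℂ}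
    (hz : 0 < z.im) :
    HasSum (fun n : ℤ => maassCoeff u n * modeK n z) (maassFun u z) ∧
    HasSum (fun n : ℤ => maassCoeff u n * modeK' n z) (maassDz u z) := by
  obtain ⟨b, hb, -, hle⟩ := hu.exists_summable_bound hz
  constructor
  · have := hasSum_lineCoeff (f := maassFun u) hu.smooth.continuousOn
      (fun z hz => (hu.add_one hz).1) hz ?_
    · convert this using 2 with n
      rw [hu.lineCoeff_eq n hz, modeK]
      ring
    · refine Summable.of_norm_bounded (hb.mul_right (Real.exp (-z.im))) fun n => ?_
      have := (hle n z le_rfl).1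
      rwa [modeK, ← mul_assoc, norm_mul, norm_expTwoPi_real, mul_one, ← hu.lineCoeff_eq n hz] at this
  · have := hasSum_lineCoeff (f := maassDz u) hu.contDiffOn_maassDz.continuousOn
      (fun z hz => (hu.add_one hz).2) hz ?_
    · convert this using 2 with n
      rw [hu.lineCoeff_maassDz_eq n hz, modeK']
      ring
    · refine Summable.of_norm_bounded (hb.mul_right (Real.exp (-z.im))) fun n => ?_
      have := (hle n z le_rfl).2
      rwa [modeK', ← mul_assoc, norm_mul, norm_expTwoPi_real, mul_one,
        ← hu.lineCoeff_maassDz_eq n hz] at this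

theorem IsMaassWaveformHalf.decaysAtInfty {u : UpperHalfPlane → ℂ} (hu : IsMaassWaveformHalf u) :
    DecaysAtInfty (maassFun u) (maassDz u) := by
  intro h hh
  obtain ⟨b, hb, hb0, hle⟩ := hu.exists_summable_bound hh
  have hS : 0 ≤ ∑' n, b n := tsum_nonneg hb0
  refine ⟨∑' n, b n + 1, by positivity, fun z hz => ?_⟩
  have hz0 := hh.trans_le hz
  have hs := hb.hasSum.mul_right (Real.exp (-z.im))
  have hle' : (∑' n, b n) * Real.exp (-z.im) ≤ (∑' n, b n + 1) * Real.exp (-z.im) := by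
    gcongr; linarith
  exact ⟨((hu.hasSum hz0).1.norm_le_of_bounded hs fun n => (hle n z hz).1).trans hle',
    ((hu.hasSum hz0).2.norm_le_of_bounded hs fun n => (hle n z hz).2).trans hle'⟩

/-- Rapid decay of a Maass waveform and its derivative along sectors at the cusp `-d/c`. -/
theorem IsMaassWaveformHalf.exists_norm_le_sector {u : UpperHalfPlane → ℂ}
    (hu : IsMaassWaveformHalf u) {γ : SL(2, ℤ)} (hc : γ 1 0 ≠ 0) {δ R : ℝ} (hδ : 0 < δ)
    (hR : 0 < R) :
    ∃ C A : ℝ, 0 < C ∧ 0 < A ∧ ∀ t : ℝ, 0 < t → t ≤ 1 → ∀ ζ : ℂ, δ ≤ ζ.im → ‖ζ‖ ≤ R →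
      ‖maassFun u (((-(γ 1 1 : ℝ) / (γ 1 0 : ℝ) : ℝ) : ℂ) + t * ζ)‖ ≤ C * Real.exp (-(A * t⁻¹)) ∧
      ‖maassDz u (((-(γ 1 1 : ℝ) / (γ 1 0 : ℝ) : ℝ) : ℂ) + t * ζ)‖ ≤ C * Real.exp (-(A * t⁻¹)) := by
  set c : ℝ := (γ 1 0 : ℝ) with hcdef
  have hc0 : 0 < |c| := abs_pos.2 (by rw [hcdef]; exact_mod_cast hc)
  have hc2 : c ^ 2 = |c| ^ 2 := (sq_abs c).symm
  set A : ℝ := δ / (|c| ^ 2 * R ^ 2) with hA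
  have hA0 : 0 < A := by positivity
  obtain ⟨C₁, hC₁, hb⟩ := hu.decaysAtInfty A hA0
  -- The weight-2 factor of ∂u/∂z is of size t^{-2} and is absorbed by half of the decay.
  obtain ⟨C₂, hC₂, hx⟩ := rpow_le_mul_exp 2 one_pos (half_pos hA0)
  refine ⟨C₁ + C₁ * (((|c| * δ) ^ 2)⁻¹ * C₂), A / 2, by positivity, half_pos hA0,
    fun t ht ht1 ζ hζ hζR => ?_⟩
  have hζ0 : δ ≤ ‖ζ‖ := hζ.trans ((le_abs_self _).trans (Complex.abs_im_le_norm ζ))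
  have htζ : 0 < ((t : ℂ) * ζ).im := by rw [im_ofReal_mul]; exact mul_pos ht (hδ.trans_le hζ)
  have hnorm : ‖(t : ℂ) * ζ‖ = t * ‖ζ‖ := by
    rw [norm_mul, Complex.norm_real, Real.norm_of_nonneg ht.le]
  have ht1' : 1 ≤ t⁻¹ := by rw [one_le_inv₀ ht]; exact ht1
  set τ : ℂ := ((-(γ 1 1 : ℝ) / c : ℝ) : ℂ) + t * ζ with hτ
  have hτ0 : 0 < τ.im := by rw [hτ]; simpa using htζ
  have him : A * t⁻¹ ≤ (γ • ofComplex τ).im := by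
    rw [(smul_im_of_add hc htζ).2, hnorm, im_ofReal_mul, ← hcdef, hc2]
    have e : t * ζ.im / (|c| ^ 2 * (t * ‖ζ‖) ^ 2) = ζ.im / (|c| ^ 2 * ‖ζ‖ ^ 2) * t⁻¹ := by
      have : ‖ζ‖ ≠ 0 := (hδ.trans_le hζ0).ne'
      field_simp
    rw [e]
    have : 0 < ‖ζ‖ := hδ.trans_le hζ0
    have : 0 ≤ ζ.im := hδ.le.trans hζ
    refine mul_le_mul_of_nonneg_right ?_ (inv_nonneg.2 ht.le)
    rw [hA]
    gcongr
  obtain ⟨b1, b2⟩ := hb ((γ • ofComplex τ : UpperHalfPlane) : ℂ)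
    ((le_mul_of_one_le_right hA0.le ht1').trans him)
  have hexp : Real.exp (-((γ • ofComplex τ : UpperHalfPlane) : ℂ).im) ≤ Real.exp (-(A * t⁻¹)) :=
    Real.exp_le_exp.2 (neg_le_neg him)
  have hhalf : Real.exp (-(A * t⁻¹)) ≤ Real.exp (-(A / 2 * t⁻¹)) := by
    refine Real.exp_le_exp.2 (neg_le_neg ?_)
    have : 0 < A * t⁻¹ := by positivity
    linarith
  constructor
  · rw [hu.maassFun_smul γ]
    calc _ ≤ C₁ * Real.exp (-(A / 2 * t⁻¹)) :=
          b1.trans (mul_le_mul_of_nonneg_left (hexp.trans hhalf) hC₁.le)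
      _ ≤ _ := by gcongr; exact le_add_of_nonneg_right (by positivity)
  · have hden : ((γ 1 0 : ℤ) : ℂ) * τ + ((γ 1 1 : ℤ) : ℂ) = ((γ 1 0 : ℤ) : ℂ) * (t * ζ) := by
      have := (smul_im_of_add hc htζ).1
      rwa [UpperHalfPlane.ofComplex_apply_of_im_pos hτ0] at this
    rw [hu.maassDz_smul γ hτ0, norm_mul, hden, norm_inv, norm_pow, norm_mul, hnorm,
      Complex.norm_intCast, ← hcdef]
    have h2 : ((|c| * (t * ‖ζ‖)) ^ 2)⁻¹ ≤ ((|c| * δ) ^ 2)⁻¹ * (C₂ * Real.exp (A / 2 * t⁻¹)) := by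
      have := hx t⁻¹ ht1'
      rw [Real.rpow_two] at this
      calc _ ≤ ((|c| * (t * δ)) ^ 2)⁻¹ := by gcongr
        _ = ((|c| * δ) ^ 2)⁻¹ * t⁻¹ ^ 2 := by rw [← inv_pow, ← inv_pow, ← mul_pow]; congr 1; field_simp
        _ ≤ _ := by gcongr
    calc _ ≤ C₁ * Real.exp (-(A * t⁻¹)) * (((|c| * δ) ^ 2)⁻¹ * (C₂ * Real.exp (A / 2 * t⁻¹))) := by
          gcongr
          exact b2.trans (mul_le_mul_of_nonneg_left hexp hC₁.le)
      _ = C₁ * (((|c| * δ) ^ 2)⁻¹ * C₂) * (Real.exp (-(A * t⁻¹)) * Real.exp (A / 2 * t⁻¹)) := by ring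
      _ = C₁ * (((|c| * δ) ^ 2)⁻¹ * C₂) * Real.exp (-(A / 2 * t⁻¹)) := by
          rw [← Real.exp_add]; ring_nf
      _ ≤ _ := by gcongr; exact le_add_of_nonneg_left hC₁.le

end MedianResum

namespace MedianResum

/-! ### Ray integrals of the closed form of two eigenfunctions -/

variable {α α' β : ℝ} {w z : ℂ} {a p : ℂ → ℂ}

theorem le_norm_I_mul_conj_sub (z w : ℂ) : z.im + w.im ≤ ‖I * ((starRingEnd ℂ) z - w)‖ := by
  rw [← re_I_mul_conj_sub]
  exact re_le_norm _

/-- The modulus of i(z̄ - w) is at least Im z + Im w ≥ Im z, so its power -1/2 absorbs √y. -/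
theorem norm_waveV_le (hw : 0 < w.im) (hz : 0 < z.im) :
    ‖waveV β w z‖ ≤ ‖branch β (1 / 2) (z - w)‖ := by
  have h1 := le_norm_I_mul_conj_sub z w
  have h2 : z.im ≤ ‖I * ((starRingEnd ℂ) z - w)‖ := by linarith
  have h0 := norm_pos_iff.1 (hz.trans_le h2)
  have e : -((1 / 2 : ℝ) : ℂ) = ((-(1 / 2) : ℝ) : ℂ) := by push_cast; ring
  rw [waveV, norm_mul, norm_mul, Complex.norm_real, Real.norm_of_nonneg (Real.sqrt_nonneg _), e,
    norm_cpow_ofReal_eq h0, mul_right_comm]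
  refine mul_le_of_le_one_left (norm_nonneg _) ?_
  rw [Real.sqrt_eq_rpow, Real.rpow_neg (norm_nonneg _), ← div_eq_mul_inv]
  refine div_le_one_of_le₀ (Real.rpow_le_rpow hz.le h2 (by norm_num)) (by positivity)

theorem norm_waveV'_le (hw : 0 < w.im) (hz : 0 < z.im) :
    ‖waveV' β w z‖ ≤ (z.im ^ 2)⁻¹ * ‖branch β (-(1 / 2)) (z - w)‖ := by
  have h1 := le_norm_I_mul_conj_sub z w
  have h2 : z.im ≤ ‖I * ((starRingEnd ℂ) z - w)‖ := by linarith
  have h0 := norm_pos_iff.1 (hz.trans_le h2)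
  have e : -((3 / 2 : ℝ) : ℂ) = ((-(3 / 2) : ℝ) : ℂ) := by push_cast; ring
  have h3 : ‖(-(1 / 4) : ℂ)‖ ≤ 1 := by norm_num
  have h4 : ‖I * ((starRingEnd ℂ) z - w)‖ ^ (-(3 / 2) : ℝ) ≤ z.im ^ (-(3 / 2) : ℝ) :=
    Real.rpow_le_rpow_of_nonpos hz h2 (by norm_num)
  have h5 : (√z.im)⁻¹ * z.im ^ (-(3 / 2) : ℝ) = (z.im ^ 2)⁻¹ := by
    rw [Real.sqrt_eq_rpow, ← Real.rpow_neg hz.le, ← Real.rpow_add hz, ← Real.rpow_two,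
      ← Real.rpow_neg hz.le]
    norm_num
  rw [waveV', norm_mul, norm_mul, norm_mul, Complex.norm_real,
    Real.norm_of_nonneg (inv_nonneg.2 (Real.sqrt_nonneg _)), e, norm_cpow_ofReal_eq h0, ← h5]
  calc _ ≤ 1 * (√z.im)⁻¹ * ‖branch β (-(1 / 2)) (z - w)‖ * z.im ^ (-(3 / 2) : ℝ) := by gcongr
    _ = _ := by ring

/-- The constant B depends on h, d, ε and R only. Uniformity in w serves for holomorphy in w and for
the limit w → i∞, uniformity in a and p for summing over Fourier modes. -/
theorem exists_norm_waveForm_le {h d ε : ℝ} (R : ℝ) (hh : 0 < h) (hd : 0 < d) (hε : 0 < ε) :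
    ∃ B : ℝ, 0 < B ∧ ∀ {β t C : ℝ} {w z : ℂ} {a p : ℂ → ℂ}, 0 < w.im → h ≤ z.im → d ≤ ‖z - w‖ →
      ‖z - w‖ ≤ R + t → ‖a z‖ ≤ C → ‖p z‖ ≤ C →
      ‖waveForm a p β w z‖ ≤ C * (B * Real.exp (ε * t)) := by
  obtain ⟨C₁, hC₁, h₁⟩ := rpow_le_mul_exp (-(1 / 2)) hd hε
  obtain ⟨C₂, hC₂, h₂⟩ := rpow_le_mul_exp (1 / 2) hd hε
  refine ⟨(C₁ + (h ^ 2)⁻¹ * C₂) * Real.exp (ε * R), by positivity,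
    fun {β t C w z a p} hw hz hdz hR ha hp => ?_⟩
  have hz0 := hh.trans_le hz
  have hne := norm_pos_iff.1 (hd.trans_le hdz)
  have hC := (norm_nonneg _).trans ha
  have hexp : Real.exp (ε * ‖z - w‖) ≤ Real.exp (ε * R) * Real.exp (ε * t) := by
    rw [← Real.exp_add, ← mul_add]; gcongr
  have b1 : ‖branch β (1 / 2) (z - w)‖ ≤ C₁ * (Real.exp (ε * R) * Real.exp (ε * t)) := by
    rw [norm_branch _ hne]
    exact (h₁ _ hdz).trans (by gcongr)
  have b2 : ‖branch β (-(1 / 2)) (z - w)‖ ≤ C₂ * (Real.exp (ε * R) * Real.exp (ε * t)) := by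
    rw [norm_branch _ hne, neg_neg]
    exact (h₂ _ hdz).trans (by gcongr)
  refine (norm_wirt_le _ _).trans ?_
  rw [norm_mul, norm_mul]
  calc _ ≤ C * (C₁ * (Real.exp (ε * R) * Real.exp (ε * t))) +
        C * ((h ^ 2)⁻¹ * (C₂ * (Real.exp (ε * R) * Real.exp (ε * t)))) := by
        gcongr
        · exact (norm_waveV_le hw hz0).trans b1
        · refine (norm_waveV'_le hw hz0).trans ?_
          gcongr
    _ = _ := by ring

/-- The domain of `waveForm a p β w`. -/
def waveDomain (β : ℝ) (w : ℂ) : Set ℂ := {z | 0 < z.im ∧ z - w ∈ halfPlane β}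

theorem convex_waveDomain (β : ℝ) (w : ℂ) : Convex ℝ (waveDomain β w) := by
  have hset : waveDomain β w = {z | 0 < z.im} ∩ (fun z => -w + z) ⁻¹' halfPlane β := by
    ext z; simp [neg_add_eq_sub, waveDomain]
  rw [hset]
  exact (convex_halfSpace_im_gt 0).inter ((convex_halfPlane β).translate_preimage_right (-w))

theorem isOpen_waveDomain (β : ℝ) (w : ℂ) : IsOpen (waveDomain β w) :=
  (isOpen_lt continuous_const continuous_im).inter
    ((isOpen_halfPlane β).preimage (by fun_prop : Continuous fun z : ℂ => z - w))

theorem add_mul_dir_im (z : ℂ) (t α : ℝ) : (z + t * dir α).im = z.im + t * Real.sin α := by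
  rw [add_im, im_ofReal_mul, dir_im]

theorem le_norm_ray_sub (h : IsSide α β) {d t : ℝ} (hz : d ≤ ((z - w) * dir (-β)).re) :
    d ≤ ‖z + t * dir α - w‖ := by
  refine le_trans ?_ (re_mul_le_norm _ β)
  rwa [add_sub_right_comm, add_mul, add_re, mul_assoc (t : ℂ), re_ofReal_mul, h.re_eq_zero, mul_zero,
    add_zero]

theorem norm_ray_sub_le {t : ℝ} (ht : 0 ≤ t) : ‖z + t * dir α - w‖ ≤ ‖z - w‖ + t := by
  rw [add_sub_right_comm]
  refine (norm_add_le _ _).trans (add_le_add le_rfl ?_)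
  rw [norm_mul, norm_dir, Complex.norm_real, Real.norm_of_nonneg ht, mul_one]

theorem rayForm_waveForm (hw : 0 < w.im) (hwave : IsWave a p) (hdec : DecaysAtInfty a p)
    (hα : α ∈ Ioo 0 Real.pi) (h : IsSide α β) :
    RayForm (waveDomain β w) (dir α) (waveForm a p β w) where
  convex := convex_waveDomain β w
  isOpen := isOpen_waveDomain β w
  add_mem := fun z hz t ht => by
    refine ⟨?_, ?_⟩
    · rw [add_mul_dir_im]
      have := Real.sin_pos_of_mem_Ioo hα
      have := hz.1
      positivity
    · rw [add_sub_right_comm]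
      exact add_mul_mem_halfPlane h.re_eq_zero hz.2 t
  cont := (exists_primitive_waveForm hwave hw (convex_waveDomain β w) (isOpen_waveDomain β w)
    (fun z hz => hz.1) (fun z hz => hz.2)).2
  prim := (exists_primitive_waveForm hwave hw (convex_waveDomain β w) (isOpen_waveDomain β w)
    (fun z hz => hz.1) (fun z hz => hz.2)).1
  decay := fun P hP Q hQ => by
    have hsin := Real.sin_pos_of_mem_Ioo hα
    have hh : 0 < min P.im Q.im := lt_min hP.1 hQ.1
    obtain ⟨d, hd, hdz⟩ := exists_lower_bound_segment hP.2 hQ.2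
    obtain ⟨C, hC, hCb⟩ := hdec _ hh
    obtain ⟨B, hB, hb⟩ := exists_norm_waveForm_le (‖P - w‖ + ‖Q - w‖) hh hd (half_pos hsin)
    refine ⟨C * B, Real.sin α / 2, half_pos hsin, fun z hz t ht => ?_⟩
    have hz' : z - w ∈ segment ℝ (P - w) (Q - w) :=
      add_segment_mem (P := P - w) (Q := Q - w) (v := w) (z := z) (by simpa using hz)
    have h1 := min_im_le_of_mem_segment hz
    have him : min P.im Q.im ≤ (z + t * dir α).im := by
      rw [add_mul_dir_im]
      have : 0 ≤ t * Real.sin α := by positivity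
      linarith
    have hexp : Real.exp (-(z + t * dir α).im) ≤ Real.exp (-(Real.sin α * t)) := by
      refine Real.exp_le_exp.2 (neg_le_neg ?_)
      rw [add_mul_dir_im]
      linarith
    have key := hb (β := β) (t := t) (C := C * Real.exp (-(Real.sin α * t))) (a := a) (p := p) hw him
      (le_norm_ray_sub h (hdz _ hz'))
      ((norm_ray_sub_le ht).trans (by gcongr; exact norm_le_of_mem_segment hz'))
      ((hCb _ him).1.trans (by gcongr)) ((hCb _ him).2.trans (by gcongr))
    refine key.trans_eq ?_
    rw [show C * Real.exp (-(Real.sin α * t)) * (B * Real.exp (Real.sin α / 2 * t)) =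
      C * B * (Real.exp (-(Real.sin α * t)) * Real.exp (Real.sin α / 2 * t)) by ring,
      ← Real.exp_add]
    ring_nf

theorem waveForm_eq_neg (hα : α ∈ Ioo 0 Real.pi) (hα' : α' ∈ Ioo 0 Real.pi) (h : α < α')
    (hz : z ∈ waveDomain (α - Real.pi / 2) w ∩ waveDomain (α' + Real.pi / 2) w) :
    waveForm a p (α' + Real.pi / 2) w z = -waveForm a p (α - Real.pi / 2) w z := by
  have h1 := branch_overlap_sides hα hα' h 1 hz.1.2 hz.2.2
  have h2 := branch_overlap_sides hα hα' h 2 hz.1.2 hz.2.2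
  norm_num at h1 h2
  have e1 : waveV (α' + Real.pi / 2) w z = -waveV (α - Real.pi / 2) w z := by
    rw [waveV, waveV, h1]; ring
  have e2 : waveV' (α' + Real.pi / 2) w z = -waveV' (α - Real.pi / 2) w z := by
    rw [waveV', waveV', h2]; ring
  rw [waveForm, waveForm, e1, e2]
  ext v
  simp only [wirt_apply, neg_apply]
  ring

/-- The sum of the two ray integrals of `waveForm a p β w` with vertex `P`. -/
def waveSum (a p : ℂ → ℂ) (α α' : ℝ) (w P : ℂ) : ℂ :=
  rayIntegral (waveForm a p (α - Real.pi / 2) w) (dir α) P +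
    rayIntegral (waveForm a p (α' + Real.pi / 2) w) (dir α') P

theorem waveSum_eq (hw : 0 < w.im) (hwave : IsWave a p) (hdec : DecaysAtInfty a p)
    (hα : α ∈ Ioo 0 Real.pi) (hα' : α' ∈ Ioo 0 Real.pi) (h : α < α') {P Q : ℂ}
    (hP : P ∈ waveDomain (α - Real.pi / 2) w ∩ waveDomain (α' + Real.pi / 2) w)
    (hQ : Q ∈ waveDomain (α - Real.pi / 2) w ∩ waveDomain (α' + Real.pi / 2) w) :
    waveSum a p α α' w P = waveSum a p α α' w Q :=
  (rayForm_waveForm hw hwave hdec hα (isSide_right α)).add_eq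
    (rayForm_waveForm hw hwave hdec hα' (isSide_left α'))
    (fun _ hz => waveForm_eq_neg hα hα' h hz) hP hQ

theorem modeK_add_real (n : ℤ) (z : ℂ) (r : ℝ) :
    modeK n (z + r) = expTwoPi (n * r) * modeK n z ∧
      modeK' n (z + r) = expTwoPi (n * r) * modeK' n z := by
  have h1 : (z + r).im = z.im := by simp
  have h2 : expTwoPi (n * ((z + r).re : ℂ)) = expTwoPi (n * r) * expTwoPi (n * (z.re : ℂ)) := by
    rw [← expTwoPi_add]; congr 1; simp; ring
  rw [modeK, modeK, modeK', modeK', h1, h2]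
  constructor <;> ring

theorem waveV_add_real (β : ℝ) (w z : ℂ) (r : ℝ) :
    waveV β (w + r) (z + r) = waveV β w z ∧ waveV' β (w + r) (z + r) = waveV' β w z := by
  have h1 : (z + r).im = z.im := by simp
  have h2 : z + r - (w + r) = z - w := by ring
  have h3 : (starRingEnd ℂ) (z + r) - (w + r) = (starRingEnd ℂ) z - w := by
    rw [map_add, conj_ofReal]; ring
  rw [waveV, waveV, waveV', waveV', h1, h2, h3]
  exact ⟨rfl, rfl⟩

theorem waveSum_add_real (n : ℤ) (α α' : ℝ) (w P : ℂ) (r : ℝ) :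
    waveSum (modeK n) (modeK' n) α α' (w + r) (P + r) =
      expTwoPi (n * r) * waveSum (modeK n) (modeK' n) α α' w P := by
  have key : ∀ α β : ℝ, rayIntegral (waveForm (modeK n) (modeK' n) β (w + r)) (dir α) (P + r) =
      expTwoPi (n * r) * rayIntegral (waveForm (modeK n) (modeK' n) β w) (dir α) P := by
    intro α β
    rw [rayIntegral, rayIntegral, ← integral_const_mul]
    refine integral_congr_ae (Eventually.of_forall fun t => ?_)
    simp only [waveForm, wirt_apply]
    rw [add_right_comm, (modeK_add_real n _ r).1, (modeK_add_real n _ r).2, (waveV_add_real β w _ r).1,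
      (waveV_add_real β w _ r).2]
    ring
  rw [waveSum, waveSum, key, key, mul_add]

end MedianResum

namespace MedianResum

/-! ### The ray integrals of the Fourier modes -/

variable {α α' β : ℝ} {a p : ℂ → ℂ}

theorem waveV_differentiableAt {w z : ℂ} (hw : 0 < w.im) (hz : z ∈ waveDomain β w) :
    DifferentiableAt ℂ (fun w => waveV β w z) w ∧ DifferentiableAt ℂ (fun w => waveV' β w z) w := by
  have h1 : ∀ s : ℝ, DifferentiableAt ℂ (fun w => branch β s (z - w)) w := fun s =>
    (branch_hasDerivAt s hz.2).differentiableAt.comp w ((differentiableAt_const z).sub differentiableAt_id)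
  have h2 : ∀ s : ℂ, DifferentiableAt ℂ (fun w => (I * ((starRingEnd ℂ) z - w)) ^ s) w := fun s => by
    refine DifferentiableAt.cpow_const (by fun_prop) (Or.inl ?_)
    rw [re_I_mul_conj_sub]
    exact add_pos hz.1 hw
  exact ⟨((differentiableAt_const _).mul (h1 _)).mul (h2 _),
    ((differentiableAt_const _).mul (h1 _)).mul (h2 _)⟩

theorem rayIntegral_waveForm_differentiableAt (hwave : IsWave a p) (hdec : DecaysAtInfty a p)
    (hα : α ∈ Ioo 0 Real.pi) (h : IsSide α β) {w P : ℂ} (hw : 0 < w.im) (hP : P ∈ waveDomain β w) :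
    DifferentiableAt ℂ (fun w => rayIntegral (waveForm a p β w) (dir α) P) w := by
  have hsin := Real.sin_pos_of_mem_Ioo hα
  have hd : 0 < ((P - w) * dir (-β)).re := hP.2
  set d := ((P - w) * dir (-β)).re / 2 with hddef
  have hd0 : 0 < d := half_pos hd
  set U : Set ℂ := {v | 0 < v.im} ∩ {v | d < ((P - v) * dir (-β)).re} ∩ {v | ‖P - v‖ < ‖P - w‖ + 1}
  have hU : IsOpen U := ((isOpen_lt continuous_const continuous_im).inter
    (isOpen_lt continuous_const (by fun_prop))).inter (isOpen_lt (by fun_prop) continuous_const)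
  have hwU : w ∈ U := by
    refine ⟨⟨hw, ?_⟩, ?_⟩
    · change d < ((P - w) * dir (-β)).re
      rw [hddef]; linarith
    · change ‖P - w‖ < ‖P - w‖ + 1
      linarith
  have hmem : ∀ v ∈ U, P ∈ waveDomain β v := fun v hv => ⟨hP.1, hd0.trans hv.1.2⟩
  obtain ⟨C, hC, hCb⟩ := hdec _ hP.1
  obtain ⟨B, hB, hb⟩ := exists_norm_waveForm_le (‖P - w‖ + 1) hP.1 hd0 (half_pos hsin)
  refine hasDerivAt_integral_of_holomorphic hU
    (F := fun v (t : ℝ) => waveForm a p β v (P + t * dir α) (dir α))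
    (B := fun t => C * B * Real.exp (-(Real.sin α / 2) * t))
    ((integrableOn_exp_mul_Ioi (by linarith) 0).const_mul _) ?_ ?_ ?_ hwU
  · intro v hv
    have hr := rayForm_waveForm hv.1.1 hwave hdec hα h
    exact (hr.continuousOn_apply (fun t ht => hr.add_mem P (hmem v hv) t
      (le_of_lt ht))).aestronglyMeasurable measurableSet_Ioi
  · filter_upwards [ae_restrict_mem measurableSet_Ioi] with t ht v hv
    have ht0 : 0 ≤ t := le_of_lt ht
    have him : P.im ≤ (P + t * dir α).im := by
      rw [add_mul_dir_im]
      have : 0 ≤ t * Real.sin α := by positivity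
      linarith
    have hexp : Real.exp (-(P + t * dir α).im) ≤ Real.exp (-(Real.sin α * t)) := by
      refine Real.exp_le_exp.2 (neg_le_neg ?_)
      rw [add_mul_dir_im]
      have : 0 < P.im := hP.1
      linarith
    have key := hb (β := β) (t := t) (C := C * Real.exp (-(Real.sin α * t))) (a := a) (p := p) hv.1.1
      him (le_norm_ray_sub h (le_of_lt hv.1.2))
      ((norm_ray_sub_le ht0).trans (by gcongr; exact le_of_lt hv.2))
      ((hCb _ him).1.trans (by gcongr)) ((hCb _ him).2.trans (by gcongr))
    refine (ContinuousLinearMap.le_opNorm _ _).trans ?_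
    rw [norm_dir, mul_one]
    refine key.trans_eq ?_
    rw [show C * Real.exp (-(Real.sin α * t)) * (B * Real.exp (Real.sin α / 2 * t)) =
      C * B * (Real.exp (-(Real.sin α * t)) * Real.exp (Real.sin α / 2 * t)) by ring,
      ← Real.exp_add]
    ring_nf
  · filter_upwards [ae_restrict_mem measurableSet_Ioi] with t ht v hv
    have hz := (rayForm_waveForm hv.1.1 hwave hdec hα h).add_mem P (hmem v hv) t (le_of_lt ht)
    obtain ⟨h1, h2⟩ := waveV_differentiableAt hv.1.1 hz
    simp only [waveForm, wirt_apply]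
    exact (((h1.const_mul _).mul_const _).add ((h2.const_mul _).mul_const _)).differentiableWithinAt

/-- A common vertex for the two rays, below `w`. -/
def waveVertex (α α' : ℝ) (w : ℂ) : ℂ := w + (w.im / 2 : ℝ) * -dir ((α + α') / 2)

theorem neg_dir_mem_halfPlane (hα : α ∈ Ioo 0 Real.pi) (hα' : α' ∈ Ioo 0 Real.pi) (h : α < α') :
    -dir ((α + α') / 2) ∈ halfPlane (α - Real.pi / 2) ∩ halfPlane (α' + Real.pi / 2) := by
  constructor
  · refine neg_mem_halfPlane_right ?_
    rw [dir_mul_dir, dir_im]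
    exact Real.sin_pos_of_pos_of_lt_pi (by linarith) (by linarith [hα'.2, hα.1])
  · refine neg_mem_halfPlane_left ?_
    rw [dir_mul_dir, dir_im]
    exact Real.sin_neg_of_neg_of_neg_pi_lt (by linarith) (by linarith [hα'.2, hα.1])

theorem waveVertex_mem (hα : α ∈ Ioo 0 Real.pi) (hα' : α' ∈ Ioo 0 Real.pi) (h : α < α') {w : ℂ}
    (hw : 0 < w.im) :
    waveVertex α α' w ∈ waveDomain (α - Real.pi / 2) w ∩ waveDomain (α' + Real.pi / 2) w := by
  have him : 0 < (waveVertex α α' w).im := by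
    rw [waveVertex, add_im, im_ofReal_mul, neg_im, dir_im]
    have := Real.sin_le_one ((α + α') / 2)
    nlinarith
  have hm := neg_dir_mem_halfPlane hα hα' h
  have hsub : waveVertex α α' w - w = (w.im / 2 : ℝ) * -dir ((α + α') / 2) := by
    rw [waveVertex]; ring
  exact ⟨⟨him, by rw [hsub]; exact smul_mem_halfPlane (half_pos hw) hm.1⟩,
    ⟨him, by rw [hsub]; exact smul_mem_halfPlane (half_pos hw) hm.2⟩⟩

/-- Multiplied by e^{-2πinw}, the sum is holomorphic in w and invariant under real translations; its
derivative in a real direction vanishes, hence so does the complex derivative, and it is constant.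
-/
theorem exists_waveSum_modeK {n : ℤ} (hn : n ≠ 0) (hα : α ∈ Ioo 0 Real.pi)
    (hα' : α' ∈ Ioo 0 Real.pi) (h : α < α') :
    ∃ K : ℂ, ∀ w P : ℂ, 0 < w.im →
      P ∈ waveDomain (α - Real.pi / 2) w ∩ waveDomain (α' + Real.pi / 2) w →
      waveSum (modeK n) (modeK' n) α α' w P = K * expTwoPi (n * w) := by
  have hwave := isWave_modeK hn
  have hdec := decaysAtInfty_modeK hn
  have hopen : IsOpen {w : ℂ | 0 < w.im} := isOpen_lt continuous_const continuous_im
  set J : ℂ → ℂ := fun w => waveSum (modeK n) (modeK' n) α α' w (waveVertex α α' w) *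
    expTwoPi (-n * w) with hJ
  have hdiff : DifferentiableOn ℂ J {w : ℂ | 0 < w.im} := by
    intro w hw
    have hm := waveVertex_mem hα hα' h hw
    have h1 := (rayIntegral_waveForm_differentiableAt hwave hdec hα (isSide_right α) hw hm.1).add
      (rayIntegral_waveForm_differentiableAt hwave hdec hα' (isSide_left α') hw hm.2)
    refine DifferentiableAt.differentiableWithinAt (DifferentiableAt.mul ?_
      (expTwoPi_differentiable.comp (differentiable_id.const_mul _)).differentiableAt)
    -- The vertex `waveVertex` does not depend holomorphically on w, but near a given w it may be
    -- replaced by a fixed vertex without changing the sum.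
    refine h1.congr_of_eventuallyEq ?_
    have hcont : ∀ β : ℝ, IsOpen {v : ℂ | waveVertex α α' w - v ∈ halfPlane β} := fun β =>
      (isOpen_halfPlane β).preimage (by fun_prop : Continuous fun v : ℂ => waveVertex α α' w - v)
    filter_upwards [hopen.mem_nhds hw, (hcont _).mem_nhds hm.1.2, (hcont _).mem_nhds hm.2.2]
      with v hv h2 h3
    exact waveSum_eq hv hwave hdec hα hα' h (waveVertex_mem hα hα' h hv)
      ⟨⟨hm.1.1, h2⟩, ⟨hm.1.1, h3⟩⟩
  have htrans : ∀ w : ℂ, 0 < w.im → ∀ r : ℝ, J (w + r) = J w := by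
    intro w _ r
    have e1 : waveVertex α α' (w + r) = waveVertex α α' w + r := by
      rw [waveVertex, waveVertex, add_im, ofReal_im, add_zero]; ring
    have e2 : expTwoPi (n * r) * expTwoPi (-n * (w + r)) = expTwoPi (-n * w) := by
      rw [← expTwoPi_add]; congr 1; ring
    simp only [hJ]
    rw [e1, waveSum_add_real, ← e2]
    ring
  have hderiv : ∀ w ∈ {w : ℂ | 0 < w.im}, deriv J w = 0 := by
    intro w hw
    have h1 : HasDerivAt J (deriv J w) (w + ((0 : ℝ) : ℂ)) := by
      rw [ofReal_zero, add_zero]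
      exact ((hdiff w hw).differentiableAt (hopen.mem_nhds hw)).hasDerivAt
    have h2 : HasDerivAt (fun r : ℝ => w + (r : ℂ)) 1 0 := (hasDerivAt_id (0 : ℝ)).ofReal_comp.const_add w
    have h3 := HasDerivAt.comp (h := fun r : ℝ => w + (r : ℂ)) (0 : ℝ) h1 h2
    have h4 : HasDerivAt (J ∘ fun r : ℝ => w + (r : ℂ)) 0 0 := by
      have : (J ∘ fun r : ℝ => w + (r : ℂ)) = fun _ => J w := funext fun r => htrans w hw r
      rw [this]
      exact hasDerivAt_const _ _
    simpa using h3.unique h4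
  refine ⟨J I, fun w P hw hP => ?_⟩
  have hc : J w = J I := hopen.is_const_of_deriv_eq_zero
    (convex_halfSpace_im_gt 0).isPreconnected hdiff hderiv hw (by simp)
  have e : expTwoPi (-n * w) * expTwoPi (n * w) = 1 := by
    rw [← expTwoPi_add, neg_mul, neg_add_cancel, expTwoPi, mul_zero, Complex.exp_zero]
  rw [← hc, waveSum_eq hw hwave hdec hα hα' h hP (waveVertex_mem hα hα' h hw), hJ, mul_assoc, e, mul_one]

end MedianResum

namespace MedianResum

/-! ### The constant in the ray integrals of the Fourier modes -/

variable {α α' β : ℝ}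

theorem exp_mul_waveK_tendsto_of_pos {ν : ℝ} (hν : 0 < ν) :
    Tendsto (fun y : ℝ => Real.exp (2 * Real.pi * ν * y) * waveK ν y) atTop
      (𝓝 ((√ν)⁻¹ * (1 / 2))) ∧
    Tendsto (fun y : ℝ => Real.exp (2 * Real.pi * ν * y) * waveK' ν y) atTop
      (𝓝 (√ν * -Real.pi)) := by
  have h : Tendsto (fun y : ℝ => ν * y) atTop atTop := tendsto_id.const_mul_atTop hν
  constructor
  · refine ((exp_mul_waveK_tendsto.comp h).const_mul (√ν)⁻¹).congr fun y => ?_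
    rw [waveK_scale hν, Function.comp_apply, ← mul_assoc (2 * Real.pi)]
    ring
  · refine ((exp_mul_waveK'_tendsto.comp h).const_mul (√ν)).congr fun y => ?_
    rw [waveK'_scale hν, Function.comp_apply, ← mul_assoc (2 * Real.pi)]
    ring

/-- The limit of `e^{2π|n|b} modeK' n (ib + σ)` as `b → ∞`, up to a constant. -/
def modeLimit (n : ℤ) (σ : ℂ) : ℂ :=
  expTwoPi (n * (σ.re : ℂ)) * (Real.exp (-(2 * Real.pi * |(n : ℝ)| * σ.im)) : ℂ)

/-- The constant in the limit of `e^{2π|n|b} modeK' n (ib + σ)`. -/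
def modeConst (n : ℤ) : ℂ :=
  I * (Real.pi * n * ((√|(n : ℝ)|)⁻¹ * (1 / 2) : ℝ) - (√|(n : ℝ)| * -Real.pi : ℝ) / 2)

theorem exp_mul_mode_eq (n : ℤ) (b : ℝ) (σ : ℂ) :
    (Real.exp (2 * Real.pi * |(n : ℝ)| * b) : ℂ) * modeK n (b * I + σ) =
      (Real.exp (2 * Real.pi * |(n : ℝ)| * (b + σ.im)) * waveK |(n : ℝ)| (b + σ.im) : ℝ) *
        modeLimit n σ ∧
    (Real.exp (2 * Real.pi * |(n : ℝ)| * b) : ℂ) * modeK' n (b * I + σ) =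
      I * (Real.pi * n * (Real.exp (2 * Real.pi * |(n : ℝ)| * (b + σ.im)) *
          waveK |(n : ℝ)| (b + σ.im) : ℝ) -
        (Real.exp (2 * Real.pi * |(n : ℝ)| * (b + σ.im)) * waveK' |(n : ℝ)| (b + σ.im) : ℝ) / 2) *
        modeLimit n σ := by
  have h1 : (b * I + σ).im = b + σ.im := by simp
  have h2 : (b * I + σ).re = σ.re := by simp
  have h3 : (Real.exp (2 * Real.pi * |(n : ℝ)| * b) : ℂ) =
      (Real.exp (2 * Real.pi * |(n : ℝ)| * (b + σ.im)) : ℂ) *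
        (Real.exp (-(2 * Real.pi * |(n : ℝ)| * σ.im)) : ℂ) := by
    rw [← ofReal_mul, ← Real.exp_add]
    ring_nf
  rw [modeK, modeK', modeLimit, h1, h2, h3]
  push_cast
  constructor <;> ring

theorem tendsto_exp_mul_mode {n : ℤ} (hn : n ≠ 0) (σ : ℂ) :
    Tendsto (fun b : ℝ => (Real.exp (2 * Real.pi * |(n : ℝ)| * b) : ℂ) * modeK n (b * I + σ)) atTop
      (𝓝 (((√|(n : ℝ)|)⁻¹ * (1 / 2) : ℝ) * modeLimit n σ)) ∧
    Tendsto (fun b : ℝ => (Real.exp (2 * Real.pi * |(n : ℝ)| * b) : ℂ) * modeK' n (b * I + σ)) atTop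
      (𝓝 (modeConst n * modeLimit n σ)) := by
  have hν : 0 < |(n : ℝ)| := abs_pos.2 (by exact_mod_cast hn)
  have hb : Tendsto (fun b : ℝ => b + σ.im) atTop atTop := tendsto_atTop_add_const_right _ _ tendsto_id
  have h1 := (continuous_ofReal.tendsto _).comp ((exp_mul_waveK_tendsto_of_pos hν).1.comp hb)
  have h2 := (continuous_ofReal.tendsto _).comp ((exp_mul_waveK_tendsto_of_pos hν).2.comp hb)
  simp_rw [(exp_mul_mode_eq n _ σ).1, (exp_mul_mode_eq n _ σ).2]
  exact ⟨h1.mul_const _, ((((h1.const_mul _).sub (h2.div_const 2)).const_mul I).mul_const _)⟩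

theorem exists_exp_mul_mode_le {n : ℤ} (hn : n ≠ 0) : ∃ M Y : ℝ, 0 < M ∧ ∀ (b : ℝ) (σ : ℂ),
    Y ≤ b + σ.im →
    ‖(Real.exp (2 * Real.pi * |(n : ℝ)| * b) : ℂ) * modeK n (b * I + σ)‖ ≤
      M * Real.exp (-(2 * Real.pi * |(n : ℝ)| * σ.im)) ∧
    ‖(Real.exp (2 * Real.pi * |(n : ℝ)| * b) : ℂ) * modeK' n (b * I + σ)‖ ≤
      M * Real.exp (-(2 * Real.pi * |(n : ℝ)| * σ.im)) := by
  have hν : 0 < |(n : ℝ)| := abs_pos.2 (by exact_mod_cast hn)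
  have hπ := Real.pi_pos
  obtain ⟨h1, h2⟩ := exp_mul_waveK_tendsto_of_pos hν
  set k₁ := ‖(√|(n : ℝ)|)⁻¹ * (1 / 2)‖ + 1
  set k₂ := ‖√|(n : ℝ)| * -Real.pi‖ + 1
  have hk₁ : 0 < k₁ := by positivity
  have hk₂ : 0 < k₂ := by positivity
  obtain ⟨Y₁, hY₁⟩ := eventually_atTop.1 (h1.norm.eventually_lt_const (lt_add_one _))
  obtain ⟨Y₂, hY₂⟩ := eventually_atTop.1 (h2.norm.eventually_lt_const (lt_add_one _))
  refine ⟨k₁ + (Real.pi * |(n : ℝ)| * k₁ + k₂ / 2), max Y₁ Y₂, by positivity, fun b σ hb => ?_⟩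
  have e1 := (hY₁ _ ((le_max_left _ _).trans hb)).le
  have e2 := (hY₂ _ ((le_max_right _ _).trans hb)).le
  have hlim : ‖modeLimit n σ‖ = Real.exp (-(2 * Real.pi * |(n : ℝ)| * σ.im)) := by
    rw [modeLimit, norm_mul, norm_expTwoPi_real, one_mul, Complex.norm_real,
      Real.norm_of_nonneg (Real.exp_pos _).le]
  have hp : 0 ≤ Real.pi * |(n : ℝ)| * k₁ + k₂ / 2 := by positivity
  rw [(exp_mul_mode_eq n b σ).1, (exp_mul_mode_eq n b σ).2, norm_mul, norm_mul, hlim]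
  constructor
  · gcongr
    rw [Complex.norm_real]
    linarith
  · gcongr
    rw [norm_mul, norm_I, one_mul]
    refine (norm_sub_le _ _).trans ?_
    rw [norm_mul, norm_mul, norm_div, Complex.norm_real, Complex.norm_real, Complex.norm_real,
      Complex.norm_intCast, Complex.norm_ofNat, Real.norm_of_nonneg hπ.le]
    have : Real.pi * |(n : ℝ)| * ‖Real.exp (2 * Real.pi * |(n : ℝ)| * (b + σ.im)) *
        waveK |(n : ℝ)| (b + σ.im)‖ ≤ Real.pi * |(n : ℝ)| * k₁ := by gcongr
    linarith

/-- With z - w = σ fixed and w = ib, the quantity i(z̄ - w) is asymptotic to 2b and y to b, so √y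
times its power -1/2 tends to 2^{-1/2}. The derivative carries a factor O(y^{-2}) and disappears, so
only the dz part of the form survives. -/
theorem tendsto_waveV (β : ℝ) (σ : ℂ) :
    Tendsto (fun b : ℝ => waveV β (b * I) (b * I + σ)) atTop
      (𝓝 ((2 : ℂ) ^ (-((1 / 2 : ℝ) : ℂ)) * branch β (1 / 2) σ)) ∧
    Tendsto (fun b : ℝ => waveV' β (b * I) (b * I + σ)) atTop (𝓝 0) := by
  have hb : Tendsto (fun b : ℝ => b + σ.im) atTop atTop := tendsto_atTop_add_const_right _ _ tendsto_id
  have him : ∀ b : ℝ, ((b : ℂ) * I + σ).im = b + σ.im := fun b => by simp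
  have hsub : ∀ b : ℝ, (b : ℂ) * I + σ - b * I = σ := fun b => by ring
  constructor
  · have hinv : Tendsto (fun b : ℝ => ((b + σ.im : ℝ) : ℂ)⁻¹) atTop (𝓝 0) := by
      have := (continuous_ofReal.tendsto _).comp (tendsto_inv_atTop_zero.comp hb)
      refine (by simpa using this : Tendsto _ _ _).congr fun b => ?_
      simp
    have hq : Tendsto (fun b : ℝ => (I * ((starRingEnd ℂ) ((b : ℂ) * I + σ) - b * I)) /
        ((b + σ.im : ℝ) : ℂ)) atTop (𝓝 2) := by
      have h1 := (hinv.const_mul (I * (starRingEnd ℂ) σ - 2 * σ.im)).const_add 2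
      rw [mul_zero, add_zero] at h1
      refine h1.congr' ?_
      filter_upwards [hb.eventually_gt_atTop 0] with b hb0
      have hne : ((b + σ.im : ℝ) : ℂ) ≠ 0 := by exact_mod_cast hb0.ne'
      rw [map_add, map_mul, conj_I, conj_ofReal, eq_div_iff hne, add_mul, mul_assoc,
        inv_mul_cancel₀ hne]
      push_cast
      linear_combination (2 * b : ℂ) * I_sq
    have hc := hq.cpow (tendsto_const_nhds (x := -((1 / 2 : ℝ) : ℂ))) (Or.inl (by norm_num))
    refine (hc.mul_const (branch β (1 / 2) σ)).congr' ?_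
    filter_upwards [hb.eventually_gt_atTop 0, eventually_gt_atTop 0] with b hb0 hb1
    have hA : 0 < ((b + σ.im : ℝ) : ℂ).re := by rwa [ofReal_re]
    have hR : 0 < (I * ((starRingEnd ℂ) ((b : ℂ) * I + σ) - b * I)).re := by
      rw [re_I_mul_conj_sub, him]
      simp
      linarith
    have hsq : ((√(b + σ.im) : ℝ) : ℂ) = ((b + σ.im : ℝ) : ℂ) ^ ((1 / 2 : ℝ) : ℂ) := by
      rw [Real.sqrt_eq_rpow, ofReal_cpow hb0.le]
    rw [div_cpow_of_re_pos hA hR, neg_neg, waveV, hsub, him, hsq]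
    ring
  · have hinv : Tendsto (fun b : ℝ => ((b + σ.im) ^ 2)⁻¹ * ‖branch β (-(1 / 2)) σ‖) atTop (𝓝 0) := by
      have := (tendsto_inv_atTop_zero.comp ((tendsto_pow_atTop two_ne_zero).comp hb)).mul_const
        ‖branch β (-(1 / 2)) σ‖
      simpa using this
    refine squeeze_zero_norm' ?_ hinv
    filter_upwards [hb.eventually_gt_atTop 0, eventually_gt_atTop 0] with b hb0 hb1
    have := norm_waveV'_le (β := β) (w := b * I) (z := b * I + σ) (by simpa using hb1)
      (by rwa [him])
    rwa [hsub, him] at this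

theorem tendsto_rayIntegral_modeK {n : ℤ} (hn : n ≠ 0) (hα : α ∈ Ioo 0 Real.pi) (h : IsSide α β)
    {Q : ℂ} (hQ : Q ∈ halfPlane β) :
    Tendsto (fun b : ℝ => (Real.exp (2 * Real.pi * |(n : ℝ)| * b) : ℂ) *
        rayIntegral (waveForm (modeK n) (modeK' n) β (b * I)) (dir α) (b * I + Q)) atTop
      (𝓝 ((2 : ℂ) ^ (-((1 / 2 : ℝ) : ℂ)) * modeConst n *
        rayIntegral (holForm fun z => modeLimit n z * branch β (1 / 2) z) (dir α) Q)) := by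
  have hν1 : 1 ≤ |(n : ℝ)| := by exact_mod_cast Int.one_le_abs hn
  have hπ := Real.pi_gt_three
  have hsin := Real.sin_pos_of_mem_Ioo hα
  obtain ⟨M, Y, hM, hMb⟩ := exists_exp_mul_mode_le hn
  have hd : 0 < (Q * dir (-β)).re := hQ
  obtain ⟨B, hB, hBb⟩ := exists_norm_waveForm_le ‖Q‖ one_pos hd (half_pos hsin)
  set M' := M * Real.exp (-(2 * Real.pi * |(n : ℝ)| * Q.im)) with hM'
  have hmemσ : ∀ t : ℝ, Q + t * dir α ∈ halfPlane β := fun t => add_mul_mem_halfPlane h.re_eq_zero hQ t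
  have hdom : ∀ b : ℝ, 0 < b + Q.im → b * I + Q ∈ waveDomain β (b * I) := fun b hb =>
    ⟨by simpa using hb, by rwa [add_sub_cancel_left]⟩
  have key : Tendsto (fun b : ℝ => ∫ t in Ioi (0 : ℝ), (Real.exp (2 * Real.pi * |(n : ℝ)| * b) : ℂ) *
      waveForm (modeK n) (modeK' n) β (b * I) (b * I + Q + t * dir α) (dir α)) atTop
      (𝓝 (∫ t in Ioi (0 : ℝ), (2 : ℂ) ^ (-((1 / 2 : ℝ) : ℂ)) * modeConst n *
        (holForm (fun z => modeLimit n z * branch β (1 / 2) z) (Q + t * dir α) (dir α)))) := by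
    refine tendsto_integral_filter_of_dominated_convergence
      (fun t => M' * B * Real.exp (-(Real.sin α / 2) * t)) ?_ ?_
      ((integrableOn_exp_mul_Ioi (by linarith) 0).const_mul _) ?_
    · filter_upwards [eventually_gt_atTop (-Q.im), eventually_gt_atTop 0] with b hb hb0
      have hw : 0 < ((b : ℂ) * I).im := by simpa using hb0
      have hr := rayForm_waveForm hw (isWave_modeK hn) (decaysAtInfty_modeK hn) hα h
      exact ((hr.continuousOn_apply (fun t ht => hr.add_mem _ (hdom b (by linarith)) t
        (le_of_lt ht))).aestronglyMeasurable measurableSet_Ioi).const_mul _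
    · filter_upwards [eventually_gt_atTop (Y - Q.im), eventually_gt_atTop (1 - Q.im),
        eventually_gt_atTop 0] with b hbY hb1 hb0
      filter_upwards [ae_restrict_mem measurableSet_Ioi] with t ht
      have ht0 : (0 : ℝ) < t := ht
      have hw : 0 < ((b : ℂ) * I).im := by simpa using hb0
      have him : (Q + t * dir α).im = Q.im + t * Real.sin α := add_mul_dir_im _ _ _
      have hts : 0 < t * Real.sin α := mul_pos ht0 hsin
      obtain ⟨m1, m2⟩ := hMb b (Q + t * dir α) (by rw [him]; linarith)
      have hexp : M * Real.exp (-(2 * Real.pi * |(n : ℝ)| * (Q + t * dir α).im)) ≤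
          M' * Real.exp (-(Real.sin α * t)) := by
        rw [hM', mul_assoc M, ← Real.exp_add, him]
        refine mul_le_mul_of_nonneg_left (Real.exp_le_exp.2 ?_) hM.le
        have : 1 ≤ Real.pi * |(n : ℝ)| := by nlinarith
        nlinarith
      rw [← add_assoc] at m1 m2
      have k := hBb (β := β) (t := t) (C := M' * Real.exp (-(Real.sin α * t)))
        (z := b * I + Q + t * dir α)
        (a := fun z => (Real.exp (2 * Real.pi * |(n : ℝ)| * b) : ℂ) * modeK n z)
        (p := fun z => (Real.exp (2 * Real.pi * |(n : ℝ)| * b) : ℂ) * modeK' n z) hw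
        (by rw [add_assoc, add_im, him]; simp; linarith)
        (le_norm_ray_sub h (by rw [add_sub_cancel_left]))
        ((norm_ray_sub_le ht0.le).trans_eq (by rw [add_sub_cancel_left]))
        (m1.trans hexp) (m2.trans hexp)
      have hlin : (Real.exp (2 * Real.pi * |(n : ℝ)| * b) : ℂ) *
          waveForm (modeK n) (modeK' n) β (b * I) (b * I + Q + t * dir α) (dir α) =
          waveForm (fun z => (Real.exp (2 * Real.pi * |(n : ℝ)| * b) : ℂ) * modeK n z)
            (fun z => (Real.exp (2 * Real.pi * |(n : ℝ)| * b) : ℂ) * modeK' n z) β (b * I)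
            (b * I + Q + t * dir α) (dir α) := by
        simp only [waveForm, wirt_apply]; ring
      rw [hlin]
      refine (ContinuousLinearMap.le_opNorm _ _).trans ?_
      rw [norm_dir, mul_one]
      refine k.trans_eq ?_
      rw [show M' * Real.exp (-(Real.sin α * t)) * (B * Real.exp (Real.sin α / 2 * t)) =
        M' * B * (Real.exp (-(Real.sin α * t)) * Real.exp (Real.sin α / 2 * t)) by ring,
        ← Real.exp_add]
      ring_nf
    · refine Eventually.of_forall fun t => ?_
      obtain ⟨m1, m2⟩ := tendsto_exp_mul_mode hn (Q + t * dir α)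
      obtain ⟨v1, v2⟩ := tendsto_waveV β (Q + t * dir α)
      have := ((m2.mul v1).mul_const (dir α)).add ((m1.mul v2).mul_const ((starRingEnd ℂ) (dir α)))
      simp only [waveForm, wirt_apply, holForm_apply, add_assoc _ Q]
      convert this using 2
      · ring
      · ring
  rw [integral_const_mul] at key
  refine key.congr fun b => ?_
  rw [integral_const_mul, rayIntegral]

/-- Multiply by e^{2π|n|b} at w = ib and let b → ∞. For n > 0 the left side stays equal to K, and
the limit is a Hankel sum with s = 1/2 whose scaling n^{-1/2} cancels against `modeConst`. For n < 0
the leading terms in `modeConst` cancel, so the limit is 0. -/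
theorem exists_waveSum_const : ∃ C : ℂ, C ≠ 0 ∧ ∀ α ∈ Ioo 0 Real.pi, ∀ α' ∈ Ioo 0 Real.pi, α < α' →
    ∀ n : ℤ, n ≠ 0 → ∀ w P : ℂ, 0 < w.im →
      P ∈ waveDomain (α - Real.pi / 2) w ∩ waveDomain (α' + Real.pi / 2) w →
      waveSum (modeK n) (modeK' n) α α' w P = if 0 < n then C * expTwoPi (n * w) else 0 := by
  obtain ⟨H, hH0, hH⟩ := exists_hankelSum 1
  have h2 : (2 : ℂ) ^ (-((1 / 2 : ℝ) : ℂ)) ≠ 0 := by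
    rw [Ne, cpow_eq_zero_iff]; norm_num
  have hπ := Real.pi_pos
  have hπc : (Real.pi : ℂ) ≠ 0 := by exact_mod_cast hπ.ne'
  refine ⟨(2 : ℂ) ^ (-((1 / 2 : ℝ) : ℂ)) * (I * Real.pi) * H,
    mul_ne_zero (mul_ne_zero h2 (mul_ne_zero I_ne_zero hπc)) hH0,
    fun α hα α' hα' hlt n hn w P hw hP => ?_⟩
  have hν : 0 < |(n : ℝ)| := abs_pos.2 (by exact_mod_cast hn)
  obtain ⟨K, hK⟩ := exists_waveSum_modeK hn hα hα' hlt
  obtain ⟨hQ, hQ'⟩ := neg_dir_mem_halfPlane hα hα' hlt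
  set Q := -dir ((α + α') / 2)
  have hlim := (tendsto_rayIntegral_modeK hn hα (isSide_right α) hQ).add
    (tendsto_rayIntegral_modeK hn hα' (isSide_left α') hQ')
  have hK' := hlim.congr' (f₂ := fun b : ℝ => (Real.exp (2 * Real.pi * |(n : ℝ)| * b) : ℂ) *
      (K * expTwoPi (n * (b * I)))) (by
    filter_upwards [eventually_gt_atTop 0, eventually_gt_atTop (-Q.im)] with b hb hbQ
    have him : 0 < ((b : ℂ) * I + Q).im := by
      have : ((b : ℂ) * I + Q).im = b + Q.im := by simp
      rw [this]; linarith
    rw [← hK (b * I) (b * I + Q) (by simpa using hb)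
      ⟨⟨him, by rwa [add_sub_cancel_left]⟩, ⟨him, by rwa [add_sub_cancel_left]⟩⟩, waveSum, mul_add])
  rw [hK w P hw hP]
  have hexp : ∀ b : ℝ, expTwoPi (n * (b * I)) = (Real.exp (-(2 * Real.pi * n * b)) : ℂ) := by
    intro b
    rw [expTwoPi, ofReal_exp]
    congr 1
    push_cast
    linear_combination (2 * Real.pi * n * b : ℂ) * I_sq
  have hs : (√|(n : ℝ)|)⁻¹ * |(n : ℝ)| = √|(n : ℝ)| := by
    have hs0 := (Real.sqrt_pos.2 hν).ne'
    field_simp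
    rw [Real.sq_sqrt hν.le]
  split_ifs with hpos
  · have hn' : |(n : ℝ)| = n := abs_of_pos (by exact_mod_cast hpos)
    have hconst : ∀ b : ℝ, (Real.exp (2 * Real.pi * |(n : ℝ)| * b) : ℂ) *
        (K * expTwoPi (n * (b * I))) = K := fun b => by
      rw [hexp, hn', mul_left_comm, ← ofReal_mul, ← Real.exp_add, add_neg_cancel, Real.exp_zero,
        ofReal_one, mul_one]
    simp_rw [hconst] at hK'
    have hKe := tendsto_nhds_unique tendsto_const_nhds hK'
    have hml : ∀ z : ℂ, modeLimit n z = expTwoPi (((n : ℝ) : ℂ) * z) := fun z => by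
      have e : (Real.exp (-(2 * Real.pi * |(n : ℝ)| * z.im)) : ℂ) = expTwoPi (n * (z.im * I)) := by
        rw [hexp, hn']
      rw [modeLimit, e, ← expTwoPi_add, ← mul_add, Complex.re_add_im, ofReal_intCast]
    have hray : ∀ {α β : ℝ}, IsSide α β → Q ∈ halfPlane β →
        rayIntegral (holForm fun z => modeLimit n z * branch β (1 / 2) z) (dir α) Q =
          (((n : ℝ) ^ ((1 / 2 : ℝ) - 1) : ℝ) : ℂ) * hankelRay α β (1 / 2) (n * Q) := by
      intro α β h hQ
      have := rayIntegral_expTwoPi_scale h (1 / 2) (r := n) (by exact_mod_cast hpos) (w := 0) (P := Q)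
        (by rwa [sub_zero])
      simp only [sub_zero, mul_zero] at this
      simp_rw [hml]
      rw [this, ofReal_intCast, expTwoPi, mul_zero, Complex.exp_zero, one_mul]
    have hnr : (0 : ℝ) < (n : ℝ) := by exact_mod_cast hpos
    have hHn := hH α hα α' hα' hlt (n * Q) (by
      have := smul_mem_halfPlane hnr hQ; rwa [ofReal_intCast] at this) (by
      have := smul_mem_halfPlane hnr hQ'; rwa [ofReal_intCast] at this)
    rw [hankelSum] at hHn
    norm_num at hHn
    rw [hray (isSide_right α) hQ, hray (isSide_left α') hQ', ← mul_add, ← mul_add] at hKe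
    norm_num at hKe
    rw [hHn] at hKe
    have hr : (n : ℝ) ^ (-(1 / 2) : ℝ) = (√|(n : ℝ)|)⁻¹ := by
      rw [hn', Real.sqrt_eq_rpow, Real.rpow_neg hnr.le]
    have hmc : modeConst n * (((√|(n : ℝ)|)⁻¹ : ℝ) : ℂ) = I * Real.pi := by
      have e1 : (√|(n : ℝ)|)⁻¹ * √|(n : ℝ)| = 1 := inv_mul_cancel₀ (Real.sqrt_pos.2 hν).ne'
      have e1' : (((√|(n : ℝ)|)⁻¹ : ℝ) : ℂ) * ((√|(n : ℝ)| : ℝ) : ℂ) = 1 := by exact_mod_cast e1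
      have e2 : (((√|(n : ℝ)|)⁻¹ : ℝ) : ℂ) * (n : ℂ) = ((√|(n : ℝ)| : ℝ) : ℂ) := by
        rw [hn'] at hs ⊢; exact_mod_cast hs
      rw [modeConst]
      push_cast at e1' e2 ⊢
      linear_combination (I * Real.pi / 2 * (((√|(n : ℝ)| : ℝ) : ℂ))⁻¹) * e2 + I * Real.pi * e1'
    rw [hr] at hKe
    rw [hKe, show (-((1 / 2 : ℝ) : ℂ)) = -(1 / 2) by push_cast; ring]
    linear_combination ((2 : ℂ) ^ (-(1 / 2) : ℂ) * H * expTwoPi (n * w)) * hmc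
  · have hneg : (n : ℝ) < 0 := by
      have : n < 0 := lt_of_le_of_ne (not_lt.1 hpos) hn
      exact_mod_cast this
    have hn' : |(n : ℝ)| = -n := abs_of_neg hneg
    have hmc : modeConst n = 0 := by
      have e2 : (√|(n : ℝ)|)⁻¹ * (n : ℝ) = -√|(n : ℝ)| := by
        linear_combination (√|(n : ℝ)|)⁻¹ * hn' - hs
      have e3 : (((√|(n : ℝ)|)⁻¹ : ℝ) : ℂ) * (n : ℂ) = -((√|(n : ℝ)| : ℝ) : ℂ) := by exact_mod_cast e2
      rw [modeConst]
      push_cast at e3 ⊢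
      linear_combination I * Real.pi / 2 * e3
    rw [hmc, mul_zero, zero_mul, zero_mul, add_zero] at hK'
    have hK0 := hK'.norm
    rw [norm_zero] at hK0
    -- For n < 0 the left side has modulus ‖K‖ e^{4π|n|b} ≥ ‖K‖, yet it tends to 0.
    have hKn : ‖K‖ ≤ 0 := by
      refine ge_of_tendsto hK0 ?_
      filter_upwards [eventually_ge_atTop 0] with b hb
      rw [hexp, mul_left_comm, ← ofReal_mul, ← Real.exp_add, norm_mul, Complex.norm_real,
        Real.norm_of_nonneg (Real.exp_pos _).le]
      refine le_mul_of_one_le_right (norm_nonneg _) (Real.one_le_exp ?_)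
      have : 0 ≤ Real.pi * (-(n : ℝ)) * b := by
        have : 0 < -(n : ℝ) := by linarith
        positivity
      rw [hn']
      nlinarith
    rw [norm_le_zero_iff.1 hKn, zero_mul]

end MedianResum

namespace MedianResum

/-! ### Superpositions with two conjugate parameters -/

section Ray

variable {α α' β : ℝ} {m : ℝ → ℂ}

theorem ae_re_rayInv_mul_dir_nonpos {θ : ℝ} (h : Real.cos (θ - α) ≤ 0) :
    ∀ᵐ t ∂(volume.restrict (Ioi (0 : ℝ))), (rayInv α t * dir θ).re ≤ 0 := by
  filter_upwards [ae_restrict_mem measurableSet_Ioi] with t ht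
  rw [re_rayInv_mul_dir]
  exact mul_nonpos_of_nonneg_of_nonpos (inv_nonneg.2 (le_of_lt ht)) h

/-- The integrand of the superposition of `(1 - w p)^{-1/2} (1 - w p̄)^{-b}`, `p = rayInv α t`. -/
def conjIntegrand (α b : ℝ) (m : ℝ → ℂ) (w : ℂ) (t : ℝ) : ℂ :=
  (1 - w * rayInv α t) ^ (-((1 / 2 : ℝ) : ℂ)) * (1 - w * rayInv (-α) t) ^ (-(b : ℂ)) * m t

theorem integrable_conjIntegrand (h : Admissible (volume.restrict (Ioi 0)) (rayInv α) m) {b : ℝ}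
    (hb : 0 < b) {θ : ℝ} (h₁ : Real.cos (θ - α) ≤ 0) (h₂ : Real.cos (θ + α) ≤ 0) {w : ℂ}
    (hw : 0 < (w * dir (-θ)).re) : IntegrableOn (conjIntegrand α b m w) (Ioi 0) := by
  have e2 := ae_re_rayInv_mul_dir_nonpos (α := -α) (θ := θ) (by rwa [sub_neg_eq_add])
  have i1 : Integrable (fun t => (1 - w * rayInv (-α) t) ^ (-(b : ℂ)) * m t)
      (volume.restrict (Ioi 0)) := by
    refine h.integrable_m.bdd_mul (c := ‖dir θ / w‖ ^ b * (dir θ / w).re ^ (-b))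
      (aestronglyMeasurable_one_sub_mul_cpow measurable_rayInv.aestronglyMeasurable w _) ?_
    filter_upwards [e2] with t ht using norm_one_sub_mul_cpow_le hb hw ht
  have i2 : Integrable (fun t => (1 - w * rayInv α t) ^ (-((1 / 2 : ℝ) : ℂ)) *
      ((1 - w * rayInv (-α) t) ^ (-(b : ℂ)) * m t)) (volume.restrict (Ioi 0)) := by
    refine i1.bdd_mul (c := ‖dir θ / w‖ ^ (1 / 2 : ℝ) * (dir θ / w).re ^ (-(1 / 2 : ℝ)))
      (aestronglyMeasurable_one_sub_mul_cpow measurable_rayInv.aestronglyMeasurable w _) ?_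
    filter_upwards [ae_re_rayInv_mul_dir_nonpos h₁] with t ht
    exact norm_one_sub_mul_cpow_le (by norm_num) hw ht
  refine i2.congr (Eventually.of_forall fun t => ?_)
  simp only [conjIntegrand, mul_assoc]

/-- The Feynman parametrization merges the conjugate parameters e^{∓iα}/t into one with total
exponent 1/2 + b = n/2. The segment between them satisfies Re(p e^{iθ}) ≤ 0 because both endpoints
do, which is what the two cosine conditions say. -/
theorem exists_hasModerateSum_conjIntegrand
    (h : Admissible (volume.restrict (Ioi 0)) (rayInv α) m) {b : ℝ} (hb : 0 < b) {n : ℕ}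
    (hn : 1 / 2 + b = n / 2) {j : ℕ} (hj : 0 < j) :
    ∃ φ : PowerSeries ℂ, ∀ θ : ℝ, Real.cos (θ - α) ≤ 0 → Real.cos (θ + α) ≤ 0 →
      HasModerateSum ((j : ℝ) / 2) θ φ (fun w => ∫ t in Ioi (0 : ℝ), conjIntegrand α b m w t) := by
  have hm₁ : AEStronglyMeasurable (rayInv α) (volume.restrict (Ioi 0)) :=
    measurable_rayInv.aestronglyMeasurable
  have hm₂ : AEStronglyMeasurable (rayInv (-α)) (volume.restrict (Ioi 0)) :=
    measurable_rayInv.aestronglyMeasurable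
  have n₁ : ∀ᵐ t ∂(volume.restrict (Ioi (0 : ℝ))), ‖rayInv α t‖ ≤ ‖rayInv α t‖ :=
    Eventually.of_forall fun _ => le_rfl
  have n₂ : ∀ᵐ t ∂(volume.restrict (Ioi (0 : ℝ))), ‖rayInv (-α) t‖ ≤ ‖rayInv α t‖ := by
    filter_upwards [ae_restrict_mem measurableSet_Ioi] with t ht
    rw [norm_rayInv ht, norm_rayInv ht]
  obtain ⟨φ, hφ⟩ := superpositionSummable_nat n j hj _
    (h.feynman hm₁ hm₂ n₁ n₂ (one_half_pos) hb)
  refine ⟨φ, fun θ h₁ h₂ => ?_⟩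
  obtain ⟨hre, hint⟩ := h.integral_feynman hm₁ hm₂ n₁ n₂ one_half_pos hb
    (ae_re_rayInv_mul_dir_nonpos h₁) (ae_re_rayInv_mul_dir_nonpos (by rwa [sub_neg_eq_add]))
  refine (hφ θ hre).congr fun w hw => ?_
  rw [← hn]
  exact hint w hw

/-! ### The closed form on the two rays -/

theorem conj_ray_cpow {w : ℂ} {t : ℝ} (ht : 0 < t) (hα : α ∈ Ioo 0 Real.pi) (hw : 0 < w.im) (s : ℂ) :
    (I * ((starRingEnd ℂ) (t * dir α) - w)) ^ (-s) =
      (I * (t * dir (-α))) ^ (-s) * (1 - w * rayInv (-α) t) ^ (-s) := by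
  have hsin := Real.sin_pos_of_mem_Ioo hα
  have hc : (starRingEnd ℂ) (t * dir α) = t * dir (-α) := by rw [map_mul, conj_ofReal, conj_dir]
  have hA : 0 < (I * (t * dir (-α))).re := by
    rw [I_mul_re, im_ofReal_mul, dir_im, Real.sin_neg]
    nlinarith
  have hR : 0 < (I * ((starRingEnd ℂ) (t * dir α) - w)).re := by
    rw [re_I_mul_conj_sub, im_ofReal_mul, dir_im]
    positivity
  have hA0 := ne_zero_of_re_pos hA
  have hq : 1 - w * rayInv (-α) t =
      I * ((starRingEnd ℂ) (t * dir α) - w) / (I * (t * dir (-α))) := by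
    rw [eq_div_iff hA0, hc, ray_sub ht.ne']
    ring
  rw [hq, div_cpow_of_re_pos hA hR, neg_neg, ← mul_assoc, ← cpow_add _ _ hA0, neg_add_cancel, cpow_zero,
    one_mul]

/-- The weights of the densities obtained from `waveForm` on the ray of direction `α`. -/
def waveWeight (α t : ℝ) : ℂ :=
  ((√(t * Real.sin α) : ℝ) : ℂ) * (((t ^ (-(1 / 2) : ℝ) : ℝ) : ℂ) * dir (-(1 / 2 * α))) *
    (I * (t * dir (-α))) ^ (-((1 / 2 : ℝ) : ℂ)) * dir α

/-- The weights of the densities obtained from `waveForm` on the ray of direction `α`. -/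
def waveWeight' (α t : ℝ) : ℂ :=
  -(1 / 4) * (((√(t * Real.sin α))⁻¹ : ℝ) : ℂ) *
    (((t ^ (-(-(1 / 2)) : ℝ) : ℝ) : ℂ) * dir (-(-(1 / 2) * α))) *
    (I * (t * dir (-α))) ^ (-((3 / 2 : ℝ) : ℂ)) * dir (-α)

theorem measurable_waveWeight : Measurable (waveWeight α) := by
  unfold waveWeight
  fun_prop

theorem measurable_waveWeight' : Measurable (waveWeight' α) := by
  unfold waveWeight'
  fun_prop

theorem norm_ray_cpow {t : ℝ} (ht : 0 < t) (s : ℝ) :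
    ‖(I * (t * dir (-α))) ^ (-(s : ℂ))‖ = t ^ (-s) := by
  have hne : I * (t * dir (-α)) ≠ 0 :=
    mul_ne_zero I_ne_zero (mul_ne_zero (by exact_mod_cast ht.ne') (dir_ne_zero _))
  rw [← ofReal_neg, norm_cpow_ofReal_eq hne, norm_mul, norm_I, one_mul, norm_mul, norm_dir, mul_one,
    Complex.norm_real, Real.norm_of_nonneg ht.le]

theorem norm_waveWeight_le {t : ℝ} (ht : 0 < t) : ‖waveWeight α t‖ ≤ 1 * t ^ (-(1 / 2) : ℝ) := by
  have h1 : √(t * Real.sin α) ≤ t ^ (1 / 2 : ℝ) := by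
    rw [← Real.sqrt_eq_rpow]
    exact Real.sqrt_le_sqrt (mul_le_of_le_one_right ht.le (Real.sin_le_one α))
  have h2 : t ^ (1 / 2 : ℝ) * t ^ (-(1 / 2) : ℝ) = 1 := by
    rw [← Real.rpow_add ht]; norm_num
  rw [waveWeight, norm_mul, norm_mul, norm_mul, norm_mul, norm_dir, norm_dir, norm_ray_cpow ht,
    Complex.norm_real, Complex.norm_real, Real.norm_of_nonneg (Real.sqrt_nonneg _),
    Real.norm_of_nonneg (Real.rpow_nonneg ht.le _), mul_one, mul_one]
  gcongr
  exact (mul_le_mul_of_nonneg_right h1 (Real.rpow_nonneg ht.le _)).trans_eq h2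

theorem norm_waveWeight'_le {t : ℝ} (ht : 0 < t) :
    ‖waveWeight' α t‖ ≤ (√(Real.sin α))⁻¹ * t ^ (-(3 / 2) : ℝ) := by
  have h2 : (t ^ (1 / 2 : ℝ))⁻¹ * t ^ (-(-(1 / 2)) : ℝ) = 1 := by
    rw [neg_neg]
    exact inv_mul_cancel₀ (Real.rpow_pos_of_pos ht _).ne'
  have h3 : ‖(-(1 / 4) : ℂ)‖ ≤ 1 := by norm_num
  rw [waveWeight', norm_mul, norm_mul, norm_mul, norm_mul, norm_mul, norm_dir, norm_dir,
    norm_ray_cpow ht, Complex.norm_real, Complex.norm_real,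
    Real.norm_of_nonneg (inv_nonneg.2 (Real.sqrt_nonneg _)),
    Real.norm_of_nonneg (Real.rpow_nonneg ht.le _), mul_one, mul_one, Real.sqrt_mul ht.le, mul_inv,
    Real.sqrt_eq_rpow t]
  gcongr
  calc _ = ‖(-(1 / 4) : ℂ)‖ * (√(Real.sin α))⁻¹ *
        ((t ^ (1 / 2 : ℝ))⁻¹ * t ^ (-(-(1 / 2)) : ℝ)) := by ring
    _ ≤ 1 * (√(Real.sin α))⁻¹ * 1 := by
        rw [h2]; gcongr
    _ = _ := by ring

/-- The factor (1 - wp)^{1/2} in the derivative of V is written as (1 - wp)(1 - wp)^{-1/2}. All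
three resulting terms then have negative exponents, at the price of one factor w. -/
theorem waveForm_ray {a p : ℂ → ℂ} {w : ℂ} {t : ℝ} (ht : 0 < t) (hα : α ∈ Ioo 0 Real.pi)
    (hw : 0 < w.im) (hs : IsSide α β) (hwβ : -w ∈ halfPlane β)
    (h : (β = α - Real.pi / 2 ∧ 0 < (w * dir (-α)).im) ∨
      (β = α + Real.pi / 2 ∧ (w * dir (-α)).im < 0)) :
    waveForm a p β w (t * dir α) (dir α) =
      conjIntegrand α (1 / 2) (fun t => waveWeight α t * p (t * dir α)) w t +
      (conjIntegrand α (3 / 2) (fun t => waveWeight' α t * a (t * dir α)) w t -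
        w * conjIntegrand α (3 / 2)
          (fun t => rayInv α t * (waveWeight' α t * a (t * dir α))) w t) := by
  have him : (t * dir α).im = t * Real.sin α := by rw [im_ofReal_mul, dir_im]
  have hne : 1 - w * rayInv α t ≠ 0 := by
    have := ne_zero_of_mem_halfPlane (mul_dir_sub_mem_halfPlane hs hwβ t)
    rw [ray_sub ht.ne'] at this
    exact right_ne_zero_of_mul this
  have hpow : (1 - w * rayInv α t) ^ (-((-(1 / 2) : ℝ) : ℂ)) =
      (1 - w * rayInv α t) * (1 - w * rayInv α t) ^ (-((1 / 2 : ℝ) : ℂ)) := by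
    have e : (-((-(1 / 2) : ℝ) : ℂ)) = 1 + -((1 / 2 : ℝ) : ℂ) := by push_cast; ring
    rw [e, cpow_add _ _ hne, cpow_one]
  rw [waveForm, wirt_apply, waveV, waveV', branch_ray_sub _ ht h, branch_ray_sub _ ht h,
    conj_ray_cpow ht hα hw, conj_ray_cpow ht hα hw, him, hpow, conj_dir]
  simp only [conjIntegrand, waveWeight, waveWeight']
  ring

end Ray

end MedianResum

namespace MedianResum

/-! ### Ray integrals starting at the cusp -/

/-- Exponential decay of two functions along sectors with vertex `0`. -/
def DecaysAtZero (a p : ℂ → ℂ) : Prop :=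
  ∀ δ R : ℝ, 0 < δ → 0 < R → ∃ C A : ℝ, 0 < C ∧ 0 < A ∧ ∀ t : ℝ, 0 < t → t ≤ 1 → ∀ ζ : ℂ,
    δ ≤ ζ.im → ‖ζ‖ ≤ R →
      ‖a (t * ζ)‖ ≤ C * Real.exp (-(A * t⁻¹)) ∧ ‖p (t * ζ)‖ ≤ C * Real.exp (-(A * t⁻¹))

section Wave

variable {α α' β : ℝ} {a p : ℂ → ℂ}

theorem IsWave.continuousAt_ray (hwave : IsWave a p) (hα : α ∈ Ioo 0 Real.pi) {t : ℝ} (ht : 0 < t) :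
    ContinuousAt (fun t : ℝ => a (t * dir α)) t ∧ ContinuousAt (fun t : ℝ => p (t * dir α)) t := by
  have him : 0 < ((t : ℂ) * dir α).im := by
    rw [im_ofReal_mul, dir_im]
    exact mul_pos ht (Real.sin_pos_of_mem_Ioo hα)
  have hc : ContinuousAt (fun t : ℝ => (t : ℂ) * dir α) t := by fun_prop
  obtain ⟨q, hq⟩ := hwave.fst _ him
  obtain ⟨q', hq'⟩ := hwave.snd _ him
  exact ⟨ContinuousAt.comp (f := fun t : ℝ => (t : ℂ) * dir α) hq.continuousAt hc,
    ContinuousAt.comp (f := fun t : ℝ => (t : ℂ) * dir α) hq'.continuousAt hc⟩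

theorem exists_norm_le_ray (hdec : DecaysAtInfty a p) (hzero : DecaysAtZero a p)
    (hα : α ∈ Ioo 0 Real.pi) :
    ∃ C A : ℝ, 0 ≤ C ∧ 0 < A ∧ ∀ t : ℝ, 0 < t →
      ‖a (t * dir α)‖ ≤ C * Real.exp (-(A * (t + t⁻¹))) ∧
      ‖p (t * dir α)‖ ≤ C * Real.exp (-(A * (t + t⁻¹))) := by
  have hsin := Real.sin_pos_of_mem_Ioo hα
  obtain ⟨C₁, A₁, hC₁, hA₁, h₁⟩ := hzero _ 1 hsin one_pos
  obtain ⟨C₂, hC₂, h₂⟩ := hdec _ hsin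
  obtain ⟨C, A, hC, hA, hb⟩ := exists_norm_le_exp_add_inv
    (f := fun t : ℝ => (a (t * dir α), p (t * dir α))) hC₁.le hC₂.le hA₁ hsin
    (fun t ht ht1 => by
      obtain ⟨b1, b2⟩ := h₁ t ht ht1 (dir α) (by rw [dir_im]) (norm_dir α).le
      exact norm_prod_le_iff.2 ⟨b1, b2⟩)
    (fun t ht => by
      have him : ((t : ℂ) * dir α).im = Real.sin α * t := by rw [im_ofReal_mul, dir_im, mul_comm]
      obtain ⟨b1, b2⟩ := h₂ (t * dir α) (by rw [him]; exact le_mul_of_one_le_right hsin.le ht)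
      rw [him] at b1 b2
      exact norm_prod_le_iff.2 ⟨b1, b2⟩)
  exact ⟨C, A, hC, hA, fun t ht => norm_prod_le_iff.1 (hb t ht)⟩

theorem admissible_ray_mul {f k : ℝ → ℂ} {C A c s : ℝ} (hA : 0 < A) (hc : 0 ≤ c)
    (hf : ∀ t : ℝ, 0 < t → ContinuousAt f t) (hk : Measurable k)
    (hfb : ∀ t : ℝ, 0 < t → ‖f t‖ ≤ C * Real.exp (-(A * (t + t⁻¹))))
    (hkb : ∀ t : ℝ, 0 < t → ‖k t‖ ≤ c * t ^ s) :
    Admissible (volume.restrict (Ioi 0)) (rayInv α) (fun t => k t * f t) := by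
  obtain ⟨C', hC', hx⟩ := rpow_le_mul_exp_add_inv s (half_pos hA)
  refine admissible_ray (C := c * C' * C) (half_pos hA) one_pos
    measurable_rayInv.aestronglyMeasurable ?_ (fun t ht => by rw [norm_rayInv ht, one_mul])
    (fun t ht => ?_)
  · have hcont : ContinuousOn f (Ioi 0) := fun t ht => (hf t ht).continuousWithinAt
    exact hk.aestronglyMeasurable.mul (hcont.aestronglyMeasurable measurableSet_Ioi)
  · rw [norm_mul]
    calc _ ≤ c * (C' * Real.exp (A / 2 * (t + t⁻¹))) * (C * Real.exp (-(A * (t + t⁻¹)))) := by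
          gcongr
          · exact (hkb t ht).trans (mul_le_mul_of_nonneg_left (hx t ht) hc)
          · exact hfb t ht
      _ = c * C' * C * (Real.exp (A / 2 * (t + t⁻¹)) * Real.exp (-(A * (t + t⁻¹)))) := by ring
      _ = _ := by rw [← Real.exp_add]; ring_nf

theorem admissible_wave (hwave : IsWave a p) (hdec : DecaysAtInfty a p) (hzero : DecaysAtZero a p)
    (hα : α ∈ Ioo 0 Real.pi) :
    Admissible (volume.restrict (Ioi 0)) (rayInv α) (fun t => waveWeight α t * p (t * dir α)) ∧
    Admissible (volume.restrict (Ioi 0)) (rayInv α) (fun t => waveWeight' α t * a (t * dir α)) := by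
  obtain ⟨C, A, -, hA, hb⟩ := exists_norm_le_ray hdec hzero hα
  exact ⟨admissible_ray_mul hA zero_le_one (fun t ht => (hwave.continuousAt_ray hα ht).2)
      measurable_waveWeight (fun t ht => (hb t ht).2) fun t ht => norm_waveWeight_le ht,
    admissible_ray_mul hA (inv_nonneg.2 (Real.sqrt_nonneg _))
      (fun t ht => (hwave.continuousAt_ray hα ht).1)
      measurable_waveWeight' (fun t ht => (hb t ht).1) fun t ht => norm_waveWeight'_le ht⟩

/-- The integrand of the ray integral of `waveForm a p β w` from `0` in the direction `α`. -/
def waveIntegrand (a p : ℂ → ℂ) (α : ℝ) (w : ℂ) (t : ℝ) : ℂ :=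
  conjIntegrand α (1 / 2) (fun t => waveWeight α t * p (t * dir α)) w t +
    (conjIntegrand α (3 / 2) (fun t => waveWeight' α t * a (t * dir α)) w t -
      w * conjIntegrand α (3 / 2) (fun t => rayInv α t * (waveWeight' α t * a (t * dir α))) w t)

theorem exists_hasModerateSum_waveIntegrand (hwave : IsWave a p) (hdec : DecaysAtInfty a p)
    (hzero : DecaysAtZero a p) (hα : α ∈ Ioo 0 Real.pi) {j : ℕ} (hj : 0 < j) :
    ∃ φ : PowerSeries ℂ, ∀ θ : ℝ, Real.cos (θ - α) ≤ 0 → Real.cos (θ + α) ≤ 0 →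
      HasModerateSum ((j : ℝ) / 2) θ φ (fun w => ∫ t in Ioi (0 : ℝ), waveIntegrand a p α w t) := by
  obtain ⟨h₁, h₂⟩ := admissible_wave hwave hdec hzero hα
  have hj' : (0 : ℝ) < (j : ℝ) / 2 := by positivity
  obtain ⟨φ₁, hφ₁⟩ := exists_hasModerateSum_conjIntegrand h₁ (b := 1 / 2) (n := 2) (by norm_num)
    (by norm_num) hj
  obtain ⟨φ₂, hφ₂⟩ := exists_hasModerateSum_conjIntegrand h₂ (b := 3 / 2) (n := 4) (by norm_num)
    (by norm_num) hj
  -- The third term carries the factor w, so its series is taken with shift κ + 1 = (j + 2)/2.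
  obtain ⟨φ₃, hφ₃⟩ := exists_hasModerateSum_conjIntegrand h₂.mul_self (b := 3 / 2) (n := 4)
    (by norm_num) (by norm_num) (j := j + 2) (by omega)
  refine ⟨φ₁ + (φ₂ + PowerSeries.C (-1) * (PowerSeries.X * φ₃)), fun θ c₁ c₂ => ?_⟩
  have hX := hφ₃ θ c₁ c₂
  rw [show ((j + 2 : ℕ) : ℝ) / 2 = (j : ℝ) / 2 + 1 by push_cast; ring] at hX
  refine ((hφ₁ θ c₁ c₂).add hj' ((hφ₂ θ c₁ c₂).add hj' (hX.X_mul.const_mul (-1)))).congr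
    fun w hw => ?_
  have i₁ := integrable_conjIntegrand h₁ (b := 1 / 2) (by norm_num) c₁ c₂ hw
  have i₂ := integrable_conjIntegrand h₂ (b := 3 / 2) (by norm_num) c₁ c₂ hw
  have i₃ := (integrable_conjIntegrand h₂.mul_self (b := 3 / 2) (by norm_num) c₁ c₂ hw).const_mul w
  have e₁ := integral_add i₁ (i₂.sub i₃)
  have e₂ := integral_sub i₂ i₃
  simp only [Pi.sub_apply] at e₁
  rw [integral_const_mul] at e₂
  simp only [waveIntegrand]
  rw [e₁, e₂]
  ring

/-- Near the cusp the bound on the derivative of V can grow like t^{-2}, which the decay e^{-A/t} of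
a absorbs; V itself stays bounded. -/
theorem exists_norm_waveForm_le_segment (hzero : DecaysAtZero a p) (hα : α ∈ Ioo 0 Real.pi)
    (h : IsSide α β) {w : ℂ} (hw : 0 < w.im) (hwβ : -w ∈ halfPlane β) :
    ∃ B : ℝ, ∀ t : ℝ, 0 < t → t < 1 / 2 → ∀ z ∈ segment ℝ ((t : ℂ) * dir α) (t * w),
      ‖waveForm a p β w z‖ ≤ B := by
  obtain ⟨B₁, hB₁, hb₁⟩ := h.exists_branch_le_segment (1 / 2) hwβ
  obtain ⟨B₂, hB₂, hb₂⟩ := h.exists_branch_le_segment (-(1 / 2)) hwβ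
  have hδ : 0 < min (dir α).im w.im :=
    lt_min (by rw [dir_im]; exact Real.sin_pos_of_mem_Ioo hα) hw
  set δ := min (dir α).im w.im
  obtain ⟨C, A, hC, hA, hb⟩ := hzero δ (‖dir α‖ + ‖w‖) hδ (by rw [norm_dir]; positivity)
  obtain ⟨C₂, hC₂, hx⟩ := rpow_le_mul_exp 2 one_pos hA
  refine ⟨C * B₁ + C * C₂ * ((δ ^ 2)⁻¹ * B₂), fun t ht ht2 z hz => ?_⟩
  have hz1 := hb₁ t ht ht2 z hz
  have hz2 := hb₂ t ht ht2 z hz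
  obtain ⟨ζ, hζ, rfl⟩ := exists_of_mem_segment_mul hz
  have hζδ := min_im_le_of_mem_segment hζ
  obtain ⟨ha, hp⟩ := hb t ht (by linarith) ζ hζδ (norm_le_of_mem_segment hζ)
  have him : t * δ ≤ ((t : ℂ) * ζ).im := by rw [im_ofReal_mul]; gcongr
  have htδ : 0 < t * δ := by positivity
  have hi := inv_pos.2 ht
  have hexp : Real.exp (-(A * t⁻¹)) ≤ 1 := Real.exp_le_one_iff.2 (by simp only [Left.neg_nonpos_iff]; positivity)
  have hinv : (((t : ℂ) * ζ).im ^ 2)⁻¹ ≤ C₂ * Real.exp (A * t⁻¹) * (δ ^ 2)⁻¹ := by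
    have h1 := hx t⁻¹ ((one_le_inv₀ ht).2 (by linarith))
    rw [Real.rpow_two] at h1
    calc _ ≤ ((t * δ) ^ 2)⁻¹ := by gcongr
      _ = t⁻¹ ^ 2 * (δ ^ 2)⁻¹ := by rw [mul_pow, mul_inv, inv_pow]
      _ ≤ _ := by gcongr
  refine (norm_wirt_le _ _).trans ?_
  rw [norm_mul, norm_mul]
  refine add_le_add ?_ ?_
  · refine mul_le_mul (hp.trans (mul_le_of_le_one_right hC.le hexp))
      ((norm_waveV_le hw (htδ.trans_le him)).trans hz1) (norm_nonneg _) hC.le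
  · calc _ ≤ C * Real.exp (-(A * t⁻¹)) * ((C₂ * Real.exp (A * t⁻¹) * (δ ^ 2)⁻¹) * B₂) := by
          gcongr
          refine (norm_waveV'_le hw (htδ.trans_le him)).trans ?_
          gcongr
      _ = C * C₂ * ((δ ^ 2)⁻¹ * B₂) * (Real.exp (-(A * t⁻¹)) * Real.exp (A * t⁻¹)) := by ring
      _ = _ := by rw [← Real.exp_add, neg_add_cancel, Real.exp_zero, mul_one]

theorem integral_waveIntegrand_add (hwave : IsWave a p) (hdec : DecaysAtInfty a p)
    (hzero : DecaysAtZero a p) (hα : α ∈ Ioo 0 Real.pi) (hα' : α' ∈ Ioo 0 Real.pi) (hlt : α < α')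
    {w : ℂ} (hw : 0 < (w * dir (-α)).im) (hw' : (w * dir (-α')).im < 0) :
    (1 / 2 : ℝ) * w ∈ waveDomain (α - Real.pi / 2) w ∩ waveDomain (α' + Real.pi / 2) w ∧
    (∫ t in Ioi (0 : ℝ), waveIntegrand a p α w t) + (∫ t in Ioi (0 : ℝ), waveIntegrand a p α' w t) =
      waveSum a p α α' w ((1 / 2 : ℝ) * w) := by
  have hsin := Real.sin_pos_of_mem_Ioo hα
  have hsin' := Real.sin_pos_of_mem_Ioo hα'
  have him := im_pos_of_sector hα hα' hlt hw hw'
  have hr := neg_mem_halfPlane_right hw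
  have hl := neg_mem_halfPlane_left hw'
  have hmem : ∀ t : ℝ, 0 < t → t < 1 →
      (t : ℂ) * w ∈ waveDomain (α - Real.pi / 2) w ∩ waveDomain (α' + Real.pi / 2) w := by
    intro t ht ht1
    have : 0 < ((t : ℂ) * w).im := by rw [im_ofReal_mul]; positivity
    exact ⟨⟨this, mul_sub_mem_halfPlane hr ht1⟩, ⟨this, mul_sub_mem_halfPlane hl ht1⟩⟩
  have hP := hmem (1 / 2) (by norm_num) (by norm_num)
  refine ⟨hP, ?_⟩
  obtain ⟨B, hB⟩ := exists_norm_waveForm_le_segment hzero hα (isSide_right α) him hr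
  obtain ⟨B', hB'⟩ := exists_norm_waveForm_le_segment hzero hα' (isSide_left α') him hl
  have hsum := (rayForm_waveForm him hwave hdec hα (isSide_right α)).zero_add_eq
    (rayForm_waveForm him hwave hdec hα' (isSide_left α'))
    (fun z hz => waveForm_eq_neg hα hα' hlt hz) (v := w) (r := 1 / 2) (C := max B B') (by norm_num)
    (fun t ht => ⟨by rw [im_ofReal_mul, dir_im]; positivity,
      mul_dir_sub_mem_halfPlane (isSide_right α) hr t⟩)
    (fun t ht => ⟨by rw [im_ofReal_mul, dir_im]; positivity,
      mul_dir_sub_mem_halfPlane (isSide_left α') hl t⟩)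
    (fun t ht ht2 => hmem t ht (by linarith))
    (fun t ht ht2 z hz => (hB t ht ht2 z hz).trans (le_max_left _ _))
    (fun t ht ht2 z hz => (hB' t ht ht2 z hz).trans (le_max_right _ _)) hP
  rw [waveSum, ← hsum]
  congr 1
  · exact setIntegral_congr_fun measurableSet_Ioi fun t ht =>
      (waveForm_ray ht hα him (isSide_right α) hr (Or.inl ⟨rfl, hw⟩)).symm
  · exact setIntegral_congr_fun measurableSet_Ioi fun t ht =>
      (waveForm_ray ht hα' him (isSide_left α') hl (Or.inr ⟨rfl, hw'⟩)).symm

/-! ### Fourier expansion of the ray integrals -/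

/-- The bounds b n e^{-y} hold at all heights above Im P, so one summable sequence dominates every
mode along the ray. The condition on c 0 removes `modeK 0`, for which the wave property is not
available. -/
theorem hasSum_rayIntegral_waveForm {c : ℤ → ℂ} {b : ℤ → ℝ} (hα : α ∈ Ioo 0 Real.pi)
    (h : IsSide α β) {w P : ℂ} (hw : 0 < w.im) (hP : P ∈ waveDomain β w) (hc : c 0 = 0)
    (hb : Summable b) (hb0 : ∀ n, 0 ≤ b n)
    (hle : ∀ n z, P.im ≤ z.im → ‖c n * modeK n z‖ ≤ b n * Real.exp (-z.im) ∧
      ‖c n * modeK' n z‖ ≤ b n * Real.exp (-z.im))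
    (hs : ∀ z : ℂ, 0 < z.im → HasSum (fun n => c n * modeK n z) (a z) ∧
      HasSum (fun n => c n * modeK' n z) (p z)) :
    HasSum (fun n => c n * rayIntegral (waveForm (modeK n) (modeK' n) β w) (dir α) P)
      (rayIntegral (waveForm a p β w) (dir α) P) := by
  have hsin := Real.sin_pos_of_mem_Ioo hα
  have hP0 : 0 < P.im := hP.1
  have hd : 0 < ((P - w) * dir (-β)).re := hP.2
  obtain ⟨B, hB, hBb⟩ := exists_norm_waveForm_le ‖P - w‖ hP0 hd (half_pos hsin)
  have him : ∀ t : ℝ, 0 < t → P.im ≤ (P + t * dir α).im ∧ Real.sin α * t ≤ (P + t * dir α).im := by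
    intro t ht
    have := mul_pos ht hsin
    rw [add_mul_dir_im]
    constructor <;> linarith
  have hlin : ∀ (n : ℤ) (z v : ℂ), waveForm (fun z => c n * modeK n z) (fun z => c n * modeK' n z) β w z v =
      c n * waveForm (modeK n) (modeK' n) β w z v := fun n z v => by
    simp only [waveForm, wirt_apply]; ring
  have key := hasSum_rayIntegral (e := dir α) (P := P)
    (W := fun n : ℤ => waveForm (fun z => c n * modeK n z) (fun z => c n * modeK' n z) β w)
    (V := waveForm a p β w) (b := b) (G := fun t => B * Real.exp (-(Real.sin α / 2) * t)) ?_ hb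
    ((integrableOn_exp_mul_Ioi (by linarith) 0).const_mul B) ?_ ?_
  · convert key using 2 with n
    simp only [rayIntegral, hlin, integral_const_mul]
  · intro n
    simp only [hlin]
    rcases eq_or_ne n 0 with rfl | hn
    · simp only [hc, zero_mul]
      exact aestronglyMeasurable_const
    · have hr := rayForm_waveForm hw (isWave_modeK hn) (decaysAtInfty_modeK hn) hα h
      exact ((hr.continuousOn_apply (fun t ht => hr.add_mem P hP t
        (le_of_lt ht))).aestronglyMeasurable measurableSet_Ioi).const_mul _
  · intro n t ht
    obtain ⟨h1, h2⟩ := him t ht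
    obtain ⟨l1, l2⟩ := hle n _ h1
    have hexp : b n * Real.exp (-(P + t * dir α).im) ≤ b n * Real.exp (-(Real.sin α * t)) :=
      mul_le_mul_of_nonneg_left (Real.exp_le_exp.2 (neg_le_neg h2)) (hb0 n)
    have k := hBb (β := β) (t := t) (C := b n * Real.exp (-(Real.sin α * t)))
      (a := fun z => c n * modeK n z) (p := fun z => c n * modeK' n z) hw h1
      (le_norm_ray_sub h le_rfl) (norm_ray_sub_le ht.le) (l1.trans hexp) (l2.trans hexp)
    refine (ContinuousLinearMap.le_opNorm _ _).trans ?_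
    rw [norm_dir, mul_one]
    refine k.trans_eq ?_
    rw [show b n * Real.exp (-(Real.sin α * t)) * (B * Real.exp (Real.sin α / 2 * t)) =
      b n * (B * (Real.exp (-(Real.sin α * t)) * Real.exp (Real.sin α / 2 * t))) by ring,
      ← Real.exp_add]
    ring_nf
  · intro t ht
    obtain ⟨s1, s2⟩ := hs (P + t * dir α) (hP0.trans_le (him t ht).1)
    simp only [waveForm, wirt_apply]
    exact ((s2.mul_right _).mul_right _).add ((s1.mul_right _).mul_right _)

end Wave

/-! ### Maass waveforms -/

section Maass

variable {u : UpperHalfPlane → ℂ}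

theorem IsWave.translate {a p : ℂ → ℂ} (h : IsWave a p) (x₀ : ℝ) :
    IsWave (fun z => a (x₀ + z)) (fun z => p (x₀ + z)) := by
  have him : ∀ z : ℂ, ((x₀ : ℂ) + z).im = z.im := fun z => by simp
  constructor
  · intro z hz
    obtain ⟨q, hq⟩ := h.fst (x₀ + z) (by rwa [him])
    exact ⟨q, (hasFDerivAt_comp_add_left (x₀ : ℂ)).2 hq⟩
  · intro z hz
    obtain ⟨q, hq⟩ := h.snd (x₀ + z) (by rwa [him])
    rw [him] at hq
    exact ⟨q, (hasFDerivAt_comp_add_left (x₀ : ℂ)).2 hq⟩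

theorem DecaysAtInfty.translate {a p : ℂ → ℂ} (h : DecaysAtInfty a p) (x₀ : ℝ) :
    DecaysAtInfty (fun z => a (x₀ + z)) (fun z => p (x₀ + z)) := by
  intro η hη
  obtain ⟨C, hC, hb⟩ := h η hη
  refine ⟨C, hC, fun z hz => ?_⟩
  have him : ((x₀ : ℂ) + z).im = z.im := by simp
  have := hb (x₀ + z) (by rwa [him])
  rwa [him] at this

theorem IsMaassWaveformHalf.decaysAtZero (hu : IsMaassWaveformHalf u) {γ : SL(2, ℤ)}
    (hc : γ 1 0 ≠ 0) :
    DecaysAtZero (fun z => maassFun u (((-(γ 1 1 : ℝ) / (γ 1 0 : ℝ) : ℝ) : ℂ) + z))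
      (fun z => maassDz u (((-(γ 1 1 : ℝ) / (γ 1 0 : ℝ) : ℝ) : ℂ) + z)) :=
  fun _ _ hδ hR => hu.exists_norm_le_sector hc hδ hR

theorem IsMaassWaveformHalf.hasSum_add (hu : IsMaassWaveformHalf u) (x₀ : ℝ) {z : ℂ} (hz : 0 < z.im) :
    HasSum (fun n : ℤ => maassCoeff u n * expTwoPi (n * x₀) * modeK n z) (maassFun u (x₀ + z)) ∧
    HasSum (fun n : ℤ => maassCoeff u n * expTwoPi (n * x₀) * modeK' n z) (maassDz u (x₀ + z)) := by
  obtain ⟨h1, h2⟩ := hu.hasSum (z := z + x₀) (by simpa using hz)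
  simp only [(modeK_add_real _ z x₀).1, (modeK_add_real _ z x₀).2, ← mul_assoc] at h1 h2
  rw [add_comm z] at h1 h2
  exact ⟨h1, h2⟩

theorem exists_median_maass (hu : IsMaassWaveformHalf u) {γ : SL(2, ℤ)} (hc : γ 1 0 ≠ 0) :
    ∃ φ : PowerSeries ℂ,
      IsAsymptoticExpansion (maassPeriodic u) (-(γ 1 1 : ℝ) / (γ 1 0 : ℝ)) φ ∧
      ∀ j : ℕ, 0 < j → HasMedianSum ((j : ℝ) / 2) (Real.pi / 2) φ
        (fun w : ℂ => maassPeriodic u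
          (ofComplex (w + ((-(γ 1 1 : ℝ) / (γ 1 0 : ℝ) : ℝ) : ℂ)))) := by
  obtain ⟨C, hC0, hC⟩ := exists_waveSum_const
  have hzero := hu.decaysAtZero hc
  set x₀ : ℝ := -(γ 1 1 : ℝ) / (γ 1 0 : ℝ) with hx₀
  have hwave := hu.isWave.translate x₀
  have hdec := hu.decaysAtInfty.translate x₀
  -- C is the common value of the contour integrals of all positive modes, up to e^{2πinw}; 2/C
  -- makes two rays add up to 2g.
  refine median_of_rays (fun α w => 2 / C * ∫ t in Ioi (0 : ℝ),
    waveIntegrand (fun z => maassFun u (x₀ + z)) (fun z => maassDz u (x₀ + z)) α w t) ?_ ?_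
  · intro α hα j hj
    obtain ⟨φ, hφ⟩ := exists_hasModerateSum_waveIntegrand hwave hdec hzero hα hj
    exact ⟨PowerSeries.C (2 / C) * φ, fun θ h₁ h₂ => (hφ θ h₁ h₂).const_mul _⟩
  · intro α hα α' hα' hlt w hw hw'
    have him := im_pos_of_sector hα hα' hlt hw hw'
    obtain ⟨hP, hsum⟩ := integral_waveIntegrand_add hwave hdec hzero hα hα' hlt hw hw'
    set P : ℂ := (1 / 2 : ℝ) * w
    obtain ⟨b, hb, hb0, hle⟩ := hu.exists_summable_bound hP.1.1
    have hle' : ∀ (n : ℤ) (z : ℂ), P.im ≤ z.im →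
        ‖maassCoeff u n * expTwoPi (n * x₀) * modeK n z‖ ≤ b n * Real.exp (-z.im) ∧
        ‖maassCoeff u n * expTwoPi (n * x₀) * modeK' n z‖ ≤ b n * Real.exp (-z.im) := by
      intro n z hz
      have e : ∀ x : ℂ, ‖maassCoeff u n * expTwoPi (n * x₀) * x‖ = ‖maassCoeff u n * x‖ := fun x => by
        rw [norm_mul, norm_mul, norm_expTwoPi_real, mul_one, norm_mul]
      rw [e, e]
      exact hle n z hz
    have hc0 : maassCoeff u 0 * expTwoPi ((0 : ℤ) * x₀) = 0 := by rw [hu.maassCoeff_zero, zero_mul]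
    have hS := (hasSum_rayIntegral_waveForm hα (isSide_right α) him hP.1
      (c := fun n : ℤ => maassCoeff u n * expTwoPi (n * x₀)) hc0 hb hb0 hle'
      fun z hz => hu.hasSum_add x₀ hz).add
      (hasSum_rayIntegral_waveForm hα' (isSide_left α') him hP.2
      (c := fun n : ℤ => maassCoeff u n * expTwoPi (n * x₀)) hc0 hb hb0 hle'
      fun z hz => hu.hasSum_add x₀ hz)
    simp only [← mul_add] at hS
    change HasSum (fun n : ℤ => maassCoeff u n * expTwoPi (n * x₀) *
      waveSum (modeK n) (modeK' n) α α' w P) (waveSum _ _ α α' w P) at hS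
    -- Modes with n ≤ 0 contribute nothing, so the sum over ℤ reduces to the positive frequencies,
    -- which form the periodic function.
    have hinj : Function.Injective fun n : ℕ => ((n + 1 : ℕ) : ℤ) := fun m n h => by
      simpa using h
    rw [← hinj.hasSum_iff fun n hn => ?_] at hS
    · have hterm : ∀ n : ℕ, maassCoeff u ((n + 1 : ℕ) : ℤ) * expTwoPi (((n + 1 : ℕ) : ℤ) * x₀) *
            waveSum (modeK ((n + 1 : ℕ) : ℤ)) (modeK' ((n + 1 : ℕ) : ℤ)) α α' w P =
          maassCoeff u ((n + 1 : ℕ) : ℤ) *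
            Complex.exp (2 * Real.pi * I * ((n + 1 : ℕ) : ℂ) * (w + (x₀ : ℂ))) * C := by
        intro n
        have h3 : Complex.exp (2 * Real.pi * I * ((n + 1 : ℕ) : ℂ) * (w + (x₀ : ℂ))) =
            expTwoPi (((n + 1 : ℕ) : ℤ) * x₀) * expTwoPi (((n + 1 : ℕ) : ℤ) * w) := by
          rw [← expTwoPi_add, expTwoPi]
          push_cast
          ring_nf
        rw [hC α hα α' hα' hlt _ (by positivity) w P him hP, if_pos (by positivity), h3]
        ring
      have hz : 0 < (w + (x₀ : ℂ)).im := by simpa using him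
      have hg := hS.tsum_eq
      simp only [Function.comp_def, hterm] at hg
      rw [tsum_mul_right, ← hsum] at hg
      have hcancel : ∀ S : ℂ, 2 / C * (S * C) = 2 * S := fun S => by field_simp
      rw [maassPeriodic, UpperHalfPlane.ofComplex_apply_of_im_pos hz, ← mul_add, ← hg, hcancel]
    · rcases eq_or_ne n 0 with rfl | hn0
      · rw [hc0, zero_mul]
      · rw [hC α hα α' hα' hlt n hn0 w P him hP, if_neg, mul_zero]
        intro hpos
        exact hn ⟨(n - 1).toNat, by simp; omega⟩

end Maass

end MedianResum

end

/-! ### The proposition -/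

theorem proposition3p3 (N : ℕ) (hN : 0 < N) (g : UpperHalfPlane → ℂ)
    (hg : MedianResum.IsHalfIntegralEichler N g ∨ MedianResum.IsMaassPeriodicHalf g)
    (γ : SL(2, ℤ)) (hγ : γ ∈ CongruenceSubgroup.Gamma0 N) (hc : γ 1 0 ≠ 0) :
    ∃ φ : PowerSeries ℂ,
      MedianResum.IsAsymptoticExpansion g (-(γ 1 1 : ℝ) / (γ 1 0 : ℝ)) φ ∧
      ∀ j : ℕ, 0 < j →
        MedianResum.HasMedianSum ((j : ℝ) / 2) (Real.pi / 2) φ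
          (fun w : ℂ => g (ofComplex (w + ((-(γ 1 1 : ℝ) / (γ 1 0 : ℝ) : ℝ) : ℂ)))) := by
  rcases hg with ⟨_, m, f, hf, rfl⟩ | ⟨u, hu, rfl⟩
  · exact MedianResum.exists_median_eichler hf hγ hc
  · exact MedianResum.exists_median_maass hu hc
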